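/- Let $\mu,g>0$ and let $\bar\rho\in C^\infty(\mathbb R)$ satisfy $\bar\rho'\in C_0^\infty(\mathbb R)$ and $\inf\bar\rho>0$; write $\bar\rho=\bar\rho(x_3)$ on $\mathbb R^3$ and $e_3=(0,0,1)$. Consider in $\mathbb R^3$ the perturbed problem $$\varrho_t+\mathbf u\cdot\nabla(\varrho+\bar\rho)=0,\qquad (\varrho+\bar\rho)\mathbf u_t+(\varrho+\bar\rho)\,\mathbf u\cdot\nabla\mathbf u+\nabla q+g\varrho e_3=\mu\Delta\mathbf u,\qquad \operatorname{div}\mathbf u=0,$$ with $(\varrho,\mathbf u)|_{t=0}=(\varrho_0,\mathbf u_0)$ and $\mathbf u(t,x)\to 0$ as $|x|\to\infty$ for $t>0$. For $0<T\le\infty$, a classical solution on $[0,T)$ is a triple $(\varrho,\mathbf u,q)$ such that $\varrho,\mathbf u$ are continuous on $[0,T)\times\mathbb R^3$; $\varrho$, $\mathbf u$ are $C^1$ in $(t,x)$ on $(0,T)\times\mathbb R^3$, and $\nabla^2\mathbf u$, $\nabla q$ exist and are continuous there; the equations hold pointwise on $(0,T)\times\mathbb R^3$; and $\varrho\in C([0,T);H^1)$,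 $\mathbf u\in C([0,T);H^2)$, $\mathbf u_t\in C((0,T);L^2)$, $\nabla\mathbf u_t\in L^2_{\rm loc}((0,T);L^2)$. Let $0<\alpha\le\beta$. There exist $\delta_1\in(0,1]$, $C_1>0$ and a nondecreasing function $C(\cdot)>0$, depending only on $\mu,g,\bar\rho,\alpha,\beta$, such that the following holds. If the initial data satisfy $\alpha\le\varrho_0+\bar\rho\le\beta$ and $$\delta_0:=\sqrt{\|\varrho_0\|_{H^1}^2+\|\mathbf u_0\|_{H^2}^2}\in(0,\delta_1),$$ then every classical solution $(\varrho,\mathbf u,q)$ on $[0,T)$ with data $(\varrho_0,\mathbf u_0)$, $0<T\le\infty$ (in particular with $T=T^{\max}$, its maximal time of existence), satisfies, with $T_\delta=\min\{T,-C_1^{-1}\ln\delta_0\}$, $$\sup_{0<s\le T_\delta,\ s<T}\big(\|\varrho\|_{H^1}^2+\|\mathbf u\|_{H^2}^2+\|\mathbf u_t\|_{L^2}^2+\|\nabla q\|_{L^2}^2\big)(s)+\int_0^{T_\delta}\big(\|\nabla\mathbf u\|_{H^1}^2+\|\nabla\mathbf u_t\|_{L^2}^2\big)(s)\,ds\le C(T_\delta)\,\delta_0^2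 .$$ -/

import Mathlib

open MeasureTheory Filter Topology Set
open scoped ENNReal ContDiff

namespace RayleighTaylor

/-- Physical space `ℝ³` with the Euclidean norm; the vertical coordinate `x₃` is `x 2`. -/
abbrev R3 : Type := EuclideanSpace ℝ (Fin 3)

/-- The unit vectors `e₁, e₂, e₃` are `e 0, e 1, e 2`. -/
noncomputable def e (i : Fin 3) : R3 := EuclideanSpace.single i 1

section Sobolev

variable {F : Type*} [NormedAddCommGroup F] [NormedSpace ℝ F]

/-- `g` is the weak partial derivative `∂ᵢ f` on `ℝ³`. -/
def IsWeakPartial (i : Fin 3) (f g : R3 → F) : Prop :=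
  LocallyIntegrable f volume ∧ LocallyIntegrable g volume ∧
    ∀ φ : R3 → ℝ, ContDiff ℝ ∞ φ → HasCompactSupport φ →
      ∫ x, (fderiv ℝ φ x (e i)) • f x = - ∫ x, φ x • g x

/-- `‖f‖²_{L²}`, with value `∞` if `f` is not square integrable. -/
noncomputable def l2Sq (f : R3 → F) : ℝ≥0∞ := ∫⁻ x, ‖f x‖ₑ ^ 2

/-- `‖∂_{i_k} ⋯ ∂_{i_1} f‖²_{L²}` for the list `[i_1, …, i_k]`. Weak derivatives are unique up to
null sets, so each infimum runs over functions that agree almost everywhere; it is `∞` if the weak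
derivative does not exist. -/
noncomputable def derivSq : List (Fin 3) → (R3 → F) → ℝ≥0∞
  | [], f => l2Sq f
  | i :: l, f => ⨅ (g : R3 → F) (_ : IsWeakPartial i f g), derivSq l g

/-- `‖∇f‖²_{L²}`. -/
noncomputable def gradSq (f : R3 → F) : ℝ≥0∞ := ∑ i, derivSq [i] f

/-- `‖∇²f‖²_{L²}`. -/
noncomputable def hessSq (f : R3 → F) : ℝ≥0∞ := ∑ i, ∑ j, derivSq [i, j] f

/-- `‖f‖²_{H¹}`. -/
noncomputable def h1Sq (f : R3 → F) : ℝ≥0∞ := l2Sq f + gradSq f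

/-- `‖f‖²_{H²}`. -/
noncomputable def h2Sq (f : R3 → F) : ℝ≥0∞ := l2Sq f + gradSq f + hessSq f

/-- `‖∇f‖²_{H¹}`. -/
noncomputable def gradH1Sq (f : R3 → F) : ℝ≥0∞ := gradSq f + hessSq f

/-- `w ∈ C(I; X)` for the space `X` whose squared norm is `N`. -/
def ContInTime (N : (R3 → F) → ℝ≥0∞) (I : Set ℝ) (w : ℝ → R3 → F) : Prop :=
  ∀ t ∈ I, N (w t) < ⊤ ∧ Tendsto (fun s => N (fun x => w s x - w t x)) (𝓝[I] t) (𝓝 0)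

/-- The classical time derivative `w_t(t)`, as a function on `ℝ³`. -/
noncomputable def dt (w : ℝ → R3 → F) (t : ℝ) : R3 → F := fun x => deriv (fun s => w s x) t

end Sobolev

/-- The steady density profile: smooth, with compactly supported derivative, and bounded below by a
positive constant. -/
structure IsProfile (ρbar : ℝ → ℝ) : Prop where
  smooth : ContDiff ℝ ∞ ρbar
  compact : HasCompactSupport (deriv ρbar)
  inf_pos : ∃ c : ℝ, 0 < c ∧ ∀ z, c ≤ ρbar z

/-- The times `t` with `0 < t < T`, where `0 < T ≤ ∞`. -/
def openTimes (T : EReal) : Set ℝ := {t | 0 < t ∧ (t : EReal) < T}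

/-- The times `t` with `0 ≤ t < T`, where `0 < T ≤ ∞`. -/
def closedTimes (T : EReal) : Set ℝ := {t | 0 ≤ t ∧ (t : EReal) < T}

/-- `(ϱ, u, q)` is a classical solution on `[0, T) × ℝ³` of the perturbed problem
`ϱ_t + u·∇(ϱ + ρ̄) = 0`, `(ϱ + ρ̄) u_t + (ϱ + ρ̄) u·∇u + ∇q + g ϱ e₃ = μ Δu`, `div u = 0`,
with initial data `(ϱ₀, u₀)` and `u → 0` at spatial infinity: the derivatives in the system exist
and are continuous, the equations hold pointwise, and the solution lies in the energy space. -/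
structure IsClassicalSolution (μ g : ℝ) (ρbar : ℝ → ℝ) (T : EReal)
    (ϱ₀ : R3 → ℝ) (u₀ : R3 → R3)
    (ϱ : ℝ → R3 → ℝ) (u : ℝ → R3 → R3) (q : ℝ → R3 → ℝ) : Prop where
  T_pos : 0 < T
  -- pointwise regularity
  ϱ_cont : ContinuousOn (fun p : ℝ × R3 => ϱ p.1 p.2) (closedTimes T ×ˢ univ)
  ϱ_C1 : ContDiffOn ℝ 1 (fun p : ℝ × R3 => ϱ p.1 p.2) (openTimes T ×ˢ univ)
  u_cont : ContinuousOn (fun p : ℝ × R3 => u p.1 p.2) (closedTimes T ×ˢ univ)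
  u_C1 : ContDiffOn ℝ 1 (fun p : ℝ × R3 => u p.1 p.2) (openTimes T ×ˢ univ)
  u_C2 : ∀ t ∈ openTimes T, ContDiff ℝ 2 (u t)
  u_C2_cont : ContinuousOn (fun p : ℝ × R3 => iteratedFDeriv ℝ 2 (u p.1) p.2)
    (openTimes T ×ˢ univ)
  q_C1 : ∀ t ∈ openTimes T, ContDiff ℝ 1 (q t)
  q_C1_cont : ContinuousOn (fun p : ℝ × R3 => gradient (q p.1) p.2) (openTimes T ×ˢ univ)
  -- energy class
  ϱ_H1 : ContInTime h1Sq (closedTimes T) ϱ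
  u_H2 : ContInTime h2Sq (closedTimes T) u
  ut_L2 : ContInTime l2Sq (openTimes T) (dt u)
  ut_H1 : ∀ a ∈ openTimes T, ∀ b ∈ openTimes T, ∫⁻ s in Icc a b, gradSq (dt u s) < ⊤
  -- the equations
  mass : ∀ t ∈ openTimes T, ∀ x,
    dt ϱ t x + fderiv ℝ (fun y => ϱ t y + ρbar (y 2)) x (u t x) = 0
  momentum : ∀ t ∈ openTimes T, ∀ x,
    (ϱ t x + ρbar (x 2)) • dt u t x + (ϱ t x + ρbar (x 2)) • fderiv ℝ (u t) x (u t x)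
      + gradient (q t) x + (g * ϱ t x) • e 2 = μ • Laplacian.laplacian (u t) x
  div_free : ∀ t ∈ openTimes T, ∀ x, ∑ i, fderiv ℝ (u t) x (e i) i = 0
  -- initial and boundary conditions
  ϱ_init : ϱ 0 = ϱ₀
  u_init : u 0 = u₀
  u_decay : ∀ t ∈ openTimes T, Tendsto (u t) (cocompact R3) (𝓝 0)

/-- `T_δ = min {T, -C₁⁻¹ ln δ₀}`. -/
noncomputable def Tδ (T : EReal) (C₁ δ₀ : ℝ) : ℝ :=
  (min T ((-(C₁⁻¹ * Real.log δ₀) : ℝ) : EReal)).toReal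

end RayleighTaylor

/-! The proof is a continuation argument for the quantity Z = ‖u‖² + ‖∇u‖² + ‖ϱ‖² + ‖u_t‖²
(`energy`), all norms in L². The gradient of ϱ is deliberately left out of Z. As long as Z ≤ 1, one
has Z(t) + ∫‖∇u_t‖² ≤ C Z(a) exp(C(t - a)) (`exists_energy_inequality`). Near time zero Z is of size
δ₀², and the logarithmic time T_δ is chosen so that exp(C₁ T_δ) ≤ 1/δ₀. Hence Z is at most a
multiple of δ₀ up to T_δ, which is below 1/4 when δ₁ is small, and the assumption Z ≤ 1 can never
fail (`le_quarter_of_bootstrap`, `exists_energy_bound`).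

The other norms follow from Z. At a fixed time the momentum equation is a stationary Stokes system
whose force is made of u_t, the convective term and gravity, so ∇²u and ∇q are bounded by Z
(`exists_elliptic_bound`). The gradient of ϱ is transported with growth rate ‖∇u‖_∞. A
representation by a regularised Stokeslet (`exists_stokes_gradient_bound`) bounds this rate by 1 +
‖u_t‖_{L⁶}, which is square integrable in time by the Sobolev inequality and the bound on ∫‖∇u_t‖².
A Gronwall argument with an L² coefficient then gives `exists_gr_density_bound`.

For the energy inequality itself, a maximum principle (`density_le`) keeps the total density between
α and β. The balance of ‖∇u‖² comes from testing with u_t, and that of ‖ϱ‖² from the transport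
equation, where only the bounded function ρ̄' survives. The delicate part is ‖u_t‖²: the momentum
equation cannot be differentiated in time, and u_t has only weak space derivatives, at almost every
time. The balance is therefore written for the increment w = u(t + h) - u(t)
(`Slice.difference_identity`). The transport equation moves one derivative onto the test function,
so a density increment is O(h) in a negative norm without any use of ∇ϱ
(`abs_integral_increment_le`). After division by h² and absorption of a small multiple of ‖∇u_t‖²,
the limit h → 0 uses strong L² convergence of the time difference quotients and weak lower
semicontinuity of the gradient norm (`exists_acceleration_energy`).

The pressure enters only through ∇q in L², and it is removed by `integral_inner_gradient_eq_zero`: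
translation differences of q are square integrable even if q is not, and translates of ∇q tend
weakly to zero. -/

namespace RayleighTaylor

/-! ### The L² norm on ℝ³ -/

section Basics

variable {F : Type*} [NormedAddCommGroup F]

/-- The `L²` norm on `ℝ³` as a real number. -/
noncomputable def n2 (f : R3 → F) : ℝ := (eLpNorm f 2 volume).toReal

lemma n2_nonneg (f : R3 → F) : 0 ≤ n2 f := ENNReal.toReal_nonneg

lemma ofReal_n2 {f : R3 → F} (hf : MemLp f 2) : ENNReal.ofReal (n2 f) = eLpNorm f 2 volume :=
  ENNReal.ofReal_toReal hf.2.ne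

lemma eLpNorm_two_sq (f : R3 → F) : eLpNorm f 2 volume ^ 2 = l2Sq f := by
  have := eLpNorm_nnreal_pow_eq_lintegral (f := f) (μ := volume) (p := 2) (by norm_num)
  simpa [l2Sq] using this

lemma l2Sq_eq_ofReal {f : R3 → F} (hf : MemLp f 2) : l2Sq f = ENNReal.ofReal (n2 f ^ 2) := by
  rw [← eLpNorm_two_sq, ← ofReal_n2 hf, ENNReal.ofReal_pow (n2_nonneg f)]

lemma memLp_of_l2Sq {f : R3 → F} (hm : AEStronglyMeasurable f volume) (h : l2Sq f < ⊤) :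
    MemLp f 2 := by
  refine ⟨hm, ?_⟩
  rw [← eLpNorm_two_sq] at h
  by_contra hc
  simp only [not_lt, top_le_iff] at hc
  simp [hc] at h

lemma n2_le_of_l2Sq {f : R3 → F} {M : ℝ} (hM : 0 ≤ M) (h : l2Sq f ≤ ENNReal.ofReal (M ^ 2)) :
    eLpNorm f 2 volume ≤ ENNReal.ofReal M := by
  rw [← eLpNorm_two_sq, ENNReal.ofReal_pow hM] at h
  exact (ENNReal.pow_le_pow_left_iff (by norm_num)).1 h

lemma n2_le_of_eLpNorm {f : R3 → F} {M : ℝ} (hM : 0 ≤ M)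
    (h : eLpNorm f 2 volume ≤ ENNReal.ofReal M) : n2 f ≤ M :=
  ENNReal.toReal_le_of_le_ofReal hM h

lemma n2_sq {f : R3 → F} (hf : MemLp f 2) : n2 f ^ 2 = ∫ x, ‖f x‖ ^ 2 := by
  rw [integral_eq_lintegral_of_nonneg_ae (Eventually.of_forall fun x => by positivity)
    (by exact hf.1.norm.pow 2)]
  have : ∀ x, ENNReal.ofReal (‖f x‖ ^ 2) = ‖f x‖ₑ ^ 2 := fun x => by
    rw [ENNReal.ofReal_pow (norm_nonneg _), ofReal_norm]
  simp only [this]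
  change _ = (l2Sq f).toReal
  rw [l2Sq_eq_ofReal hf, ENNReal.toReal_ofReal (sq_nonneg _)]

lemma n2_add_le {f g : R3 → F} (hf : MemLp f 2) (hg : MemLp g 2) :
    n2 (fun x => f x + g x) ≤ n2 f + n2 g := by
  unfold n2
  rw [← ENNReal.toReal_add hf.2.ne hg.2.ne]
  exact ENNReal.toReal_mono (ENNReal.add_lt_top.2 ⟨hf.2, hg.2⟩).ne
    (eLpNorm_add_le hf.1 hg.1 (by norm_num))

lemma memLp_fun_add {f g : R3 → F} {p : ℝ≥0∞} (hf : MemLp f p) (hg : MemLp g p) :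
    MemLp (fun x => f x + g x) p := hf.add hg

lemma memLp_fun_sub {f g : R3 → F} {p : ℝ≥0∞} (hf : MemLp f p) (hg : MemLp g p) :
    MemLp (fun x => f x - g x) p := hf.sub hg

lemma memLp_fun_smul [NormedSpace ℝ F] {f : R3 → F} {p : ℝ≥0∞} (hf : MemLp f p) (c : ℝ) :
    MemLp (fun x => c • f x) p := hf.const_smul c

lemma n2_neg (f : R3 → F) : n2 (fun x => - f x) = n2 f := by
  unfold n2
  rw [show (fun x => - f x) = -f from rfl, eLpNorm_neg]

lemma n2_sub_le {f g : R3 → F} (hf : MemLp f 2) (hg : MemLp g 2) :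
    n2 (fun x => f x - g x) ≤ n2 f + n2 g := by
  have := n2_add_le hf (g := fun x => - g x) hg.neg
  simpa [sub_eq_add_neg, n2_neg] using this

lemma abs_n2_sub_n2_le {f g : R3 → F} (hf : MemLp f 2) (hg : MemLp g 2) :
    |n2 f - n2 g| ≤ n2 (fun x => f x - g x) := by
  rw [abs_le]
  constructor
  · have := n2_sub_le hf (g := fun x => f x - g x) (hf.sub hg)
    simp only [sub_sub_cancel] at this
    linarith
  · have := n2_add_le hg (g := fun x => f x - g x) (hf.sub hg)
    simp only [add_sub_cancel] at this
    linarith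

lemma n2_smul [NormedSpace ℝ F] (c : ℝ) (f : R3 → F) : n2 (fun x => c • f x) = |c| * n2 f := by
  unfold n2
  rw [show (fun x => c • f x) = c • f from rfl, eLpNorm_const_smul, ENNReal.toReal_mul]
  simp

lemma n2_mul_const_left (c : ℝ) (f : R3 → ℝ) : n2 (fun x => c * f x) = |c| * n2 f :=
  n2_smul c f

lemma memLp_n2_of_le {G : Type*} [NormedAddCommGroup G] {f : R3 → F} {g : R3 → G} {C : ℝ}
    (hC : 0 ≤ C) (hg : MemLp g 2) (hf : AEStronglyMeasurable f volume)
    (h : ∀ x, ‖f x‖ ≤ C * ‖g x‖) : MemLp f 2 ∧ n2 f ≤ C * n2 g := by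
  have h1 : eLpNorm f 2 volume ≤ ENNReal.ofReal C * eLpNorm g 2 volume :=
    eLpNorm_le_mul_eLpNorm_of_ae_le_mul (Eventually.of_forall h) 2
  have h2 : ENNReal.ofReal C * eLpNorm g 2 volume < ⊤ :=
    ENNReal.mul_lt_top ENNReal.ofReal_lt_top hg.2
  refine ⟨⟨hf, h1.trans_lt h2⟩, ?_⟩
  have := ENNReal.toReal_mono h2.ne h1
  rwa [ENNReal.toReal_mul, ENNReal.toReal_ofReal hC] at this

lemma integrable_norm_mul {G : Type*} [NormedAddCommGroup G] {f : R3 → F} {g : R3 → G}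
    (hf : MemLp f 2) (hg : MemLp g 2) : Integrable (fun x => ‖f x‖ * ‖g x‖) :=
  MemLp.integrable_mul hf.norm hg.norm

lemma integral_norm_mul_le {G : Type*} [NormedAddCommGroup G] {f : R3 → F} {g : R3 → G}
    (hf : MemLp f 2) (hg : MemLp g 2) : ∫ x, ‖f x‖ * ‖g x‖ ≤ n2 f * n2 g := by
  have h := integral_mul_norm_le_Lp_mul_Lq (μ := volume) (f := fun x => ‖f x‖)
    (g := fun x => ‖g x‖) (p := 2) (q := 2) ⟨by norm_num, by norm_num, by norm_num⟩
    (by simpa using hf.norm) (by simpa using hg.norm)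
  simp only [Real.rpow_ofNat, norm_norm] at h
  rwa [← n2_sq hf, ← n2_sq hg, ← Real.sqrt_eq_rpow, ← Real.sqrt_eq_rpow,
    Real.sqrt_sq (n2_nonneg f), Real.sqrt_sq (n2_nonneg g)] at h

/-- Cauchy–Schwarz for a function dominated by a product. -/
lemma abs_integral_le_n2_mul {G : Type*} [NormedAddCommGroup G] {k : R3 → ℝ} {f : R3 → F}
    {g : R3 → G} {C : ℝ} (hC : 0 ≤ C) (hf : MemLp f 2) (hg : MemLp g 2)
    (h : ∀ x, |k x| ≤ C * (‖f x‖ * ‖g x‖)) : |∫ x, k x| ≤ C * (n2 f * n2 g) := by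
  calc |∫ x, k x| ≤ ∫ x, C * (‖f x‖ * ‖g x‖) :=
        MeasureTheory.norm_integral_le_of_norm_le (f := k)
          ((integrable_norm_mul hf hg).const_mul C) (Eventually.of_forall h)
    _ = C * ∫ x, ‖f x‖ * ‖g x‖ := integral_const_mul _ _
    _ ≤ _ := by gcongr; exact integral_norm_mul_le hf hg

lemma integrable_of_le_mul {G : Type*} [NormedAddCommGroup G] {K : Type*} [NormedAddCommGroup K]
    {k : R3 → K} {f : R3 → F} {g : R3 → G} (C : ℝ) (hk : AEStronglyMeasurable k volume)
    (hf : MemLp f 2) (hg : MemLp g 2) (h : ∀ x, ‖k x‖ ≤ C * (‖f x‖ * ‖g x‖)) : Integrable k :=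
  ((integrable_norm_mul hf hg).const_mul C).mono' hk (Eventually.of_forall h)

/-- Fatou's lemma. Pointwise convergence with uniform L² bounds suffices, and this is what
difference quotients and mollifications provide. -/
lemma memLp_of_tendsto {f : ℕ → R3 → F} {g : R3 → F} {M : ℝ} (hM : 0 ≤ M)
    (hf : ∀ n, MemLp (f n) 2) (hb : ∀ n, n2 (f n) ≤ M)
    (h : ∀ x, Tendsto (fun n => f n x) atTop (𝓝 (g x))) : MemLp g 2 ∧ n2 g ≤ M := by
  have h1 : eLpNorm g 2 volume ≤ ENNReal.ofReal M := by
    refine Lp.eLpNorm_le_of_ae_tendsto (u := atTop) (Eventually.of_forall fun n => ?_)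
      (fun n => (hf n).1) (Eventually.of_forall h)
    rw [← ofReal_n2 (hf n)]
    exact ENNReal.ofReal_le_ofReal (hb n)
  refine ⟨⟨aestronglyMeasurable_of_tendsto_ae atTop (fun n => (hf n).1) (Eventually.of_forall h),
    h1.trans_lt ENNReal.ofReal_lt_top⟩, n2_le_of_eLpNorm hM h1⟩

/-- An average of `L²` functions has `L²` norm at most that of its members. -/
lemma l2Sq_le_of_average {Θ : Type*} [MeasurableSpace Θ] {ν : Measure Θ} [IsProbabilityMeasure ν]
    {g : R3 → F} {K : Θ → R3 → ℝ≥0∞} (hK : Measurable (Function.uncurry K))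
    (hg : ∀ x, ‖g x‖ₑ ≤ ∫⁻ θ, K θ x ∂ν) {M : ℝ≥0∞}
    (hM : ∀ᵐ θ ∂ν, ∫⁻ x, K θ x ^ 2 ≤ M) : l2Sq g ≤ M := by
  -- Jensen's inequality for the probability measure `ν`; Tonelli then exchanges the two integrals.
  have h1 : ∀ x, ‖g x‖ₑ ^ 2 ≤ ∫⁻ θ, K θ x ^ 2 ∂ν := by
    intro x
    have hm : Measurable fun θ => K θ x := hK.comp (measurable_id.prodMk measurable_const)
    have := eLpNorm_le_eLpNorm_of_exponent_le (μ := ν) (p := 1) (q := 2) (f := fun θ => K θ x)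
      (by norm_num) hm.aestronglyMeasurable
    have e := eLpNorm_nnreal_pow_eq_lintegral (f := fun θ => K θ x) (μ := ν) (p := 2) (by norm_num)
    simp only [NNReal.coe_ofNat, ENNReal.coe_ofNat, ENNReal.rpow_ofNat, enorm_eq_self] at e
    rw [eLpNorm_one_eq_lintegral_enorm] at this
    simp only [enorm_eq_self] at this
    rw [← e]
    exact pow_le_pow_left' ((hg x).trans this) 2
  calc l2Sq g ≤ ∫⁻ x, ∫⁻ θ, K θ x ^ 2 ∂ν := lintegral_mono h1
    _ = ∫⁻ θ, (∫⁻ x, K θ x ^ 2) ∂ν :=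
      lintegral_lintegral_swap ((hK.comp measurable_swap).pow_const 2).aemeasurable
    _ ≤ ∫⁻ _, M ∂ν := lintegral_mono_ae hM
    _ = M := by simp

lemma eLpNorm_translate (f : R3 → F) (hf : AEStronglyMeasurable f volume) (p : ℝ≥0∞) (y : R3) :
    eLpNorm (fun x => f (x + y)) p volume = eLpNorm f p volume :=
  eLpNorm_comp_measurePreserving hf (measurePreserving_add_right volume y)

lemma MemLp.translate {f : R3 → F} {p : ℝ≥0∞} (hf : MemLp f p) (y : R3) :
    MemLp (fun x => f (x + y)) p :=
  hf.comp_measurePreserving (measurePreserving_add_right volume y)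

lemma n2_translate {f : R3 → F} (hf : MemLp f 2) (y : R3) : n2 (fun x => f (x + y)) = n2 f := by
  unfold n2; rw [eLpNorm_translate f hf.1]

end Basics

/-! ### Classical partial derivatives and integration by parts -/

section Derivatives

variable {F : Type*} [NormedAddCommGroup F] [NormedSpace ℝ F]

/-- The classical partial derivative. -/
noncomputable def pd (i : Fin 3) (f : R3 → F) : R3 → F := fun x => fderiv ℝ f x (e i)

@[simp] lemma norm_e (i : Fin 3) : ‖e i‖ = 1 := by simp [e]

lemma e_apply (i j : Fin 3) : e i j = if j = i then 1 else 0 := by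
  simp [e]

lemma sum_smul_e (v : R3) : ∑ i, v i • e i = v := by
  ext j
  simp [e_apply]

lemma norm_pd_le (i : Fin 3) (f : R3 → F) (x : R3) : ‖pd i f x‖ ≤ ‖fderiv ℝ f x‖ := by
  simpa [pd] using (fderiv ℝ f x).le_opNorm (e i)

lemma fderiv_apply_eq_sum (f : R3 → F) (x v : R3) : fderiv ℝ f x v = ∑ i, v i • pd i f x := by
  conv_lhs => rw [← sum_smul_e v]
  simp [pd]

/-- The operator norm is at most the Hilbert–Schmidt norm, by Cauchy–Schwarz in coordinates. -/
lemma norm_fderiv_sq_le (f : R3 → F) (x : R3) :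
    ‖fderiv ℝ f x‖ ^ 2 ≤ ∑ i, ‖pd i f x‖ ^ 2 := by
  have h : ‖fderiv ℝ f x‖ ≤ √(∑ i, ‖pd i f x‖ ^ 2) := by
    refine ContinuousLinearMap.opNorm_le_bound _ (Real.sqrt_nonneg _) fun v => ?_
    rw [fderiv_apply_eq_sum]
    calc ‖∑ i, v i • pd i f x‖ ≤ ∑ i, |v i| * ‖pd i f x‖ := by
          refine (norm_sum_le _ _).trans (le_of_eq ?_)
          simp [norm_smul]
      _ ≤ √(∑ i, |v i| ^ 2) * √(∑ i, ‖pd i f x‖ ^ 2) := Real.sum_mul_le_sqrt_mul_sqrt _ _ _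
      _ = √(∑ i, ‖pd i f x‖ ^ 2) * ‖v‖ := by
          rw [EuclideanSpace.norm_eq, mul_comm]; simp
  calc ‖fderiv ℝ f x‖ ^ 2 ≤ √(∑ i, ‖pd i f x‖ ^ 2) ^ 2 := by gcongr
    _ = _ := Real.sq_sqrt (by positivity)

/-- `C¹` functions in `H¹`. -/
structure H1C1 (f : R3 → F) : Prop where
  c1 : ContDiff ℝ 1 f
  mem : MemLp f 2
  memD : MemLp (fderiv ℝ f) 2

/-- `C²` functions in `H²`. -/
structure H2C2 (f : R3 → F) : Prop where
  c2 : ContDiff ℝ 2 f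
  mem : MemLp f 2
  memD : MemLp (fderiv ℝ f) 2
  memDD : MemLp (fderiv ℝ (fderiv ℝ f)) 2

lemma H2C2.h1 {f : R3 → F} (h : H2C2 f) : H1C1 f := ⟨h.c2.of_le (by norm_num), h.mem, h.memD⟩

lemma H2C2.h1D {f : R3 → F} (h : H2C2 f) : H1C1 (fderiv ℝ f) :=
  ⟨h.c2.fderiv_right (by norm_num), h.memD, h.memDD⟩

lemma H1C1.diff {f : R3 → F} (h : H1C1 f) : Differentiable ℝ f := h.c1.differentiable (by norm_num)

lemma contDiff_pd {f : R3 → F} (h : ContDiff ℝ 2 f) (i : Fin 3) : ContDiff ℝ 1 (pd i f) :=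
  (h.fderiv_right (m := 1) (by norm_num)).clm_apply contDiff_const

lemma continuous_pd {f : R3 → F} (h : ContDiff ℝ 1 f) (i : Fin 3) : Continuous (pd i f) :=
  (h.continuous_fderiv (by norm_num)).clm_apply continuous_const

lemma H1C1.mem_pd {f : R3 → F} (h : H1C1 f) (i : Fin 3) :
    MemLp (pd i f) 2 ∧ n2 (pd i f) ≤ n2 (fderiv ℝ f) := by
  simpa using memLp_n2_of_le zero_le_one h.memD (continuous_pd h.c1 i).aestronglyMeasurable
    fun x => by simpa using norm_pd_le i f x

lemma n2_fderiv_sq_le {f : R3 → F} (h : H1C1 f) :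
    n2 (fderiv ℝ f) ^ 2 ≤ ∑ i, n2 (pd i f) ^ 2 := by
  rw [n2_sq h.memD, Finset.sum_congr rfl fun i _ => n2_sq (h.mem_pd i).1,
    ← integral_finsetSum _ fun i _ => (h.mem_pd i).1.integrable_norm_pow (by norm_num)]
  exact integral_mono (h.memD.integrable_norm_pow (by norm_num))
    (integrable_finsetSum _ fun i _ => (h.mem_pd i).1.integrable_norm_pow (by norm_num))
    fun x => norm_fderiv_sq_le f x

lemma fderiv_pd {f : R3 → F} (h : ContDiff ℝ 2 f) (i : Fin 3) (x v : R3) :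
    fderiv ℝ (pd i f) x v = fderiv ℝ (fderiv ℝ f) x v (e i) := by
  have hd : DifferentiableAt ℝ (fderiv ℝ f) x :=
    (h.fderiv_right (m := 1) (by norm_num)).differentiable (by norm_num) x
  unfold pd
  rw [fderiv_clm_apply hd (differentiableAt_const _)]
  simp

lemma norm_fderiv_pd_le {f : R3 → F} (h : ContDiff ℝ 2 f) (i : Fin 3) (x : R3) :
    ‖fderiv ℝ (pd i f) x‖ ≤ ‖fderiv ℝ (fderiv ℝ f) x‖ := by
  refine ContinuousLinearMap.opNorm_le_bound _ (norm_nonneg (fderiv ℝ (fderiv ℝ f) x)) fun v => ?_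
  rw [fderiv_pd h]
  calc _ ≤ ‖fderiv ℝ (fderiv ℝ f) x v‖ * ‖e i‖ := ContinuousLinearMap.le_opNorm _ _
    _ ≤ _ := by rw [norm_e, mul_one]; exact ContinuousLinearMap.le_opNorm _ _

lemma H2C2.h1_pd {f : R3 → F} (h : H2C2 f) (i : Fin 3) : H1C1 (pd i f) :=
  ⟨contDiff_pd h.c2 i, (h.h1.mem_pd i).1,
    (memLp_n2_of_le (f := fderiv ℝ (pd i f)) (g := fderiv ℝ (fderiv ℝ f)) zero_le_one h.memDD
      ((contDiff_pd h.c2 i).continuous_fderiv (by norm_num)).aestronglyMeasurable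
      fun x => by rw [one_mul]; exact norm_fderiv_pd_le h.c2 i x).1⟩

lemma pd_comm {f : R3 → F} (h : ContDiff ℝ 2 f) (i j : Fin 3) : pd i (pd j f) = pd j (pd i f) := by
  funext x
  change fderiv ℝ (pd j f) x (e i) = fderiv ℝ (pd i f) x (e j)
  rw [fderiv_pd h, fderiv_pd h]
  exact (h.contDiffAt.isSymmSndFDerivAt (by simp)).eq _ _

lemma pd_eq {f : R3 → F} (i : Fin 3) (x : R3) : pd i f x = fderiv ℝ f x (e i) := rfl

lemma H1C1.add {f g : R3 → F} (hf : H1C1 f) (hg : H1C1 g) : H1C1 (fun x => f x + g x) := by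
  refine ⟨hf.c1.add hg.c1, hf.mem.add hg.mem, ?_⟩
  have : fderiv ℝ (fun x => f x + g x) = fun x => fderiv ℝ f x + fderiv ℝ g x := by
    funext x; exact fderiv_fun_add (hf.diff x) (hg.diff x)
  rw [this]; exact memLp_fun_add hf.memD hg.memD

lemma fderiv_const_smul_fun (c : ℝ) (f : R3 → F) :
    fderiv ℝ (fun x => c • f x) = fun x => c • fderiv ℝ f x := by
  funext x; exact congrFun (fderiv_const_smul_field (𝕜 := ℝ) (f := f) c) x

lemma H1C1.smul {f : R3 → F} (hf : H1C1 f) (c : ℝ) : H1C1 (fun x => c • f x) := by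
  refine ⟨contDiff_const.smul hf.c1, hf.mem.const_smul c, ?_⟩
  rw [fderiv_const_smul_fun]; exact memLp_fun_smul hf.memD c

lemma H1C1.sub {f g : R3 → F} (hf : H1C1 f) (hg : H1C1 g) : H1C1 (fun x => f x - g x) := by
  have := hf.add (hg.smul (-1))
  simpa [sub_eq_add_neg] using this

lemma fderiv_translate (f : R3 → F) (y : R3) :
    fderiv ℝ (fun x => f (x + y)) = fun x => fderiv ℝ f (x + y) := by
  funext x; exact fderiv_comp_add_right y

lemma H1C1.translate {f : R3 → F} (hf : H1C1 f) (y : R3) : H1C1 (fun x => f (x + y)) := by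
  refine ⟨hf.c1.comp (contDiff_id.add contDiff_const), MemLp.translate hf.mem y, ?_⟩
  rw [fderiv_translate]; exact MemLp.translate hf.memD y

lemma H2C2.of_h1 {f : R3 → F} (hc : ContDiff ℝ 2 f) (h : H1C1 f) (h' : H1C1 (fderiv ℝ f)) :
    H2C2 f := ⟨hc, h.mem, h.memD, h'.memD⟩

lemma H2C2.add {f g : R3 → F} (hf : H2C2 f) (hg : H2C2 g) : H2C2 (fun x => f x + g x) := by
  refine .of_h1 (hf.c2.add hg.c2) (hf.h1.add hg.h1) ?_
  have : fderiv ℝ (fun x => f x + g x) = fun x => fderiv ℝ f x + fderiv ℝ g x := by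
    funext x; exact fderiv_fun_add (hf.h1.diff x) (hg.h1.diff x)
  rw [this]; exact hf.h1D.add hg.h1D

lemma H2C2.smul {f : R3 → F} (hf : H2C2 f) (c : ℝ) : H2C2 (fun x => c • f x) := by
  refine .of_h1 (contDiff_const.smul hf.c2) (hf.h1.smul c) ?_
  rw [fderiv_const_smul_fun]; exact hf.h1D.smul c

lemma H2C2.sub {f g : R3 → F} (hf : H2C2 f) (hg : H2C2 g) : H2C2 (fun x => f x - g x) := by
  have := hf.add (hg.smul (-1))
  simpa [sub_eq_add_neg] using this

lemma H2C2.translate {f : R3 → F} (hf : H2C2 f) (y : R3) : H2C2 (fun x => f (x + y)) := by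
  refine .of_h1 (hf.c2.comp (contDiff_id.add contDiff_const)) (hf.h1.translate y) ?_
  rw [fderiv_translate]; exact hf.h1D.translate y

lemma pd_translate (f : R3 → F) (y : R3) (i : Fin 3) :
    pd i (fun x => f (x + y)) = fun x => pd i f (x + y) := by
  funext x; simp [pd, fderiv_comp_add_right]

lemma pd_sub {f g : R3 → F} (hf : Differentiable ℝ f) (hg : Differentiable ℝ g) (i : Fin 3) :
    pd i (fun x => f x - g x) = fun x => pd i f x - pd i g x := by
  funext x; simp [pd, fderiv_fun_sub (hf x) (hg x)]

lemma pd_smul (c : ℝ) (f : R3 → F) (i : Fin 3) :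
    pd i (fun x => c • f x) = fun x => c • pd i f x := by
  funext x; simp [pd, fderiv_const_smul_fun]

lemma pd_coord {f : R3 → R3} (hf : Differentiable ℝ f) (i k : Fin 3) (x : R3) :
    pd i (fun y => f y k) x = pd i f x k := by
  have : HasFDerivAt (fun y => f y k)
      ((EuclideanSpace.proj k : R3 →L[ℝ] ℝ).comp (fderiv ℝ f x)) x :=
    (EuclideanSpace.proj k : R3 →L[ℝ] ℝ).hasFDerivAt.comp x (hf x).hasFDerivAt
  simp [pd, this.fderiv]

lemma H1C1.coord {f : R3 → R3} (hf : H1C1 f) (k : Fin 3) : H1C1 (fun x => f x k) := by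
  have hc : ContDiff ℝ 1 fun x => f x k := (EuclideanSpace.proj k : R3 →L[ℝ] ℝ).contDiff.comp hf.c1
  refine ⟨hc, ?_, ?_⟩
  · refine (memLp_n2_of_le zero_le_one hf.mem hc.continuous.aestronglyMeasurable fun x => ?_).1
    simpa using PiLp.norm_apply_le (f x) k
  · refine (memLp_n2_of_le zero_le_one hf.memD
      (hc.continuous_fderiv (by norm_num)).aestronglyMeasurable fun x => ?_).1
    refine ContinuousLinearMap.opNorm_le_bound _ (by positivity) fun v => ?_
    have : HasFDerivAt (fun y => f y k)
        ((EuclideanSpace.proj k : R3 →L[ℝ] ℝ).comp (fderiv ℝ f x)) x :=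
      (EuclideanSpace.proj k : R3 →L[ℝ] ℝ).hasFDerivAt.comp x (hf.diff x).hasFDerivAt
    rw [this.fderiv, one_mul]
    exact (PiLp.norm_apply_le (fderiv ℝ f x v) k).trans
      (ContinuousLinearMap.le_opNorm _ _)

/-- Integration by parts for scalar functions. -/
lemma integral_pd_mul {f g : R3 → ℝ} (hf : H1C1 f) (hg : H1C1 g) (i : Fin 3) :
    ∫ x, pd i f x * g x = - ∫ x, f x * pd i g x := by
  have := integral_mul_fderiv_eq_neg_fderiv_mul_of_integrable (μ := volume) (f := f) (g := g)
    (v := e i) (MemLp.integrable_mul (hf.mem_pd i).1 hg.mem)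
    (MemLp.integrable_mul hf.mem (hg.mem_pd i).1) (MemLp.integrable_mul hf.mem hg.mem)
    (fun x _ => hf.diff x) (fun x _ => hg.diff x)
  simp only [pd]
  linarith

end Derivatives

lemma integrable_inner' {E : Type*} [NormedAddCommGroup E] [InnerProductSpace ℝ E]
    {f g : R3 → E} (hf : MemLp f 2) (hg : MemLp g 2) :
    Integrable (fun x => inner ℝ (f x) (g x)) :=
  integrable_of_le_mul 1 (hf.1.inner hg.1) hf hg fun x => by
    simpa using norm_inner_le_norm (𝕜 := ℝ) (f x) (g x)

lemma abs_integral_inner_le {E : Type*} [NormedAddCommGroup E] [InnerProductSpace ℝ E]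
    {f g : R3 → E} (hf : MemLp f 2) (hg : MemLp g 2) :
    |∫ x, inner ℝ (f x) (g x)| ≤ n2 f * n2 g := by
  simpa using abs_integral_le_n2_mul (k := fun x => inner ℝ (f x) (g x)) zero_le_one hf hg
    fun x => by simpa using norm_inner_le_norm (𝕜 := ℝ) (f x) (g x)

/-- Integration by parts for functions with values in an inner product space. -/
lemma integral_inner_pd {E : Type*} [NormedAddCommGroup E] [InnerProductSpace ℝ E]
    {f g : R3 → E} (hf : H1C1 f) (hg : H1C1 g) (i : Fin 3) :
    ∫ x, inner ℝ (pd i f x) (g x) = - ∫ x, inner ℝ (f x) (pd i g x) := by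
  have := integral_bilinear_fderiv_right_eq_neg_left_of_integrable (μ := volume) (f := f) (g := g)
    (v := e i) (B := innerSL ℝ) (integrable_inner' (hf.mem_pd i).1 hg.mem)
    (integrable_inner' hf.mem (hg.mem_pd i).1) (integrable_inner' hf.mem hg.mem)
    (fun x _ => hf.diff x) (fun x _ => hg.diff x)
  simp only [innerSL_apply_apply ℝ] at this
  simp only [pd]
  linarith

/-! ### Difference quotients in space -/

section DifferenceQuotient

variable {F : Type*} [NormedAddCommGroup F] [NormedSpace ℝ F]

/-- The `L²` bound of a translation difference by the directional derivative. -/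
lemma memLp_translate_sub [CompleteSpace F] {f : R3 → F} (hf : ContDiff ℝ 1 f) (y : R3)
    (hy : MemLp (fun x => fderiv ℝ f x y) 2) :
    MemLp (fun x => f (x + y) - f x) 2 ∧
      n2 (fun x => f (x + y) - f x) ≤ n2 (fun x => fderiv ℝ f x y) := by
  have : IsProbabilityMeasure (volume.restrict (Ioc (0 : ℝ) 1)) := ⟨by simp⟩
  have hc : Continuous (fun x => fderiv ℝ f x y) :=
    (hf.continuous_fderiv (by norm_num)).clm_apply continuous_const
  -- The increment is the average over θ ∈ (0, 1] of the derivative at x + θy, and all these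
  -- translates have the same L² norm.
  have hl : l2Sq (fun x => f (x + y) - f x) ≤ ENNReal.ofReal (n2 (fun x => fderiv ℝ f x y) ^ 2) := by
    refine l2Sq_le_of_average (ν := volume.restrict (Ioc (0 : ℝ) 1))
      (K := fun θ x => ‖fderiv ℝ f (x + θ • y) y‖ₑ) (by
        exact (hc.comp (g := fun x => fderiv ℝ f x y) (f := fun p : ℝ × R3 => p.2 + p.1 • y)
          (by fun_prop)).enorm.measurable) ?_ (Eventually.of_forall fun θ => ?_)
    · intro x
      have h1 : f (x + y) - f x = ∫ θ in (0:ℝ)..1, fderiv ℝ f (x + θ • y) y := by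
        have := intervalIntegral.integral_eq_sub_of_hasDerivAt (a := 0) (b := 1)
          (f := fun θ : ℝ => f (x + θ • y)) (f' := fun θ => fderiv ℝ f (x + θ • y) y) (fun θ _ => by
            have h2 : HasDerivAt (fun θ : ℝ => x + θ • y) y θ := by
              simpa using ((hasDerivAt_id θ).smul_const y).const_add x
            exact ((hf.differentiable (by norm_num)) _).hasFDerivAt.comp_hasDerivAt θ h2)
          (Continuous.intervalIntegrable (hc.comp (by fun_prop)) _ _)
        simp [this]
      rw [h1, intervalIntegral.integral_of_le zero_le_one]
      exact enorm_integral_le_lintegral_enorm _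
    · change l2Sq (fun x => (fun x => fderiv ℝ f x y) (x + θ • y)) ≤ _
      rw [l2Sq_eq_ofReal (MemLp.translate hy _), n2_translate hy]
  have hm : AEStronglyMeasurable (fun x => f (x + y) - f x) volume := by
    have := hf.continuous
    exact Continuous.aestronglyMeasurable (by fun_prop)
  exact ⟨memLp_of_l2Sq hm (hl.trans_lt ENNReal.ofReal_lt_top),
    n2_le_of_eLpNorm (n2_nonneg _) (n2_le_of_l2Sq (n2_nonneg _) hl)⟩

/-- The difference quotient in direction `e j`. -/
noncomputable def dq (h : ℝ) (j : Fin 3) (f : R3 → F) : R3 → F :=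
  fun x => h⁻¹ • (f (x + h • e j) - f x)

lemma memLp_dq [CompleteSpace F] {f : R3 → F} (hf : ContDiff ℝ 1 f) (j : Fin 3) (hj : MemLp (pd j f) 2) {h : ℝ}
    (hh : h ≠ 0) : MemLp (dq h j f) 2 ∧ n2 (dq h j f) ≤ n2 (pd j f) := by
  have h0 : (fun x => fderiv ℝ f x (h • e j)) = fun x => h • pd j f x := by
    funext x; simp [pd]
  have h1 := memLp_translate_sub hf (h • e j) (by rw [h0]; exact hj.const_smul h)
  refine ⟨h1.1.const_smul h⁻¹, ?_⟩
  unfold dq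
  rw [n2_smul]
  rw [h0, n2_smul] at h1
  calc |h⁻¹| * _ ≤ |h⁻¹| * (|h| * n2 (pd j f)) := by gcongr; exact h1.2
    _ = n2 (pd j f) := by rw [abs_inv, inv_mul_cancel_left₀ (abs_ne_zero.2 hh)]

lemma H2C2.dq {f : R3 → F} (hf : H2C2 f) (h : ℝ) (j : Fin 3) : H2C2 (dq h j f) :=
  ((hf.translate _).sub hf).smul _

lemma H1C1.dq {f : R3 → F} (hf : H1C1 f) (h : ℝ) (j : Fin 3) : H1C1 (dq h j f) :=
  ((hf.translate _).sub hf).smul _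

lemma pd_dq {f : R3 → F} (hf : Differentiable ℝ f) (h : ℝ) (i j : Fin 3) :
    pd i (dq h j f) = RayleighTaylor.dq h j (pd i f) := by
  unfold RayleighTaylor.dq
  have h1 : Differentiable ℝ fun x => f (x + h • e j) := hf.comp (differentiable_id.add_const _)
  rw [pd_smul, pd_sub h1 hf, pd_translate]

lemma tendsto_dq {f : R3 → F} (hf : Differentiable ℝ f) (j : Fin 3) (x : R3) :
    Tendsto (fun h => dq h j f x) (𝓝[≠] 0) (𝓝 (pd j f x)) := by
  have h2 : HasDerivAt (fun θ : ℝ => x + θ • e j) (e j) 0 := by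
    simpa using ((hasDerivAt_id (0:ℝ)).smul_const (e j)).const_add x
  have h3 : HasDerivAt (fun θ : ℝ => f (x + θ • e j)) (pd j f x) 0 := by
    have h4 : HasFDerivAt f (fderiv ℝ f x) (x + (0:ℝ) • e j) := by
      simpa using (hf x).hasFDerivAt
    exact h4.comp_hasDerivAt (0:ℝ) h2
  have := h3.tendsto_slope_zero
  simpa [dq] using this

end DifferenceQuotient

/-! ### The Sobolev inequality in L⁶ -/

section Sobolev6

/-- The `L⁶` norm on `ℝ³` as a real number. -/
noncomputable def n6 {F : Type*} [NormedAddCommGroup F] (f : R3 → F) : ℝ :=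
  (eLpNorm f 6 volume).toReal

lemma n6_nonneg {F : Type*} [NormedAddCommGroup F] (f : R3 → F) : 0 ≤ n6 f := ENNReal.toReal_nonneg

variable {F : Type*} [NormedAddCommGroup F] [NormedSpace ℝ F]

/-- Dilations of a single bump function: the gradient decays like 1/(n + 1), so cutting off costs a
vanishing multiple of the L² norm. -/
lemma exists_cutoff : ∃ (χ : ℕ → R3 → ℝ) (K : ℝ), 0 ≤ K ∧ (∀ n, ContDiff ℝ ∞ (χ n)) ∧
    (∀ n, HasCompactSupport (χ n)) ∧ (∀ n x, 0 ≤ χ n x ∧ χ n x ≤ 1) ∧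
    (∀ n x, ‖fderiv ℝ (χ n) x‖ ≤ K / (n + 1)) ∧ ∀ x, ∀ᶠ n in atTop, χ n x = 1 := by
  let φ : ContDiffBump (0 : R3) := ⟨1, 2, by norm_num, by norm_num⟩
  have hφ : ContDiff ℝ ∞ φ := φ.contDiff
  obtain ⟨K, hK⟩ := (φ.hasCompactSupport.fderiv (𝕜 := ℝ)).exists_bound_of_continuous
    (hφ.continuous_fderiv (by simp))
  have hpos : ∀ n : ℕ, (0 : ℝ) < n + 1 := fun n => by positivity
  refine ⟨fun n x => φ (((n : ℝ) + 1)⁻¹ • x), K, (norm_nonneg _).trans (hK 0), fun n => ?_,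
    fun n => ?_, fun n x => ⟨φ.nonneg, φ.le_one⟩, fun n x => ?_, fun x => ?_⟩
  · exact hφ.comp (contDiff_const_smul _)
  · exact φ.hasCompactSupport.comp_smul (inv_ne_zero (hpos n).ne')
  · rw [fderiv_comp_smul, norm_smul, Real.norm_of_nonneg (inv_nonneg.2 (hpos n).le), div_eq_inv_mul]
    gcongr
    exact hK _
  · obtain ⟨N, hN⟩ := exists_nat_ge ‖x‖
    filter_upwards [eventually_ge_atTop N] with n hn
    refine φ.one_of_mem_closedBall ?_
    rw [mem_closedBall_zero_iff, norm_smul, Real.norm_of_nonneg (inv_nonneg.2 (hpos n).le),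
      inv_mul_le_iff₀ (hpos n)]
    have : (N : ℝ) ≤ n := by exact_mod_cast hn
    change _ ≤ _ * (1 : ℝ)
    linarith

variable (F) in
/-- The constant of the Sobolev inequality `‖f‖_{L⁶} ≤ S ‖∇f‖_{L²}`. -/
noncomputable def sobC [FiniteDimensional ℝ F] : ℝ :=
  SNormLESNormFDerivOfEqConst F (volume : Measure R3) 2

lemma sobC_nonneg [FiniteDimensional ℝ F] : 0 ≤ sobC F := NNReal.coe_nonneg _

/-- The Gagliardo–Nirenberg–Sobolev inequality applies to the compactly supported functions χₙ f.
The gradient of the cutoff contributes K/(n + 1) times ‖f‖, and Fatou's lemma removes it. -/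
lemma H1C1.sobolev [FiniteDimensional ℝ F] {f : R3 → F} (hf : H1C1 f) :
    MemLp f 6 ∧ n6 f ≤ sobC F * n2 (fderiv ℝ f) := by
  obtain ⟨χ, K, hK, hχ, hχc, hχ1, hχd, hχe⟩ := exists_cutoff
  have hd1 : ∀ n, Differentiable ℝ (χ n) := fun n => (hχ n).differentiable (by simp)
  have hfd : ∀ n x, fderiv ℝ (fun x => χ n x • f x) x
      = χ n x • fderiv ℝ f x + (fderiv ℝ (χ n) x).smulRight (f x) := fun n x =>
    fderiv_fun_smul (hd1 n x) (hf.diff x)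
  have hb : ∀ n : ℕ, eLpNorm (fun x => χ n x • f x) 6 volume ≤
      ENNReal.ofReal (sobC F * (n2 (fderiv ℝ f) + K / (n + 1) * n2 f)) := by
    intro n
    have hc : ContDiff ℝ 1 (fun x => χ n x • f x) := ((hχ n).of_le (by simp)).smul hf.c1
    have h := eLpNorm_le_eLpNorm_fderiv_of_eq (μ := (volume : Measure R3)) (p := 2) (p' := 6) hc
      ((hχc n).smul_right) (by norm_num) (by simp) (by simp; norm_num)
    have hm1 : MemLp (fun x => χ n x • fderiv ℝ f x) 2 ∧
        n2 (fun x => χ n x • fderiv ℝ f x) ≤ 1 * n2 (fderiv ℝ f) := by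
      refine memLp_n2_of_le zero_le_one hf.memD ?_ fun x => ?_
      · exact ((hχ n).continuous.smul (hf.c1.continuous_fderiv (by norm_num))).aestronglyMeasurable
      · rw [norm_smul, Real.norm_of_nonneg (hχ1 n x).1]
        exact mul_le_mul_of_nonneg_right (hχ1 n x).2 (norm_nonneg _)
    have hm2 : MemLp (fun x => (fderiv ℝ (χ n) x).smulRight (f x)) 2 ∧
        n2 (fun x => (fderiv ℝ (χ n) x).smulRight (f x)) ≤ K / (n + 1) * n2 f := by
      refine memLp_n2_of_le (by positivity) hf.mem ?_ fun x => ?_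
      · refine Continuous.aestronglyMeasurable ?_
        have h1 := (hχ n).continuous_fderiv (by simp)
        have h2 := hf.c1.continuous
        exact (ContinuousLinearMap.smulRightL ℝ R3 F).continuous₂.comp (h1.prodMk h2)
      · rw [ContinuousLinearMap.norm_smulRight_apply]
        gcongr
        exact hχd n x
    refine h.trans ?_
    have h3 : eLpNorm (fderiv ℝ fun x => χ n x • f x) 2 volume ≤
        ENNReal.ofReal (n2 (fderiv ℝ f) + K / (n + 1) * n2 f) := by
      rw [show (fderiv ℝ fun x => χ n x • f x) = fun x => χ n x • fderiv ℝ f x +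
        (fderiv ℝ (χ n) x).smulRight (f x) from funext (hfd n),
        ← ofReal_n2 (memLp_fun_add hm1.1 hm2.1)]
      refine ENNReal.ofReal_le_ofReal ((n2_add_le hm1.1 hm2.1).trans ?_)
      linarith [hm1.2, hm2.2]
    rw [ENNReal.ofReal_mul sobC_nonneg, sobC, ENNReal.ofReal_coe_nnreal]
    exact mul_le_mul' le_rfl (by simpa using h3)
  have hlim : ∀ x, Tendsto (fun n => χ n x • f x) atTop (𝓝 (f x)) := fun x =>
    tendsto_const_nhds.congr' ((hχe x).mono fun n hn => by simp [hn])
  have hall : ∀ N : ℕ, eLpNorm f 6 volume ≤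
      ENNReal.ofReal (sobC F * (n2 (fderiv ℝ f) + K / (N + 1) * n2 f)) := by
    intro N
    refine Lp.eLpNorm_le_of_ae_tendsto (u := atTop) (f := fun n x => χ n x • f x) ?_
      (fun n => ((hχ n).continuous.smul hf.c1.continuous).aestronglyMeasurable)
      (Eventually.of_forall hlim)
    filter_upwards [eventually_ge_atTop N] with n hn
    refine (hb n).trans (ENNReal.ofReal_le_ofReal ?_)
    have := sobC_nonneg (F := F)
    have := n2_nonneg f
    gcongr
  have hmem : MemLp f 6 := ⟨hf.c1.continuous.aestronglyMeasurable,
    (hall 0).trans_lt ENNReal.ofReal_lt_top⟩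
  refine ⟨hmem, ?_⟩
  have hall' : ∀ N : ℕ, n6 f ≤ sobC F * (n2 (fderiv ℝ f) + K / (N + 1) * n2 f) := fun N =>
    ENNReal.toReal_le_of_le_ofReal (mul_nonneg sobC_nonneg (add_nonneg (n2_nonneg _)
      (mul_nonneg (by positivity) (n2_nonneg _)))) (hall N)
  have hlim2 : Tendsto (fun N : ℕ => sobC F * (n2 (fderiv ℝ f) + K * (1 / ((N : ℝ) + 1)) * n2 f))
      atTop (𝓝 (sobC F * (n2 (fderiv ℝ f) + K * 0 * n2 f))) :=
    (((tendsto_one_div_add_atTop_nhds_zero_nat.const_mul K).mul_const _).const_add _).const_mul _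
  have := ge_of_tendsto' hlim2 (fun N => by rw [mul_one_div]; exact hall' N)
  simpa using this

end Sobolev6

/-! ### L² norm of a product -/

section Product

variable {F G H : Type*} [NormedAddCommGroup F] [NormedAddCommGroup G] [NormedAddCommGroup H]

lemma lintegral_pow_six (f : R3 → F) : ∫⁻ x, ‖f x‖ₑ ^ 6 = eLpNorm f 6 volume ^ 6 := by
  have := eLpNorm_nnreal_pow_eq_lintegral (f := f) (μ := volume) (p := 6) (by norm_num)
  simpa using this.symm

/-- `‖f g‖²_{L²} ≤ ‖f‖²_{L⁶} ‖g‖_{L²} ‖g‖_{L⁶}`. -/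
lemma memLp_n2_mul {f : R3 → F} {g : R3 → G} {h : R3 → H} {C : ℝ} (hC : 0 ≤ C)
    (hf : MemLp f 6) (hg : MemLp g 2) (hg6 : MemLp g 6) (hh : AEStronglyMeasurable h volume)
    (hle : ∀ x, ‖h x‖ ≤ C * (‖f x‖ * ‖g x‖)) :
    MemLp h 2 ∧ n2 h ^ 2 ≤ C ^ 2 * (n6 f ^ 2 * (n2 g * n6 g)) := by
  have hfm := hf.1.enorm
  have hgm := hg.1.enorm
  -- Cauchy–Schwarz will split f²g² as (f²g)·g. The square f⁴g² of the first factor is estimated by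
  -- Hölder with exponents 3/2 and 3.
  have hA : ∫⁻ x, ‖f x‖ₑ ^ 4 * ‖g x‖ₑ ^ 2 ≤ eLpNorm f 6 volume ^ 4 * eLpNorm g 6 volume ^ 2 := by
    have := ENNReal.lintegral_mul_le_Lp_mul_Lq volume (p := 3 / 2) (q := 3)
      ⟨by norm_num, by norm_num, by norm_num⟩ (f := fun x => ‖f x‖ₑ ^ 4)
      (g := fun x => ‖g x‖ₑ ^ 2) (hfm.pow_const 4) (hgm.pow_const 2)
    refine this.trans (le_of_eq ?_)
    have e1 : ∀ a : ℝ≥0∞, (a ^ 4) ^ (3 / 2 : ℝ) = a ^ 6 := fun a => by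
      rw [← ENNReal.rpow_natCast, ← ENNReal.rpow_mul, ← ENNReal.rpow_natCast]; norm_num
    have e2 : ∀ a : ℝ≥0∞, (a ^ 2) ^ (3 : ℝ) = a ^ 6 := fun a => by
      rw [← ENNReal.rpow_natCast, ← ENNReal.rpow_mul, ← ENNReal.rpow_natCast]; norm_num
    simp only [e1, e2, lintegral_pow_six]
    congr 1
    · rw [← ENNReal.rpow_natCast, ← ENNReal.rpow_mul, ← ENNReal.rpow_natCast]; norm_num
    · rw [← ENNReal.rpow_natCast, ← ENNReal.rpow_mul, ← ENNReal.rpow_natCast]; norm_num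
  have hB : ∫⁻ x, ‖f x‖ₑ ^ 2 * ‖g x‖ₑ * ‖g x‖ₑ ≤
      eLpNorm f 6 volume ^ 2 * eLpNorm g 6 volume * eLpNorm g 2 volume := by
    have := ENNReal.lintegral_mul_le_Lp_mul_Lq volume (p := 2) (q := 2)
      ⟨by norm_num, by norm_num, by norm_num⟩ (f := fun x => ‖f x‖ₑ ^ 2 * ‖g x‖ₑ)
      (g := fun x => ‖g x‖ₑ) ((hfm.pow_const 2).mul hgm) hgm
    refine this.trans ?_
    have e0 : ∀ a b : ℝ≥0∞, (a ^ 2 * b) ^ (2 : ℝ) = a ^ 4 * b ^ 2 := fun a b => by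
      rw [ENNReal.rpow_two]; ring
    simp only [e0, ENNReal.rpow_two]
    have e1 : (∫⁻ x, ‖g x‖ₑ ^ 2) ^ (1 / 2 : ℝ) = eLpNorm g 2 volume := by
      change (l2Sq g) ^ (1 / 2 : ℝ) = _
      rw [← eLpNorm_two_sq, ← ENNReal.rpow_natCast, ← ENNReal.rpow_mul]; norm_num
    rw [e1]
    gcongr
    refine (ENNReal.rpow_le_rpow hA (by norm_num)).trans (le_of_eq ?_)
    rw [ENNReal.mul_rpow_of_nonneg _ _ (by norm_num), ← ENNReal.rpow_natCast, ← ENNReal.rpow_mul,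
      ← ENNReal.rpow_natCast, ← ENNReal.rpow_mul, ← ENNReal.rpow_natCast]
    norm_num
  have hl : l2Sq h ≤ ENNReal.ofReal (C ^ 2 * (n6 f ^ 2 * (n2 g * n6 g))) := by
    calc l2Sq h ≤ ∫⁻ x, ENNReal.ofReal C ^ 2 * (‖f x‖ₑ ^ 2 * ‖g x‖ₑ * ‖g x‖ₑ) := by
          refine lintegral_mono fun x => ?_
          have : ‖h x‖ₑ ≤ ENNReal.ofReal C * (‖f x‖ₑ * ‖g x‖ₑ) := by
            simp only [← ofReal_norm]
            rw [← ENNReal.ofReal_mul (norm_nonneg _), ← ENNReal.ofReal_mul hC]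
            exact ENNReal.ofReal_le_ofReal (hle x)
          refine (pow_le_pow_left' this 2).trans (le_of_eq ?_)
          ring
      _ = ENNReal.ofReal C ^ 2 * ∫⁻ x, (‖f x‖ₑ ^ 2 * ‖g x‖ₑ * ‖g x‖ₑ) :=
          lintegral_const_mul'' _ (((hfm.pow_const 2).mul hgm).mul hgm)
      _ ≤ ENNReal.ofReal C ^ 2 *
          (eLpNorm f 6 volume ^ 2 * eLpNorm g 6 volume * eLpNorm g 2 volume) := by gcongr
      _ = _ := by
          rw [← ENNReal.ofReal_toReal hf.2.ne, ← ENNReal.ofReal_toReal hg.2.ne,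
            ← ENNReal.ofReal_toReal hg6.2.ne]
          change ENNReal.ofReal C ^ 2 * (ENNReal.ofReal (n6 f) ^ 2 * ENNReal.ofReal (n6 g) *
            ENNReal.ofReal (n2 g)) = _
          have := n6_nonneg f
          have := n6_nonneg g
          have := n2_nonneg g
          rw [← ENNReal.ofReal_pow hC, ← ENNReal.ofReal_pow (by positivity),
            ← ENNReal.ofReal_mul (by positivity), ← ENNReal.ofReal_mul (by positivity),
            ← ENNReal.ofReal_mul (by positivity)]
          congr 1; ring
  have hm := memLp_of_l2Sq hh (hl.trans_lt ENNReal.ofReal_lt_top)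
  refine ⟨hm, ?_⟩
  rw [l2Sq_eq_ofReal hm] at hl
  have := n2_nonneg g
  have := n6_nonneg g
  exact (ENNReal.ofReal_le_ofReal_iff (by positivity)).1 hl

end Product

/-! ### Orthogonality of gradients and divergence-free fields -/

section Orthogonality

lemma tendsto_n2_indicator {F : Type*} [NormedAddCommGroup F] {f : R3 → F} (hf : MemLp f 2) :
    Tendsto (fun n : ℕ => n2 ((Metric.closedBall (0 : R3) n)ᶜ.indicator f)) atTop (𝓝 0) := by
  have hm : ∀ n : ℕ, MemLp ((Metric.closedBall (0 : R3) n)ᶜ.indicator f) 2 := fun n =>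
    hf.indicator Metric.isClosed_closedBall.measurableSet.compl
  have h : Tendsto (fun n : ℕ => n2 ((Metric.closedBall (0 : R3) n)ᶜ.indicator f) ^ 2) atTop
      (𝓝 0) := by
    simp only [fun n => n2_sq (hm n)]
    rw [show (0 : ℝ) = ∫ _ : R3, (0 : ℝ) by simp]
    refine tendsto_integral_of_dominated_convergence (fun x => ‖f x‖ ^ 2)
      (fun n => by exact (hm n).1.norm.pow 2) (hf.integrable_norm_pow (by norm_num)) (fun n => ?_) ?_
    · refine Eventually.of_forall fun x => ?_
      rw [Real.norm_of_nonneg (by positivity)]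
      gcongr
      exact norm_indicator_le_norm_self _ _
    · refine Eventually.of_forall fun x => tendsto_const_nhds.congr' ?_
      obtain ⟨N, hN⟩ := exists_nat_ge ‖x‖
      filter_upwards [eventually_ge_atTop N] with n hn
      have : (N : ℝ) ≤ n := by exact_mod_cast hn
      rw [indicator_of_notMem (by simpa using hN.trans this)]
      simp
  have := h.sqrt
  simpa [Real.sqrt_sq (n2_nonneg _)] using this

/-- At every point one of the two factors may be replaced by `v` or by the translate of `k`; in the
application these are the tails of `w` and `K` outside a large ball. -/
lemma abs_integral_inner_translate_le {K w k v : R3 → R3} (hK : MemLp K 2) (hw : MemLp w 2)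
    (hk : MemLp k 2) (hv : MemLp v 2) {y : R3} (hy : ∀ x, w x = v x ∨ K (x + y) = k (x + y)) :
    |∫ x, inner ℝ (K (x + y)) (w x)| ≤ n2 K * n2 v + n2 k * n2 w := by
  have hpt : ∀ x, ‖inner ℝ (K (x + y)) (w x)‖ ≤ ‖K (x + y)‖ * ‖v x‖ + ‖k (x + y)‖ * ‖w x‖ := by
    intro x
    refine (norm_inner_le_norm (𝕜 := ℝ) _ _).trans ?_
    rcases hy x with h | h
    · rw [h]; exact le_add_of_nonneg_right (by positivity)
    · rw [h]; exact le_add_of_nonneg_left (by positivity)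
  have h1 := integrable_norm_mul (MemLp.translate hK y) hv
  have h2 := integrable_norm_mul (MemLp.translate hk y) hw
  have e1 := integral_norm_mul_le (MemLp.translate hK y) hv
  have e2 := integral_norm_mul_le (MemLp.translate hk y) hw
  rw [n2_translate hK] at e1
  rw [n2_translate hk] at e2
  refine le_trans (MeasureTheory.norm_integral_le_of_norm_le (h1.add h2)
    (Eventually.of_forall hpt)) ?_
  exact (integral_add h1 h2).trans_le (add_le_add e1 e2)

/-- Translates of an `L²` function tend weakly to zero. -/
lemma exists_translate_inner_le {K w : R3 → R3} (hK : MemLp K 2) (hw : MemLp w 2) {ε : ℝ}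
    (hε : 0 < ε) : ∃ y : R3, |∫ x, inner ℝ (K (x + y)) (w x)| ≤ ε := by
  have ht : Tendsto (fun n : ℕ => n2 K * n2 ((Metric.closedBall (0 : R3) n)ᶜ.indicator w)
      + n2 ((Metric.closedBall (0 : R3) n)ᶜ.indicator K) * n2 w) atTop
      (𝓝 (n2 K * 0 + 0 * n2 w)) :=
    ((tendsto_n2_indicator hw).const_mul _).add ((tendsto_n2_indicator hK).mul_const _)
  simp only [mul_zero, zero_mul, add_zero] at ht
  obtain ⟨n, hn⟩ := (ht.eventually_le_const hε).exists
  have hB := (Metric.isClosed_closedBall (x := (0 : R3)) (ε := n)).measurableSet.compl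
  -- A shift longer than 2n separates two balls of radius n: for each x, either x or x + y lies
  -- outside.
  refine ⟨(2 * n + 1 : ℝ) • e 0, (abs_integral_inner_translate_le hK hw (hK.indicator hB)
    (hw.indicator hB) fun x => ?_).trans hn⟩
  by_cases hx : x ∈ (Metric.closedBall (0 : R3) n)ᶜ
  · exact Or.inl (indicator_of_mem hx w).symm
  refine Or.inr (indicator_of_mem ?_ K).symm
  have hy : ‖(2 * n + 1 : ℝ) • e 0‖ = 2 * n + 1 := by
    rw [norm_smul, norm_e, mul_one]
    exact Real.norm_of_nonneg (by positivity)
  simp only [mem_compl_iff, mem_closedBall_zero_iff, not_le, not_lt] at hx ⊢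
  have := norm_sub_norm_le ((2 * n + 1 : ℝ) • e 0) (-x)
  rw [sub_neg_eq_add, norm_neg, add_comm _ x, hy] at this
  linarith

lemma inner_gradient (q : R3 → ℝ) (x v : R3) : inner ℝ (gradient q x) v = fderiv ℝ q x v := by
  rw [gradient]; exact InnerProductSpace.toDual_symm_apply

lemma norm_gradient (q : R3 → ℝ) (x : R3) : ‖gradient q x‖ = ‖fderiv ℝ q x‖ := by
  rw [gradient]; exact LinearIsometryEquiv.norm_map _ _

/-- The divergence of a vector field. -/
noncomputable def dvg (w : R3 → R3) : R3 → ℝ := fun x => ∑ i, pd i w x i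

/-- Plain integration by parts, which needs `p` itself in L². A pressure need not satisfy this, so
the lemma is applied to translation differences of the pressure. -/
lemma integral_fderiv_apply_eq_zero {p : R3 → ℝ} {w : R3 → R3} (hp : H1C1 p) (hw : H1C1 w)
    (hdiv : ∀ x, dvg w x = 0) : ∫ x, fderiv ℝ p x (w x) = 0 := by
  have h1 : ∀ x, fderiv ℝ p x (w x) = ∑ i, pd i p x * w x i := fun x => by
    rw [fderiv_apply_eq_sum]; simp [mul_comm]
  simp only [h1]
  have i1 : ∀ i, Integrable fun x => pd i p x * w x i := fun i =>
    MemLp.integrable_mul (hp.mem_pd i).1 (hw.coord i).mem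
  have i2 : ∀ i, Integrable fun x => p x * pd i (fun x => w x i) x := fun i =>
    MemLp.integrable_mul hp.mem ((hw.coord i).mem_pd i).1
  rw [integral_finsetSum _ fun i _ => i1 i,
    Finset.sum_congr rfl fun i _ => integral_pd_mul hp (hw.coord i) i, Finset.sum_neg_distrib,
    ← integral_finsetSum _ fun i _ => i2 i]
  simp only [← Finset.mul_sum, fun i x => pd_coord hw.diff i i x]
  simp [show ∀ x, ∑ i, pd i w x i = 0 from hdiv]

/-- Gradients in `L²` are orthogonal to divergence-free fields. -/
lemma integral_inner_gradient_eq_zero {q : R3 → ℝ} {w : R3 → R3} (hq : ContDiff ℝ 1 q)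
    (hg : MemLp (gradient q) 2) (hw : H1C1 w) (hdiv : ∀ x, dvg w x = 0) :
    ∫ x, inner ℝ (gradient q x) (w x) = 0 := by
  have hgd : MemLp (fderiv ℝ q) 2 :=
    (memLp_n2_of_le zero_le_one hg (hq.continuous_fderiv (by norm_num)).aestronglyMeasurable
      fun x => by rw [norm_gradient, one_mul]).1
  -- The function q(· + y) - q is square integrable because ∇q is, hence its gradient is orthogonal
  -- to w: the pairing does not see translations of ∇q.
  have key : ∀ y, ∫ x, inner ℝ (gradient q (x + y)) (w x) = ∫ x, inner ℝ (gradient q x) (w x) := by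
    intro y
    have hqt : ContDiff ℝ 1 fun x => q (x + y) := hq.comp (contDiff_id.add contDiff_const)
    have hp : H1C1 fun x => q (x + y) - q x := by
      refine ⟨hqt.sub hq, (memLp_translate_sub hq y ?_).1, ?_⟩
      · refine (memLp_n2_of_le (norm_nonneg y) hgd ?_ fun x => ?_).1
        · exact ((hq.continuous_fderiv (by norm_num)).clm_apply
            continuous_const).aestronglyMeasurable
        · rw [mul_comm]; exact ContinuousLinearMap.le_opNorm _ _
      · have : fderiv ℝ (fun x => q (x + y) - q x) = fun x => fderiv ℝ q (x + y) - fderiv ℝ q x := by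
          funext x
          rw [fderiv_fun_sub (hqt.differentiable (by norm_num) x)
            (hq.differentiable (by norm_num) x), fderiv_translate]
        rw [this]; exact memLp_fun_sub (MemLp.translate hgd y) hgd
    have h0 := integral_fderiv_apply_eq_zero hp hw hdiv
    have h1 : ∀ x, fderiv ℝ (fun x => q (x + y) - q x) x (w x)
        = inner ℝ (gradient q (x + y)) (w x) - inner ℝ (gradient q x) (w x) := by
      intro x
      rw [fderiv_fun_sub (hqt.differentiable (by norm_num) x)
            (hq.differentiable (by norm_num) x), fderiv_translate, inner_gradient, inner_gradient]
      rfl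
    simp only [h1] at h0
    rw [integral_sub (integrable_inner' (MemLp.translate hg y) hw.mem)
      (integrable_inner' hg hw.mem)] at h0
    linarith
  by_contra hne
  have hpos : 0 < |∫ x, inner ℝ (gradient q x) (w x)| := abs_pos.2 hne
  -- A far translate makes the pairing at most half of its own absolute value.
  obtain ⟨y, hy⟩ := exists_translate_inner_le hg hw.mem (half_pos hpos)
  rw [key y] at hy
  linarith

end Orthogonality

/-! ### H² estimate for the Stokes system -/

section Stokes

lemma dvg_translate {w : R3 → R3} (h : ∀ x, dvg w x = 0) (y : R3) :
    ∀ x, dvg (fun x => w (x + y)) x = 0 := fun x => by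
  simpa [dvg, pd_translate] using h (x + y)

lemma dvg_sub {w v : R3 → R3} (hw : Differentiable ℝ w) (hv : Differentiable ℝ v)
    (h : ∀ x, dvg w x = 0) (h' : ∀ x, dvg v x = 0) : ∀ x, dvg (fun x => w x - v x) x = 0 :=
  fun x => by
    have h1 := h x
    have h2 := h' x
    simp only [dvg] at h1 h2 ⊢
    simp [pd_sub hw hv, Finset.sum_sub_distrib, h1, h2]

lemma dvg_smul {w : R3 → R3} (c : ℝ) (h : ∀ x, dvg w x = 0) : ∀ x, dvg (fun x => c • w x) x = 0 :=
  fun x => by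
    have h1 := h x
    simp only [dvg] at h1 ⊢
    simp [pd_smul, ← Finset.mul_sum, h1]

lemma dvg_dq {w : R3 → R3} (hw : Differentiable ℝ w) (h : ∀ x, dvg w x = 0) (t : ℝ) (j : Fin 3) :
    ∀ x, dvg (dq t j w) x = 0 :=
  dvg_smul _ (dvg_sub (hw.comp (differentiable_id.add_const _)) hw (dvg_translate h _) h)

/-- Discrete integration by parts: a translation of the variable moves the difference quotient to
the other factor and reverses the step. -/
lemma integral_inner_dq {f g : R3 → R3} (hf : MemLp f 2) (hg : MemLp g 2) (t : ℝ) (j : Fin 3) :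
    ∫ x, inner ℝ (f x) (dq (-t) j g x) = - ∫ x, inner ℝ (dq t j f x) (g x) := by
  have e1 : ∫ x, inner ℝ (f (x + t • e j)) (g x) = ∫ x, inner ℝ (f x) (g (x + (-t) • e j)) := by
    rw [← integral_add_right_eq_self (fun x => inner ℝ (f x) (g (x + (-t) • e j))) (t • e j)]
    simp
  have i1 := integrable_inner' hf (MemLp.translate hg ((-t) • e j))
  have i2 := integrable_inner' (MemLp.translate hf (t • e j)) hg
  have i3 := integrable_inner' hf hg
  simp only [dq, inner_smul_left, inner_smul_right, inner_sub_left, inner_sub_right]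
  rw [integral_const_mul, integral_const_mul, integral_sub i1 i3, integral_sub i2 i3, e1]
  simp only [conj_trivial, inv_neg]
  ring

/-- The `H²` estimate for the Stokes system on `ℝ³`. -/
lemma stokes_n2_le {u f : R3 → R3} {q : R3 → ℝ} {μ : ℝ} (hμ : 0 < μ) (hu : H2C2 u)
    (hdiv : ∀ x, dvg u x = 0) (hq : ContDiff ℝ 1 q) (hg : MemLp (gradient q) 2) (hf : MemLp f 2)
    (heq : ∀ x, μ • ∑ i, pd i (pd i u) x = gradient q x + f x) (i j : Fin 3) :
    n2 (pd i (pd j u)) ≤ n2 f / μ := by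
  have key : ∀ t : ℝ, t ≠ 0 → ∀ i, n2 (pd i (dq t j u)) ≤ n2 f / μ := by
    intro t ht
    set d := dq t j u with hd
    -- The test field is a second difference quotient of `u`. It is divergence free, so the pressure
    -- drops out, and summation by parts leaves the squared norm of ∇d, where d is the first
    -- difference quotient.
    set z := dq (-t) j d with hz
    have hdu : H2C2 d := hu.dq t j
    have hzu : H2C2 z := hdu.dq (-t) j
    have hzd : ∀ x, dvg z x = 0 := dvg_dq hdu.h1.diff (dvg_dq hu.h1.diff hdiv t j) (-t) j
    have hzn : n2 z ≤ n2 (pd j d) := (memLp_dq hdu.h1.c1 j (hdu.h1.mem_pd j).1 (neg_ne_zero.2 ht)).2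
    have hS : ∑ i, n2 (pd i d) ^ 2 = - ∑ i, ∫ x, inner ℝ (pd i u x) (pd i z x) := by
      rw [← Finset.sum_neg_distrib]
      refine Finset.sum_congr rfl fun i _ => ?_
      rw [hz, pd_dq hdu.h1.diff, integral_inner_dq (hu.h1.mem_pd i).1 (hdu.h1.mem_pd i).1, neg_neg,
        ← pd_dq hu.h1.diff, n2_sq (hdu.h1.mem_pd i).1]
      simp [hd]
    have hS2 : ∑ i, n2 (pd i d) ^ 2 = ∫ x, inner ℝ (∑ i, pd i (pd i u) x) (z x) := by
      rw [hS, ← Finset.sum_neg_distrib]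
      simp only [sum_inner]
      rw [integral_finsetSum _ fun i _ => integrable_inner' ((hu.h1_pd i).mem_pd i).1 hzu.mem]
      exact Finset.sum_congr rfl fun i _ => (integral_inner_pd (hu.h1_pd i) hzu.h1 i).symm
    have hS3 : μ * ∑ i, n2 (pd i d) ^ 2 = ∫ x, inner ℝ (f x) (z x) := by
      rw [hS2, ← integral_const_mul]
      simp only [← real_inner_smul_left, heq, inner_add_left]
      rw [integral_add (integrable_inner' hg hzu.mem) (integrable_inner' hf hzu.mem),
        integral_inner_gradient_eq_zero hq hg hzu.h1 hzd, zero_add]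
    have hS4 : μ * ∑ i, n2 (pd i d) ^ 2 ≤ n2 f * n2 (pd j d) := by
      rw [hS3]
      refine (le_abs_self _).trans ((abs_integral_inner_le hf hzu.mem).trans ?_)
      have := n2_nonneg f
      gcongr
    have h5 : ∀ i, μ * n2 (pd i d) ^ 2 ≤ n2 f * n2 (pd j d) := fun i =>
      le_trans (mul_le_mul_of_nonneg_left (Finset.single_le_sum
        (f := fun i => n2 (pd i d) ^ 2) (fun i _ => sq_nonneg _) (Finset.mem_univ i)) hμ.le) hS4
    -- The right side of `h5` involves only ∂ⱼd, so the direction i = j closes by itself and then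
    -- controls the other directions.
    have h6 : n2 (pd j d) ≤ n2 f / μ := by
      rw [le_div_iff₀ hμ]
      rcases (n2_nonneg (pd j d)).eq_or_lt with h | h
      · rw [← h]; simpa using n2_nonneg f
      · have := h5 j
        nlinarith
    intro i
    have h7 : n2 (pd i d) ^ 2 ≤ (n2 f / μ) ^ 2 := by
      have h8 : n2 (pd i d) ^ 2 ≤ n2 f / μ * n2 (pd j d) := by
        rw [div_mul_eq_mul_div, le_div_iff₀ hμ, mul_comm]; exact h5 i
      have : 0 ≤ n2 f / μ := div_nonneg (n2_nonneg f) hμ.le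
      nlinarith
    exact le_of_sq_le_sq h7 (div_nonneg (n2_nonneg f) hμ.le)
  have hlim : Tendsto (fun n : ℕ => (1 : ℝ) / (n + 1)) atTop (𝓝[≠] 0) := by
    refine tendsto_nhdsWithin_iff.2 ⟨tendsto_one_div_add_atTop_nhds_zero_nat, ?_⟩
    exact Eventually.of_forall fun n => by
      have : (0 : ℝ) < 1 / ((n : ℝ) + 1) := by positivity
      exact this.ne'
  rw [pd_comm hu.c2]
  refine (memLp_of_tendsto (div_nonneg (n2_nonneg f) hμ.le)
    (f := fun (n : ℕ) => pd i (dq (1 / ((n : ℝ) + 1)) j u))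
    (fun n => ((hu.dq _ j).h1.mem_pd i).1) (fun n => key _ (by positivity) i) fun x => ?_).2
  simp only [pd_dq hu.h1.diff]
  exact (tendsto_dq (hu.h1_pd i).diff j x).comp hlim

end Stokes

/-! ### Regularised power kernels as approximate identities -/

section Kernel

/-- The regularised power `(|x|² + s)^a`. -/
noncomputable def rp (s a : ℝ) (x : R3) : ℝ := (‖x‖ ^ 2 + s) ^ a

variable {s : ℝ}

lemma rp_base_pos (hs : 0 < s) (x : R3) : 0 < ‖x‖ ^ 2 + s := by positivity

lemma rp_pos (hs : 0 < s) (a : ℝ) (x : R3) : 0 < rp s a x := Real.rpow_pos_of_pos (rp_base_pos hs x) a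

lemma contDiff_rp (hs : 0 < s) (a : ℝ) : ContDiff ℝ ∞ (rp s a) :=
  ((contDiff_norm_sq ℝ).add contDiff_const).rpow_const_of_ne fun x => (rp_base_pos hs x).ne'

lemma continuous_rp (hs : 0 < s) (a : ℝ) : Continuous (rp s a) := (contDiff_rp hs a).continuous

lemma differentiable_rp (hs : 0 < s) (a : ℝ) : Differentiable ℝ (rp s a) :=
  (contDiff_rp hs a).differentiable (by simp)

lemma pd_rp (hs : 0 < s) (a : ℝ) (i : Fin 3) (x : R3) :
    pd i (rp s a) x = 2 * a * x i * rp s (a - 1) x := by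
  have h1 : HasFDerivAt (fun x : R3 => ‖x‖ ^ 2 + s) (2 • innerSL ℝ x) x :=
    (hasStrictFDerivAt_norm_sq x).hasFDerivAt.add_const s
  have h2 := h1.rpow_const (p := a) (Or.inl (rp_base_pos hs x).ne')
  have h3 : fderiv ℝ (rp s a) x = _ := h2.fderiv
  simp only [pd, h3]
  have : inner ℝ x (e i) = x i := by
    simp [e, EuclideanSpace.inner_single_right]
  simp [this, rp]
  ring

lemma rp_mul (hs : 0 < s) (a b : ℝ) (x : R3) : rp s a x * rp s b x = rp s (a + b) x :=
  (Real.rpow_add (rp_base_pos hs x) a b).symm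

lemma rp_one (x : R3) : rp s 1 x = ‖x‖ ^ 2 + s := Real.rpow_one _

lemma abs_coord_le (x : R3) (i : Fin 3) : |x i| ≤ ‖x‖ := by simpa using PiLp.norm_apply_le x i

lemma norm_le_rp_half (hs : 0 < s) (x : R3) : ‖x‖ ≤ rp s (1 / 2) x := by
  rw [rp, ← Real.sqrt_eq_rpow]
  exact Real.le_sqrt_of_sq_le (by linarith)

lemma integrable_rp (hs : 0 < s) {a : ℝ} (ha : a < - 3 / 2) : Integrable (rp s a) := by
  have h := integrable_rpow_neg_one_add_norm_sq (E := R3) (μ := volume) (r := -2 * a) (by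
    simp; linarith)
  obtain ⟨m, hm0, hm1, hms⟩ : ∃ m : ℝ, 0 < m ∧ m ≤ 1 ∧ m ≤ s :=
    ⟨min 1 s, lt_min one_pos hs, min_le_left _ _, min_le_right _ _⟩
  refine (h.const_mul (m ^ a)).mono' (continuous_rp hs a).aestronglyMeasurable
    (Eventually.of_forall fun x => ?_)
  rw [Real.norm_of_nonneg (rp_pos hs a x).le, rp, show -(-2 * a) / 2 = a by ring,
    ← Real.mul_rpow hm0.le (by positivity)]
  refine Real.rpow_le_rpow_of_nonpos (by positivity) ?_ (by linarith)
  nlinarith [sq_nonneg ‖x‖]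

lemma memLp_rp (hs : 0 < s) {a : ℝ} (ha : a < - 3 / 4) : MemLp (rp s a) 2 := by
  rw [memLp_two_iff_integrable_sq (continuous_rp hs a).aestronglyMeasurable]
  refine (integrable_rp hs (a := a + a) (by linarith)).congr (Eventually.of_forall fun x => ?_)
  simp only [← rp_mul hs]
  ring

lemma rp_le_rp {a b : ℝ} (h : a ≤ b) (x : R3) : rp 1 a x ≤ rp 1 b x :=
  Real.rpow_le_rpow_of_exponent_le (by nlinarith [sq_nonneg ‖x‖]) h

lemma rp_neg_two (hs : 0 < s) (x : R3) : rp s (-2) x = ((‖x‖ ^ 2 + s) ^ 2)⁻¹ := by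
  rw [rp, Real.rpow_neg (rp_base_pos hs x).le]
  norm_num

lemma rp_neg_one (x : R3) : rp s (-1) x = (‖x‖ ^ 2 + s)⁻¹ := by
  rw [rp, Real.rpow_neg_one]

/-- The mass of the kernel `(1 + |x|²)^{-a}`. -/
noncomputable def rpMass (a : ℝ) : ℝ := ∫ x : R3, rp 1 (-a) x

lemma rpMass_pos {a : ℝ} (ha : 2 ≤ a) : 0 < rpMass a :=
  integral_pos_of_integrable_nonneg_nonzero (x := 0) (continuous_rp one_pos _)
    (integrable_rp one_pos (by linarith)) (fun x => (rp_pos one_pos _ x).le)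
    (rp_pos one_pos _ 0).ne'

/-- The kernels `c³ (1 + |c x|²)^{-a}` are an approximate identity. -/
lemma tendsto_rp_peak {v : R3 → ℝ} (hv : Continuous v) (hm : MemLp v 2) {a : ℝ} (ha : 2 ≤ a) :
    Tendsto (fun c : ℝ => ∫ x, c ^ 3 * rp 1 (-a) (c • x) * v x) atTop (𝓝 (rpMass a * v 0)) := by
  have hB : MeasurableSet (Metric.ball (0 : R3) 1) := Metric.isOpen_ball.measurableSet
  have hmass := rpMass_pos ha
  -- `v` is split at the unit sphere. Inside it is integrable and the approximate identity applies;
  -- outside, the kernel is at most 4/c times a fixed L² function because a ≥ 2.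
  have h1 : Tendsto (fun c : ℝ => ∫ x, (c ^ 3 * ((rpMass a)⁻¹ * rp 1 (-a) (c • x))) •
      (Metric.ball (0 : R3) 1).indicator v x) atTop
        (𝓝 ((Metric.ball (0 : R3) 1).indicator v 0)) := by
    have := tendsto_integral_comp_smul_smul_of_integrable (μ := (volume : Measure R3))
      (φ := fun x => (rpMass a)⁻¹ * rp 1 (-a) x) (g := (Metric.ball (0 : R3) 1).indicator v)
      (fun x => mul_nonneg (inv_nonneg.2 hmass.le) (rp_pos one_pos _ _).le)
      (by rw [integral_const_mul]; exact inv_mul_cancel₀ hmass.ne') ?_ ?_ ?_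
    · simpa using this
    · have h0 : Tendsto (fun x : R3 => (rpMass a)⁻¹ * ‖x‖⁻¹) (Bornology.cobounded R3) (𝓝 0) := by
        simpa using (tendsto_inv_atTop_zero.comp
          (tendsto_norm_cobounded_atTop (E := R3))).const_mul (rpMass a)⁻¹
      refine squeeze_zero' (Eventually.of_forall fun x => ?_) ?_ h0
      · have := rp_pos one_pos (-a) x
        positivity
      · filter_upwards [tendsto_norm_cobounded_atTop.eventually_ge_atTop 1] with x hx
        have hx0 : 0 < ‖x‖ := by linarith
        have h2 : rp 1 (-a) x ≤ (‖x‖ ^ 4)⁻¹ := by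
          refine (rp_le_rp (by linarith : -a ≤ -2) x).trans ?_
          rw [rp_neg_two one_pos]
          refine inv_anti₀ (by positivity) ?_
          nlinarith [sq_nonneg ‖x‖]
        calc _ = (rpMass a)⁻¹ * (‖x‖ ^ 3 * rp 1 (-a) x) := by simp; ring
          _ ≤ (rpMass a)⁻¹ * (‖x‖ ^ 3 * (‖x‖ ^ 4)⁻¹) := by gcongr
          _ = _ := by field_simp
    · rw [integrable_indicator_iff hB]
      exact (hv.continuousOn.integrableOn_compact (isCompact_closedBall 0 1)).mono_set
        Metric.ball_subset_closedBall
    · refine hv.continuousAt.congr ?_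
      filter_upwards [Metric.ball_mem_nhds (0 : R3) one_pos] with x hx
      rw [indicator_of_mem hx]
  have h2 : Tendsto (fun c : ℝ => ∫ x, c ^ 3 * rp 1 (-a) (c • x) *
      (Metric.ball (0 : R3) 1)ᶜ.indicator v x) atTop (𝓝 0) := by
    have h0 : Tendsto (fun c : ℝ => 4 * c⁻¹ * (n2 (rp 1 (-2)) * n2 v)) atTop (𝓝 0) := by
      simpa using (tendsto_inv_atTop_zero.const_mul (4 : ℝ)).mul_const (n2 (rp 1 (-2)) * n2 v)
    refine squeeze_zero_norm' ?_ h0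
    filter_upwards [eventually_ge_atTop 1] with c hc
    have hc0 : 0 < c := by linarith
    refine abs_integral_le_n2_mul (by positivity) (memLp_rp one_pos (by norm_num)) hm fun x => ?_
    by_cases hx : x ∈ (Metric.ball (0 : R3) 1)ᶜ
    · rw [indicator_of_mem hx, abs_mul, Real.norm_of_nonneg (rp_pos one_pos _ x).le, ← mul_assoc]
      refine mul_le_mul_of_nonneg_right ?_ (abs_nonneg _)
      have hx1 : 1 ≤ ‖x‖ := by simpa using hx
      have hr := rp_pos one_pos (-a) (c • x)
      rw [abs_of_nonneg (by positivity)]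
      calc c ^ 3 * rp 1 (-a) (c • x) ≤ c ^ 3 * rp 1 (-2) (c • x) := by
            gcongr; exact rp_le_rp (by linarith) _
        _ = c ^ 3 * ((c ^ 2 * ‖x‖ ^ 2 + 1) ^ 2)⁻¹ := by
            rw [rp_neg_two one_pos, norm_smul, Real.norm_of_nonneg hc0.le, mul_pow]
        _ ≤ c ^ 3 * ((c ^ 2 * ((‖x‖ ^ 2 + 1) / 2)) ^ 2)⁻¹ := by
            gcongr
            have : c ^ 2 * (‖x‖ ^ 2 + 1) ≤ c ^ 2 * (2 * ‖x‖ ^ 2) := by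
              gcongr; nlinarith
            nlinarith
        _ = 4 * c⁻¹ * rp 1 (-2) x := by
            rw [rp_neg_two one_pos]; field_simp; norm_num
    · rw [indicator_of_notMem hx, mul_zero, abs_zero]
      have := rp_pos one_pos (-2) x
      positivity
  have h3 := (h1.const_mul (rpMass a)).add h2
  rw [indicator_of_mem (Metric.mem_ball_self one_pos), add_zero] at h3
  refine h3.congr' ?_
  filter_upwards [eventually_gt_atTop 0] with c hc
  have hi : ∀ B : Set R3, MeasurableSet B →
      Integrable fun x => c ^ 3 * rp 1 (-a) (c • x) * B.indicator v x := by
    intro B hBm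
    have : MemLp (fun x => rp 1 (-a) (c • x)) 2 := by
      refine (memLp_two_iff_integrable_sq
        ((continuous_rp one_pos _).comp (continuous_const_smul c)).aestronglyMeasurable).2 ?_
      have h4 := (memLp_two_iff_integrable_sq
        (continuous_rp one_pos (-a)).aestronglyMeasurable).1 (memLp_rp one_pos (by linarith))
      exact h4.comp_smul hc.ne'
    exact MemLp.integrable_mul (this.const_mul (c ^ 3)) (hm.indicator hBm)
  rw [← integral_const_mul]
  have e1 : ∀ x, rpMass a * ((c ^ 3 * ((rpMass a)⁻¹ * rp 1 (-a) (c • x))) •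
      (Metric.ball (0 : R3) 1).indicator v x) =
      c ^ 3 * rp 1 (-a) (c • x) * (Metric.ball (0 : R3) 1).indicator v x := fun x => by
    rw [smul_eq_mul]; field_simp
  simp only [e1]
  rw [← integral_add (hi _ hB) (hi _ hB.compl)]
  refine integral_congr_ae (Eventually.of_forall fun x => ?_)
  simp only [← mul_add]
  congr 1
  exact congrFun (indicator_self_add_compl (Metric.ball (0 : R3) 1) v) x

/-- A bound on `s^{a-3/2} ∫ (|x|² + s)^{-a} v` uniform in small `s` bounds `v 0`. -/
lemma abs_le_of_rp_bound {v : R3 → ℝ} (hv : Continuous v) (hm : MemLp v 2) {a M : ℝ} (ha : 2 ≤ a)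
    (h : ∀ s : ℝ, 0 < s → s ≤ 1 → |s ^ (a - 3 / 2) * ∫ x, rp s (-a) x * v x| ≤ M) :
    |v 0| ≤ M / rpMass a := by
  have h1 := (tendsto_rp_peak hv hm ha).abs
  have h2 : |rpMass a * v 0| ≤ M := by
    refine le_of_tendsto h1 ?_
    filter_upwards [eventually_ge_atTop 1] with c hc
    have hc0 : 0 < c := by linarith
    -- With s = c⁻², homogeneity turns s^(a - 3/2) (|x|² + s)^(-a) into the peak c³ (1 +
    -- |cx|²)^(-a).
    refine le_trans (le_of_eq ?_) (h ((c ^ 2)⁻¹) (by positivity) (inv_le_one_of_one_le₀ (by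
      nlinarith)))
    congr 1
    rw [← integral_const_mul]
    refine integral_congr_ae (Eventually.of_forall fun x => ?_)
    simp only [rp]
    rw [← mul_assoc]
    congr 1
    have e1 : ‖c • x‖ ^ 2 + 1 = c ^ 2 * (‖x‖ ^ 2 + (c ^ 2)⁻¹) := by
      rw [norm_smul, Real.norm_of_nonneg hc0.le, mul_pow]; field_simp
    rw [e1, Real.mul_rpow (by positivity) (by positivity), ← mul_assoc]
    congr 1
    rw [← Real.rpow_natCast c 2, ← Real.rpow_natCast c 3, ← Real.rpow_neg hc0.le,
      ← Real.rpow_mul hc0.le, ← Real.rpow_mul hc0.le, ← Real.rpow_add hc0]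
    congr 1
    push_cast
    ring
  rw [abs_mul, abs_of_pos (rpMass_pos ha)] at h2
  rwa [le_div_iff₀ (rpMass_pos ha), mul_comm]

end Kernel

lemma integrable_mul_l2 {f g : R3 → ℝ} (hf : MemLp f 2) (hg : MemLp g 2) :
    Integrable fun x => f x * g x := MemLp.integrable_mul hf hg

lemma abs_integral_le_of_le {X : Type*} [MeasurableSpace X] {ν : Measure X} {k g : X → ℝ}
    (hg : Integrable g ν) (h : ∀ x, |k x| ≤ g x) : |∫ x, k x ∂ν| ≤ ∫ x, g x ∂ν :=
  MeasureTheory.norm_integral_le_of_norm_le (f := k) hg (Eventually.of_forall h)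

/-! ### A Riesz potential bound uniform in the regularisation -/

section Potential

lemma n6_eq {F : Type*} [NormedAddCommGroup F] {g : R3 → F} (hg : MemLp g 6) :
    (∫ x, ‖g x‖ ^ (6 : ℝ)) ^ (1 / 6 : ℝ) = n6 g := by
  have := hg.eLpNorm_eq_integral_rpow_norm (by norm_num) (by norm_num)
  rw [n6, this, ENNReal.toReal_ofReal (by positivity)]
  norm_num

/-- The Riesz-type potential bound `∫ |g| / (|x|² + s) ≤ C (‖g‖_{L²} + ‖g‖_{L⁶})`. -/
lemma exists_potential_bound : ∃ C : ℝ, 0 ≤ C ∧ ∀ (F : Type) [NormedAddCommGroup F] (g : R3 → F),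
    MemLp g 2 → MemLp g 6 → ∀ s : ℝ, 0 < s →
      Integrable (fun x => rp s (-1) x * ‖g x‖) ∧
        ∫ x, rp s (-1) x * ‖g x‖ ≤ C * (n2 g + n6 g) := by
  -- Near the origin |x|⁻² lies in L^{6/5}, because 12/5 < 3, and is paired with the L⁶ norm. Away
  -- from it (1 + |x|²)⁻¹ lies in L² and is paired with the L² norm.
  set k : R3 → ℝ := (Metric.ball (0 : R3) 1).indicator fun x => ‖x‖ ^ (-2 : ℝ) with hk
  have hB : MeasurableSet (Metric.ball (0 : R3) 1) := Metric.isOpen_ball.measurableSet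
  have hkm : Measurable k := by
    refine Measurable.indicator ?_ hB
    exact measurable_norm.pow_const (-2 : ℝ)
  have hk0 : ∀ x, 0 ≤ k x := fun x => indicator_nonneg (fun x _ => by positivity) x
  have hkp : MemLp k (ENNReal.ofReal (6 / 5)) := by
    rw [← integrable_norm_rpow_iff hkm.aestronglyMeasurable (by norm_num) (by simp),
      ENNReal.toReal_ofReal (by norm_num)]
    have h1 : IntegrableOn (fun x : R3 => ‖x‖ ^ (-(12 / 5) : ℝ)) (Metric.ball 0 1) :=
      integrableOn_ball_of_norm_le_rpow (C := 1) (α := 12 / 5) (by simp) (by simp; norm_num)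
        (Eventually.of_forall fun x => by
          rw [Real.norm_of_nonneg (by positivity), one_mul])
        (measurable_norm.pow_const _).aestronglyMeasurable
    refine ((integrable_indicator_iff hB).2 h1).congr (Eventually.of_forall fun x => ?_)
    by_cases hx : x ∈ Metric.ball (0 : R3) 1
    · simp only [hk, indicator_of_mem hx]
      rw [Real.norm_of_nonneg (by positivity), ← Real.rpow_mul (norm_nonneg _)]
      norm_num
    · simp only [hk, indicator_of_notMem hx, norm_zero]
      rw [Real.zero_rpow (by norm_num)]
  set A := (∫ x, ‖k x‖ ^ (6 / 5 : ℝ)) ^ (1 / (6 / 5) : ℝ) with hA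
  have hA0 : 0 ≤ A := by positivity
  refine ⟨A + 2 * n2 (rp 1 (-1)), add_nonneg hA0 (mul_nonneg zero_le_two (n2_nonneg _)), ?_⟩
  intro F _ g hg hg6 s hs
  have hg6' : MemLp (fun x => ‖g x‖) (ENNReal.ofReal 6) := by simpa using hg6.norm
  have hpq : Real.HolderConjugate (6 / 5) 6 := ⟨by norm_num, by norm_num, by norm_num⟩
  have h1 := integral_mul_norm_le_Lp_mul_Lq hpq hkp hg6'
  simp only [norm_norm] at h1
  rw [n6_eq hg6] at h1
  have i1 : Integrable fun x => ‖k x‖ * ‖g x‖ := by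
    have : ENNReal.HolderConjugate (ENNReal.ofReal (6 / 5)) (ENNReal.ofReal 6) := hpq.ennrealOfReal
    exact MemLp.integrable_mul hkp.norm hg6'
  have m1 := memLp_rp one_pos (a := -1) (by norm_num)
  have h2 := integral_norm_mul_le m1 hg
  have i2 := (integrable_norm_mul m1 hg).const_mul 2
  -- Outside the unit ball |x|² + 1 ≤ 2(|x|² + s), whence the 2. The origin must be excluded because
  -- `k` vanishes there by the convention for negative powers of 0.
  have hpt : ∀ᵐ x : R3, rp s (-1) x * ‖g x‖ ≤ ‖k x‖ * ‖g x‖ + 2 * (‖rp 1 (-1) x‖ * ‖g x‖) := by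
    filter_upwards [(Set.countable_singleton (0 : R3)).ae_notMem volume] with x h0
    rw [← mul_assoc, ← add_mul]
    refine mul_le_mul_of_nonneg_right ?_ (norm_nonneg _)
    rw [Real.norm_of_nonneg (hk0 x), Real.norm_of_nonneg (rp_pos one_pos _ x).le]
    by_cases hx : x ∈ Metric.ball (0 : R3) 1
    · refine le_add_of_le_of_nonneg ?_ (by have := rp_pos one_pos (-1) x; positivity)
      simp only [hk, indicator_of_mem hx]
      rw [rp_neg_one, Real.rpow_neg (norm_nonneg _), Real.rpow_two]
      have h0' : 0 < ‖x‖ := norm_pos_iff.2 (by simpa using h0)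
      exact inv_anti₀ (by positivity) (by linarith)
    · refine le_add_of_nonneg_of_le (hk0 x) ?_
      have hx1 : 1 ≤ ‖x‖ := by simpa using hx
      rw [rp_neg_one, rp_neg_one, ← div_eq_mul_inv, inv_eq_one_div,
        div_le_div_iff₀ (by positivity) (by positivity)]
      nlinarith
  have i3 : Integrable fun x => rp s (-1) x * ‖g x‖ := by
    refine (i1.add i2).mono' ((continuous_rp hs _).aestronglyMeasurable.mul hg.1.norm) ?_
    filter_upwards [hpt] with x hx
    rw [Real.norm_of_nonneg (mul_nonneg (rp_pos hs _ x).le (norm_nonneg _))]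
    exact hx
  refine ⟨i3, ?_⟩
  calc ∫ x, rp s (-1) x * ‖g x‖ ≤ ∫ x, (‖k x‖ * ‖g x‖ + 2 * (‖rp 1 (-1) x‖ * ‖g x‖)) :=
        integral_mono_ae i3 (i1.add i2) hpt
    _ = (∫ x, ‖k x‖ * ‖g x‖) + 2 * ∫ x, ‖rp 1 (-1) x‖ * ‖g x‖ := by
        rw [integral_add i1 i2, integral_const_mul]
    _ ≤ A * n6 g + 2 * (n2 (rp 1 (-1)) * n2 g) := by gcongr
    _ ≤ _ := by
        have e1 := mul_nonneg hA0 (n2_nonneg g)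
        have e2 := mul_nonneg (n2_nonneg (rp 1 (-1))) (n6_nonneg g)
        linarith

end Potential

/-! ### Supremum bound by the gradient in L² ∩ L⁶ -/

section SupBound

variable {s : ℝ}

lemma pd_mul {f g : R3 → ℝ} (hf : Differentiable ℝ f) (hg : Differentiable ℝ g) (i : Fin 3) (x : R3) :
    pd i (fun x => f x * g x) x = pd i f x * g x + f x * pd i g x := by
  simp only [pd, fderiv_fun_mul (hf x) (hg x)]
  simp
  ring

lemma pd_coordinate (i k : Fin 3) (x : R3) :
    pd i (fun x : R3 => x k) x = if k = i then 1 else 0 := by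
  have := pd_coord (f := fun x => x) differentiable_id i k x
  rw [this]
  simp [pd, e_apply]

lemma differentiable_coord (k : Fin 3) : Differentiable ℝ fun x : R3 => x k :=
  (EuclideanSpace.proj k : R3 →L[ℝ] ℝ).differentiable

lemma contDiff_coord (k : Fin 3) : ContDiff ℝ ∞ fun x : R3 => x k :=
  (EuclideanSpace.proj k : R3 →L[ℝ] ℝ).contDiff

lemma rp_half_mul (hs : 0 < s) (a : ℝ) (x : R3) : ‖x‖ * rp s a x ≤ rp s (a + 1 / 2) x := by
  rw [add_comm, ← rp_mul hs]
  exact mul_le_mul_of_nonneg_right (norm_le_rp_half hs x) (rp_pos hs a x).le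

lemma rp_le_const_mul (hs : 0 < s) {a b : ℝ} (h : a ≤ b) (x : R3) :
    rp s a x ≤ s ^ (a - b) * rp s b x := by
  have : rp s a x = rp s (a - b) x * rp s b x := by rw [rp_mul hs]; congr 1; ring
  rw [this]
  refine mul_le_mul_of_nonneg_right ?_ (rp_pos hs b x).le
  exact Real.rpow_le_rpow_of_nonpos hs (by nlinarith [sq_nonneg ‖x‖]) (by linarith)

lemma H1C1.of_pd {f : R3 → ℝ} {g : R3 → ℝ} {C : ℝ} (hC : 0 ≤ C) (hg : MemLp g 2)
    (hf : ContDiff ℝ 1 f) (h0 : ∀ x, |f x| ≤ C * |g x|) (h1 : ∀ i x, |pd i f x| ≤ C * |g x|) :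
    H1C1 f := by
  refine ⟨hf, (memLp_n2_of_le hC hg hf.continuous.aestronglyMeasurable h0).1,
    (memLp_n2_of_le (C := 3 * C) (by positivity) hg
      (hf.continuous_fderiv (by norm_num)).aestronglyMeasurable fun x => ?_).1⟩
  have h2 := norm_fderiv_sq_le f x
  have h3 : ∑ i, ‖pd i f x‖ ^ 2 ≤ ∑ _i : Fin 3, (C * ‖g x‖) ^ 2 :=
    Finset.sum_le_sum fun i _ => pow_le_pow_left₀ (norm_nonneg _) (h1 i x) 2
  simp only [Finset.sum_const, Finset.card_univ, Fintype.card_fin, nsmul_eq_mul] at h3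
  have h4 : 0 ≤ C * ‖g x‖ := by positivity
  refine le_of_sq_le_sq (h2.trans (h3.trans ?_)) (by positivity)
  push_cast
  nlinarith

/-- Pointwise bound by the gradient in `L² ∩ L⁶`. -/
lemma exists_sup_bound : ∃ C : ℝ, 0 ≤ C ∧ ∀ v : R3 → ℝ, H1C1 v → MemLp (fderiv ℝ v) 6 →
    ∀ x, |v x| ≤ C * (n2 (fderiv ℝ v) + n6 (fderiv ℝ v)) := by
  obtain ⟨K, hK, hpot⟩ := exists_potential_bound
  refine ⟨K / rpMass (5 / 2), div_nonneg hK (rpMass_pos (by norm_num)).le, ?_⟩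
  have key : ∀ v : R3 → ℝ, H1C1 v → MemLp (fderiv ℝ v) 6 →
      |v 0| ≤ K / rpMass (5 / 2) * (n2 (fderiv ℝ v) + n6 (fderiv ℝ v)) := by
    intro v hv hv6
    rw [div_mul_eq_mul_div]
    refine abs_le_of_rp_bound hv.c1.continuous hv.mem (by norm_num) fun s hs hs1 => ?_
    obtain ⟨hi, hb⟩ := hpot _ (fderiv ℝ v) hv.memD hv6 s hs
    -- Up to a constant this is the gradient of the Newtonian kernel with |x|² replaced by |x|² + s.
    -- Its divergence 3s(|x|² + s)^(-5/2) concentrates at the origin, so pairing `k` with ∇v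
    -- recovers v(0).
    set k : Fin 3 → R3 → ℝ := fun i x => x i * rp s (-(3 / 2)) x with hk
    have hkd : ∀ i j x, pd j (k i) x = (if i = j then 1 else 0) * rp s (-(3 / 2)) x
        - 3 * (x i * x j) * rp s (-(5 / 2)) x := by
      intro i j x
      rw [hk, pd_mul (differentiable_coord i) (differentiable_rp hs _), pd_coordinate, pd_rp hs]
      norm_num
      ring
    have hk0 : ∀ i x, |k i x| ≤ rp s (-1) x := by
      intro i x
      rw [hk, abs_mul, abs_of_pos (rp_pos hs _ x)]
      have := rp_half_mul hs (-(3 / 2)) x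
      norm_num at this
      refine le_trans (mul_le_mul_of_nonneg_right (abs_coord_le x i) (rp_pos hs _ x).le) ?_
      convert this using 2
    have hk1 : ∀ i, H1C1 (k i) := by
      intro i
      refine H1C1.of_pd (g := rp s (-1)) (C := 1 + 4 * s ^ (-(1 / 2) : ℝ)) (by positivity)
        (memLp_rp hs (by norm_num)) ?_ (fun x => ?_) (fun j x => ?_)
      · exact ((contDiff_coord i).mul (contDiff_rp hs _)).of_le (by simp)
      · rw [abs_of_pos (rp_pos hs _ x)]
        have h1 := rp_pos hs (-1) x
        have h2 : 0 ≤ 4 * s ^ (-(1 / 2) : ℝ) := by positivity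
        nlinarith [hk0 i x]
      · rw [hkd, abs_of_pos (rp_pos hs _ x)]
        have h1 := rp_pos hs (-1) x
        have h3 := rp_pos hs (-(3 / 2)) x
        have h2 := rp_le_const_mul hs (show (-(3 / 2) : ℝ) ≤ -1 by norm_num) x
        have h4 : |x i * x j| * rp s (-(5 / 2)) x ≤ rp s (-(3 / 2)) x := by
          rw [abs_mul]
          have e1 := rp_half_mul hs (-(5 / 2)) x
          have e2 := rp_half_mul hs (-(5 / 2) + 1 / 2) x
          have e3 : (-(5 / 2) + 1 / 2 + 1 / 2 : ℝ) = -(3 / 2) := by norm_num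
          rw [e3] at e2
          have e4 := rp_pos hs (-(5 / 2)) x
          calc |x i| * |x j| * rp s (-(5 / 2)) x ≤ ‖x‖ * ‖x‖ * rp s (-(5 / 2)) x := by
                gcongr <;> exact abs_coord_le x _
            _ = ‖x‖ * (‖x‖ * rp s (-(5 / 2)) x) := by ring
            _ ≤ ‖x‖ * rp s (-(5 / 2) + 1 / 2) x := by gcongr
            _ ≤ _ := e2
        have e5 : (-(3 / 2) - -1 : ℝ) = -(1 / 2) := by norm_num
        rw [e5] at h2
        calc _ ≤ |(if i = j then 1 else 0) * rp s (-(3 / 2)) x|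
              + |3 * (x i * x j) * rp s (-(5 / 2)) x| := abs_sub _ _
          _ ≤ rp s (-(3 / 2)) x + 3 * (|x i * x j| * rp s (-(5 / 2)) x) := by
              gcongr
              · rw [abs_mul, abs_of_pos h3]
                split_ifs <;> simp [h3.le]
              · rw [abs_mul, abs_mul, abs_of_pos (rp_pos hs _ x), abs_of_pos (by norm_num : (0:ℝ) < 3)]
                exact (mul_assoc _ _ _).le
          _ ≤ 4 * rp s (-(3 / 2)) x := by linarith
          _ ≤ _ := by nlinarith
    have hsum : ∀ x, ∑ i, pd i (k i) x = 3 * (s * rp s (-(5 / 2)) x) := by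
      intro x
      simp only [hkd]
      have e1 : rp s (-(3 / 2)) x = (‖x‖ ^ 2 + s) * rp s (-(5 / 2)) x := by
        rw [← rp_one, rp_mul hs]; norm_num
      have e2 : ‖x‖ ^ 2 = x 0 ^ 2 + x 1 ^ 2 + x 2 ^ 2 := by
        rw [EuclideanSpace.norm_sq_eq, Fin.sum_univ_three]; simp
      rw [Fin.sum_univ_three, e1, e2]
      simp
      ring
    have hmain : 3 * (s * ∫ x, rp s (-(5 / 2)) x * v x) = - ∑ i, ∫ x, k i x * pd i v x := by
      rw [← Finset.sum_neg_distrib, ← Finset.sum_congr rfl fun i _ => integral_pd_mul (hk1 i) hv i,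
        ← integral_finsetSum _ fun i _ => integrable_mul_l2 ((hk1 i).mem_pd i).1 hv.mem,
        ← integral_const_mul, ← integral_const_mul]
      refine integral_congr_ae (Eventually.of_forall fun x => ?_)
      dsimp only
      rw [← Finset.sum_mul, hsum]
      ring
    have hle : ∀ i, |∫ x, k i x * pd i v x| ≤ K * (n2 (fderiv ℝ v) + n6 (fderiv ℝ v)) := by
      intro i
      refine le_trans (abs_integral_le_of_le hi fun x => ?_) hb
      rw [abs_mul]
      exact mul_le_mul (hk0 i x) (norm_pd_le i v x) (abs_nonneg _) (rp_pos hs _ x).le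
    have e : s ^ (5 / 2 - 3 / 2 : ℝ) = s := by norm_num
    rw [e]
    have h3 : |3 * (s * ∫ x, rp s (-(5 / 2)) x * v x)| ≤
        3 * (K * (n2 (fderiv ℝ v) + n6 (fderiv ℝ v))) := by
      rw [hmain, abs_neg]
      refine (Finset.abs_sum_le_sum_abs _ _).trans ?_
      rw [Fin.sum_univ_three]
      linarith [hle 0, hle 1, hle 2]
    rw [abs_mul, abs_of_pos (by norm_num : (0:ℝ) < 3)] at h3
    linarith
  intro v hv hv6 x
  have := key (fun y => v (y + x)) (hv.translate x) (by
    rw [fderiv_translate]; exact MemLp.translate hv6 x)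
  rw [fderiv_translate, n2_translate hv.memD, n6, eLpNorm_translate _ hv6.1, zero_add] at this
  exact this

end SupBound

/-! ### Pointwise gradient bound for the Stokes system -/

section Stokeslet

variable {s : ℝ}

/-- Kronecker delta. -/
def kd (i j : Fin 3) : ℝ := if i = j then 1 else 0

lemma kd_comm (i j : Fin 3) : kd i j = kd j i := by simp [kd, eq_comm]

lemma abs_kd_le (i j : Fin 3) : |kd i j| ≤ 1 := by unfold kd; split_ifs <;> simp

/-- The third derivatives of `(|x|² + s)^{1/2}`. -/
noncomputable def T3 (s : ℝ) (i j k : Fin 3) (x : R3) : ℝ :=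
  -(kd i j * x k + kd i k * x j + kd j k * x i) * rp s (-(3 / 2)) x
    + 3 * (x i * x j * x k) * rp s (-(5 / 2)) x

/-- The fourth derivatives of `(|x|² + s)^{1/2}`. -/
noncomputable def T4 (s : ℝ) (l i j k : Fin 3) (x : R3) : ℝ :=
  -(kd i j * kd k l + kd i k * kd j l + kd j k * kd i l) * rp s (-(3 / 2)) x
    + 3 * ((kd i j * x k + kd i k * x j + kd j k * x i) * x l
      + (kd i l * x j * x k + kd j l * x i * x k + kd k l * x i * x j)) * rp s (-(5 / 2)) x
    - 15 * (x i * x j * x k * x l) * rp s (-(7 / 2)) x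

lemma contDiff_T3 (hs : 0 < s) (i j k : Fin 3) : ContDiff ℝ 1 (T3 s i j k) := by
  have h1 := fun k => (contDiff_coord k).of_le (m := 1) (by simp)
  have h3 := (contDiff_rp hs (-(3 / 2))).of_le (m := 1) (by simp)
  have h5 := (contDiff_rp hs (-(5 / 2))).of_le (m := 1) (by simp)
  have h2 := h1 i
  have h4 := h1 j
  have h6 := h1 k
  unfold T3
  fun_prop

lemma pd_T3 (hs : 0 < s) (l i j k : Fin 3) (x : R3) : pd l (T3 s i j k) x = T4 s l i j k x := by
  have h1 : ∀ k : Fin 3, HasFDerivAt (fun x : R3 => x k) (EuclideanSpace.proj k : R3 →L[ℝ] ℝ) x :=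
    fun k => (EuclideanSpace.proj k : R3 →L[ℝ] ℝ).hasFDerivAt
  have h3 := (differentiable_rp hs (-(3 / 2)) x).hasFDerivAt
  have h5 := (differentiable_rp hs (-(5 / 2)) x).hasFDerivAt
  have h := (((((h1 k).const_mul (kd i j)).add ((h1 j).const_mul (kd i k))).add
    ((h1 i).const_mul (kd j k))).neg.mul h3).add
      (((((h1 i).mul (h1 j)).mul (h1 k)).const_mul 3).mul h5)
  have eT : fderiv ℝ (T3 s i j k) x = _ := h.fderiv
  have e3 : fderiv ℝ (rp s (-(3 / 2))) x (e l) = _ := pd_rp hs (-(3 / 2)) l x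
  have e5 : fderiv ℝ (rp s (-(5 / 2))) x (e l) = _ := pd_rp hs (-(5 / 2)) l x
  have n3 : (-(3 / 2) - 1 : ℝ) = -(5 / 2) := by norm_num
  have n5 : (-(5 / 2) - 1 : ℝ) = -(7 / 2) := by norm_num
  rw [n3] at e3
  rw [n5] at e5
  have he : ∀ m : Fin 3, e l m = kd m l := fun m => by rw [e_apply]; rfl
  rw [pd, eT]
  simp [he, e3, e5, T4]
  ring

/-- `T4` is totally symmetric, being a fourth derivative. Only the exchanges of the first index with
each of the other three are needed. -/
lemma T4_swap (l i j k : Fin 3) (x : R3) : T4 s l i j k x = T4 s i l j k x := by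
  simp only [T4, kd_comm l, kd_comm j i, kd_comm k i]
  ring

lemma T4_swap_third (l i j k : Fin 3) (x : R3) : T4 s l i j k x = T4 s j i l k x := by
  simp only [T4, kd_comm l, kd_comm k j]
  ring

lemma T4_swap_fourth (l i j k : Fin 3) (x : R3) : T4 s l i j k x = T4 s k i j l x := by
  simp only [T4, kd_comm l]
  ring

/-- The bilaplacian of (|x|² + s)^(1/2). Since |x| is a multiple of the fundamental solution of the
bilaplacian, the result is again a kernel that concentrates at the origin as s → 0. -/
lemma sum_T4 (hs : 0 < s) (x : R3) :
    ∑ l, ∑ m, T4 s l m m l x = -15 * (s ^ 2 * rp s (-(7 / 2)) x) := by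
  have e1 : rp s (-(3 / 2)) x = (‖x‖ ^ 2 + s) ^ 2 * rp s (-(7 / 2)) x := by
    rw [← rp_one, sq, rp_mul hs, rp_mul hs]; norm_num
  have e2 : rp s (-(5 / 2)) x = (‖x‖ ^ 2 + s) * rp s (-(7 / 2)) x := by
    rw [← rp_one, rp_mul hs]; norm_num
  have e3 : ‖x‖ ^ 2 = x 0 ^ 2 + x 1 ^ 2 + x 2 ^ 2 := by
    rw [EuclideanSpace.norm_sq_eq, Fin.sum_univ_three]; simp
  simp only [Fin.sum_univ_three, T4, e1, e2, e3, kd]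
  simp
  ring

lemma abs_mono_mul_rp_le (hs : 0 < s) (x : R3) (i j : Fin 3) (a : ℝ) :
    |x i * x j| * rp s a x ≤ rp s (a + 1) x := by
  have h := rp_pos hs a x
  have h1 : |x i * x j| ≤ ‖x‖ ^ 2 + s := by
    rw [abs_mul]
    have := mul_le_mul (abs_coord_le x i) (abs_coord_le x j) (abs_nonneg _) (norm_nonneg x)
    nlinarith
  calc _ ≤ (‖x‖ ^ 2 + s) * rp s a x := by gcongr
    _ = rp s (a + 1) x := by rw [← rp_one, rp_mul hs, add_comm]

lemma abs_T3_le (hs : 0 < s) (i j k : Fin 3) (x : R3) : |T3 s i j k x| ≤ 6 * rp s (-1) x := by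
  have h3 : ∀ m, |x m| * rp s (-(3 / 2)) x ≤ rp s (-1) x := fun m => by
    have := rp_half_mul hs (-(3 / 2)) x
    rw [show (-(3 / 2) + 1 / 2 : ℝ) = -1 by norm_num] at this
    exact (mul_le_mul_of_nonneg_right (abs_coord_le x m) (rp_pos hs _ x).le).trans this
  have h5 : |x i * x j * x k| * rp s (-(5 / 2)) x ≤ rp s (-1) x := by
    have := abs_mono_mul_rp_le hs x i j (-(5 / 2))
    rw [show (-(5 / 2) + 1 : ℝ) = -(3 / 2) by norm_num] at this
    calc _ = |x k| * (|x i * x j| * rp s (-(5 / 2)) x) := by rw [abs_mul (x i * x j)]; ring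
      _ ≤ |x k| * rp s (-(3 / 2)) x := by gcongr
      _ ≤ _ := h3 k
  have hk : ∀ a b m, |kd a b * x m| ≤ |x m| := fun a b m => by
    rw [abs_mul]; exact mul_le_of_le_one_left (abs_nonneg _) (abs_kd_le a b)
  have hr3 := rp_pos hs (-(3 / 2)) x
  have hr5 := rp_pos hs (-(5 / 2)) x
  unfold T3
  calc _ ≤ |-(kd i j * x k + kd i k * x j + kd j k * x i) * rp s (-(3 / 2)) x|
        + |3 * (x i * x j * x k) * rp s (-(5 / 2)) x| := abs_add_le _ _
    _ ≤ (|x k| + |x j| + |x i|) * rp s (-(3 / 2)) x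
        + 3 * (|x i * x j * x k| * rp s (-(5 / 2)) x) := by
        rw [abs_mul, abs_neg, abs_of_pos hr3, abs_mul, abs_of_pos hr5, abs_mul,
          abs_of_pos (by norm_num : (0 : ℝ) < 3), mul_assoc 3]
        gcongr
        exact (abs_add_three _ _ _).trans (add_le_add_three (hk _ _ _) (hk _ _ _) (hk _ _ _))
    _ ≤ _ := by linarith [h3 i, h3 j, h3 k]

lemma abs_T4_le (hs : 0 < s) (l i j k : Fin 3) (x : R3) :
    |T4 s l i j k x| ≤ 36 * rp s (-(3 / 2)) x := by
  have hr3 := rp_pos hs (-(3 / 2)) x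
  have hr5 := rp_pos hs (-(5 / 2)) x
  have hr7 := rp_pos hs (-(7 / 2)) x
  have h5 : ∀ m n, |x m * x n| * rp s (-(5 / 2)) x ≤ rp s (-(3 / 2)) x := fun m n => by
    have := abs_mono_mul_rp_le hs x m n (-(5 / 2))
    rwa [show (-(5 / 2) + 1 : ℝ) = -(3 / 2) by norm_num] at this
  have h7 : |x i * x j * x k * x l| * rp s (-(7 / 2)) x ≤ rp s (-(3 / 2)) x := by
    have := abs_mono_mul_rp_le hs x i j (-(7 / 2))
    rw [show (-(7 / 2) + 1 : ℝ) = -(5 / 2) by norm_num] at this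
    calc _ = |x k * x l| * (|x i * x j| * rp s (-(7 / 2)) x) := by
          rw [mul_assoc (x i * x j), abs_mul (x i * x j)]; ring
      _ ≤ |x k * x l| * rp s (-(5 / 2)) x := by gcongr
      _ ≤ _ := h5 k l
  have hk : ∀ a b c d, |kd a b * kd c d| ≤ 1 := fun a b c d => by
    rw [abs_mul]; exact mul_le_one₀ (abs_kd_le a b) (abs_nonneg _) (abs_kd_le c d)
  have hk2 : ∀ a b m n, |kd a b * x m * x n| ≤ |x m * x n| := fun a b m n => by
    rw [mul_assoc, abs_mul]; exact mul_le_of_le_one_left (abs_nonneg _) (abs_kd_le a b)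
  have e1 : |-(kd i j * kd k l + kd i k * kd j l + kd j k * kd i l) * rp s (-(3 / 2)) x|
      ≤ 3 * rp s (-(3 / 2)) x := by
    rw [abs_mul, abs_neg, abs_of_pos hr3]
    gcongr
    refine (abs_add_three _ _ _).trans ?_
    linarith [hk i j k l, hk i k j l, hk j k i l]
  have e2 : |3 * ((kd i j * x k + kd i k * x j + kd j k * x i) * x l
      + (kd i l * x j * x k + kd j l * x i * x k + kd k l * x i * x j)) * rp s (-(5 / 2)) x|
      ≤ 18 * rp s (-(3 / 2)) x := by
    rw [abs_mul, abs_mul, abs_of_pos hr5, abs_of_pos (by norm_num : (0 : ℝ) < 3)]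
    have : |(kd i j * x k + kd i k * x j + kd j k * x i) * x l
      + (kd i l * x j * x k + kd j l * x i * x k + kd k l * x i * x j)| ≤
      (|x k * x l| + |x j * x l| + |x i * x l|) + (|x j * x k| + |x i * x k| + |x i * x j|) := by
      rw [add_mul, add_mul]
      refine (abs_add_le _ _).trans (add_le_add ((abs_add_three _ _ _).trans ?_)
        ((abs_add_three _ _ _).trans ?_)) <;>
      exact add_le_add_three (hk2 _ _ _ _) (hk2 _ _ _ _) (hk2 _ _ _ _)
    calc _ ≤ 3 * ((|x k * x l| + |x j * x l| + |x i * x l|)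
          + (|x j * x k| + |x i * x k| + |x i * x j|)) * rp s (-(5 / 2)) x := by gcongr
      _ ≤ _ := by linarith [h5 k l, h5 j l, h5 i l, h5 j k, h5 i k, h5 i j]
  have e3 : |15 * (x i * x j * x k * x l) * rp s (-(7 / 2)) x| ≤ 15 * rp s (-(3 / 2)) x := by
    rw [abs_mul, abs_mul, abs_of_pos hr7, abs_of_pos (by norm_num : (0 : ℝ) < 15), mul_assoc]
    gcongr
  unfold T4
  refine (abs_sub _ _).trans ?_
  linarith [abs_add_le (-(kd i j * kd k l + kd i k * kd j l + kd j k * kd i l) * rp s (-(3 / 2)) x)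
    (3 * ((kd i j * x k + kd i k * x j + kd j k * x i) * x l
      + (kd i l * x j * x k + kd j l * x i * x k + kd k l * x i * x j)) * rp s (-(5 / 2)) x)]

lemma h1C1_T3 (hs : 0 < s) (i j k : Fin 3) : H1C1 (T3 s i j k) := by
  have hc : 0 ≤ s ^ (-(1 / 2) : ℝ) := by positivity
  refine H1C1.of_pd (g := rp s (-1)) (C := 6 + 36 * s ^ (-(1 / 2) : ℝ)) (by positivity)
    (memLp_rp hs (by norm_num)) (contDiff_T3 hs i j k) (fun x => ?_) fun l x => ?_
  · have h1 := rp_pos hs (-1) x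
    rw [abs_of_pos h1]
    exact (abs_T3_le hs i j k x).trans (by gcongr; linarith)
  · have h1 := rp_pos hs (-1) x
    rw [abs_of_pos h1, pd_T3 hs]
    have h2 := rp_le_const_mul hs (show (-(3 / 2) : ℝ) ≤ -1 by norm_num) x
    rw [show (-(3 / 2) - -1 : ℝ) = -(1 / 2) by norm_num] at h2
    refine (abs_T4_le hs l i j k x).trans ?_
    nlinarith

lemma pd_finset_sum {ι : Type*} (t : Finset ι) {f : ι → R3 → ℝ} (hf : ∀ m, Differentiable ℝ (f m))
    (i : Fin 3) (x : R3) : pd i (fun x => ∑ m ∈ t, f m x) x = ∑ m ∈ t, pd i (f m) x := by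
  simp only [pd]
  rw [fderiv_fun_sum fun m _ => hf m x]
  simp

lemma H1C1.finset_sum {ι : Type*} (t : Finset ι) {f : ι → R3 → ℝ} (hf : ∀ m, H1C1 (f m)) :
    H1C1 (fun x => ∑ m ∈ t, f m x) := by
  classical
  induction t using Finset.induction_on with
  | empty =>
    simp only [Finset.sum_empty]
    refine ⟨contDiff_const, MemLp.zero', ?_⟩
    rw [show fderiv ℝ (fun _ : R3 => (0 : ℝ)) = fun _ => 0 from funext fun x => by simp]
    exact (memLp_n2_of_le (g := fun _ : R3 => (0 : ℝ)) zero_le_one MemLp.zero'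
      aestronglyMeasurable_const (by simp)).1
  | insert a t ha ih =>
    simp only [Finset.sum_insert ha]
    exact (hf a).add ih

/-- A vector field from its components. -/
noncomputable def vec (w : Fin 3 → R3 → ℝ) : R3 → R3 := fun x => WithLp.toLp 2 fun i => w i x

lemma vec_apply (w : Fin 3 → R3 → ℝ) (x : R3) (i : Fin 3) : vec w x i = w i x := rfl

lemma vec_eq (w : Fin 3 → R3 → ℝ) : vec w = fun x => ∑ i, w i x • e i := by
  funext x; exact (sum_smul_e (vec w x)).symm

lemma H1C1.smul_const_vec {f : R3 → ℝ} (hf : H1C1 f) (v : R3) : H1C1 (fun x => f x • v) := by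
  have hc : ContDiff ℝ 1 fun x => f x • v := hf.c1.smul contDiff_const
  refine ⟨hc, ?_, ?_⟩
  · refine (memLp_n2_of_le (norm_nonneg v) hf.mem hc.continuous.aestronglyMeasurable fun x => ?_).1
    rw [norm_smul, mul_comm]
  · refine (memLp_n2_of_le (norm_nonneg v) hf.memD
      (hc.continuous_fderiv (by norm_num)).aestronglyMeasurable fun x => ?_).1
    rw [((hf.diff x).hasFDerivAt.smul_const v).fderiv, ContinuousLinearMap.norm_smulRight_apply, mul_comm]

lemma h1C1_vec {w : Fin 3 → R3 → ℝ} (hw : ∀ i, H1C1 (w i)) : H1C1 (vec w) := by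
  rw [vec_eq]
  simp only [Fin.sum_univ_three]
  exact (((hw 0).smul_const_vec _).add ((hw 1).smul_const_vec _)).add ((hw 2).smul_const_vec _)

lemma norm_le_sum_abs (v : R3) : ‖v‖ ≤ ∑ i, |v i| := by
  conv_lhs => rw [← sum_smul_e v]
  refine (norm_sum_le _ _).trans (le_of_eq ?_)
  simp [norm_smul]

/-- The Stokes system bounds the gradient of the velocity pointwise. -/
lemma exists_stokes_gradient_bound : ∃ C : ℝ, 0 ≤ C ∧ ∀ (μ : ℝ) (u f : R3 → R3) (q : R3 → ℝ),
    0 < μ → H2C2 u → (∀ x, dvg u x = 0) → ContDiff ℝ 1 q → MemLp (gradient q) 2 →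
    MemLp f 2 → MemLp f 6 → (∀ x, μ • ∑ i, pd i (pd i u) x = gradient q x + f x) →
    ∀ x k j, |pd k u x j| ≤ C / μ * (n2 f + n6 f) := by
  obtain ⟨K, hK, hpot⟩ := exists_potential_bound
  have hmass : 0 < rpMass (7 / 2) := rpMass_pos (by norm_num)
  -- Each component of the test field below is at most (6 + 18)/(|x|² + s) and there are three of
  -- them, which gives 72; the 15 is the factor in `sum_T4`.
  refine ⟨72 * K / 15 / rpMass (7 / 2), by positivity, ?_⟩
  have key : ∀ (μ : ℝ) (u f : R3 → R3) (q : R3 → ℝ),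
    0 < μ → H2C2 u → (∀ x, dvg u x = 0) → ContDiff ℝ 1 q → MemLp (gradient q) 2 →
    MemLp f 2 → MemLp f 6 → (∀ x, μ • ∑ i, pd i (pd i u) x = gradient q x + f x) →
    ∀ k j, |pd k u 0 j| ≤ (72 * K / 15 * (n2 f + n6 f) / μ) / rpMass (7 / 2) := by
    intro μ u f q hμ hu hdiv hq hg hf hf6 heq k j
    have hU : ∀ l m, H1C1 (fun x => pd l u x m) := fun l m => (hu.h1_pd l).coord m
    have hUc : ∀ i l m x, pd i (fun x => pd l u x m) x = pd i (pd l u) x m := fun i l m x =>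
      pd_coord (hu.h1_pd l).diff i m x
    refine abs_le_of_rp_bound (v := fun x => pd k u x j) (hU k j).c1.continuous (hU k j).mem
      (by norm_num) fun s hs hs1 => ?_
    -- With φ = (|x|² + s)^(1/2), this is ∂ₖΔφ.
    set Θ : Fin 3 → R3 → ℝ := fun k x => ∑ m, T3 s m m k x with hΘ
    have hT : ∀ i j k, H1C1 (T3 s i j k) := h1C1_T3 hs
    have hΘ1 : ∀ k, H1C1 (Θ k) := fun k => H1C1.finset_sum _ fun m => hT m m k
    have hΘd : ∀ l k x, pd l (Θ k) x = ∑ m, T4 s l m m k x := fun l k x => by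
      rw [hΘ, pd_finset_sum _ (fun m => (hT m m k).diff)]
      exact Finset.sum_congr rfl fun m _ => pd_T3 hs l m m k x
    have hΘs : ∀ l k x, pd l (Θ k) x = pd k (Θ l) x := fun l k x => by
      rw [hΘd, hΘd]
      refine Finset.sum_congr rfl fun m _ => ?_
      exact T4_swap_fourth l m m k x
    -- The derivative ∂ₖ of the j-th column ∂ᵢ∂ⱼφ - δᵢⱼΔφ of the regularised Stokeslet. It is
    -- divergence free, so the pressure drops out of the pairing with the equation.
    set w : Fin 3 → R3 → ℝ := fun i x => T3 s i j k x - kd i j * Θ k x with hw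
    have hw1 : ∀ i, H1C1 (w i) := fun i => (hT i j k).sub ((hΘ1 k).smul (kd i j))
    have hwd : ∀ i l x, pd l (w i) x = T4 s l i j k x - kd i j * pd l (Θ k) x := fun i l x => by
      have h2 := pd_sub (hT i j k).diff ((hΘ1 k).smul (kd i j)).diff l
      have h3 := pd_smul (kd i j) (Θ k) l
      have h4 := congrFun h2 x
      rw [h3, pd_T3 hs] at h4
      exact h4
    have hWd : ∀ x, dvg (vec w) x = 0 := by
      intro x
      have : ∀ i, pd i (vec w) x i = pd i (w i) x := fun i =>
        (pd_coord (h1C1_vec hw1).diff i i x).symm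
      simp only [dvg, this, hwd, hΘd, Finset.sum_sub_distrib]
      have e1 : ∑ i, kd i j * ∑ m, T4 s i m m k x = ∑ m, T4 s j m m k x := by
        rw [Finset.sum_eq_single j]
        · simp [kd]
        · intro b _ hb; simp [kd, hb]
        · simp
      rw [e1, sub_eq_zero]
      refine Finset.sum_congr rfl fun m _ => ?_
      exact T4_swap_third m m j k x
    have hWn : ∀ x, ‖vec w x‖ ≤ 72 * rp s (-1) x := by
      intro x
      have hr := rp_pos hs (-1) x
      have hΘb : |Θ k x| ≤ 18 * rp s (-1) x := by
        rw [hΘ]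
        refine (Finset.abs_sum_le_sum_abs _ _).trans ?_
        rw [Fin.sum_univ_three]
        linarith [abs_T3_le hs 0 0 k x, abs_T3_le hs 1 1 k x, abs_T3_le hs 2 2 k x]
      have hwb : ∀ i, |w i x| ≤ 24 * rp s (-1) x := fun i => by
        have h1 := abs_T3_le hs i j k x
        have h2 : |kd i j * Θ k x| ≤ 18 * rp s (-1) x := by
          rw [abs_mul]
          exact (mul_le_of_le_one_left (abs_nonneg _) (abs_kd_le i j)).trans hΘb
        exact (abs_sub _ _).trans (by linarith)
      refine (norm_le_sum_abs _).trans ?_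
      simp only [vec_apply, Fin.sum_univ_three]
      linarith [hwb 0, hwb 1, hwb 2]
    obtain ⟨hi, hb⟩ := hpot _ f hf hf6 s hs
    have hfW : |∫ x, inner ℝ (f x) (vec w x)| ≤ 72 * (K * (n2 f + n6 f)) := by
      calc _ ≤ ∫ x, 72 * (rp s (-1) x * ‖f x‖) := by
            refine abs_integral_le_of_le (hi.const_mul 72) fun x => ?_
            refine (abs_real_inner_le_norm _ _).trans ?_
            nlinarith [hWn x, norm_nonneg (f x)]
        _ ≤ _ := by rw [integral_const_mul]; gcongr
    have hL2 : ∀ i l m, MemLp (fun x => pd i (pd l u) x m) 2 := fun i l m => by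
      have := ((hU l m).mem_pd i).1
      rwa [show pd i (fun x => pd l u x m) = fun x => pd i (pd l u) x m from
        funext (hUc i l m)] at this
    have hibp : ∀ (i l m : Fin 3) (g : R3 → ℝ), H1C1 g →
        ∫ x, pd i (pd l u) x m * g x = - ∫ x, pd l u x m * pd i g x := by
      intro i l m g hg'
      simp only [← hUc]
      exact integral_pd_mul (hU l m) hg' i
    -- By the symmetry of `T4` one derivative can be exchanged between the two factors, which
    -- produces the gradient of div u.
    have hA : ∑ i, ∑ l, ∫ x, pd l (pd l u) x i * T3 s i j k x = 0 := by
      have e1 : ∀ i l, ∫ x, pd l (pd l u) x i * T3 s i j k x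
          = ∫ x, pd i (pd l u) x i * T3 s l j k x := by
        intro i l
        rw [hibp _ _ _ _ (hT i j k), hibp _ _ _ _ (hT l j k)]
        simp only [pd_T3 hs, T4_swap l i j k]
      rw [Finset.sum_congr rfl fun i _ => Finset.sum_congr rfl fun l _ => e1 i l, Finset.sum_comm]
      refine Finset.sum_eq_zero fun l _ => ?_
      rw [← integral_finsetSum _ fun i _ => integrable_mul_l2 (hL2 i l i) (hT l j k).mem]
      simp only [← Finset.sum_mul]
      have e2 : ∀ x, ∑ i, pd i (pd l u) x i = 0 := by
        intro x
        have h0 : (fun x => ∑ i, pd i u x i) = fun _ => 0 := funext hdiv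
        have h1 : pd l (fun x => ∑ i, pd i u x i) x = 0 := by rw [h0]; simp [pd]
        rw [pd_finset_sum _ fun i => (hU i i).diff] at h1
        rw [← h1]
        exact Finset.sum_congr rfl fun i _ => by rw [hUc, pd_comm hu.c2]
      simp [e2]
    -- Integrations by parts put ∂ₖ on u and the full divergence of Θ, that is Δ²φ, on the kernel.
    have hB : ∑ l, ∫ x, pd l (pd l u) x j * Θ k x
        = 15 * (s ^ 2 * ∫ x, rp s (-(7 / 2)) x * pd k u x j) := by
      have e1 : ∀ l, ∫ x, pd l (pd l u) x j * Θ k x = - ∫ x, pd k u x j * pd l (Θ l) x := by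
        intro l
        rw [hibp _ _ _ _ (hΘ1 k)]
        simp only [hΘs l k]
        rw [← hibp _ _ _ _ (hΘ1 l), pd_comm hu.c2, hibp _ _ _ _ (hΘ1 l)]
      simp only [e1]
      rw [Finset.sum_neg_distrib, ← integral_finsetSum _ fun l _ =>
        integrable_mul_l2 (hU k j).mem ((hΘ1 l).mem_pd l).1]
      simp only [← Finset.mul_sum, hΘd, sum_T4 hs]
      rw [← integral_neg, ← integral_const_mul, ← integral_const_mul]
      refine integral_congr_ae (Eventually.of_forall fun x => ?_)
      dsimp only
      ring
    have hmain : ∫ x, inner ℝ (f x) (vec w x) =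
        -(15 * μ) * (s ^ 2 * ∫ x, rp s (-(7 / 2)) x * pd k u x j) := by
      have h0 := integral_inner_gradient_eq_zero hq hg (h1C1_vec hw1) hWd
      have h1 : ∫ x, inner ℝ (μ • ∑ i, pd i (pd i u) x) (vec w x)
          = ∫ x, inner ℝ (f x) (vec w x) := by
        simp only [heq, inner_add_left]
        rw [integral_add (integrable_inner' hg (h1C1_vec hw1).mem)
          (integrable_inner' hf (h1C1_vec hw1).mem), h0, zero_add]
      have h2 : ∀ x, inner ℝ (μ • ∑ i, pd i (pd i u) x) (vec w x) =
          μ * ((∑ i, ∑ l, pd l (pd l u) x i * T3 s i j k x)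
            - ∑ l, pd l (pd l u) x j * Θ k x) := by
        intro x
        rw [real_inner_smul_left, PiLp.inner_apply]
        congr 1
        have e3 : ∀ i, inner ℝ ((∑ l, pd l (pd l u) x) i) (vec w x i) =
            (∑ l, pd l (pd l u) x i * T3 s i j k x)
              - kd i j * ∑ l, pd l (pd l u) x i * Θ k x := by
          intro i
          rw [vec_apply, hw, ← Finset.sum_mul, ← Finset.sum_mul]
          simp
          ring
        simp only [e3, Finset.sum_sub_distrib]
        congr 1
        rw [Finset.sum_eq_single j]
        · simp [kd]
        · intro b _ hb; simp [kd, hb]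
        · simp
      have i1 : ∀ i l, Integrable fun x => pd l (pd l u) x i * T3 s i j k x := fun i l =>
        integrable_mul_l2 (hL2 l l i) (hT i j k).mem
      have i2 : ∀ l, Integrable fun x => pd l (pd l u) x j * Θ k x := fun l =>
        integrable_mul_l2 (hL2 l l j) (hΘ1 k).mem
      rw [← h1]
      simp only [h2]
      rw [integral_const_mul, integral_sub (integrable_finsetSum _ fun i _ =>
          integrable_finsetSum _ fun l _ => i1 i l) (integrable_finsetSum _ fun l _ => i2 l),
        integral_finsetSum _ fun i _ => integrable_finsetSum _ fun l _ => i1 i l,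
        Finset.sum_congr rfl fun i _ => integral_finsetSum _ fun l _ => i1 i l,
        integral_finsetSum _ fun l _ => i2 l, hA, hB]
      ring
    rw [hmain, abs_mul, abs_neg, abs_of_pos (by positivity)] at hfW
    have e : s ^ (7 / 2 - 3 / 2 : ℝ) = s ^ 2 := by norm_num
    rw [e, le_div_iff₀ hμ]
    nlinarith
  intro μ u f q hμ hu hdiv hq hg hf hf6 heq x k j
  have hgt : gradient (fun y => q (y + x)) = fun y => gradient q (y + x) := by
    funext y
    simp only [gradient, fderiv_translate]
  have := key μ (fun y => u (y + x)) (fun y => f (y + x)) (fun y => q (y + x)) hμ (hu.translate x)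
    (dvg_translate hdiv x) (hq.comp (contDiff_id.add contDiff_const))
    (by rw [hgt]; exact MemLp.translate hg x) (MemLp.translate hf x) (MemLp.translate hf6 x)
    (fun y => by simp only [pd_translate, hgt]; exact heq _) k j
  rw [pd_translate, n2_translate hf, n6, eLpNorm_translate _ hf6.1] at this
  simp only [zero_add] at this
  refine this.trans (le_of_eq ?_)
  rw [← n6]
  ring

end Stokeslet

/-! ### Weak derivatives of classical functions -/

section Classical

variable {F : Type*} [NormedAddCommGroup F] [NormedSpace ℝ F]

lemma isWeakPartial_pd {f : R3 → F} (hf : ContDiff ℝ 1 f) (i : Fin 3) :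
    IsWeakPartial i f (pd i f) := by
  have hfc := hf.continuous
  have hpc := continuous_pd hf i
  refine ⟨hfc.locallyIntegrable, hpc.locallyIntegrable, fun φ hφ hc => ?_⟩
  have hφc := hφ.continuous
  have hφd : Continuous fun x => fderiv ℝ φ x (e i) :=
    (hφ.continuous_fderiv (by simp)).clm_apply continuous_const
  have h := integral_smul_fderiv_eq_neg_fderiv_smul_of_integrable (μ := (volume : Measure R3))
    (f := φ) (g := f) (v := e i)
    ((hφd.smul hfc).integrable_of_hasCompactSupport ((hc.fderiv_apply (𝕜 := ℝ) (e i)).smul_right))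
    ((hφc.smul hpc).integrable_of_hasCompactSupport hc.smul_right)
    ((hφc.smul hfc).integrable_of_hasCompactSupport hc.smul_right)
    (fun x _ => hφ.differentiable (by simp) x) (fun x _ => hf.differentiable (by norm_num) x)
  simp only [pd]
  rw [h, neg_neg]

lemma IsWeakPartial.ae_eq [CompleteSpace F] {i : Fin 3} {f g g' : R3 → F}
    (h : IsWeakPartial i f g) (h' : IsWeakPartial i f g') : g =ᵐ[volume] g' :=
  ae_eq_of_integral_contDiff_smul_eq h.2.1 h'.2.1 fun φ hφ hc => by
    have := (h.2.2 φ hφ hc).symm.trans (h'.2.2 φ hφ hc)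
    exact neg_injective this

lemma IsWeakPartial.congr {i : Fin 3} {f f' g g' : R3 → F} (h : IsWeakPartial i f g)
    (hf : f =ᵐ[volume] f') (hg : g =ᵐ[volume] g') : IsWeakPartial i f' g' := by
  refine ⟨h.1.congr hf, h.2.1.congr hg, fun φ hφ hc => ?_⟩
  have e1 : ∫ x, (fderiv ℝ φ x (e i)) • f' x = ∫ x, (fderiv ℝ φ x (e i)) • f x :=
    integral_congr_ae (hf.mono fun x hx => by simp only [hx])
  have e2 : ∫ x, φ x • g' x = ∫ x, φ x • g x :=
    integral_congr_ae (hg.mono fun x hx => by simp only [hx])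
  rw [e1, e2, h.2.2 φ hφ hc]

omit [NormedSpace ℝ F] in
lemma l2Sq_congr {f g : R3 → F} (h : f =ᵐ[volume] g) : l2Sq f = l2Sq g :=
  lintegral_congr_ae (h.mono fun x hx => by simp only [hx])

lemma derivSq_congr {f g : R3 → F} (h : f =ᵐ[volume] g) : ∀ l, derivSq l f = derivSq l g
  | [] => l2Sq_congr h
  | i :: l => by
    simp only [derivSq]
    refine iInf_congr fun k => ?_
    exact iInf_congr_Prop ⟨fun hk => hk.congr h .rfl, fun hk => hk.congr h.symm .rfl⟩ fun _ => rfl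

/-- The infimum runs over a single almost-everywhere class, and the classical derivative belongs to
it. -/
lemma derivSq_cons_of_contDiff [CompleteSpace F] {f : R3 → F} (hf : ContDiff ℝ 1 f) (i : Fin 3)
    (l : List (Fin 3)) : derivSq (i :: l) f = derivSq l (pd i f) := by
  refine le_antisymm (iInf₂_le _ (isWeakPartial_pd hf i)) (le_iInf₂ fun g hg => ?_)
  exact (derivSq_congr ((isWeakPartial_pd hf i).ae_eq hg) l).le

lemma gradSq_eq [CompleteSpace F] {f : R3 → F} (hf : ContDiff ℝ 1 f) :
    gradSq f = ∑ i, l2Sq (pd i f) :=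
  Finset.sum_congr rfl fun i _ => derivSq_cons_of_contDiff hf i []

lemma hessSq_eq [CompleteSpace F] {f : R3 → F} (hf : ContDiff ℝ 2 f) :
    hessSq f = ∑ i, ∑ j, l2Sq (pd j (pd i f)) :=
  Finset.sum_congr rfl fun i _ => Finset.sum_congr rfl fun j _ => by
    rw [derivSq_cons_of_contDiff (hf.of_le (by norm_num)),
      derivSq_cons_of_contDiff (contDiff_pd hf i)]; rfl

lemma norm_fderiv_le_sum (f : R3 → F) (x : R3) : ‖fderiv ℝ f x‖ ≤ ∑ i, ‖pd i f x‖ := by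
  refine le_of_sq_le_sq ((norm_fderiv_sq_le f x).trans ?_) (by positivity)
  exact Finset.sum_sq_le_sq_sum_of_nonneg fun i _ => norm_nonneg _

lemma h1C1_of_h1Sq [CompleteSpace F] {f : R3 → F} (hf : ContDiff ℝ 1 f) (h : l2Sq f < ⊤)
    (h1 : gradSq f < ⊤) : H1C1 f := by
  rw [gradSq_eq hf, ENNReal.sum_lt_top] at h1
  have h2 : ∀ i, MemLp (pd i f) 2 := fun i =>
    memLp_of_l2Sq (continuous_pd hf i).aestronglyMeasurable (h1 i (Finset.mem_univ i))
  refine ⟨hf, memLp_of_l2Sq hf.continuous.aestronglyMeasurable h, ?_⟩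
  have h3 : MemLp (fun x => ∑ i, ‖pd i f x‖) 2 := memLp_finsetSum _ fun i _ => (h2 i).norm
  exact h3.mono' (hf.continuous_fderiv (by norm_num)).aestronglyMeasurable
    (Eventually.of_forall fun x => norm_fderiv_le_sum f x)

lemma pd_fderiv {f : R3 → F} (hf : ContDiff ℝ 2 f) (i : Fin 3) :
    pd i (fderiv ℝ f) = fderiv ℝ (pd i f) := by
  funext x
  ext v
  rw [fderiv_pd hf]
  exact (hf.contDiffAt.isSymmSndFDerivAt (by simp)).eq _ _

lemma h2C2_of_h2Sq [CompleteSpace F] {f : R3 → F} (hf : ContDiff ℝ 2 f) (h : h2Sq f < ⊤) :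
    H2C2 f := by
  have h' : l2Sq f < ⊤ ∧ gradSq f < ⊤ ∧ hessSq f < ⊤ := by
    simpa [h2Sq, ENNReal.add_lt_top, and_assoc] using h
  obtain ⟨h0, h1, h2⟩ := h'
  have hf1 : ContDiff ℝ 1 f := hf.of_le (by norm_num)
  have hH := h1C1_of_h1Sq hf1 h0 h1
  refine ⟨hf, hH.mem, hH.memD, ?_⟩
  rw [hessSq_eq hf, ENNReal.sum_lt_top] at h2
  have h3 : ∀ i, H1C1 (pd i f) := fun i => by
    refine h1C1_of_h1Sq (contDiff_pd hf i) ?_ ?_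
    · rw [l2Sq_eq_ofReal (hH.mem_pd i).1]; exact ENNReal.ofReal_lt_top
    · rw [gradSq_eq (contDiff_pd hf i)]; exact h2 i (Finset.mem_univ i)
  have h4 : MemLp (fun x => ∑ i, ‖fderiv ℝ (pd i f) x‖) 2 :=
    memLp_finsetSum _ fun i _ => (h3 i).memD.norm
  have : SecondCountableTopologyEither R3 (R3 →L[ℝ] R3 →L[ℝ] F) := ⟨Or.inl inferInstance⟩
  refine h4.mono' ((hf.fderiv_right (m := 1) (by norm_num)).continuous_fderiv
    (by norm_num)).aestronglyMeasurable (Eventually.of_forall fun x => ?_)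
  have := norm_fderiv_le_sum (fderiv ℝ f) x
  simpa only [pd_fderiv hf] using this

/-- The squared `L²` norm of the gradient. -/
noncomputable def gr (f : R3 → F) : ℝ := ∑ i, n2 (pd i f) ^ 2

/-- The squared `L²` norm of the second derivatives. -/
noncomputable def hs (f : R3 → F) : ℝ := ∑ i, ∑ j, n2 (pd j (pd i f)) ^ 2

lemma gr_nonneg (f : R3 → F) : 0 ≤ gr f := Finset.sum_nonneg fun _ _ => sq_nonneg _

lemma hs_nonneg (f : R3 → F) : 0 ≤ hs f :=
  Finset.sum_nonneg fun _ _ => Finset.sum_nonneg fun _ _ => sq_nonneg _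

lemma H1C1.gradSq_eq [CompleteSpace F] {f : R3 → F} (hf : H1C1 f) :
    gradSq f = ENNReal.ofReal (gr f) := by
  rw [RayleighTaylor.gradSq_eq hf.c1, gr, ENNReal.ofReal_sum_of_nonneg fun i _ => sq_nonneg _]
  exact Finset.sum_congr rfl fun i _ => l2Sq_eq_ofReal (hf.mem_pd i).1

lemma H2C2.hessSq_eq [CompleteSpace F] {f : R3 → F} (hf : H2C2 f) :
    hessSq f = ENNReal.ofReal (hs f) := by
  rw [RayleighTaylor.hessSq_eq hf.c2, hs,
    ENNReal.ofReal_sum_of_nonneg fun i _ => Finset.sum_nonneg fun _ _ => sq_nonneg _]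
  refine Finset.sum_congr rfl fun i _ => ?_
  rw [ENNReal.ofReal_sum_of_nonneg fun i _ => sq_nonneg _]
  exact Finset.sum_congr rfl fun j _ => l2Sq_eq_ofReal ((hf.h1_pd i).mem_pd j).1

lemma H1C1.n2_fderiv_sq_le_gr {f : R3 → F} (hf : H1C1 f) : n2 (fderiv ℝ f) ^ 2 ≤ gr f :=
  n2_fderiv_sq_le hf

lemma H2C2.n2_fderiv2_sq_le_hs {f : R3 → F} (hf : H2C2 f) :
    n2 (fderiv ℝ (fderiv ℝ f)) ^ 2 ≤ hs f := by
  refine (n2_fderiv_sq_le hf.h1D).trans (Finset.sum_le_sum fun i _ => ?_)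
  rw [pd_fderiv hf.c2]
  exact n2_fderiv_sq_le (hf.h1_pd i)

end Classical

/-! ### Quasi-triangle inequalities for the squared norms -/

section Seminorm

variable {F : Type*} [NormedAddCommGroup F] [NormedSpace ℝ F]

omit [NormedSpace ℝ F] in
lemma l2Sq_add_le {f g : R3 → F} (hf : AEStronglyMeasurable f volume) :
    l2Sq (fun x => f x + g x) ≤ 2 * l2Sq f + 2 * l2Sq g := by
  calc l2Sq (fun x => f x + g x) ≤ ∫⁻ x, (2 * ‖f x‖ₑ ^ 2 + 2 * ‖g x‖ₑ ^ 2) := by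
        refine lintegral_mono fun x => ?_
        simp only [← ofReal_norm]
        rw [← ENNReal.ofReal_pow (norm_nonneg _), ← ENNReal.ofReal_pow (norm_nonneg _),
          ← ENNReal.ofReal_pow (norm_nonneg _), ← ENNReal.ofReal_ofNat,
          ← ENNReal.ofReal_mul (by norm_num), ← ENNReal.ofReal_mul (by norm_num),
          ← ENNReal.ofReal_add (by positivity) (by positivity)]
        refine ENNReal.ofReal_le_ofReal ?_
        have := norm_add_le (f x) (g x)
        nlinarith [norm_nonneg (f x + g x), sq_nonneg (‖f x‖ - ‖g x‖)]
    _ = _ := by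
        rw [lintegral_add_left' ((hf.enorm.pow_const 2).const_mul 2),
          lintegral_const_mul' _ _ (by norm_num), lintegral_const_mul' _ _ (by norm_num)]
        rfl

lemma IsWeakPartial.add {i : Fin 3} {f f' g g' : R3 → F} (h : IsWeakPartial i f g)
    (h' : IsWeakPartial i f' g') :
    IsWeakPartial i (fun x => f x + f' x) (fun x => g x + g' x) := by
  refine ⟨h.1.add h'.1, h.2.1.add h'.2.1, fun φ hφ hc => ?_⟩
  have hφd : Continuous fun x => fderiv ℝ φ x (e i) :=
    (hφ.continuous_fderiv (by simp)).clm_apply continuous_const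
  have hcd : HasCompactSupport fun x => fderiv ℝ φ x (e i) := hc.fderiv_apply (𝕜 := ℝ) (e i)
  simp only [smul_add]
  rw [integral_add (h.1.integrable_smul_left_of_hasCompactSupport hφd hcd)
    (h'.1.integrable_smul_left_of_hasCompactSupport hφd hcd),
    integral_add (h.2.1.integrable_smul_left_of_hasCompactSupport hφ.continuous hc)
    (h'.2.1.integrable_smul_left_of_hasCompactSupport hφ.continuous hc), h.2.2 φ hφ hc,
    h'.2.2 φ hφ hc, neg_add]

/-- The sum of two nearly optimal weak derivatives competes in the infimum for the sum. The factor 2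
is affordable: it is used only to compare the data with the solution at small times, where δ₀²
becomes 3δ₀². -/
lemma derivSq_add_le : ∀ (l : List (Fin 3)) {f g : R3 → F}, AEStronglyMeasurable f volume →
    derivSq l (fun x => f x + g x) ≤ 2 * derivSq l f + 2 * derivSq l g
  | [], _, _, hf => l2Sq_add_le hf
  | i :: l, f, g, _ => by
    refine ENNReal.le_of_forall_pos_le_add fun ε hε hlt => ?_
    have hlt' : derivSq (i :: l) f < ⊤ ∧ derivSq (i :: l) g < ⊤ := by
      rw [ENNReal.add_lt_top] at hlt
      exact ⟨lt_of_le_of_lt (le_mul_of_one_le_left' (by norm_num)) hlt.1,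
        lt_of_le_of_lt (le_mul_of_one_le_left' (by norm_num)) hlt.2⟩
    have hε4 : (0 : ℝ≥0∞) < (ε / 4 : NNReal) := by
      rw [ENNReal.coe_pos]; positivity
    have hf1 : derivSq (i :: l) f < derivSq (i :: l) f + (ε / 4 : NNReal) :=
      ENNReal.lt_add_right hlt'.1.ne hε4.ne'
    have hg1 : derivSq (i :: l) g < derivSq (i :: l) g + (ε / 4 : NNReal) :=
      ENNReal.lt_add_right hlt'.2.ne hε4.ne'
    conv_lhs at hf1 => rw [derivSq]
    conv_lhs at hg1 => rw [derivSq]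
    simp only [iInf_lt_iff] at hf1 hg1
    obtain ⟨f', hf', hfl⟩ := hf1
    obtain ⟨g', hg', hgl⟩ := hg1
    calc derivSq (i :: l) (fun x => f x + g x) ≤ derivSq l (fun x => f' x + g' x) :=
          iInf₂_le _ (hf'.add hg')
      _ ≤ 2 * derivSq l f' + 2 * derivSq l g' :=
          derivSq_add_le l hf'.2.1.aestronglyMeasurable
      _ ≤ 2 * (derivSq (i :: l) f + (ε / 4 : NNReal))
          + 2 * (derivSq (i :: l) g + (ε / 4 : NNReal)) := by gcongr
      _ = _ := by
          have : (ε : ℝ≥0∞) = 4 * (ε / 4 : NNReal) := by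
            rw [show (4 : ℝ≥0∞) = ((4 : NNReal) : ℝ≥0∞) by rfl, ← ENNReal.coe_mul]
            congr 1
            field_simp
          rw [this]
          ring

lemma gradSq_add_le {f g : R3 → F} (hf : AEStronglyMeasurable f volume) :
    gradSq (fun x => f x + g x) ≤ 2 * gradSq f + 2 * gradSq g := by
  unfold gradSq
  rw [Finset.mul_sum, Finset.mul_sum, ← Finset.sum_add_distrib]
  exact Finset.sum_le_sum fun i _ => derivSq_add_le _ hf

lemma hessSq_add_le {f g : R3 → F} (hf : AEStronglyMeasurable f volume) :
    hessSq (fun x => f x + g x) ≤ 2 * hessSq f + 2 * hessSq g := by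
  unfold hessSq
  simp only [Finset.mul_sum, ← Finset.sum_add_distrib]
  exact Finset.sum_le_sum fun i _ => Finset.sum_le_sum fun j _ => derivSq_add_le _ hf

lemma h1Sq_add_le {f g : R3 → F} (hf : AEStronglyMeasurable f volume) :
    h1Sq (fun x => f x + g x) ≤ 2 * h1Sq f + 2 * h1Sq g := by
  unfold h1Sq
  refine (add_le_add (l2Sq_add_le hf) (gradSq_add_le hf)).trans (le_of_eq ?_)
  ring

lemma h2Sq_add_le {f g : R3 → F} (hf : AEStronglyMeasurable f volume) :
    h2Sq (fun x => f x + g x) ≤ 2 * h2Sq f + 2 * h2Sq g := by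
  unfold h2Sq
  refine (add_le_add (add_le_add (l2Sq_add_le hf) (gradSq_add_le hf))
    (hessSq_add_le hf)).trans (le_of_eq ?_)
  ring

end Seminorm

/-! ### Mollification of fields with weak gradient in L² -/

lemma exists_weakPartial {i : Fin 3} {V : R3 → R3} (h : derivSq [i] V < ⊤) :
    ∃ G : R3 → R3, IsWeakPartial i V G ∧ StronglyMeasurable G ∧ l2Sq G = derivSq [i] V := by
  have h' := h
  simp only [derivSq, iInf_lt_iff] at h'
  obtain ⟨g, hg, -⟩ := h'
  have hm := hg.2.1.aestronglyMeasurable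
  have hG : IsWeakPartial i V (hm.mk g) := hg.congr .rfl hm.ae_eq_mk
  refine ⟨hm.mk g, hG, hm.stronglyMeasurable_mk, le_antisymm ?_ ?_⟩
  · exact le_iInf₂ fun k hk => (l2Sq_congr (hG.ae_eq hk)).le
  · exact iInf₂_le (f := fun g _ => derivSq [] g) _ hG

/-- Regularization of `V` by a bump function. -/
noncomputable def moll (φ : ContDiffBump (0 : R3)) (V : R3 → R3) : R3 → R3 :=
  fun x => ∫ t, φ.normed volume t • V (x - t)

/-- The normalised bump is a probability density supported in the ball of radius `rOut`, so only
translations by such `t` have to be estimated. -/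
lemma l2Sq_le_of_bump_average (φ : ContDiffBump (0 : R3)) {g : R3 → R3} {K : R3 → R3 → ℝ≥0∞}
    (hK : Measurable (Function.uncurry K))
    (hg : ∀ x, ‖g x‖ₑ ≤ ∫⁻ t, ENNReal.ofReal (φ.normed volume t) * K t x) {M : ℝ≥0∞}
    (hM : ∀ t, ‖t‖ < φ.rOut → ∫⁻ x, K t x ^ 2 ≤ M) : l2Sq g ≤ M := by
  have hφm : Measurable fun t => ENNReal.ofReal (φ.normed volume t) :=
    (φ.continuous_normed (μ := volume)).measurable.ennreal_ofReal
  let ν : Measure R3 := volume.withDensity fun t => ENNReal.ofReal (φ.normed volume t)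
  have : IsProbabilityMeasure ν := ⟨by
    rw [withDensity_apply _ MeasurableSet.univ, Measure.restrict_univ,
      ← ofReal_integral_eq_lintegral_ofReal φ.integrable_normed
        (Eventually.of_forall fun x => φ.nonneg_normed x), φ.integral_normed, ENNReal.ofReal_one]⟩
  refine l2Sq_le_of_average (ν := ν) hK (fun x => (hg x).trans (le_of_eq ?_)) (M := M) ?_
  · have hKx : Measurable fun t => K t x := hK.comp measurable_prodMk_right
    exact (lintegral_withDensity_eq_lintegral_mul _ hφm hKx).symm
  · rw [ae_withDensity_iff hφm]
    refine Eventually.of_forall fun t ht => hM t ?_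
    have : t ∈ Function.support (φ.normed volume) := fun h => ht (by simp [h])
    rw [φ.support_normed_eq] at this
    simpa using this

lemma ofReal_normed (φ : ContDiffBump (0 : R3)) (t : R3) :
    ENNReal.ofReal (φ.normed volume t) = ‖φ.normed volume t‖ₑ := by
  rw [← ofReal_norm, Real.norm_of_nonneg (φ.nonneg_normed t)]

lemma l2Sq_moll_le (φ : ContDiffBump (0 : R3)) {G : R3 → R3} (hG : StronglyMeasurable G) :
    l2Sq (moll φ G) ≤ l2Sq G := by
  refine l2Sq_le_of_bump_average φ (K := fun t x => ‖G (x - t)‖ₑ)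
    (hG.measurable.comp (measurable_snd.sub measurable_fst)).enorm (fun x => ?_) fun t _ => ?_
  · refine (enorm_integral_le_lintegral_enorm _).trans (lintegral_mono fun t => ?_)
    rw [enorm_smul, ofReal_normed]
  · exact (lintegral_sub_right_eq_self (fun x => ‖G x‖ₑ ^ 2) t).le

lemma moll_locallyIntegrable_aux (φ : ContDiffBump (0 : R3)) {V : R3 → R3} (hV : Continuous V)
    (x : R3) : Integrable fun t => φ.normed volume t • V (x - t) :=
  (φ.continuous_normed.smul (hV.comp (continuous_const.sub continuous_id))
    ).integrable_of_hasCompactSupport φ.hasCompactSupport_normed.smul_right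

lemma l2Sq_moll_sub_le (φ : ContDiffBump (0 : R3)) {V : R3 → R3} (hV : Continuous V) {M : ℝ≥0∞}
    (hM : ∀ t, ‖t‖ < φ.rOut → l2Sq (fun x => V (x - t) - V x) ≤ M) :
    l2Sq (fun x => moll φ V x - V x) ≤ M := by
  refine l2Sq_le_of_bump_average φ (K := fun t x => ‖V (x - t) - V x‖ₑ)
    (((hV.comp (continuous_snd.sub continuous_fst)).sub (hV.comp continuous_snd)).enorm).measurable
    (fun x => ?_) hM
  have h1 : moll φ V x - V x = ∫ t, φ.normed volume t • (V (x - t) - V x) := by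
    simp only [smul_sub]
    rw [integral_sub (moll_locallyIntegrable_aux φ hV x) (φ.integrable_normed.smul_const _),
      integral_smul_const, φ.integral_normed, one_smul]
    rfl
  rw [h1]
  refine (enorm_integral_le_lintegral_enorm _).trans (lintegral_mono fun t => ?_)
  rw [enorm_smul, ofReal_normed]

lemma moll_eq_convolution (φ : ContDiffBump (0 : R3)) (V : R3 → R3) :
    moll φ V = convolution (φ.normed volume) V (ContinuousLinearMap.lsmul ℝ ℝ) volume := rfl

lemma contDiff_moll (φ : ContDiffBump (0 : R3)) {V : R3 → R3} (hV : LocallyIntegrable V) :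
    ContDiff ℝ 1 (moll φ V) := by
  rw [moll_eq_convolution]
  exact φ.hasCompactSupport_normed.contDiff_convolution_left _ φ.contDiff_normed hV

/-- The derivative falls on the kernel, and y ↦ φ(x - y) is an admissible test function in the
definition of the weak derivative. -/
lemma pd_moll (φ : ContDiffBump (0 : R3)) {i : Fin 3} {V G : R3 → R3} (h : IsWeakPartial i V G) :
    pd i (moll φ V) = moll φ G := by
  funext x
  have h1 := (φ.hasCompactSupport_normed (μ := volume)).hasFDerivAt_convolution_left
    (ContinuousLinearMap.lsmul ℝ ℝ) (g := V) (μ := volume) φ.contDiff_normed h.1 x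
  rw [pd, moll_eq_convolution, h1.fderiv]
  have hex := (φ.hasCompactSupport_normed (μ := volume)).fderiv (𝕜 := ℝ)
    |>.convolutionExists_left ((ContinuousLinearMap.lsmul ℝ ℝ).precompL R3)
      ((φ.contDiff_normed (n := 1) (μ := volume)).continuous_fderiv (by norm_num)) h.1 x
  rw [convolution_def, ContinuousLinearMap.integral_apply hex]
  simp only [ContinuousLinearMap.precompL_apply, ContinuousLinearMap.lsmul_apply]
  have h2 := h.2.2 (fun y => φ.normed volume (x - y))
    ((φ.contDiff_normed (μ := volume)).comp (contDiff_const.sub contDiff_id))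
    ((φ.hasCompactSupport_normed (μ := volume)).comp_homeomorph (Homeomorph.subLeft x))
  have h3 : ∀ y, fderiv ℝ (fun y => φ.normed volume (x - y)) y (e i)
      = - fderiv ℝ (φ.normed volume) (x - y) (e i) := fun y => by
    have := (((φ.contDiff_normed (n := 1) (μ := volume)).differentiable (by norm_num)
      (x - y)).hasFDerivAt).comp y ((hasFDerivAt_const x y).sub (hasFDerivAt_id y))
    have h4 := this.fderiv
    simp only [Function.comp_def] at h4
    erw [h4]
    simp
  simp only [h3, neg_smul, integral_neg, neg_inj] at h2
  rw [← integral_sub_left_eq_self _ volume x]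
  simp only [sub_sub_cancel]
  rw [h2, moll, ← integral_sub_left_eq_self _ volume x]
  simp only [sub_sub_cancel]

/-- The mollifier of radius `1 / (n + 1)`. -/
noncomputable def bump (n : ℕ) : ContDiffBump (0 : R3) where
  rIn := 1 / (2 * (n + 1))
  rOut := 1 / (n + 1)
  rIn_pos := by positivity
  rIn_lt_rOut := by
    apply one_div_lt_one_div_of_lt
    · positivity
    · have : (0 : ℝ) < n + 1 := by positivity
      linarith

lemma tendsto_moll_bump {V : R3 → R3} (hV : Continuous V) (x : R3) :
    Tendsto (fun n => moll (bump n) V x) atTop (𝓝 (V x)) := by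
  have := ContDiffBump.convolution_tendsto_right_of_continuous (μ := volume) (φ := bump)
    (l := atTop) tendsto_one_div_add_atTop_nhds_zero_nat hV x
  exact this

lemma h1C1_moll (φ : ContDiffBump (0 : R3)) {V : R3 → R3} (hV : Continuous V) (hm : MemLp V 2)
    (hg : gradSq V < ⊤) :
    H1C1 (moll φ V) ∧ n2 (moll φ V) ≤ n2 V ∧ gr (moll φ V) ≤ (gradSq V).toReal := by
  have hc := contDiff_moll φ hV.locallyIntegrable
  have hfin : ∀ i, derivSq [i] V < ⊤ := fun i => by
    have := hg
    rw [gradSq, ENNReal.sum_lt_top] at this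
    exact this i (Finset.mem_univ i)
  have h0 : l2Sq (moll φ V) ≤ l2Sq V := l2Sq_moll_le φ hV.stronglyMeasurable
  have h1 : ∀ i, l2Sq (pd i (moll φ V)) ≤ derivSq [i] V := fun i => by
    obtain ⟨G, hG, hGm, hGl⟩ := exists_weakPartial (hfin i)
    rw [pd_moll φ hG, ← hGl]
    exact l2Sq_moll_le φ hGm
  have hV2 : l2Sq V < ⊤ := by rw [l2Sq_eq_ofReal hm]; exact ENNReal.ofReal_lt_top
  have h2 : gradSq (moll φ V) ≤ gradSq V := by
    rw [gradSq_eq hc]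
    exact Finset.sum_le_sum fun i _ => h1 i
  have hH := h1C1_of_h1Sq hc (h0.trans_lt hV2) (h2.trans_lt hg)
  refine ⟨hH, ?_, ?_⟩
  · rw [l2Sq_eq_ofReal hm, l2Sq_eq_ofReal hH.mem,
      ENNReal.ofReal_le_ofReal_iff (sq_nonneg _)] at h0
    exact le_of_sq_le_sq h0 (n2_nonneg _)
  · rw [hH.gradSq_eq] at h2
    exact (ENNReal.ofReal_le_iff_le_toReal hg.ne).1 h2

/-- The bound for C¹ functions holds for every mollification with the same right side, and passes to
the limit by Fatou's lemma. -/
lemma n2_translate_sub_le_of_gradSq {V : R3 → R3} (hV : Continuous V) (hm : MemLp V 2)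
    (hg : gradSq V < ⊤) (y : R3) :
    n2 (fun x => V (x + y) - V x) ≤ ‖y‖ * √(gradSq V).toReal := by
  refine (memLp_of_tendsto (f := fun n x => moll (bump n) V (x + y) - moll (bump n) V x)
    (by positivity) (fun n => ?_) (fun n => ?_)
    fun x => (tendsto_moll_bump hV (x + y)).sub (tendsto_moll_bump hV x)).2
  · have h := (h1C1_moll (bump n) hV hm hg).1
    exact memLp_fun_sub (h.translate y).mem h.mem
  · obtain ⟨h, -, hgr⟩ := h1C1_moll (bump n) hV hm hg
    have h1 := memLp_n2_of_le (f := fun x => fderiv ℝ (moll (bump n) V) x y)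
      (g := fderiv ℝ (moll (bump n) V)) (norm_nonneg y) h.memD
      ((h.c1.continuous_fderiv (by norm_num)).clm_apply continuous_const).aestronglyMeasurable
      fun x => by
        rw [mul_comm]
        exact ContinuousLinearMap.le_opNorm _ _
    refine ((memLp_translate_sub h.c1 y h1.1).2.trans h1.2).trans ?_
    gcongr
    exact Real.le_sqrt_of_sq_le (h.n2_fderiv_sq_le_gr.trans hgr)

lemma tendsto_n2_moll_sub {V : R3 → R3} (hV : Continuous V) (hm : MemLp V 2)
    (hg : gradSq V < ⊤) :
    Tendsto (fun n => n2 fun x => moll (bump n) V x - V x) atTop (𝓝 0) := by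
  have hb : ∀ n : ℕ, n2 (fun x => moll (bump n) V x - V x)
      ≤ 1 / ((n : ℝ) + 1) * √(gradSq V).toReal := fun n => by
    refine n2_le_of_eLpNorm (by positivity) (n2_le_of_l2Sq (by positivity) ?_)
    refine l2Sq_moll_sub_le _ hV fun t ht => ?_
    have h1 := n2_translate_sub_le_of_gradSq hV hm hg (-t)
    simp only [← sub_eq_add_neg, norm_neg] at h1
    have h2 : MemLp (fun x => V (x - t) - V x) 2 := by
      have := memLp_fun_sub (MemLp.translate (f := V) hm (-t)) hm
      simpa only [← sub_eq_add_neg] using this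
    rw [l2Sq_eq_ofReal h2]
    refine ENNReal.ofReal_le_ofReal (pow_le_pow_left₀ (n2_nonneg _) (h1.trans ?_) 2)
    gcongr
    exact ht.le
  refine squeeze_zero (fun n => n2_nonneg _) hb ?_
  have := (tendsto_one_div_add_atTop_nhds_zero_nat (𝕜 := ℝ)).mul_const √(gradSq V).toReal
  simpa using this

lemma exists_sobolev_const : ∃ S : ℝ, 0 < S ∧ ∀ f : R3 → R3, H1C1 f →
    MemLp f 6 ∧ n6 f ≤ S * √(gr f) := by
  have h0 : 0 ≤ sobC R3 := sobC_nonneg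
  refine ⟨sobC R3 + 1, by linarith, fun f hf => ⟨hf.sobolev.1, hf.sobolev.2.trans ?_⟩⟩
  exact mul_le_mul (by linarith) (Real.le_sqrt_of_sq_le hf.n2_fderiv_sq_le_gr) (n2_nonneg _)
    (by linarith)

/-- Meant for u_t, which is continuous in x but has only weak derivatives: the Sobolev inequality is
taken over from the mollifications. -/
lemma exists_eLpNorm_six_le : ∃ S : ℝ, 0 < S ∧ ∀ V : R3 → R3, Continuous V → MemLp V 2 →
    gradSq V < ⊤ → eLpNorm V 6 volume ≤ ENNReal.ofReal (S * √(gradSq V).toReal) := by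
  obtain ⟨S, hS, hSob⟩ := exists_sobolev_const
  refine ⟨S, hS, fun V hV hm hg => ?_⟩
  refine Lp.eLpNorm_le_of_ae_tendsto (f := fun n => moll (bump n) V) (u := atTop)
    (Eventually.of_forall fun n => ?_)
    (fun n => (h1C1_moll (bump n) hV hm hg).1.c1.continuous.aestronglyMeasurable)
    (Eventually.of_forall fun x => tendsto_moll_bump hV x)
  obtain ⟨hH, -, hgr⟩ := h1C1_moll (bump n) hV hm hg
  obtain ⟨h6, h6'⟩ := hSob _ hH
  have h7 : n6 (moll (bump n) V) ≤ S * √(gradSq V).toReal :=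
    h6'.trans (mul_le_mul_of_nonneg_left (Real.sqrt_le_sqrt hgr) hS.le)
  exact (ENNReal.le_ofReal_iff_toReal_le h6.eLpNorm_ne_top (by positivity)).2 h7

lemma exists_sobolev_gradSq : ∃ S : ℝ, 0 < S ∧ ∀ V : R3 → R3, Continuous V → MemLp V 2 →
    eLpNorm V 6 volume ^ 2 ≤ ENNReal.ofReal S * gradSq V := by
  obtain ⟨S, hS, hSob⟩ := exists_eLpNorm_six_le
  refine ⟨S ^ 2, by positivity, fun V hV hm => ?_⟩
  rcases eq_or_ne (gradSq V) ⊤ with h | h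
  · rw [h, ENNReal.mul_top (ENNReal.ofReal_pos.2 (by positivity)).ne']
    exact le_top
  have h1 := pow_le_pow_left' (hSob V hV hm h.lt_top) 2
  rwa [← ENNReal.ofReal_pow (by positivity), mul_pow, Real.sq_sqrt ENNReal.toReal_nonneg,
        ENNReal.ofReal_mul (by positivity), ENNReal.ofReal_toReal h] at h1

/-! ### Weak limits and lower semicontinuity of the gradient norm -/

/-- Bounded sequences in a Hilbert space cluster weakly. -/
lemma exists_weak_limit {E : Type*} [NormedAddCommGroup E] [InnerProductSpace ℝ E]
    [CompleteSpace E] {ι : Type*} (l : Ultrafilter ι) {p : ι → E} {M : ℝ}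
    (h : ∀ᶠ n in (l : Filter ι), ‖p n‖ ≤ M) :
    ∃ a : E, ‖a‖ ≤ M ∧ ∀ φ, Tendsto (fun n => inner ℝ (p n) φ) l (𝓝 (inner ℝ a φ)) := by
  let F : ι → WeakDual ℝ E := fun n => StrongDual.toWeakDual (InnerProductSpace.toDual ℝ E (p n))
  have hc := WeakDual.isCompact_closedBall (𝕜 := ℝ) (E := E) 0 M
  have hmem : ∀ᶠ n in (l : Filter ι),
      F n ∈ WeakDual.toStrongDual ⁻¹' Metric.closedBall (0 : StrongDual ℝ E) M := by
    filter_upwards [h] with n hn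
    simpa [F] using hn
  obtain ⟨a, ha, hla⟩ := hc.ultrafilter_le_nhds (l.map F) (by
    rw [le_principal_iff]; exact hmem)
  refine ⟨(InnerProductSpace.toDual ℝ E).symm (WeakDual.toStrongDual a), ?_, fun φ => ?_⟩
  · simpa using ha
  · have h1 : Tendsto F l (𝓝 a) := hla
    have h2 := ((WeakDual.eval_continuous φ).tendsto a).comp h1
    rw [InnerProductSpace.toDual_symm_apply]
    exact h2

/-- The derivatives are bounded in L² and so converge weakly along an ultrafilter. Integration by
parts against φ·c identifies the limit as the weak derivative of `V`, because the functions
themselves converge strongly. -/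
lemma derivSq_le_of_tendsto {ι : Type*} {l : Filter ι} [l.NeBot] {v : ι → R3 → R3}
    {V : R3 → R3} {M : ℝ} (i : Fin 3) (hv : ∀ n, H1C1 (v n))
    (hb : ∀ᶠ n in l, n2 (pd i (v n)) ≤ M) (hV : MemLp V 2)
    (hlim : Tendsto (fun n => n2 fun x => v n x - V x) l (𝓝 0)) :
    derivSq [i] V ≤ ENNReal.ofReal (M ^ 2) := by
  let p : ι → Lp R3 2 (volume : Measure R3) := fun n => ((hv n).mem_pd i).1.toLp
  have hp : ∀ n, ‖p n‖ = n2 (pd i (v n)) := fun n => Lp.norm_toLp _ _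
  have hle : (Ultrafilter.of l : Filter ι) ≤ l := Ultrafilter.of_le l
  obtain ⟨a, ha, hla⟩ := exists_weak_limit (Ultrafilter.of l) (p := p) (M := M)
    (hle (hb.mono fun n hn => by rw [hp]; exact hn))
  have hal : l2Sq (a : R3 → R3) ≤ ENNReal.ofReal (M ^ 2) := by
    rw [l2Sq_eq_ofReal (Lp.memLp a)]
    refine ENNReal.ofReal_le_ofReal (pow_le_pow_left₀ (n2_nonneg _) ?_ 2)
    rwa [Lp.norm_def] at ha
  have ham := Lp.memLp a
  refine (iInf₂_le (a : R3 → R3) ⟨hV.locallyIntegrable (by norm_num),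
    ham.locallyIntegrable (by norm_num), fun φ hφ hc => ?_⟩).trans hal
  have hφd : Continuous fun x => fderiv ℝ φ x (e i) :=
    (hφ.continuous_fderiv (by simp)).clm_apply continuous_const
  have hcd : HasCompactSupport fun x => fderiv ℝ φ x (e i) := hc.fderiv_apply (𝕜 := ℝ) (e i)
  have hφ2 : MemLp φ 2 := hφ.continuous.memLp_of_hasCompactSupport hc
  have hφd2 : MemLp (fun x => fderiv ℝ φ x (e i)) 2 := hφd.memLp_of_hasCompactSupport hcd
  have hφH : H1C1 φ := ⟨hφ.of_le (by simp), hφ2,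
    (hφ.continuous_fderiv (by simp)).memLp_of_hasCompactSupport (hc.fderiv (𝕜 := ℝ))⟩
  have hi1 : Integrable fun x => (fderiv ℝ φ x (e i)) • V x :=
    integrable_of_le_mul 1 (hφd.aestronglyMeasurable.smul hV.1) hφd2 hV fun x => by
      rw [norm_smul, one_mul]
  have hi2 : Integrable fun x => φ x • (a : R3 → R3) x :=
    integrable_of_le_mul 1 (hφ.continuous.aestronglyMeasurable.smul ham.1) hφ2 ham fun x => by
      rw [norm_smul, one_mul]
  refine ext_inner_right ℝ fun c => ?_
  rw [real_inner_comm, ← integral_inner hi1, inner_neg_left, real_inner_comm, ← integral_inner hi2]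
  simp only [real_inner_smul_right]
  have hψ : MemLp (fun x => φ x • c) 2 := (hφH.smul_const_vec c).mem
  have h1 : Tendsto (fun n => ∫ x, inner ℝ (pd i (v n) x) (φ x • c)) (Ultrafilter.of l)
      (𝓝 (∫ x, φ x * inner ℝ c ((a : R3 → R3) x))) := by
    have h := hla hψ.toLp
    have h2 : inner ℝ a hψ.toLp = ∫ x, φ x * inner ℝ c ((a : R3 → R3) x) := by
      rw [L2.inner_def]
      refine integral_congr_ae ?_
      filter_upwards [hψ.coeFn_toLp] with x hx
      rw [hx, real_inner_smul_right, real_inner_comm]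
    rw [h2] at h
    refine h.congr fun n => ?_
    rw [L2.inner_def]
    refine integral_congr_ae ?_
    filter_upwards [hψ.coeFn_toLp, ((hv n).mem_pd i).1.coeFn_toLp] with x hx hx'
    rw [hx, hx']
  have h3 : Tendsto (fun n => ∫ x, inner ℝ (v n x) (pd i (fun x => φ x • c) x)) l
      (𝓝 (∫ x, inner ℝ (V x) (pd i (fun x => φ x • c) x))) := by
    have hpm := ((hφH.smul_const_vec c).mem_pd i).1
    rw [tendsto_iff_norm_sub_tendsto_zero]
    refine squeeze_zero (fun n => norm_nonneg _) (fun n => ?_)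
      (by simpa using hlim.mul_const (n2 (pd i fun x => φ x • c)))
    rw [← integral_sub (integrable_inner' (hv n).mem hpm) (integrable_inner' hV hpm)]
    simp only [← inner_sub_left]
    exact abs_integral_inner_le (memLp_fun_sub (hv n).mem hV) hpm
  have h4 : ∀ n, ∫ x, inner ℝ (pd i (v n) x) (φ x • c)
      = - ∫ x, inner ℝ (v n x) (pd i (fun x => φ x • c) x) := fun n =>
    integral_inner_pd (hv n) (hφH.smul_const_vec c) i
  simp only [h4] at h1
  have h5 := tendsto_nhds_unique h1 (h3.neg.mono_left hle)
  rw [h5, neg_neg]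
  refine integral_congr_ae (Eventually.of_forall fun x => ?_)
  have h6 : pd i (fun x => φ x • c) x = (fderiv ℝ φ x (e i)) • c := by
    rw [pd_eq, ((hφH.diff x).hasFDerivAt.smul_const c).fderiv]
    rfl
  simp only [h6, real_inner_smul_right, real_inner_comm]

/-- Each of the three directions is bounded by the lower limit of the whole gradient norm, which
costs the factor 3. The factor is not sharp; it is compensated by the choice of the absorbed
fraction in `exists_acceleration_energy`. -/
lemma gradSq_le_liminf {v : ℕ → R3 → R3} {V : R3 → R3} (hv : ∀ n, H1C1 (v n)) (hV : MemLp V 2)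
    (hlim : Tendsto (fun n => n2 fun x => v n x - V x) atTop (𝓝 0)) :
    gradSq V ≤ 3 * liminf (fun n => ENNReal.ofReal (gr (v n))) atTop := by
  have h : ∀ i, derivSq [i] V ≤ liminf (fun n => ENNReal.ofReal (gr (v n))) atTop := fun i => by
    refine le_of_forall_gt fun c hc => ?_
    obtain ⟨c', hc1, hc2⟩ := exists_between hc
    refine lt_of_le_of_lt ?_ hc2
    have hf := frequently_lt_of_liminf_lt (by isBoundedDefault) hc1
    have hne : (atTop ⊓ 𝓟 {n | ENNReal.ofReal (gr (v n)) < c'} : Filter ℕ).NeBot :=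
      inf_principal_neBot_iff.2 fun U hU => by
        obtain ⟨n, hn, hnU⟩ := (hf.and_eventually hU).exists
        exact ⟨n, hnU, hn⟩
    have hct : c' ≠ ⊤ := (hc2.trans_le le_top).ne
    have := derivSq_le_of_tendsto (l := atTop ⊓ 𝓟 {n | ENNReal.ofReal (gr (v n)) < c'})
      (M := √c'.toReal) i hv ?_ hV (hlim.mono_left inf_le_left)
    · rwa [Real.sq_sqrt ENNReal.toReal_nonneg, ENNReal.ofReal_toReal hct] at this
    · refine mem_inf_of_right (mem_principal.2 fun n hn => ?_)
      refine Real.le_sqrt_of_sq_le (le_trans ?_ ((ENNReal.ofReal_le_iff_le_toReal hct).1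
        (le_of_lt hn)))
      exact Finset.single_le_sum (f := fun i => n2 (pd i (v n)) ^ 2) (fun _ _ => sq_nonneg _)
        (Finset.mem_univ i)
  calc gradSq V ≤ ∑ _i : Fin 3, liminf (fun n => ENNReal.ofReal (gr (v n))) atTop :=
        Finset.sum_le_sum fun i _ => h i
    _ = _ := by simp

/-! ### Differentiation of space integrals in time -/

lemma continuous_clamp {F : Type*} [TopologicalSpace F] {a b : ℝ} (hab : a ≤ b)
    {f : ℝ → R3 → F} (hf : ContinuousOn (fun p : ℝ × R3 => f p.1 p.2) (Icc a b ×ˢ univ)) :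
    Continuous fun p : ℝ × R3 => f (projIcc a b hab p.1) p.2 :=
  hf.comp_continuous (f := fun p : ℝ × R3 => (((projIcc a b hab p.1 : Icc a b) : ℝ), p.2))
    ((continuous_subtype_val.comp (continuous_projIcc.comp continuous_fst)).prodMk continuous_snd)
    fun p => ⟨(projIcc a b hab p.1).2, mem_univ _⟩

lemma continuousOn_slice {F : Type*} [TopologicalSpace F] {s : Set ℝ}
    {f : ℝ → R3 → F} (hf : ContinuousOn (fun p : ℝ × R3 => f p.1 p.2) (s ×ˢ univ)) (x : R3) :
    ContinuousOn (fun t => f t x) s :=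
  hf.comp (f := fun t : ℝ => (t, x)) (continuous_id.prodMk continuous_const).continuousOn
    fun _ ht => ⟨ht, mem_univ _⟩

/-- Differentiation under the integral sign, in integrated form. -/
lemma integral_sub_eq_integral_deriv {F F' : ℝ → R3 → ℝ} {a b B : ℝ} (hab : a ≤ b)
    (hF : ∀ t ∈ Icc a b, Integrable (F t))
    (hd : ∀ t ∈ Icc a b, ∀ x, HasDerivAt (fun s => F s x) (F' t x) t)
    (hc : ContinuousOn (fun p : ℝ × R3 => F' p.1 p.2) (Icc a b ×ˢ univ))
    (hi : ∀ t ∈ Icc a b, Integrable (F' t)) (hB : ∀ t ∈ Icc a b, ∫ x, |F' t x| ≤ B) :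
    IntervalIntegrable (fun t => ∫ x, F' t x) volume a b ∧
      (∫ x, F b x) - (∫ x, F a x) = ∫ t in a..b, ∫ x, F' t x := by
  -- Clamping the time to [a, b] gives a globally continuous function, hence the joint measurability
  -- required by Fubini's theorem.
  have hcl := continuous_clamp hab hc
  have hprod : Integrable (fun p : ℝ × R3 => F' p.1 p.2)
      ((volume.restrict (Ioc a b)).prod volume) := by
    have hm : AEStronglyMeasurable (fun p : ℝ × R3 => F' p.1 p.2)
        ((volume.restrict (Ioc a b)).prod volume) := by
      refine hcl.aestronglyMeasurable.congr ?_
      have h1 : ∀ᵐ p ∂((volume.restrict (Ioc a b)).prod (volume : Measure R3)),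
          p.1 ∈ Ioc a b :=
        Measure.quasiMeasurePreserving_fst.ae (ae_restrict_mem measurableSet_Ioc)
      filter_upwards [h1] with p hp
      rw [projIcc_of_mem hab (Ioc_subset_Icc_self hp)]
    rw [integrable_prod_iff hm]
    refine ⟨?_, ?_⟩
    · filter_upwards [ae_restrict_mem measurableSet_Ioc] with t ht
      exact hi t (Ioc_subset_Icc_self ht)
    · refine Integrable.of_bound hm.norm.integral_prod_right' B ?_
      filter_upwards [ae_restrict_mem measurableSet_Ioc] with t ht
      rw [Real.norm_of_nonneg (integral_nonneg fun x => norm_nonneg _)]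
      exact hB t (Ioc_subset_Icc_self ht)
  refine ⟨(intervalIntegrable_iff_integrableOn_Ioc_of_le hab).2 hprod.integral_prod_left, ?_⟩
  rw [← integral_sub (hF b (right_mem_Icc.2 hab)) (hF a (left_mem_Icc.2 hab)),
    intervalIntegral.integral_of_le hab, integral_integral_swap hprod]
  refine integral_congr_ae (Eventually.of_forall fun x => ?_)
  simp only
  rw [← intervalIntegral.integral_of_le hab]
  refine (intervalIntegral.integral_eq_sub_of_hasDerivAt (f := fun s => F s x)
    (f' := fun t => F' t x) (fun t ht => ?_) ?_).symm
  · exact hd t (by rwa [uIcc_of_le hab] at ht) x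
  · refine ContinuousOn.intervalIntegrable ?_
    rw [uIcc_of_le hab]
    exact continuousOn_slice hc x

/-- `L²` bound for an increment in time minus its linearization. -/
lemma n2_increment_sub_le {w v : ℝ → R3 → R3} {c : R3 → R3} {a b M : ℝ} (hab : a < b)
    (hM : 0 ≤ M) (hd : ∀ t ∈ Icc a b, ∀ x, HasDerivAt (fun s => w s x) (v t x) t)
    (hv : ContinuousOn (fun p : ℝ × R3 => v p.1 p.2) (Icc a b ×ˢ univ)) (hcc : Continuous c)
    (hb : ∀ t ∈ Icc a b, MemLp (fun x => v t x - c x) 2 ∧ n2 (fun x => v t x - c x) ≤ M) :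
    n2 (fun x => (b - a)⁻¹ • (w b x - w a x) - c x) ≤ M := by
  have hba : 0 < b - a := sub_pos.2 hab
  have hcl := continuous_clamp hab.le hv
  -- With normalised Lebesgue measure on (a, b] the difference quotient is an average of `v`, so the
  -- averaging bound for L² norms applies.
  let ν : Measure ℝ := (ENNReal.ofReal (b - a))⁻¹ • volume.restrict (Ioc a b)
  have hne : ENNReal.ofReal (b - a) ≠ 0 := (ENNReal.ofReal_pos.2 hba).ne'
  have : IsProbabilityMeasure ν := ⟨by
    simp only [ν, Measure.smul_apply, Measure.restrict_apply_univ, Real.volume_Ioc, smul_eq_mul]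
    exact ENNReal.inv_mul_cancel hne ENNReal.ofReal_ne_top⟩
  refine n2_le_of_eLpNorm hM (n2_le_of_l2Sq hM ?_)
  refine l2Sq_le_of_average (ν := ν) (K := fun θ x => ‖v (projIcc a b hab.le θ) x - c x‖ₑ)
    ((hcl.sub (hcc.comp continuous_snd)).enorm.measurable) (fun x => ?_) ?_
  · have hci : IntervalIntegrable (fun t => v t x) volume a b := by
      refine ContinuousOn.intervalIntegrable ?_
      rw [uIcc_of_le hab.le]
      exact continuousOn_slice hv x
    have h1 : (b - a)⁻¹ • (w b x - w a x) - c x = (b - a)⁻¹ • ∫ t in a..b, (v t x - c x) := by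
      rw [intervalIntegral.integral_sub hci (by simp), intervalIntegral.integral_const,
        intervalIntegral.integral_eq_sub_of_hasDerivAt (f := fun s => w s x) (fun t ht => hd t
          (by rwa [uIcc_of_le hab.le] at ht) x) hci]
      simp only [smul_sub, smul_smul, inv_mul_cancel₀ hba.ne', one_smul]
    rw [h1, enorm_smul, intervalIntegral.integral_of_le hab.le, lintegral_smul_measure]
    have h2 : ‖(b - a)⁻¹‖ₑ = (ENNReal.ofReal (b - a))⁻¹ := by
      rw [← ofReal_norm, Real.norm_of_nonneg (inv_nonneg.2 hba.le), ENNReal.ofReal_inv_of_pos hba]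
    rw [h2, smul_eq_mul]
    gcongr
    refine (enorm_integral_le_lintegral_enorm _).trans (le_of_eq ?_)
    refine setLIntegral_congr_fun measurableSet_Ioc fun t ht => ?_
    simp only [projIcc_of_mem hab.le (Ioc_subset_Icc_self ht)]
  · refine Eventually.of_forall fun θ => ?_
    obtain ⟨h1, h2⟩ := hb _ (projIcc a b hab.le θ).2
    change l2Sq _ ≤ _
    rw [l2Sq_eq_ofReal h1]
    exact ENNReal.ofReal_le_ofReal (pow_le_pow_left₀ (n2_nonneg _) h2 2)

/-! ### Joint regularity in time and space -/

section JointRegularity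

variable {F : Type*} [NormedAddCommGroup F] [NormedSpace ℝ F] {I : Set ℝ} {w : ℝ → R3 → F}

lemma hasFDerivAt_joint (hI : IsOpen I)
    (h : ContDiffOn ℝ 1 (fun p : ℝ × R3 => w p.1 p.2) (I ×ˢ univ)) {t : ℝ} (ht : t ∈ I) (x : R3) :
    HasFDerivAt (fun p : ℝ × R3 => w p.1 p.2) (fderiv ℝ (fun p : ℝ × R3 => w p.1 p.2) (t, x))
      (t, x) :=
  ((h.contDiffAt ((hI.prod isOpen_univ).mem_nhds ⟨ht, mem_univ x⟩)).differentiableAt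
    (by norm_num)).hasFDerivAt

lemma hasDerivAt_joint (hI : IsOpen I)
    (h : ContDiffOn ℝ 1 (fun p : ℝ × R3 => w p.1 p.2) (I ×ˢ univ)) {t : ℝ} (ht : t ∈ I) (x : R3) :
    HasDerivAt (fun s => w s x) (fderiv ℝ (fun p : ℝ × R3 => w p.1 p.2) (t, x) (1, 0)) t :=
  HasFDerivAt.comp_hasDerivAt (f := fun s : ℝ => (s, x)) t (hasFDerivAt_joint hI h ht x)
    ((hasDerivAt_id t).prodMk (hasDerivAt_const t x))

lemma dt_eq_fderiv (hI : IsOpen I)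
    (h : ContDiffOn ℝ 1 (fun p : ℝ × R3 => w p.1 p.2) (I ×ˢ univ)) {t : ℝ} (ht : t ∈ I) (x : R3) :
    dt w t x = fderiv ℝ (fun p : ℝ × R3 => w p.1 p.2) (t, x) (1, 0) :=
  (hasDerivAt_joint hI h ht x).deriv

lemma hasDerivAt_dt (hI : IsOpen I)
    (h : ContDiffOn ℝ 1 (fun p : ℝ × R3 => w p.1 p.2) (I ×ˢ univ)) {t : ℝ} (ht : t ∈ I) (x : R3) :
    HasDerivAt (fun s => w s x) (dt w t x) t := by
  rw [dt_eq_fderiv hI h ht]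
  exact hasDerivAt_joint hI h ht x

lemma continuousOn_fderiv_joint (hI : IsOpen I)
    (h : ContDiffOn ℝ 1 (fun p : ℝ × R3 => w p.1 p.2) (I ×ˢ univ)) :
    ContinuousOn (fderiv ℝ (fun p : ℝ × R3 => w p.1 p.2)) (I ×ˢ univ) :=
  h.continuousOn_fderiv_of_isOpen (hI.prod isOpen_univ) (by norm_num)

lemma continuousOn_dt (hI : IsOpen I)
    (h : ContDiffOn ℝ 1 (fun p : ℝ × R3 => w p.1 p.2) (I ×ˢ univ)) :
    ContinuousOn (fun p : ℝ × R3 => dt w p.1 p.2) (I ×ˢ univ) :=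
  ((continuousOn_fderiv_joint hI h).clm_apply continuousOn_const).congr fun p hp =>
    dt_eq_fderiv hI h hp.1 p.2

lemma contDiff_slice (h : ContDiffOn ℝ 1 (fun p : ℝ × R3 => w p.1 p.2) (I ×ˢ univ)) {t : ℝ}
    (ht : t ∈ I) : ContDiff ℝ 1 (w t) := by
  rw [← contDiffOn_univ]
  exact h.comp (f := fun y : R3 => (t, y)) (contDiff_const.prodMk contDiff_id).contDiffOn
    fun y _ => ⟨ht, mem_univ y⟩

lemma continuous_slice_of_continuousOn {G : Type*} [TopologicalSpace G] {w : ℝ → R3 → G}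
    (h : ContinuousOn (fun p : ℝ × R3 => w p.1 p.2) (I ×ˢ univ)) {t : ℝ} (ht : t ∈ I) :
    Continuous (w t) :=
  h.comp_continuous (f := fun y : R3 => (t, y)) (continuous_const.prodMk continuous_id)
    fun y => ⟨ht, mem_univ y⟩

end JointRegularity

/-! ### Supremum bound in H² -/

lemma H2C2.coord {u : R3 → R3} (hu : H2C2 u) (k : Fin 3) :
    H2C2 (fun x => u x k) ∧ gr (fun x => u x k) ≤ gr u ∧ hs (fun x => u x k) ≤ hs u := by
  have hc : ContDiff ℝ 2 fun x => u x k :=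
    ((EuclideanSpace.proj k : R3 →L[ℝ] ℝ).contDiff).comp hu.c2
  have hp1 : ∀ i, pd i (fun x => u x k) = fun x => pd i u x k := fun i =>
    funext fun x => pd_coord hu.h1.diff i k x
  have hp2 : ∀ i j, pd j (pd i fun x => u x k) = fun x => pd j (pd i u) x k := fun i j => by
    rw [hp1]
    exact funext fun x => pd_coord (hu.h1_pd i).diff j k x
  have hle : ∀ {w : R3 → R3}, MemLp w 2 → Continuous w →
      MemLp (fun x => w x k) 2 ∧ n2 (fun x => w x k) ≤ n2 w := fun {w} hw hwc => by
    have := memLp_n2_of_le (f := fun x => w x k) (g := w) zero_le_one hw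
      (((EuclideanSpace.proj k : R3 →L[ℝ] ℝ).continuous).comp hwc).aestronglyMeasurable
      fun x => by rw [one_mul]; exact PiLp.norm_apply_le _ _
    simpa using this
  have h1 := fun i => hle (hu.h1.mem_pd i).1 (continuous_pd hu.h1.c1 i)
  have h2 := fun i j => hle ((hu.h1_pd i).mem_pd j).1 (continuous_pd (hu.h1_pd i).c1 j)
  refine ⟨h2C2_of_h2Sq hc ?_, ?_, ?_⟩
  · rw [h2Sq, l2Sq_eq_ofReal (hu.h1.coord k).mem, (hu.h1.coord k).gradSq_eq, RayleighTaylor.hessSq_eq hc]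
    refine ENNReal.add_lt_top.2 ⟨ENNReal.add_lt_top.2 ⟨ENNReal.ofReal_lt_top,
      ENNReal.ofReal_lt_top⟩, ENNReal.sum_lt_top.2 fun i _ => ENNReal.sum_lt_top.2 fun j _ => ?_⟩
    rw [hp2, l2Sq_eq_ofReal (h2 i j).1]
    exact ENNReal.ofReal_lt_top
  · refine Finset.sum_le_sum fun i _ => pow_le_pow_left₀ (n2_nonneg _) ?_ 2
    rw [hp1]
    exact (h1 i).2
  · refine Finset.sum_le_sum fun i _ => Finset.sum_le_sum fun j _ =>
      pow_le_pow_left₀ (n2_nonneg _) ?_ 2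
    rw [hp2]
    exact (h2 i j).2

/-- The scalar bound is applied to each component; its L⁶ norm of the gradient is controlled by the
second derivatives. The L² norm of `u` itself does not enter. -/
lemma exists_sup_le : ∃ C : ℝ, 0 < C ∧ ∀ u : R3 → R3, H2C2 u → ∀ x,
    ‖u x‖ ≤ C * √(gr u + hs u) := by
  obtain ⟨C, hC, hb⟩ := exists_sup_bound
  have hS : 0 ≤ sobC (R3 →L[ℝ] ℝ) := sobC_nonneg
  refine ⟨3 * (C * (1 + sobC (R3 →L[ℝ] ℝ))) + 1, by positivity, fun u hu x => ?_⟩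
  have h : ∀ k, |u x k| ≤ C * (1 + sobC (R3 →L[ℝ] ℝ)) * √(gr u + hs u) := fun k => by
    obtain ⟨hk, hg, hh⟩ := hu.coord k
    obtain ⟨h6, h6'⟩ := hk.h1D.sobolev
    have h1 : n2 (fderiv ℝ fun x => u x k) ≤ √(gr u + hs u) :=
      Real.le_sqrt_of_sq_le (by linarith [hk.h1.n2_fderiv_sq_le_gr, hs_nonneg u])
    have h2 : n2 (fderiv ℝ (fderiv ℝ fun x => u x k)) ≤ √(gr u + hs u) :=
      Real.le_sqrt_of_sq_le (by linarith [hk.n2_fderiv2_sq_le_hs, gr_nonneg u])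
    refine (hb _ hk.h1 h6 x).trans ?_
    rw [mul_assoc]
    refine mul_le_mul_of_nonneg_left ?_ hC
    calc _ ≤ √(gr u + hs u) + sobC (R3 →L[ℝ] ℝ) * √(gr u + hs u) :=
          add_le_add h1 (h6'.trans (mul_le_mul_of_nonneg_left h2 hS))
      _ = _ := by ring
  calc ‖u x‖ ≤ ∑ k, |u x k| := norm_le_sum_abs _
    _ ≤ ∑ _k : Fin 3, C * (1 + sobC (R3 →L[ℝ] ℝ)) * √(gr u + hs u) :=
        Finset.sum_le_sum fun k _ => h k
    _ = 3 * (C * (1 + sobC (R3 →L[ℝ] ℝ))) * √(gr u + hs u) := by simp; ring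
    _ ≤ _ := mul_le_mul_of_nonneg_right (by linarith) (Real.sqrt_nonneg _)

/-! ### Norms of a solution as continuous functions of time -/

lemma isOpen_openTimes (T : EReal) : IsOpen (openTimes T) :=
  isOpen_Ioi.inter (isOpen_Iio.preimage continuous_coe_real_ereal)

lemma openTimes_subset (T : EReal) : openTimes T ⊆ closedTimes T := fun _ h => ⟨h.1.le, h.2⟩

lemma Icc_subset_openTimes {T : EReal} {a b : ℝ} (ha : a ∈ openTimes T) (hb : b ∈ openTimes T) :
    Icc a b ⊆ openTimes T := fun _ ht =>
  ⟨ha.1.trans_le ht.1, lt_of_le_of_lt (EReal.coe_le_coe_iff.2 ht.2) hb.2⟩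

lemma laplacian_eq {u : R3 → R3} (hu : ContDiff ℝ 2 u) (x : R3) :
    Laplacian.laplacian u x = ∑ i, pd i (pd i u) x := by
  rw [InnerProductSpace.laplacian_eq_iteratedFDeriv_orthonormalBasis u
    (EuclideanSpace.basisFun (Fin 3) ℝ)]
  refine Finset.sum_congr rfl fun i _ => ?_
  rw [iteratedFDeriv_two_apply, pd_eq, fderiv_pd hu]
  simp [e]

lemma tendsto_n2_of_sub {ι F : Type*} [NormedAddCommGroup F] {l : Filter ι} {f : ι → R3 → F}
    {g : R3 → F} (hf : ∀ᶠ n in l, MemLp (f n) 2) (hg : MemLp g 2)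
    (h : Tendsto (fun n => n2 fun x => f n x - g x) l (𝓝 0)) :
    Tendsto (fun n => n2 (f n)) l (𝓝 (n2 g)) := by
  rw [tendsto_iff_norm_sub_tendsto_zero]
  refine squeeze_zero' (Eventually.of_forall fun n => norm_nonneg _) ?_ h
  filter_upwards [hf] with n hn
  exact abs_n2_sub_n2_le hn hg

lemma tendsto_zero_of_ofReal {ι : Type*} {l : Filter ι} {f : ι → ℝ} (h0 : ∀ n, 0 ≤ f n)
    (h : Tendsto (fun n => ENNReal.ofReal (f n)) l (𝓝 0)) : Tendsto f l (𝓝 0) := by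
  have := (ENNReal.tendsto_toReal ENNReal.zero_ne_top).comp h
  simpa [Function.comp_def, ENNReal.toReal_ofReal, h0] using this

lemma tendsto_zero_of_sq_le {ι : Type*} {l : Filter ι} {f g : ι → ℝ} (h0 : ∀ n, 0 ≤ f n)
    (hle : ∀ n, f n ^ 2 ≤ g n) (h : Tendsto g l (𝓝 0)) : Tendsto f l (𝓝 0) := by
  have h1 : Tendsto (fun n => √(g n)) l (𝓝 0) := by
    simpa [Function.comp_def] using (Real.continuous_sqrt.tendsto 0).comp h
  exact squeeze_zero h0 (fun n => Real.le_sqrt_of_sq_le (hle n)) h1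

/-- The squared `H²` norm of a classical function. -/
noncomputable def kap {F : Type*} [NormedAddCommGroup F] [NormedSpace ℝ F] (f : R3 → F) : ℝ :=
  n2 f ^ 2 + gr f + hs f

lemma kap_nonneg {F : Type*} [NormedAddCommGroup F] [NormedSpace ℝ F] (f : R3 → F) : 0 ≤ kap f :=
  add_nonneg (add_nonneg (sq_nonneg _) (gr_nonneg f)) (hs_nonneg f)

lemma n2_pd_sq_le_gr {F : Type*} [NormedAddCommGroup F] [NormedSpace ℝ F] (f : R3 → F)
    (i : Fin 3) : n2 (pd i f) ^ 2 ≤ gr f :=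
  Finset.single_le_sum (f := fun i => n2 (pd i f) ^ 2) (fun _ _ => sq_nonneg _) (Finset.mem_univ i)

lemma n2_pd_pd_sq_le_hs {F : Type*} [NormedAddCommGroup F] [NormedSpace ℝ F] (f : R3 → F)
    (i j : Fin 3) : n2 (pd j (pd i f)) ^ 2 ≤ hs f :=
  (n2_pd_sq_le_gr (pd i f) j).trans (Finset.single_le_sum (f := fun i => gr (pd i f))
    (fun _ _ => gr_nonneg _) (Finset.mem_univ i))

lemma H2C2.h2Sq_eq {u : R3 → R3} (hu : H2C2 u) : h2Sq u = ENNReal.ofReal (kap u) := by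
  rw [h2Sq, l2Sq_eq_ofReal hu.h1.mem, hu.h1.gradSq_eq, hu.hessSq_eq,
    ← ENNReal.ofReal_add (sq_nonneg _) (gr_nonneg _),
    ← ENNReal.ofReal_add (add_nonneg (sq_nonneg _) (gr_nonneg _)) (hs_nonneg _)]
  rfl

lemma H1C1.h1Sq_eq {f : R3 → ℝ} (hf : H1C1 f) : h1Sq f = ENNReal.ofReal (n2 f ^ 2 + gr f) := by
  rw [h1Sq, l2Sq_eq_ofReal hf.mem, hf.gradSq_eq,
    ← ENNReal.ofReal_add (sq_nonneg _) (gr_nonneg _)]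

namespace IsClassicalSolution

variable {μ g : ℝ} {ρbar : ℝ → ℝ} {T : EReal} {ϱ₀ : R3 → ℝ} {u₀ : R3 → R3} {ϱ : ℝ → R3 → ℝ}
  {u : ℝ → R3 → R3} {q : ℝ → R3 → ℝ} (hS : IsClassicalSolution μ g ρbar T ϱ₀ u₀ ϱ u q)
include hS

lemma h2C2 {t : ℝ} (ht : t ∈ openTimes T) : H2C2 (u t) :=
  h2C2_of_h2Sq (hS.u_C2 t ht) (hS.u_H2 t (openTimes_subset T ht)).1

lemma h1C1 {t : ℝ} (ht : t ∈ openTimes T) : H1C1 (ϱ t) := by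
  have h := (hS.ϱ_H1 t (openTimes_subset T ht)).1
  rw [h1Sq, ENNReal.add_lt_top] at h
  exact h1C1_of_h1Sq (contDiff_slice hS.ϱ_C1 ht) h.1 h.2

lemma continuous_dt_u {t : ℝ} (ht : t ∈ openTimes T) : Continuous (dt u t) :=
  continuous_slice_of_continuousOn (continuousOn_dt (isOpen_openTimes T) hS.u_C1) ht

lemma memLp_dt_u {t : ℝ} (ht : t ∈ openTimes T) : MemLp (dt u t) 2 :=
  memLp_of_l2Sq (hS.continuous_dt_u ht).aestronglyMeasurable (hS.ut_L2 t ht).1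

lemma dvg_eq_zero {t : ℝ} (ht : t ∈ openTimes T) (x : R3) : dvg (u t) x = 0 :=
  hS.div_free t ht x

omit hS in
lemma nhdsWithin_openTimes {t : ℝ} (ht : t ∈ openTimes T) : 𝓝[closedTimes T] t = 𝓝 t :=
  nhdsWithin_eq_nhds.2 (mem_of_superset ((isOpen_openTimes T).mem_nhds ht) (openTimes_subset T))

lemma tendsto_kap {t : ℝ} (ht : t ∈ openTimes T) :
    Tendsto (fun s => kap fun x => u s x - u t x) (𝓝 t) (𝓝 0) := by
  have h := (hS.u_H2 t (openTimes_subset T ht)).2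
  rw [nhdsWithin_openTimes ht] at h
  refine tendsto_zero_of_ofReal (fun _ => kap_nonneg _) (h.congr' ?_)
  filter_upwards [(isOpen_openTimes T).mem_nhds ht] with s hs
  exact ((hS.h2C2 hs).sub (hS.h2C2 ht)).h2Sq_eq

lemma tendsto_ϱ {t : ℝ} (ht : t ∈ openTimes T) :
    Tendsto (fun s => (n2 fun x => ϱ s x - ϱ t x) ^ 2 + gr fun x => ϱ s x - ϱ t x) (𝓝 t)
      (𝓝 0) := by
  have h := (hS.ϱ_H1 t (openTimes_subset T ht)).2
  rw [nhdsWithin_openTimes ht] at h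
  refine tendsto_zero_of_ofReal (fun _ => add_nonneg (sq_nonneg _) (gr_nonneg _)) (h.congr' ?_)
  filter_upwards [(isOpen_openTimes T).mem_nhds ht] with s hs
  exact ((hS.h1C1 hs).sub (hS.h1C1 ht)).h1Sq_eq

lemma tendsto_dt_u {t : ℝ} (ht : t ∈ openTimes T) :
    Tendsto (fun s => n2 fun x => dt u s x - dt u t x) (𝓝 t) (𝓝 0) := by
  have h := (hS.ut_L2 t ht).2
  rw [(isOpen_openTimes T).nhdsWithin_eq ht] at h
  refine tendsto_zero_of_sq_le (fun _ => n2_nonneg _) (fun _ => le_rfl)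
    (tendsto_zero_of_ofReal (fun _ => sq_nonneg _) (h.congr' ?_))
  filter_upwards [(isOpen_openTimes T).mem_nhds ht] with s hs
  exact l2Sq_eq_ofReal (memLp_fun_sub (hS.memLp_dt_u hs) (hS.memLp_dt_u ht))

lemma tendsto_n2_u {t : ℝ} (ht : t ∈ openTimes T) :
    Tendsto (fun s => n2 fun x => u s x - u t x) (𝓝 t) (𝓝 0) :=
  tendsto_zero_of_sq_le (fun _ => n2_nonneg _) (fun s => by
    rw [kap]
    linarith [gr_nonneg fun x => u s x - u t x, hs_nonneg fun x => u s x - u t x])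
    (hS.tendsto_kap ht)

lemma tendsto_n2_pd_u {t : ℝ} (ht : t ∈ openTimes T) (i : Fin 3) :
    Tendsto (fun s => n2 fun x => pd i (u s) x - pd i (u t) x) (𝓝 t) (𝓝 0) := by
  refine (tendsto_zero_of_sq_le (f := fun s => n2 (pd i fun x => u s x - u t x))
    (fun _ => n2_nonneg _) (fun s => ?_) (hS.tendsto_kap ht)).congr' ?_
  · rw [kap]
    linarith [n2_pd_sq_le_gr (fun x => u s x - u t x) i, hs_nonneg fun x => u s x - u t x,
      sq_nonneg (n2 fun x => u s x - u t x)]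
  · filter_upwards [(isOpen_openTimes T).mem_nhds ht] with s hs
    rw [pd_sub (hS.h2C2 hs).h1.diff (hS.h2C2 ht).h1.diff]

lemma tendsto_n2_pd_pd_u {t : ℝ} (ht : t ∈ openTimes T) (i j : Fin 3) :
    Tendsto (fun s => n2 fun x => pd j (pd i (u s)) x - pd j (pd i (u t)) x) (𝓝 t) (𝓝 0) := by
  refine (tendsto_zero_of_sq_le (f := fun s => n2 (pd j (pd i fun x => u s x - u t x)))
    (fun _ => n2_nonneg _) (fun s => ?_) (hS.tendsto_kap ht)).congr' ?_
  · rw [kap]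
    linarith [n2_pd_pd_sq_le_hs (fun x => u s x - u t x) i j, gr_nonneg fun x => u s x - u t x,
      sq_nonneg (n2 fun x => u s x - u t x)]
  · filter_upwards [(isOpen_openTimes T).mem_nhds ht] with s hs
    rw [pd_sub (hS.h2C2 hs).h1.diff (hS.h2C2 ht).h1.diff,
      pd_sub ((hS.h2C2 hs).h1_pd i).diff ((hS.h2C2 ht).h1_pd i).diff]

lemma tendsto_n2_ϱ {t : ℝ} (ht : t ∈ openTimes T) :
    Tendsto (fun s => n2 fun x => ϱ s x - ϱ t x) (𝓝 t) (𝓝 0) :=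
  tendsto_zero_of_sq_le (fun _ => n2_nonneg _) (fun s => by
    linarith [gr_nonneg fun x => ϱ s x - ϱ t x]) (hS.tendsto_ϱ ht)

lemma tendsto_n2_pd_ϱ {t : ℝ} (ht : t ∈ openTimes T) (i : Fin 3) :
    Tendsto (fun s => n2 fun x => pd i (ϱ s) x - pd i (ϱ t) x) (𝓝 t) (𝓝 0) := by
  refine (tendsto_zero_of_sq_le (f := fun s => n2 (pd i fun x => ϱ s x - ϱ t x))
    (fun _ => n2_nonneg _) (fun s => ?_) (hS.tendsto_ϱ ht)).congr' ?_
  · linarith [n2_pd_sq_le_gr (fun x => ϱ s x - ϱ t x) i, sq_nonneg (n2 fun x => ϱ s x - ϱ t x)]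
  · filter_upwards [(isOpen_openTimes T).mem_nhds ht] with s hs
    rw [pd_sub (hS.h1C1 hs).diff (hS.h1C1 ht).diff]

omit hS in
lemma eventually_openTimes {t : ℝ} (ht : t ∈ openTimes T) {p : ℝ → Prop}
    (h : ∀ s ∈ openTimes T, p s) : ∀ᶠ s in 𝓝 t, p s :=
  mem_of_superset ((isOpen_openTimes T).mem_nhds ht) h

omit hS in
lemma continuousOn_n2_of_tendsto {F : Type*} [NormedAddCommGroup F] {f : ℝ → R3 → F}
    (hf : ∀ s ∈ openTimes T, MemLp (f s) 2)
    (h : ∀ t ∈ openTimes T, Tendsto (fun s => n2 fun x => f s x - f t x) (𝓝 t) (𝓝 0)) :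
    ContinuousOn (fun t => n2 (f t)) (openTimes T) := fun t ht =>
  (tendsto_n2_of_sub (eventually_openTimes ht hf) (hf t ht) (h t ht)).mono_left nhdsWithin_le_nhds

lemma continuousOn_n2_u : ContinuousOn (fun t => n2 (u t)) (openTimes T) :=
  continuousOn_n2_of_tendsto (fun _ h => (hS.h2C2 h).h1.mem) fun _ => hS.tendsto_n2_u

lemma continuousOn_n2_dt_u : ContinuousOn (fun t => n2 (dt u t)) (openTimes T) :=
  continuousOn_n2_of_tendsto (fun _ => hS.memLp_dt_u) fun _ => hS.tendsto_dt_u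

lemma continuousOn_n2_ϱ : ContinuousOn (fun t => n2 (ϱ t)) (openTimes T) :=
  continuousOn_n2_of_tendsto (fun _ h => (hS.h1C1 h).mem) fun _ => hS.tendsto_n2_ϱ

lemma continuousOn_gr_u : ContinuousOn (fun t => gr (u t)) (openTimes T) :=
  continuousOn_finsetSum _ fun i _ => (continuousOn_n2_of_tendsto (f := fun t => pd i (u t))
    (fun _ h => ((hS.h2C2 h).h1.mem_pd i).1) fun _ h => hS.tendsto_n2_pd_u h i).pow 2

lemma continuousOn_hs_u : ContinuousOn (fun t => hs (u t)) (openTimes T) :=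
  continuousOn_finsetSum _ fun i _ => continuousOn_finsetSum _ fun j _ =>
    (continuousOn_n2_of_tendsto (f := fun t => pd j (pd i (u t)))
      (fun _ h => (((hS.h2C2 h).h1_pd i).mem_pd j).1) fun _ h => hS.tendsto_n2_pd_pd_u h i j).pow 2

lemma continuousOn_gr_ϱ : ContinuousOn (fun t => gr (ϱ t)) (openTimes T) :=
  continuousOn_finsetSum _ fun i _ => (continuousOn_n2_of_tendsto (f := fun t => pd i (ϱ t))
    (fun _ h => ((hS.h1C1 h).mem_pd i).1) fun _ h => hS.tendsto_n2_pd_ϱ h i).pow 2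

lemma momentum_pd {t : ℝ} (ht : t ∈ openTimes T) (x : R3) :
    μ • ∑ i, pd i (pd i (u t)) x = gradient (q t) x
      + ((ϱ t x + ρbar (x 2)) • (dt u t x + fderiv ℝ (u t) x (u t x)) + (g * ϱ t x) • e 2) := by
  rw [← laplacian_eq (hS.u_C2 t ht), ← hS.momentum t ht x, smul_add]
  abel

end IsClassicalSolution

/-! ### Time difference quotients and the derivative of ‖∇u‖² -/

lemma tendsto_integral_inner {ι : Type*} {l : Filter ι} {f g : ι → R3 → R3} {F G : R3 → R3}
    (hf : ∀ᶠ n in l, MemLp (f n) 2) (hg : ∀ᶠ n in l, MemLp (g n) 2) (hF : MemLp F 2)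
    (hG : MemLp G 2) (hfF : Tendsto (fun n => n2 fun x => f n x - F x) l (𝓝 0))
    (hgG : Tendsto (fun n => n2 fun x => g n x - G x) l (𝓝 0)) :
    Tendsto (fun n => ∫ x, inner ℝ (f n x) (g n x)) l (𝓝 (∫ x, inner ℝ (F x) (G x))) := by
  rw [tendsto_iff_norm_sub_tendsto_zero]
  have hlim : Tendsto (fun n => (n2 fun x => f n x - F x) * n2 (g n)
      + n2 F * n2 fun x => g n x - G x) l (𝓝 (0 * n2 G + n2 F * 0)) :=
    (hfF.mul (tendsto_n2_of_sub hg hG hgG)).add (hgG.const_mul _)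
  rw [zero_mul, mul_zero, add_zero] at hlim
  refine squeeze_zero' (Eventually.of_forall fun n => norm_nonneg _) ?_ hlim
  filter_upwards [hf, hg] with n hfn hgn
  have h1 : (∫ x, inner ℝ (f n x) (g n x)) - (∫ x, inner ℝ (F x) (G x))
      = (∫ x, inner ℝ (f n x - F x) (g n x)) + ∫ x, inner ℝ (F x) (g n x - G x) := by
    simp only [inner_sub_left, inner_sub_right]
    rw [integral_sub (integrable_inner' hfn hgn) (integrable_inner' hF hgn),
      integral_sub (integrable_inner' hF hgn) (integrable_inner' hF hG)]
    ring
  rw [h1]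
  exact (norm_add_le _ _).trans (add_le_add (abs_integral_inner_le (memLp_fun_sub hfn hF) hgn)
    (abs_integral_inner_le hF (memLp_fun_sub hgn hG)))

/-- The Laplacian as a sum of second partial derivatives. -/
noncomputable def lap (f : R3 → R3) : R3 → R3 := fun x => ∑ i, pd i (pd i f) x

lemma memLp_lap {f : R3 → R3} (hf : H2C2 f) : MemLp (lap f) 2 :=
  memLp_finsetSum _ fun i _ => ((hf.h1_pd i).mem_pd i).1

lemma integral_inner_lap {f g : R3 → R3} (hf : H1C1 f) (hg : H2C2 g) :
    ∫ x, inner ℝ (f x) (lap g x) = - ∑ i, ∫ x, inner ℝ (pd i f x) (pd i g x) := by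
  simp only [lap, inner_sum]
  rw [integral_finsetSum _ fun i _ => integrable_inner' hf.mem ((hg.h1_pd i).mem_pd i).1,
    ← Finset.sum_neg_distrib]
  refine Finset.sum_congr rfl fun i _ => ?_
  rw [integral_inner_pd hf (hg.h1_pd i), neg_neg]

lemma H1C1.gr_eq {f : R3 → R3} (hf : H1C1 f) : gr f = ∑ i, ∫ x, inner ℝ (pd i f x) (pd i f x) :=
  Finset.sum_congr rfl fun i _ => by
    rw [n2_sq (hf.mem_pd i).1]
    simp only [real_inner_self_eq_norm_sq]

/-- A polarised identity: with f = u(t + h) and g = u(t) it gives the time derivative of ‖∇u‖²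
without any mixed derivative ∂ₜ∇u. -/
lemma gr_sub_gr {f g : R3 → R3} (hf : H2C2 f) (hg : H2C2 g) :
    gr f - gr g = - ∫ x, inner ℝ (f x - g x) (lap f x + lap g x) := by
  have hlf := memLp_lap hf
  have hlg := memLp_lap hg
  have h1 : ∫ x, inner ℝ (f x - g x) (lap f x + lap g x)
      = (∫ x, inner ℝ (f x) (lap f x)) + (∫ x, inner ℝ (f x) (lap g x))
        - ((∫ x, inner ℝ (g x) (lap f x)) + ∫ x, inner ℝ (g x) (lap g x)) := by
    rw [← integral_add (integrable_inner' hf.h1.mem hlf) (integrable_inner' hf.h1.mem hlg),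
      ← integral_add (integrable_inner' hg.h1.mem hlf) (integrable_inner' hg.h1.mem hlg),
      ← integral_sub]
    · refine integral_congr_ae (Eventually.of_forall fun x => ?_)
      simp only [inner_sub_left, inner_add_right]
      ring
    · exact (integrable_inner' hf.h1.mem hlf).add (integrable_inner' hf.h1.mem hlg)
    · exact (integrable_inner' hg.h1.mem hlf).add (integrable_inner' hg.h1.mem hlg)
  rw [h1, integral_inner_lap hf.h1 hf, integral_inner_lap hf.h1 hg, integral_inner_lap hg.h1 hf,
    integral_inner_lap hg.h1 hg, ← hf.h1.gr_eq, ← hg.h1.gr_eq]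
  have h2 : ∑ i, ∫ x, inner ℝ (pd i f x) (pd i g x) = ∑ i, ∫ x, inner ℝ (pd i g x) (pd i f x) :=
    Finset.sum_congr rfl fun i _ => integral_congr_ae
      (Eventually.of_forall fun x => real_inner_comm _ _)
  rw [h2]
  ring

/-- The time difference quotient. -/
noncomputable def tdq (u : ℝ → R3 → R3) (t h : ℝ) : R3 → R3 :=
  fun x => h⁻¹ • (u (t + h) x - u t x)

lemma tendsto_n2_finset_sum {ι κ : Type*} {l : Filter κ} (s : Finset ι) {f : ι → κ → R3 → R3}
    {F : ι → R3 → R3} (hf : ∀ i, ∀ᶠ n in l, MemLp (f i n) 2) (hF : ∀ i, MemLp (F i) 2)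
    (h : ∀ i, Tendsto (fun n => n2 fun x => f i n x - F i x) l (𝓝 0)) :
    Tendsto (fun n => n2 fun x => ∑ i ∈ s, f i n x - ∑ i ∈ s, F i x) l (𝓝 0) := by
  classical
  induction s using Finset.induction_on with
  | empty => simp [n2, tendsto_const_nhds]
  | insert a s ha ih =>
    have h2 : ∀ᶠ n in l, ∀ i ∈ s, MemLp (f i n) 2 :=
      (Filter.eventually_all_finset s).2 fun i _ => hf i
    refine squeeze_zero' (Eventually.of_forall fun n => n2_nonneg _) ?_
      (by simpa using (h a).add ih)
    filter_upwards [h2, hf a] with n hn hna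
    simp only [Finset.sum_insert ha]
    have h3 := n2_add_le (memLp_fun_sub hna (hF a))
      (memLp_fun_sub (memLp_finsetSum s hn) (memLp_finsetSum s fun i _ => hF i))
    refine le_trans (le_of_eq ?_) h3
    congr 1
    funext x
    abel

lemma tendsto_const_add_nhds_zero (t : ℝ) :
    Tendsto (fun h : ℝ => t + h) (𝓝[>] 0) (𝓝 t) := by
  have := (continuous_const_add t).tendsto 0
  rw [add_zero] at this
  exact this.mono_left nhdsWithin_le_nhds

namespace IsClassicalSolution

variable {μ g : ℝ} {ρbar : ℝ → ℝ} {T : EReal} {ϱ₀ : R3 → ℝ} {u₀ : R3 → R3} {ϱ : ℝ → R3 → ℝ}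
  {u : ℝ → R3 → R3} {q : ℝ → R3 → ℝ} (hS : IsClassicalSolution μ g ρbar T ϱ₀ u₀ ϱ u q)
include hS

lemma hasDerivAt_u {t : ℝ} (ht : t ∈ openTimes T) (x : R3) :
    HasDerivAt (fun s => u s x) (dt u t x) t := hasDerivAt_dt (isOpen_openTimes T) hS.u_C1 ht x

lemma hasDerivAt_ϱ {t : ℝ} (ht : t ∈ openTimes T) (x : R3) :
    HasDerivAt (fun s => ϱ s x) (dt ϱ t x) t := hasDerivAt_dt (isOpen_openTimes T) hS.ϱ_C1 ht x

lemma h2C2_tdq {t h : ℝ} (ht : t ∈ openTimes T) (hth : t + h ∈ openTimes T) :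
    H2C2 (tdq u t h) :=
  ((hS.h2C2 hth).sub (hS.h2C2 ht)).smul _

lemma dvg_tdq {t h : ℝ} (ht : t ∈ openTimes T) (hth : t + h ∈ openTimes T) (x : R3) :
    dvg (tdq u t h) x = 0 :=
  dvg_smul (w := fun x => u (t + h) x - u t x) _ (fun x => dvg_sub (hS.h2C2 hth).h1.diff
    (hS.h2C2 ht).h1.diff (hS.dvg_eq_zero hth) (hS.dvg_eq_zero ht) x) x

lemma n2_tdq_sub_le {t h M : ℝ} (hh : 0 < h) (ht : t ∈ openTimes T) (hth : t + h ∈ openTimes T)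
    {c : R3 → R3} (hc : Continuous c) (hcm : MemLp c 2) (hM : 0 ≤ M)
    (hb : ∀ s ∈ Icc t (t + h), n2 (fun x => dt u s x - c x) ≤ M) :
    n2 (fun x => tdq u t h x - c x) ≤ M := by
  have hsub := Icc_subset_openTimes ht hth
  have := n2_increment_sub_le (w := u) (v := dt u) (c := c) (a := t) (b := t + h) (by linarith) hM
    (fun s hs x => hS.hasDerivAt_u (hsub hs) x)
    ((continuousOn_dt (isOpen_openTimes T) hS.u_C1).mono (prod_mono hsub subset_rfl)) hc
    fun s hs => ⟨memLp_fun_sub (hS.memLp_dt_u (hsub hs)) hcm, hb s hs⟩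
  simpa only [tdq, add_sub_cancel_left] using this

lemma n2_tdq_le {t h M : ℝ} (hh : 0 < h) (ht : t ∈ openTimes T) (hth : t + h ∈ openTimes T)
    (hM : 0 ≤ M) (hb : ∀ s ∈ Icc t (t + h), n2 (dt u s) ≤ M) : n2 (tdq u t h) ≤ M := by
  have := hS.n2_tdq_sub_le hh ht hth (c := fun _ => 0) continuous_const (by simp) hM
    (by simpa using hb)
  simpa using this

lemma tendsto_tdq {t : ℝ} (ht : t ∈ openTimes T) :
    Tendsto (fun h => n2 fun x => tdq u t h x - dt u t x) (𝓝[>] 0) (𝓝 0) := by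
  rw [Metric.tendsto_nhds]
  intro ε hε
  have h1 := (Metric.tendsto_nhds.1 (hS.tendsto_dt_u ht)) (ε / 2) (half_pos hε)
  have h2 := h1.and ((isOpen_openTimes T).mem_nhds ht)
  rw [Metric.eventually_nhds_iff] at h2
  obtain ⟨δ, hδ, hb⟩ := h2
  have h3 : Ioo (0 : ℝ) δ ∈ 𝓝[>] (0 : ℝ) := Ioo_mem_nhdsGT hδ
  filter_upwards [h3] with h hh
  rw [Real.dist_0_eq_abs, abs_of_nonneg (n2_nonneg _)]
  have h4 : ∀ s ∈ Icc t (t + h), dist s t < δ := fun s hs => by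
    rw [Real.dist_eq, abs_of_nonneg (by linarith [hs.1])]
    linarith [hs.2, hh.2]
  refine lt_of_le_of_lt (hS.n2_tdq_sub_le hh.1 ht (hb (h4 _ ⟨by linarith [hh.1], le_rfl⟩)).2
    (hS.continuous_dt_u ht) (hS.memLp_dt_u ht) (half_pos hε).le fun s hs => ?_) (half_lt_self hε)
  have h5 := (hb (h4 s hs)).1
  rw [Real.dist_0_eq_abs, abs_of_nonneg (n2_nonneg _)] at h5
  exact h5.le

omit hS in
lemma eventually_add_mem {t : ℝ} (ht : t ∈ openTimes T) :
    ∀ᶠ h in 𝓝[>] (0 : ℝ), 0 < h ∧ t + h ∈ openTimes T := by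
  refine (eventually_mem_nhdsWithin).and (Filter.Eventually.filter_mono nhdsWithin_le_nhds ?_)
  have : Tendsto (fun h : ℝ => t + h) (𝓝 0) (𝓝 t) := by
    exact Continuous.tendsto' (by fun_prop) 0 t (by simp)
  exact this.eventually ((isOpen_openTimes T).mem_nhds ht)

/-- Incompressibility of u_t in dual form. The field u_t has no classical space derivatives, so
orthogonality is inherited from the divergence-free difference quotients, which converge to it in
L². -/
lemma integral_gradient_dt_u {t : ℝ} (ht : t ∈ openTimes T) {p : R3 → ℝ} (hp : ContDiff ℝ 1 p)
    (hg : MemLp (gradient p) 2) : ∫ x, inner ℝ (gradient p x) (dt u t x) = 0 := by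
  have h1 : Tendsto (fun h => ∫ x, inner ℝ (gradient p x) (tdq u t h x)) (𝓝[>] 0)
      (𝓝 (∫ x, inner ℝ (gradient p x) (dt u t x))) := by
    refine tendsto_integral_inner (Eventually.of_forall fun _ => hg)
      ((eventually_add_mem ht).mono fun h hh => (hS.h2C2_tdq ht hh.2).h1.mem) hg
      (hS.memLp_dt_u ht) (by simp [n2]) (hS.tendsto_tdq ht)
  refine tendsto_nhds_unique h1 ((tendsto_const_nhds (x := (0 : ℝ))).congr' ?_)
  filter_upwards [eventually_add_mem ht] with h hh
  exact (integral_inner_gradient_eq_zero hp hg (hS.h2C2_tdq ht hh.2).h1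
    (hS.dvg_tdq ht hh.2)).symm

lemma tendsto_lap {t : ℝ} (ht : t ∈ openTimes T) :
    Tendsto (fun s => n2 fun x => lap (u s) x - lap (u t) x) (𝓝 t) (𝓝 0) :=
  tendsto_n2_finset_sum Finset.univ (f := fun i s => pd i (pd i (u s)))
    (F := fun i => pd i (pd i (u t)))
    (fun i => eventually_openTimes ht fun _ hs => (((hS.h2C2 hs).h1_pd i).mem_pd i).1)
    (fun i => (((hS.h2C2 ht).h1_pd i).mem_pd i).1) fun i => hS.tendsto_n2_pd_pd_u ht i i

lemma continuousOn_integral_dt_u_lap :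
    ContinuousOn (fun t => ∫ x, inner ℝ (dt u t x) (lap (u t) x)) (openTimes T) := fun _ ht =>
  (tendsto_integral_inner (eventually_openTimes ht fun _ hs => hS.memLp_dt_u hs)
    (eventually_openTimes ht fun _ hs => memLp_lap (hS.h2C2 hs)) (hS.memLp_dt_u ht)
    (memLp_lap (hS.h2C2 ht)) (hS.tendsto_dt_u ht) (hS.tendsto_lap ht)).mono_left nhdsWithin_le_nhds

/-- By `gr_sub_gr` the slope pairs the difference quotient with Δu(t + h) + Δu(t), and both factors
converge strongly in L². The quotients use h > 0, so only the right derivative is obtained; it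
suffices for the fundamental theorem of calculus. -/
lemma hasDerivWithinAt_gr {t : ℝ} (ht : t ∈ openTimes T) :
    HasDerivWithinAt (fun s => gr (u s)) (-2 * ∫ x, inner ℝ (dt u t x) (lap (u t) x)) (Ioi t) t := by
  have hadd := tendsto_const_add_nhds_zero t
  have hm : ∀ᶠ h in 𝓝[>] (0 : ℝ), MemLp (tdq u t h) 2 :=
    (eventually_add_mem ht).mono fun h hh => (hS.h2C2_tdq ht hh.2).h1.mem
  have h1 : Tendsto (fun h => ∫ x, inner ℝ (tdq u t h x) (lap (u (t + h)) x)) (𝓝[>] 0)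
      (𝓝 (∫ x, inner ℝ (dt u t x) (lap (u t) x))) :=
    tendsto_integral_inner hm
      ((eventually_add_mem ht).mono fun h hh => memLp_lap (hS.h2C2 hh.2)) (hS.memLp_dt_u ht)
      (memLp_lap (hS.h2C2 ht)) (hS.tendsto_tdq ht) ((hS.tendsto_lap ht).comp hadd)
  have h2 : Tendsto (fun h => ∫ x, inner ℝ (tdq u t h x) (lap (u t) x)) (𝓝[>] 0)
      (𝓝 (∫ x, inner ℝ (dt u t x) (lap (u t) x))) :=
    tendsto_integral_inner hm (Eventually.of_forall fun _ => memLp_lap (hS.h2C2 ht))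
      (hS.memLp_dt_u ht) (memLp_lap (hS.h2C2 ht)) (hS.tendsto_tdq ht) (by simp [n2])
  rw [hasDerivWithinAt_iff_tendsto_slope' (by simp)]
  have h3 : Tendsto (fun h => slope (fun s => gr (u s)) t (t + h)) (𝓝[>] 0)
      (𝓝 (-2 * ∫ x, inner ℝ (dt u t x) (lap (u t) x))) := by
    have h4 := (h1.add h2).neg
    rw [show ∀ y : ℝ, -(y + y) = -2 * y from fun y => by ring] at h4
    refine h4.congr' ?_
    filter_upwards [eventually_add_mem ht] with h hh
    rw [slope_def_field, gr_sub_gr (hS.h2C2 hh.2) (hS.h2C2 ht), add_sub_cancel_left,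
      ← integral_add (integrable_inner' (hS.h2C2_tdq ht hh.2).h1.mem (memLp_lap (hS.h2C2 hh.2)))
      (integrable_inner' (hS.h2C2_tdq ht hh.2).h1.mem (memLp_lap (hS.h2C2 ht))), neg_div,
      ← integral_div]
    congr 1
    refine integral_congr_ae (Eventually.of_forall fun x => ?_)
    simp only [tdq, real_inner_smul_left, inner_add_right]
    field_simp
  have h5 : Tendsto (fun s => s - t) (𝓝[>] t) (𝓝[>] 0) := by
    refine tendsto_nhdsWithin_iff.2 ⟨?_, ?_⟩
    · have : Tendsto (fun s => s - t) (𝓝 t) (𝓝 (t - t)) :=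
        (continuous_id.sub continuous_const).tendsto t
      rw [sub_self] at this
      exact this.mono_left nhdsWithin_le_nhds
    · filter_upwards [self_mem_nhdsWithin] with s hs
      exact sub_pos.2 (mem_Ioi.1 hs)
  refine (h3.comp h5).congr fun s => ?_
  simp

lemma gr_sub_eq_integral {a b : ℝ} (hab : a ≤ b) (ha : a ∈ openTimes T) (hb : b ∈ openTimes T) :
    IntervalIntegrable (fun t => -2 * ∫ x, inner ℝ (dt u t x) (lap (u t) x)) volume a b ∧
    gr (u b) - gr (u a) = ∫ t in a..b, -2 * ∫ x, inner ℝ (dt u t x) (lap (u t) x) := by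
  have hsub := Icc_subset_openTimes ha hb
  have hi : IntervalIntegrable (fun t => -2 * ∫ x, inner ℝ (dt u t x) (lap (u t) x)) volume a b := by
    refine ContinuousOn.intervalIntegrable ?_
    rw [uIcc_of_le hab]
    exact continuousOn_const.mul (hS.continuousOn_integral_dt_u_lap.mono hsub)
  refine ⟨hi, (intervalIntegral.integral_eq_sub_of_hasDeriv_right_of_le hab
    (hS.continuousOn_gr_u.mono hsub) (fun t ht => hS.hasDerivWithinAt_gr
      (hsub (Ioo_subset_Icc_self ht))) hi).symm⟩

end IsClassicalSolution

/-! ### Maximum principle for the total density -/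

lemma volume_slab {c d : ℝ} (h : c < d) : volume {x : R3 | c < x 2 ∧ x 2 < d} = ⊤ := by
  have h1 := (EuclideanSpace.volume_preserving_symm_measurableEquiv_toLp (Fin 3)).measure_preimage
    (s := Set.pi univ fun i : Fin 3 => if i = 2 then Ioo c d else univ)
    (MeasurableSet.univ_pi fun i => by split_ifs <;> measurability).nullMeasurableSet
  rw [volume_pi_pi, Fin.prod_univ_three] at h1
  have h2 : (MeasurableEquiv.toLp 2 (Fin 3 → ℝ)).symm ⁻¹'
      (Set.pi univ fun i : Fin 3 => if i = 2 then Ioo c d else univ)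
      = {x : R3 | c < x 2 ∧ x 2 < d} := by
    ext x
    simp [Set.mem_pi]
  rw [h2] at h1
  rw [h1]
  have h3 : ENNReal.ofReal (d - c) ≠ 0 := (ENNReal.ofReal_pos.2 (sub_pos.2 h)).ne'
  simp [ENNReal.top_mul, h3]

/-- If the bound failed at some height, it would fail by a fixed amount on a horizontal slab. There
ϱ₀ would be bounded away from zero, although the slab has infinite volume and ϱ₀ is square
integrable. The values σ = 1 and σ = -1 give the upper and lower bounds. -/
lemma le_of_perturbation {ρbar : ℝ → ℝ} (hc : Continuous ρbar) {ϱ₀ : R3 → ℝ}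
    (h2 : l2Sq ϱ₀ < ⊤) {σ β : ℝ} (h : ∀ x, σ * (ϱ₀ x + ρbar (x 2)) ≤ β) (z : ℝ) :
    σ * ρbar z ≤ β := by
  by_contra! hz
  obtain ⟨m, hm1, hm2⟩ := exists_between hz
  have hop : {y | m < σ * ρbar y} ∈ 𝓝 z :=
    (isOpen_lt continuous_const (continuous_const.mul hc)).mem_nhds hm2
  obtain ⟨c, d, hzcd, hcd⟩ := mem_nhds_iff_exists_Ioo_subset.1 hop
  have hlow : ∀ x ∈ {x : R3 | c < x 2 ∧ x 2 < d},
      ENNReal.ofReal ((m - β) ^ 2) ≤ ENNReal.ofReal (σ ^ 2) * ‖ϱ₀ x‖ₑ ^ 2 := fun x hx => by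
    have h3 : m < σ * ρbar (x 2) := hcd hx
    have h4 := h x
    rw [← ofReal_norm, ← ENNReal.ofReal_pow (norm_nonneg _), ← ENNReal.ofReal_mul (sq_nonneg _)]
    refine ENNReal.ofReal_le_ofReal ?_
    rw [Real.norm_eq_abs, sq_abs, ← mul_pow, ← neg_sq (σ * ϱ₀ x)]
    exact pow_le_pow_left₀ (by linarith) (by linarith) 2
  have h5 : ENNReal.ofReal ((m - β) ^ 2) * volume {x : R3 | c < x 2 ∧ x 2 < d}
      ≤ ENNReal.ofReal (σ ^ 2) * l2Sq ϱ₀ := by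
    have hms : MeasurableSet {x : R3 | c < x 2 ∧ x 2 < d} :=
      ((isOpen_lt continuous_const (contDiff_coord 2).continuous).inter
        (isOpen_lt (contDiff_coord 2).continuous continuous_const)).measurableSet
    rw [← setLIntegral_const, l2Sq, ← lintegral_const_mul' _ _ ENNReal.ofReal_ne_top]
    exact (setLIntegral_mono' hms hlow).trans (setLIntegral_le_lintegral _ _)
  rw [volume_slab (hzcd.1.trans hzcd.2), ENNReal.mul_top] at h5
  · exact (ENNReal.mul_lt_top ENNReal.ofReal_lt_top h2).not_ge h5
  · exact (ENNReal.ofReal_pos.2 (pow_pos (sub_pos.2 hm1) 2)).ne'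

lemma hasDerivAt_sq_posPart (s : ℝ) : HasDerivAt (fun r : ℝ => (max r 0) ^ 2) (2 * max s 0) s := by
  rw [hasDerivAt_iff_isLittleO]
  have h1 : (fun r : ℝ => max r 0 ^ 2 - max s 0 ^ 2 - (r - s) • (2 * max s 0)) =O[𝓝 s]
      fun r => (r - s) ^ 2 := by
    refine Asymptotics.IsBigO.of_bound 1 (Eventually.of_forall fun r => ?_)
    rw [one_mul, Real.norm_eq_abs, Real.norm_eq_abs, abs_of_nonneg (sq_nonneg (r - s)), abs_le,
      smul_eq_mul]
    rcases le_total r 0 with hr | hr <;> rcases le_total s 0 with hs | hs <;>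
      simp only [max_eq_left, max_eq_right, hr, hs] <;> constructor <;>
      nlinarith [sq_nonneg (r - s), sq_nonneg s, sq_nonneg r]
  refine h1.trans_isLittleO ?_
  have h2 : Tendsto (fun r : ℝ => r - s) (𝓝 s) (𝓝 0) :=
    Continuous.tendsto' (by fun_prop) s 0 (by simp)
  have := (Asymptotics.isLittleO_pow_id (𝕜 := ℝ) (n := 2) (by norm_num)).comp_tendsto h2
  exact this

lemma contDiff_sq_posPart : ContDiff ℝ 1 (fun r : ℝ => (max r 0) ^ 2) := by
  have h : deriv (fun r : ℝ => (max r 0) ^ 2) = fun s => 2 * max s 0 :=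
    funext fun s => (hasDerivAt_sq_posPart s).deriv
  rw [contDiff_one_iff_deriv, h]
  exact ⟨fun s => (hasDerivAt_sq_posPart s).differentiableAt, by fun_prop⟩

/-- A divergence-free transport term has zero mean. -/
lemma integral_transport_eq_zero {w : R3 → R3} {G : R3 → ℝ} (hw : H1C1 w)
    (hdiv : ∀ x, dvg w x = 0) (hG : ContDiff ℝ 1 G) (hG2 : MemLp G 2)
    (hi : ∀ i, Integrable fun x => w x i * pd i G x) : ∫ x, fderiv ℝ G x (w x) = 0 := by
  have h0 : ∀ i, ∫ x, w x i * pd i G x = - ∫ x, pd i w x i * G x := fun i => by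
    have hwi := hw.coord i
    have hfd : ∀ x, fderiv ℝ (fun x => w x i) x (e i) = pd i w x i := fun x => pd_coord hw.diff i i x
    have := integral_mul_fderiv_eq_neg_fderiv_mul_of_integrable (μ := (volume : Measure R3))
      (f := fun x => w x i) (g := G) (v := e i)
      (integrable_mul_l2 (hwi.mem_pd i).1 hG2) (hi i) (integrable_mul_l2 hwi.mem hG2)
      (fun x _ => hwi.diff x) (fun x _ => hG.differentiable (by norm_num) x)
    simpa only [hfd, pd_eq] using this
  have hmem : ∀ i, MemLp (fun x => pd i w x i) 2 := fun i => by
    have := ((hw.coord i).mem_pd i).1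
    have h2 : pd i (fun x => w x i) = fun x => pd i w x i := funext (pd_coord hw.diff i i)
    rwa [h2] at this
  calc ∫ x, fderiv ℝ G x (w x) = ∫ x, ∑ i, w x i * pd i G x := by
        simp only [fderiv_apply_eq_sum G _ (w _), smul_eq_mul]
    _ = ∑ i, ∫ x, w x i * pd i G x := integral_finsetSum _ fun i _ => hi i
    _ = - ∑ i, ∫ x, pd i w x i * G x := by simp only [h0, Finset.sum_neg_distrib]
    _ = - ∫ x, dvg w x * G x := by
        rw [← integral_finsetSum _ fun i _ => integrable_mul_l2 (hmem i) hG2]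
        simp only [dvg, Finset.sum_mul]
    _ = 0 := by simp [hdiv]

lemma IsProfile.exists_bound {ρbar : ℝ → ℝ} (h : IsProfile ρbar) :
    ∃ L : ℝ, 0 ≤ L ∧ ∀ z, |deriv ρbar z| ≤ L := by
  obtain ⟨L, hL⟩ := h.compact.exists_bound_of_continuous (h.smooth.continuous_deriv (by simp))
  exact ⟨L, (norm_nonneg _).trans (hL 0), hL⟩

lemma IsProfile.contDiff {ρbar : ℝ → ℝ} (h : IsProfile ρbar) :
    ContDiff ℝ 1 fun x : R3 => ρbar (x 2) :=
  (h.smooth.of_le (by simp)).comp ((contDiff_coord 2).of_le (by simp))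

lemma IsProfile.fderiv_apply {ρbar : ℝ → ℝ} (h : IsProfile ρbar) (x v : R3) :
    fderiv ℝ (fun x : R3 => ρbar (x 2)) x v = deriv ρbar (x 2) * v 2 := by
  have h1 := (h.smooth.differentiable (by simp) (x 2)).hasDerivAt.comp_hasFDerivAt x
    (EuclideanSpace.proj (𝕜 := ℝ) (2 : Fin 3)).hasFDerivAt
  have h2 := h1.fderiv
  rw [show (fun x : R3 => ρbar (x 2)) = ρbar ∘ EuclideanSpace.proj (𝕜 := ℝ) (2 : Fin 3) from rfl, h2]
  simp

namespace IsClassicalSolution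

variable {μ g : ℝ} {ρbar : ℝ → ℝ} {T : EReal} {ϱ₀ : R3 → ℝ} {u₀ : R3 → R3} {ϱ : ℝ → R3 → ℝ}
  {u : ℝ → R3 → R3} {q : ℝ → R3 → ℝ} (hS : IsClassicalSolution μ g ρbar T ϱ₀ u₀ ϱ u q)
include hS

lemma dt_ϱ_eq (hρ : IsProfile ρbar) {t : ℝ} (ht : t ∈ openTimes T) (x : R3) :
    dt ϱ t x = -(fderiv ℝ (ϱ t) x (u t x) + deriv ρbar (x 2) * u t x 2) := by
  have h := hS.mass t ht x
  rw [show (fun y => ϱ t y + ρbar (y 2)) = ϱ t + fun y : R3 => ρbar (y 2) from rfl, fderiv_add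
    ((hS.h1C1 ht).diff x) (hρ.contDiff.differentiable (by norm_num) x), add_apply,
    hρ.fderiv_apply] at h
  linarith

/-- Uniform bounds on compact time intervals. -/
lemma exists_bound {a b : ℝ} (ha : a ∈ openTimes T) (hb : b ∈ openTimes T) :
    ∃ K : ℝ, 0 ≤ K ∧ ∀ t ∈ Icc a b, n2 (ϱ t) ≤ K ∧ n2 (fderiv ℝ (ϱ t)) ≤ K ∧ n2 (u t) ≤ K ∧
      n2 (dt u t) ≤ K ∧ n2 (fderiv ℝ (u t)) ≤ K ∧ gr (u t) ≤ K ∧ hs (u t) ≤ K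
      ∧ ∀ x, ‖u t x‖ ≤ K := by
  obtain ⟨C, hC, hsup⟩ := exists_sup_le
  have hsub := Icc_subset_openTimes ha hb
  have hc : ContinuousOn (fun t => n2 (ϱ t) + √(gr (ϱ t)) + n2 (u t) + n2 (dt u t) + √(gr (u t))
      + gr (u t) + hs (u t) + C * √(gr (u t) + hs (u t))) (Icc a b) := by
    refine ContinuousOn.mono ?_ hsub
    have h1 := hS.continuousOn_n2_ϱ
    have h2 := hS.continuousOn_gr_ϱ
    have h3 := hS.continuousOn_n2_u
    have h4 := hS.continuousOn_n2_dt_u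
    have h5 := hS.continuousOn_gr_u
    have h6 := hS.continuousOn_hs_u
    exact ((((((h1.add h2.sqrt).add h3).add h4).add h5.sqrt).add h5).add h6).add
      (continuousOn_const.mul (h5.add h6).sqrt)
  obtain ⟨K, hK⟩ := isCompact_Icc.exists_bound_of_continuousOn hc
  refine ⟨|K|, abs_nonneg _, fun t ht => ?_⟩
  have h := (le_abs_self _).trans ((hK t ht).trans (le_abs_self K))
  have n1 := n2_nonneg (ϱ t)
  have n2' := Real.sqrt_nonneg (gr (ϱ t))
  have n3 := n2_nonneg (u t)
  have n4 := n2_nonneg (dt u t)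
  have n5 := Real.sqrt_nonneg (gr (u t))
  have n6 := gr_nonneg (u t)
  have n7 := hs_nonneg (u t)
  have n8 : 0 ≤ C * √(gr (u t) + hs (u t)) := by positivity
  have m1 := Real.le_sqrt_of_sq_le (hS.h1C1 (hsub ht)).n2_fderiv_sq_le_gr
  have m2 := Real.le_sqrt_of_sq_le (hS.h2C2 (hsub ht)).h1.n2_fderiv_sq_le_gr
  refine ⟨by linarith, by linarith, by linarith, by linarith, by linarith, by linarith,
    by linarith, fun x => (hsup _ (hS.h2C2 (hsub ht)) x).trans (by linarith)⟩

lemma memLp_dt_ϱ (hρ : IsProfile ρbar) {L : ℝ} (hL : ∀ z, |deriv ρbar z| ≤ L) {t K : ℝ}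
    (ht : t ∈ openTimes T) (hK : ∀ x, ‖u t x‖ ≤ K) :
    MemLp (dt ϱ t) 2 ∧ n2 (dt ϱ t) ≤ K * n2 (fderiv ℝ (ϱ t)) + L * n2 (u t) := by
  have hK0 : 0 ≤ K := (norm_nonneg _).trans (hK 0)
  have hL0 : 0 ≤ L := (abs_nonneg _).trans (hL 0)
  have hu := hS.h2C2 ht
  have hr := hS.h1C1 ht
  have h1 := memLp_n2_of_le (f := fun x => fderiv ℝ (ϱ t) x (u t x)) (g := fderiv ℝ (ϱ t)) hK0
    hr.memD ((hr.c1.continuous_fderiv (by norm_num)).clm_apply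
      hu.c2.continuous).aestronglyMeasurable fun x => by
      rw [mul_comm]
      exact (ContinuousLinearMap.le_opNorm _ _).trans
        (mul_le_mul_of_nonneg_left (hK x) (norm_nonneg _))
  have h2 := memLp_n2_of_le (f := fun x => deriv ρbar (x 2) * u t x 2) (g := u t) hL0 hu.h1.mem
    (((hρ.smooth.continuous_deriv (by simp)).comp (contDiff_coord 2).continuous).mul
      ((contDiff_coord 2).continuous.comp hu.c2.continuous)).aestronglyMeasurable fun x => by
      rw [norm_mul]
      exact mul_le_mul (hL _) (PiLp.norm_apply_le _ _) (norm_nonneg _) hL0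
  have h3 : dt ϱ t = fun x => -(fderiv ℝ (ϱ t) x (u t x) + deriv ρbar (x 2) * u t x 2) :=
    funext (hS.dt_ϱ_eq hρ ht)
  rw [h3, n2_neg]
  exact ⟨(memLp_fun_add h1.1 h2.1).neg, (n2_add_le h1.1 h2.1).trans (add_le_add h1.2 h2.2)⟩

lemma continuous_dt_ϱ {t : ℝ} (ht : t ∈ openTimes T) : Continuous (dt ϱ t) :=
  continuous_slice_of_continuousOn (continuousOn_dt (isOpen_openTimes T) hS.ϱ_C1) ht

end IsClassicalSolution

lemma memLp_mul_self {f : R3 → ℝ} (hf : MemLp f 2) (h6 : MemLp f 6) :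
    MemLp (fun x => f x ^ 2) 2 :=
  (memLp_n2_mul zero_le_one h6 hf h6 (hf.1.pow 2) fun x => by
    rw [one_mul, Pi.pow_apply, norm_pow, sq]).1

namespace IsClassicalSolution

variable {μ g : ℝ} {ρbar : ℝ → ℝ} {T : EReal} {ϱ₀ : R3 → ℝ} {u₀ : R3 → R3} {ϱ : ℝ → R3 → ℝ}
  {u : ℝ → R3 → R3} {q : ℝ → R3 → ℝ} (hS : IsClassicalSolution μ g ρbar T ϱ₀ u₀ ϱ u q)
include hS

lemma fderiv_density (hρ : IsProfile ρbar) {t : ℝ} (ht : t ∈ openTimes T) (x v : R3) :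
    fderiv ℝ (fun y => ϱ t y + ρbar (y 2)) x v = fderiv ℝ (ϱ t) x v + deriv ρbar (x 2) * v 2 := by
  rw [show (fun y => ϱ t y + ρbar (y 2)) = ϱ t + fun y : R3 => ρbar (y 2) from rfl, fderiv_add
    ((hS.h1C1 ht).diff x) (hρ.contDiff.differentiable (by norm_num) x), add_apply,
    hρ.fderiv_apply]

/-- The integrand is minus the transport derivative of the C¹ function (σ(ϱ + ρ̄) - c)₊², which has
zero mean since div u = 0. The hypothesis on ρ̄ makes the positive part at most |σϱ|, hence square
integrable. -/
lemma integral_posPart_deriv (hρ : IsProfile ρbar) {σ c : ℝ} (hc : ∀ z, σ * ρbar z ≤ c) {t : ℝ}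
    (ht : t ∈ openTimes T) :
    ∫ x, 2 * max (σ * (ϱ t x + ρbar (x 2)) - c) 0 * (σ * dt ϱ t x) = 0 := by
  obtain ⟨K, hK0, hK⟩ := hS.exists_bound ht ht
  obtain ⟨-, -, -, -, -, -, -, hu⟩ := hK t ⟨le_rfl, le_rfl⟩
  obtain ⟨L, hL0, hL⟩ := hρ.exists_bound
  have hr := hS.h1C1 ht
  have hU := hS.h2C2 ht
  have hcr : ContDiff ℝ 1 fun x : R3 => σ * (ϱ t x + ρbar (x 2)) - c :=
    (contDiff_const.mul (hr.c1.add hρ.contDiff)).sub contDiff_const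
  have hle : ∀ x, ‖max (σ * (ϱ t x + ρbar (x 2)) - c) 0‖ ≤ |σ| * ‖ϱ t x‖ := fun x => by
    rw [Real.norm_of_nonneg (le_max_right _ _), Real.norm_eq_abs, ← abs_mul]
    refine max_le ?_ (abs_nonneg _)
    have h1 := hc (x 2)
    have h2 := le_abs_self (σ * ϱ t x)
    linarith
  have hηc : Continuous fun x => max (σ * (ϱ t x + ρbar (x 2)) - c) 0 :=
    hcr.continuous.max continuous_const
  have hη2 : MemLp (fun x => max (σ * (ϱ t x + ρbar (x 2)) - c) 0) 2 :=
    (memLp_n2_of_le (abs_nonneg σ) hr.mem hηc.aestronglyMeasurable hle).1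
  have hη6 : MemLp (fun x => max (σ * (ϱ t x + ρbar (x 2)) - c) 0) 6 :=
    hr.sobolev.1.of_le_mul hηc.aestronglyMeasurable (Eventually.of_forall hle)
  let G : R3 → ℝ := fun x => (max (σ * (ϱ t x + ρbar (x 2)) - c) 0) ^ 2
  have hGc : ContDiff ℝ 1 G := contDiff_sq_posPart.comp hcr
  have hfd : ∀ x v, fderiv ℝ G x v = 2 * max (σ * (ϱ t x + ρbar (x 2)) - c) 0
      * (σ * (fderiv ℝ (ϱ t) x v + deriv ρbar (x 2) * v 2)) := fun x v => by
    have hd : HasFDerivAt (fun y => ϱ t y + ρbar (y 2))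
        (fderiv ℝ (fun y => ϱ t y + ρbar (y 2)) x) x :=
      ((hr.c1.add hρ.contDiff).differentiable (by norm_num) x).hasFDerivAt
    have h1 := (hasDerivAt_sq_posPart (σ * (ϱ t x + ρbar (x 2)) - c)).comp_hasFDerivAt x
      ((hd.const_mul σ).sub_const c)
    have h2 := h1.fderiv
    rw [show G = (fun r : ℝ => (max r 0) ^ 2) ∘ fun y : R3 => σ * (ϱ t y + ρbar (y 2)) - c from rfl,
      h2]
    simp only [smul_apply, smul_eq_mul, hS.fderiv_density hρ ht]
  have h0 := integral_transport_eq_zero hU.h1 (hS.dvg_eq_zero ht) hGc (memLp_mul_self hη2 hη6)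
    fun i => by
      refine integrable_of_le_mul (f := fun x => max (σ * (ϱ t x + ρbar (x 2)) - c) 0)
        (g := fun x => K * ‖fderiv ℝ (ϱ t) x‖ + L * ‖u t x‖) (2 * |σ|) ?_ hη2
        (memLp_fun_add (hr.memD.norm.const_mul K) (hU.h1.mem.norm.const_mul L)) fun x => ?_
      · exact (((contDiff_coord i).continuous.comp hU.c2.continuous).mul
          (continuous_pd hGc i)).aestronglyMeasurable
      · rw [pd_eq, hfd, norm_mul, norm_mul, norm_mul, norm_mul, Real.norm_ofNat, Real.norm_eq_abs σ,
          Real.norm_of_nonneg (show 0 ≤ K * ‖fderiv ℝ (ϱ t) x‖ + L * ‖u t x‖ by positivity)]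
        have h1 : ‖fderiv ℝ (ϱ t) x (e i)‖ ≤ ‖fderiv ℝ (ϱ t) x‖ := norm_pd_le i _ x
        have h2 : ‖deriv ρbar (x 2) * e i 2‖ ≤ L := by
          rw [norm_mul]
          refine (mul_le_mul (hL _) ((PiLp.norm_apply_le _ _).trans (norm_e i).le) (norm_nonneg _)
            hL0).trans (mul_one L).le
        have h3 : ‖u t x i‖ ≤ ‖u t x‖ := PiLp.norm_apply_le _ _
        have h4 : ‖u t x i‖ * ‖fderiv ℝ (ϱ t) x (e i) + deriv ρbar (x 2) * e i 2‖
            ≤ K * ‖fderiv ℝ (ϱ t) x‖ + L * ‖u t x‖ := by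
          calc _ ≤ ‖u t x‖ * (‖fderiv ℝ (ϱ t) x‖ + L) :=
                mul_le_mul h3 ((norm_add_le _ _).trans (add_le_add h1 h2)) (norm_nonneg _)
                  (norm_nonneg _)
            _ ≤ _ := by
              have := mul_le_mul_of_nonneg_right (hu x) (norm_nonneg (fderiv ℝ (ϱ t) x))
              linarith
        have h5 : 0 ≤ |σ| * ‖max (σ * (ϱ t x + ρbar (x 2)) - c) 0‖ := by positivity
        have h6 := mul_le_mul_of_nonneg_left h4 h5
        linarith
  have h1 : ∫ x, 2 * max (σ * (ϱ t x + ρbar (x 2)) - c) 0 * (σ * dt ϱ t x)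
      = - ∫ x, fderiv ℝ G x (u t x) := by
    rw [← integral_neg]
    refine integral_congr_ae (Eventually.of_forall fun x => ?_)
    simp only [hfd, hS.dt_ϱ_eq hρ ht]
    ring
  rw [h1, h0, neg_zero]

/-- The L² norm of the excess (σ(ϱ + ρ̄) - c)₊ is constant for positive times and tends to zero as t
→ 0, because the excess is at most |σ||ϱ(t) - ϱ₀|. Continuity turns the resulting almost-everywhere
bound into a bound at every point. -/
lemma density_le (hρ : IsProfile ρbar) {σ c : ℝ} (hc : ∀ z, σ * ρbar z ≤ c)
    (h0 : ∀ x, σ * (ϱ₀ x + ρbar (x 2)) ≤ c) {b : ℝ} (hb : b ∈ openTimes T) (x : R3) :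
    σ * (ϱ b x + ρbar (x 2)) ≤ c := by
  obtain ⟨L, hL0, hL⟩ := hρ.exists_bound
  let η : ℝ → R3 → ℝ := fun t x => max (σ * (ϱ t x + ρbar (x 2)) - c) 0
  have hle : ∀ t x, ‖η t x‖ ≤ |σ| * ‖ϱ t x‖ := fun t x => by
    simp only [η]
    rw [Real.norm_of_nonneg (le_max_right _ _), Real.norm_eq_abs, ← abs_mul]
    refine max_le ?_ (abs_nonneg _)
    have h1 := hc (x 2)
    have h2 := le_abs_self (σ * ϱ t x)
    linarith
  have hηc : ∀ t ∈ openTimes T, Continuous (η t) := fun t ht =>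
    ((continuous_const.mul ((hS.h1C1 ht).c1.continuous.add hρ.contDiff.continuous)).sub
      continuous_const).max continuous_const
  have hη2 : ∀ t ∈ openTimes T, MemLp (η t) 2 := fun t ht =>
    (memLp_n2_of_le (abs_nonneg σ) (hS.h1C1 ht).mem (hηc t ht).aestronglyMeasurable (hle t)).1
  have hconst : ∀ a ∈ openTimes T, a ≤ b → n2 (η b) = n2 (η a) := fun a ha hab => by
    have hsub := Icc_subset_openTimes ha hb
    obtain ⟨K, hK0, hK⟩ := hS.exists_bound ha hb
    have hϱt : ∀ t ∈ Icc a b, MemLp (dt ϱ t) 2 ∧ n2 (dt ϱ t) ≤ K * K + L * K := fun t ht => by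
      obtain ⟨-, k2, k3, -, -, -, -, hu⟩ := hK t ht
      obtain ⟨m1, m2⟩ := hS.memLp_dt_ϱ hρ hL (hsub ht) hu
      exact ⟨m1, m2.trans (add_le_add (mul_le_mul_of_nonneg_left k2 hK0)
        (mul_le_mul_of_nonneg_left k3 hL0))⟩
    have hpt : ∀ t ∈ Icc a b, ∀ x, |2 * η t x * (σ * dt ϱ t x)| ≤
        2 * |σ| ^ 2 * (‖ϱ t x‖ * ‖dt ϱ t x‖) := fun t _ x => by
      rw [abs_mul, abs_mul, abs_mul, abs_two]
      have h1 := mul_le_mul_of_nonneg_right (hle t x) (by positivity : 0 ≤ |σ| * |dt ϱ t x|)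
      simp only [Real.norm_eq_abs] at h1 ⊢
      nlinarith
    have hϱtc : ContinuousOn (fun p : ℝ × R3 => dt ϱ p.1 p.2) (Icc a b ×ˢ univ) :=
      (continuousOn_dt (isOpen_openTimes T) hS.ϱ_C1).mono (prod_mono hsub subset_rfl)
    have hηcj : ContinuousOn (fun p : ℝ × R3 => η p.1 p.2) (Icc a b ×ˢ univ) := by
      have h1 : ContinuousOn (fun p : ℝ × R3 => ϱ p.1 p.2) (Icc a b ×ˢ univ) :=
        hS.ϱ_C1.continuousOn.mono (prod_mono hsub subset_rfl)
      have h2 : Continuous fun p : ℝ × R3 => ρbar (p.2 2) :=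
        hρ.contDiff.continuous.comp continuous_snd
      exact ((continuousOn_const.mul (h1.add h2.continuousOn)).sub continuousOn_const).sup
        continuousOn_const
    have h := (integral_sub_eq_integral_deriv (F := fun t x => η t x ^ 2)
      (F' := fun t x => 2 * η t x * (σ * dt ϱ t x)) (B := 2 * |σ| ^ 2 * (K * (K * K + L * K))) hab
      (fun t ht => (hη2 t (hsub ht)).integrable_sq) (fun t ht x => by
        have h1 := (hasDerivAt_sq_posPart (σ * (ϱ t x + ρbar (x 2)) - c)).comp t
          ((((hS.hasDerivAt_ϱ (hsub ht) x).add_const (ρbar (x 2))).const_mul σ).sub_const c)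
        exact h1) ((continuousOn_const.mul hηcj).mul (continuousOn_const.mul hϱtc))
      (fun t ht => integrable_of_le_mul (2 * |σ| ^ 2)
        ((continuous_const.mul (hηc t (hsub ht))).mul (continuous_const.mul
          (hS.continuous_dt_ϱ (hsub ht)))).aestronglyMeasurable (hS.h1C1 (hsub ht)).mem
          (hϱt t ht).1 fun x => hpt t ht x) (fun t ht => ?_)).2
    · have h1 : ∀ t ∈ Icc a b, ∫ x, 2 * η t x * (σ * dt ϱ t x) = 0 := fun t ht =>
        hS.integral_posPart_deriv hρ hc (hsub ht)
      rw [intervalIntegral.integral_congr (g := fun _ => (0 : ℝ)) (fun t ht => h1 t (by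
        rwa [uIcc_of_le hab] at ht)), intervalIntegral.integral_zero, sub_eq_zero] at h
      have h2 := n2_sq (hη2 b hb)
      have h3 := n2_sq (hη2 a ha)
      simp only [Real.norm_eq_abs, sq_abs] at h2 h3
      rw [h, ← h3] at h2
      exact (pow_left_inj₀ (n2_nonneg _) (n2_nonneg _) two_ne_zero).1 h2
    · obtain ⟨k1, -⟩ := hK t ht
      have h2 := abs_integral_le_n2_mul (k := fun x => |2 * η t x * (σ * dt ϱ t x)|)
        (C := 2 * |σ| ^ 2) (by positivity) (hS.h1C1 (hsub ht)).mem (hϱt t ht).1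
        fun x => by rw [abs_abs]; exact hpt t ht x
      refine (le_abs_self _).trans (h2.trans (mul_le_mul_of_nonneg_left ?_ (by positivity)))
      exact mul_le_mul k1 (hϱt t ht).2 (n2_nonneg _) hK0
  have h00 : (0 : ℝ) ∈ closedTimes T := ⟨le_rfl, by exact_mod_cast hS.T_pos⟩
  have hlim : Tendsto (fun t => l2Sq fun x => ϱ t x - ϱ₀ x) (𝓝[>] 0) (𝓝 0) := by
    have h1 := (hS.ϱ_H1 0 h00).2
    rw [hS.ϱ_init] at h1
    have h2 : Tendsto (fun t => l2Sq fun x => ϱ t x - ϱ₀ x) (𝓝[closedTimes T] 0) (𝓝 0) :=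
      tendsto_of_tendsto_of_tendsto_of_le_of_le tendsto_const_nhds h1 (fun _ => zero_le)
        fun _ => le_self_add
    refine h2.mono_left (le_inf nhdsWithin_le_nhds ?_)
    rw [le_principal_iff]
    filter_upwards [Ioo_mem_nhdsGT hb.1] with t ht
    exact ⟨ht.1.le, lt_trans (EReal.coe_lt_coe_iff.2 ht.2) hb.2⟩
  have hle' : ∀ t x, ‖η t x‖ ≤ |σ| * ‖ϱ t x - ϱ₀ x‖ := fun t x => by
    simp only [η]
    rw [Real.norm_of_nonneg (le_max_right _ _), Real.norm_eq_abs, ← abs_mul]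
    refine max_le ?_ (abs_nonneg _)
    have h1 := h0 x
    have h2 := le_abs_self (σ * (ϱ t x - ϱ₀ x))
    linarith
  have hzero : n2 (η b) ^ 2 = 0 := by
    have h1 : ∀ᶠ t in 𝓝[>] (0 : ℝ), ENNReal.ofReal (n2 (η b) ^ 2)
        ≤ ENNReal.ofReal (|σ| ^ 2) * l2Sq fun x => ϱ t x - ϱ₀ x := by
      filter_upwards [Ioo_mem_nhdsGT hb.1] with t ht
      have htT : t ∈ openTimes T := ⟨ht.1, lt_trans (EReal.coe_lt_coe_iff.2 ht.2) hb.2⟩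
      rw [hconst t htT ht.2.le, ← l2Sq_eq_ofReal (hη2 t htT), l2Sq, l2Sq,
        ← lintegral_const_mul' _ _ ENNReal.ofReal_ne_top]
      refine lintegral_mono fun x => ?_
      rw [← ofReal_norm, ← ofReal_norm, ← ENNReal.ofReal_pow (norm_nonneg _),
        ← ENNReal.ofReal_pow (norm_nonneg _), ← ENNReal.ofReal_mul (by positivity), ← mul_pow]
      exact ENNReal.ofReal_le_ofReal (pow_le_pow_left₀ (norm_nonneg _) (hle' t x) 2)
    have h2 : Tendsto (fun t => ENNReal.ofReal (|σ| ^ 2) * l2Sq fun x => ϱ t x - ϱ₀ x)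
        (𝓝[>] 0) (𝓝 0) := by
      have := ENNReal.Tendsto.const_mul hlim (Or.inr (ENNReal.ofReal_ne_top (r := |σ| ^ 2)))
      rwa [mul_zero] at this
    have h3 := ge_of_tendsto h2 h1
    exact le_antisymm (ENNReal.ofReal_eq_zero.1 (le_antisymm h3 zero_le)) (sq_nonneg _)
  have h1 : eLpNorm (η b) 2 volume = 0 := by
    rw [← ofReal_n2 (hη2 b hb), pow_eq_zero_iff two_ne_zero |>.1 hzero, ENNReal.ofReal_zero]
  rw [eLpNorm_eq_zero_iff (hη2 b hb).1 (by norm_num)] at h1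
  have h2 := (Continuous.ae_eq_iff_eq volume (hηc b hb) continuous_zero).1 h1
  have h3 := congrFun h2 x
  simp only [η, Pi.zero_apply] at h3
  have h4 := le_max_left (σ * (ϱ b x + ρbar (x 2)) - c) 0
  rw [h3] at h4
  linarith

end IsClassicalSolution

/-! ### The convective term and the equations at a fixed time -/

/-- The convective term `(u · ∇) u`. -/
noncomputable def conv (u : R3 → R3) : R3 → R3 := fun x => fderiv ℝ u x (u x)

lemma continuous_conv {u : R3 → R3} (hu : ContDiff ℝ 1 u) : Continuous (conv u) :=
  (hu.continuous_fderiv (by norm_num)).clm_apply hu.continuous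

lemma H2C2.sobolev_fderiv {u : R3 → R3} (hu : H2C2 u) :
    MemLp (fderiv ℝ u) 6 ∧ n6 (fderiv ℝ u) ≤ sobC (R3 →L[ℝ] R3) * √(hs u) := by
  obtain ⟨h1, h2⟩ := hu.h1D.sobolev
  exact ⟨h1, h2.trans (mul_le_mul_of_nonneg_left (Real.le_sqrt_of_sq_le hu.n2_fderiv2_sq_le_hs)
    sobC_nonneg)⟩

lemma H2C2.n2_fderiv_le {u : R3 → R3} (hu : H2C2 u) : n2 (fderiv ℝ u) ≤ √(gr u) :=
  Real.le_sqrt_of_sq_le hu.h1.n2_fderiv_sq_le_gr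

/-- The product estimate gives ‖u‖₆² ‖∇u‖₂ ‖∇u‖₆, hence a multiple of ‖∇u‖³ ‖∇²u‖ by Sobolev, and
Young's inequality separates the factors. The free ε allows absorption into the elliptic estimate.
-/
lemma exists_conv_bound : ∃ C : ℝ, 0 < C ∧ ∀ u : R3 → R3, H2C2 u →
    MemLp (conv u) 2 ∧ ∀ ε, 0 < ε → n2 (conv u) ^ 2 ≤ ε * hs u + C / ε * gr u ^ 3 := by
  obtain ⟨S, hS, hSob⟩ := exists_sobolev_const
  obtain ⟨S', hS', hSob'⟩ : ∃ S' : ℝ, 0 ≤ S' ∧ ∀ u : R3 → R3, H2C2 u →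
      MemLp (fderiv ℝ u) 6 ∧ n6 (fderiv ℝ u) ≤ S' * √(hs u) :=
    ⟨_, sobC_nonneg, fun u hu => hu.sobolev_fderiv⟩
  refine ⟨(S ^ 2 * S') ^ 2 + 1, by positivity, fun u hu => ?_⟩
  obtain ⟨h1, h2⟩ := hSob u hu.h1
  obtain ⟨h3, h4⟩ := hSob' u hu
  obtain ⟨h5, h6⟩ := memLp_n2_mul (h := conv u) zero_le_one h1 hu.h1.memD h3
    (continuous_conv hu.h1.c1).aestronglyMeasurable fun x => by
      rw [one_mul, mul_comm]
      exact ContinuousLinearMap.le_opNorm _ _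
  refine ⟨h5, fun ε hε => ?_⟩
  have hG := gr_nonneg u
  have hH := hs_nonneg u
  have h7 : n2 (conv u) ^ 2 ≤ (S * √(gr u)) ^ 2 * (√(gr u) * (S' * √(hs u))) := by
    refine h6.trans ?_
    rw [one_pow, one_mul]
    have := hu.n2_fderiv_le
    have := n2_nonneg (fderiv ℝ u)
    have := n6_nonneg (fderiv ℝ u)
    have := n6_nonneg u
    gcongr
  rw [mul_pow, Real.sq_sqrt hG] at h7
  obtain ⟨a, ha0, ha⟩ : ∃ a, 0 ≤ a ∧ a ^ 2 = gr u := ⟨_, Real.sqrt_nonneg _, Real.sq_sqrt hG⟩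
  obtain ⟨b, hb0, hb⟩ : ∃ b, 0 ≤ b ∧ b ^ 2 = hs u := ⟨_, Real.sqrt_nonneg _, Real.sq_sqrt hH⟩
  rw [← ha, ← hb, Real.sqrt_sq ha0, Real.sqrt_sq hb0] at h7
  rw [← ha, ← hb]
  refine h7.trans ?_
  have h8 : 0 ≤ (ε * b - S ^ 2 * S' * a ^ 3) ^ 2 + (S ^ 2 * S' * a ^ 3) ^ 2 + 2 * (a ^ 3) ^ 2
      + (ε * b) ^ 2 := by positivity
  rw [div_mul_eq_mul_div, ← sub_nonneg]
  have h9 : ε * b ^ 2 + ((S ^ 2 * S') ^ 2 + 1) * (a ^ 2) ^ 3 / ε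
      - S ^ 2 * a ^ 2 * (a * (S' * b)) = ((ε * b - S ^ 2 * S' * a ^ 3) ^ 2
        + (S ^ 2 * S' * a ^ 3) ^ 2 + 2 * (a ^ 3) ^ 2 + (ε * b) ^ 2) / (2 * ε) := by
    field_simp
    ring
  rw [h9]
  positivity

lemma n2_add_sq_le {f h : R3 → R3} (hf : MemLp f 2) (hh : MemLp h 2) :
    n2 (fun x => f x + h x) ^ 2 ≤ 2 * n2 f ^ 2 + 2 * n2 h ^ 2 := by
  have h1 := pow_le_pow_left₀ (n2_nonneg _) (n2_add_le hf hh) 2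
  linarith [sq_nonneg (n2 f - n2 h)]

lemma n2_lap_sq_le {u : R3 → R3} (hu : H2C2 u) : n2 (lap u) ^ 2 ≤ 3 * hs u := by
  have hm : ∀ i, MemLp (pd i (pd i u)) 2 := fun i => ((hu.h1_pd i).mem_pd i).1
  have h1 : n2 (lap u) ≤ ∑ i, n2 (pd i (pd i u)) := by
    have := n2_add_le (memLp_fun_add (hm 0) (hm 1)) (hm 2)
    have h2 := n2_add_le (hm 0) (hm 1)
    have h3 : lap u = fun x => pd 0 (pd 0 u) x + pd 1 (pd 1 u) x + pd 2 (pd 2 u) x :=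
      funext fun x => by simp only [lap, Fin.sum_univ_three]
    rw [h3, Fin.sum_univ_three]
    linarith
  have h2 := pow_le_pow_left₀ (n2_nonneg _) h1 2
  refine h2.trans ((sq_sum_le_card_mul_sum_sq).trans ?_)
  simp only [Finset.card_univ, Fintype.card_fin, Nat.cast_ofNat]
  refine mul_le_mul_of_nonneg_left (Finset.sum_le_sum fun i _ => ?_) (by norm_num)
  exact n2_pd_sq_le_gr (pd i u) i

/-- The state of the flow at a fixed positive time: density perturbation, velocity, acceleration
`v = u_t` and pressure. -/
structure Slice (μ g α β : ℝ) (ρbar : ℝ → ℝ) (ϱ : R3 → ℝ) (u v : R3 → R3) (q : R3 → ℝ) :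
    Prop where
  profile : IsProfile ρbar
  ϱ_H1 : H1C1 ϱ
  u_H2 : H2C2 u
  v_cont : Continuous v
  v_mem : MemLp v 2
  q_C1 : ContDiff ℝ 1 q
  div_free : ∀ x, dvg u x = 0
  lower : ∀ x, α ≤ ϱ x + ρbar (x 2)
  upper : ∀ x, ϱ x + ρbar (x 2) ≤ β
  abs_le : ∀ x, |ϱ x| ≤ β
  -- Incompressibility of v, stated by duality because v need not be differentiable in space.
  orth : ∀ p : R3 → ℝ, ContDiff ℝ 1 p → MemLp (gradient p) 2 →
    ∫ x, inner ℝ (gradient p x) (v x) = 0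
  momentum : ∀ x, μ • ∑ i, pd i (pd i u) x = gradient q x
    + ((ϱ x + ρbar (x 2)) • (v x + conv u x) + (g * ϱ x) • e 2)

/-- The total force in the Stokes system satisfied by a slice. -/
noncomputable def force (g : ℝ) (ρbar : ℝ → ℝ) (ϱ : R3 → ℝ) (u v : R3 → R3) : R3 → R3 := fun x =>
  (ϱ x + ρbar (x 2)) • (v x + conv u x) + (g * ϱ x) • e 2

namespace Slice

variable {μ g α β : ℝ} {ρbar : ℝ → ℝ} {ϱ : R3 → ℝ} {u v : R3 → R3} {q : R3 → ℝ}

lemma density_continuous (h : Slice μ g α β ρbar ϱ u v q) :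
    Continuous fun x => ϱ x + ρbar (x 2) :=
  h.ϱ_H1.c1.continuous.add h.profile.contDiff.continuous

lemma norm_density_le (h : Slice μ g α β ρbar ϱ u v q) (hα : 0 < α) (x : R3) :
    ‖ϱ x + ρbar (x 2)‖ ≤ β := by
  rw [Real.norm_of_nonneg (hα.le.trans (h.lower x))]
  exact h.upper x

lemma memLp_conv (h : Slice μ g α β ρbar ϱ u v q) : MemLp (conv u) 2 := by
  obtain ⟨_, _, hC⟩ := exists_conv_bound
  exact (hC u h.u_H2).1

lemma force_bound (h : Slice μ g α β ρbar ϱ u v q) (hg : 0 < g) (hα : 0 < α) :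
    MemLp (force g ρbar ϱ u v) 2 ∧
      n2 (force g ρbar ϱ u v) ^ 2 ≤
        4 * β ^ 2 * (n2 v ^ 2 + n2 (conv u) ^ 2) + 2 * g ^ 2 * n2 ϱ ^ 2 := by
  have hβ : 0 ≤ β := (abs_nonneg _).trans (h.abs_le 0)
  have hvc : MemLp (fun x => v x + conv u x) 2 := memLp_fun_add h.v_mem h.memLp_conv
  have h1 := memLp_n2_of_le (f := fun x => (ϱ x + ρbar (x 2)) • (v x + conv u x)) hβ hvc
    (h.density_continuous.smul (h.v_cont.add (continuous_conv h.u_H2.h1.c1))).aestronglyMeasurable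
    fun x => by
      rw [norm_smul]
      exact mul_le_mul_of_nonneg_right (h.norm_density_le hα x) (norm_nonneg _)
  have h2 := memLp_n2_of_le (f := fun x => (g * ϱ x) • e 2) hg.le h.ϱ_H1.mem
    ((continuous_const.mul h.ϱ_H1.c1.continuous).smul continuous_const).aestronglyMeasurable
    fun x => by
      rw [norm_smul, norm_e, mul_one, norm_mul, Real.norm_of_nonneg hg.le]
  refine ⟨memLp_fun_add h1.1 h2.1, (n2_add_sq_le h1.1 h2.1).trans ?_⟩
  have h3 := pow_le_pow_left₀ (n2_nonneg _) h1.2 2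
  have h4 := pow_le_pow_left₀ (n2_nonneg _) h2.2 2
  have h5 := n2_add_sq_le h.v_mem h.memLp_conv
  have h6 := mul_le_mul_of_nonneg_left h5 (sq_nonneg β)
  rw [mul_pow] at h3 h4
  linarith

lemma gradient_eq (h : Slice μ g α β ρbar ϱ u v q) (x : R3) :
    gradient q x = μ • lap u x - force g ρbar ϱ u v x := by
  rw [lap, h.momentum x, force]
  abel

lemma memLp_gradient (h : Slice μ g α β ρbar ϱ u v q) (hg : 0 < g) (hα : 0 < α) :
    MemLp (gradient q) 2 := by
  rw [funext h.gradient_eq]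
  exact memLp_fun_sub (memLp_fun_smul (memLp_lap h.u_H2) μ) (h.force_bound hg hα).1

lemma hs_le_force (h : Slice μ g α β ρbar ϱ u v q) (hμ : 0 < μ) (hg : 0 < g) (hα : 0 < α) :
    hs u ≤ 9 / μ ^ 2 * n2 (force g ρbar ϱ u v) ^ 2 := by
  have h1 : ∀ i j, n2 (pd j (pd i u)) ^ 2 ≤ (n2 (force g ρbar ϱ u v) / μ) ^ 2 := fun i j =>
    pow_le_pow_left₀ (n2_nonneg _) (stokes_n2_le hμ h.u_H2 h.div_free h.q_C1
      (h.memLp_gradient hg hα) (h.force_bound hg hα).1 h.momentum j i) 2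
  calc hs u ≤ ∑ _i : Fin 3, ∑ _j : Fin 3, (n2 (force g ρbar ϱ u v) / μ) ^ 2 :=
        Finset.sum_le_sum fun i _ => Finset.sum_le_sum fun j _ => h1 i j
    _ = _ := by
        simp only [Finset.sum_const, Finset.card_univ, Fintype.card_fin, div_pow]
        ring

end Slice

/-! ### Estimates at a fixed time -/

/-- Elliptic estimate for the Stokes system at a fixed time. -/
lemma exists_elliptic_bound {μ g α β : ℝ} (hμ : 0 < μ) (hg : 0 < g) (hα : 0 < α) :
    ∃ C : ℝ, 0 < C ∧ ∀ {ρbar : ℝ → ℝ} {ϱ : R3 → ℝ} {u v : R3 → R3} {q : R3 → ℝ},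
      Slice μ g α β ρbar ϱ u v q → gr u ≤ 1 →
        hs u ≤ C * (n2 v ^ 2 + gr u + n2 ϱ ^ 2) ∧
        n2 (gradient q) ^ 2 ≤ C * (n2 v ^ 2 + gr u + n2 ϱ ^ 2) := by
  obtain ⟨C₀, hC₀, hconv⟩ := exists_conv_bound
  have hA : 0 < 36 * β ^ 2 / μ ^ 2 + 1 := by positivity
  obtain ⟨A, hAdef⟩ : ∃ A, A = 36 * β ^ 2 / μ ^ 2 + 1 := ⟨_, rfl⟩
  rw [← hAdef] at hA
  obtain ⟨C₁, hC₁def⟩ : ∃ C₁, C₁ = 2 * (A + A * (C₀ * (2 * A)) + 18 * g ^ 2 / μ ^ 2) := ⟨_, rfl⟩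
  have hC₁ : 0 < C₁ := by rw [hC₁def]; positivity
  obtain ⟨C₂, hC₂def⟩ : ∃ C₂, C₂ = 6 * μ ^ 2 * C₁ + 8 * β ^ 2 * (1 + C₁ + C₀) + 4 * g ^ 2 :=
    ⟨_, rfl⟩
  have hC₂ : 0 < C₂ := by rw [hC₂def]; positivity
  refine ⟨C₁ + C₂, by positivity, fun {ρbar ϱ u v q} h hΦ => ?_⟩
  have hΦ0 := gr_nonneg u
  have hY := sq_nonneg (n2 v)
  have hr := sq_nonneg (n2 ϱ)
  have hΦ3 : gr u ^ 3 ≤ gr u := by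
    calc gr u ^ 3 ≤ gr u ^ 1 := pow_le_pow_of_le_one hΦ0 hΦ (by norm_num)
      _ = gr u := pow_one _
  obtain ⟨hF, hFb⟩ := h.force_bound hg hα
  have hH := h.hs_le_force hμ hg hα
  have hcv := (hconv u h.u_H2).2
  have h1 : hs u ≤ A * (n2 v ^ 2 + n2 (conv u) ^ 2) + 18 * g ^ 2 / μ ^ 2 * n2 ϱ ^ 2 := by
    have h2 := mul_le_mul_of_nonneg_left hFb (by positivity : 0 ≤ 9 / μ ^ 2)
    have h3 : 9 / μ ^ 2 * (4 * β ^ 2 * (n2 v ^ 2 + n2 (conv u) ^ 2) + 2 * g ^ 2 * n2 ϱ ^ 2)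
        = (A - 1) * (n2 v ^ 2 + n2 (conv u) ^ 2) + 18 * g ^ 2 / μ ^ 2 * n2 ϱ ^ 2 := by
      rw [hAdef]; ring
    rw [h3] at h2
    linarith [sq_nonneg (n2 (conv u))]
  have hHb : hs u ≤ C₁ * (n2 v ^ 2 + gr u + n2 ϱ ^ 2) := by
    -- With ε = 1/(2A), the convective term returns half of ‖∇²u‖², which is absorbed on the left.
    have h2 := mul_le_mul_of_nonneg_left (hcv (1 / (2 * A)) (by positivity)) hA.le
    have h3 : A * (1 / (2 * A) * hs u + C₀ / (1 / (2 * A)) * gr u ^ 3)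
        = hs u / 2 + A * (C₀ * (2 * A)) * gr u ^ 3 := by field_simp
    rw [h3] at h2
    have h4 := mul_le_mul_of_nonneg_left hΦ3 (by positivity : 0 ≤ A * (C₀ * (2 * A)))
    have h5 : 0 ≤ A * (C₀ * (2 * A)) := by positivity
    have h6 : 0 ≤ 18 * g ^ 2 / μ ^ 2 := by positivity
    rw [hC₁def]
    nlinarith [mul_nonneg hA.le hΦ0, mul_nonneg hA.le hr, mul_nonneg h5 hY, mul_nonneg h5 hr,
      mul_nonneg h6 hY, mul_nonneg h6 hΦ0]
  have hX : 0 ≤ n2 v ^ 2 + gr u + n2 ϱ ^ 2 := by positivity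
  have hC2X := mul_nonneg hC₂.le hX
  have hC1X := mul_nonneg hC₁.le hX
  refine ⟨by linarith, ?_⟩
  have h2 : n2 (conv u) ^ 2 ≤ (C₁ + C₀) * (n2 v ^ 2 + gr u + n2 ϱ ^ 2) := by
    have h3 := hcv 1 one_pos
    have h4 := mul_le_mul_of_nonneg_left hΦ3 hC₀.le
    rw [one_mul, div_one] at h3
    nlinarith [mul_nonneg hC₀.le hY, mul_nonneg hC₀.le hr]
  have h3 : n2 (gradient q) ^ 2 ≤ 2 * (μ ^ 2 * (3 * hs u)) + 2 * n2 (force g ρbar ϱ u v) ^ 2 := by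
    rw [funext h.gradient_eq]
    have h4 := pow_le_pow_left₀ (n2_nonneg _)
      (n2_sub_le (memLp_fun_smul (memLp_lap h.u_H2) μ) hF) 2
    rw [n2_smul, abs_of_pos hμ] at h4
    have h5 := mul_le_mul_of_nonneg_left (n2_lap_sq_le h.u_H2) (sq_nonneg μ)
    nlinarith [sq_nonneg (μ * n2 (lap u) - n2 (force g ρbar ϱ u v))]
  have h4 := mul_le_mul_of_nonneg_left hHb (by positivity : 0 ≤ 6 * μ ^ 2)
  have h5 := mul_le_mul_of_nonneg_left h2 (by positivity : 0 ≤ 8 * β ^ 2)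
  have h6 : 0 ≤ 8 * β ^ 2 * (gr u + n2 ϱ ^ 2) := by positivity
  have h7 : 0 ≤ 4 * g ^ 2 * (gr u + n2 v ^ 2) := by positivity
  refine le_trans ?_ (by linarith : C₂ * (n2 v ^ 2 + gr u + n2 ϱ ^ 2) ≤ _)
  rw [hC₂def]
  linarith

/-- The momentum equation tested with v; the pressure disappears by `orth`. -/
lemma Slice.integral_inner_force {μ g α β : ℝ} {ρbar : ℝ → ℝ} {ϱ : R3 → ℝ} {u v : R3 → R3}
    {q : R3 → ℝ} (h : Slice μ g α β ρbar ϱ u v q) (hg : 0 < g) (hα : 0 < α) :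
    μ * ∫ x, inner ℝ (v x) (lap u x) = ∫ x, inner ℝ (v x) (force g ρbar ϱ u v x) := by
  have h1 := h.orth q h.q_C1 (h.memLp_gradient hg hα)
  have hm := memLp_lap h.u_H2
  have hF := (h.force_bound hg hα).1
  have h2 : ∫ x, inner ℝ (gradient q x) (v x)
      = μ * (∫ x, inner ℝ (v x) (lap u x)) - ∫ x, inner ℝ (v x) (force g ρbar ϱ u v x) := by
    rw [← integral_const_mul, ← integral_sub ((integrable_inner' h.v_mem hm).const_mul μ)
      (integrable_inner' h.v_mem hF)]
    refine integral_congr_ae (Eventually.of_forall fun x => ?_)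
    change inner ℝ (gradient q x) (v x) = _
    rw [h.gradient_eq, real_inner_comm, inner_sub_right, real_inner_smul_right]
  linarith

/-- The lower density bound gives α‖v‖². Half of it is kept; the other half is divided equally by
Young's inequality between the convective term and gravity. -/
lemma Slice.integral_inner_force_ge {μ g α β : ℝ} {ρbar : ℝ → ℝ} {ϱ : R3 → ℝ} {u v : R3 → R3}
    {q : R3 → ℝ} (h : Slice μ g α β ρbar ϱ u v q) (hg : 0 < g) (hα : 0 < α) :
    α / 2 * n2 v ^ 2 - (β ^ 2 * n2 (conv u) ^ 2 + g ^ 2 * n2 ϱ ^ 2) / α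
      ≤ ∫ x, inner ℝ (v x) (force g ρbar ϱ u v x) := by
  have hF := (h.force_bound hg hα).1
  have hi1 := h.v_mem.norm.integrable_sq
  have hi2 := h.memLp_conv.norm.integrable_sq
  have hi3 := h.ϱ_H1.mem.norm.integrable_sq
  have hi4 : Integrable fun x => (β ^ 2 * ‖conv u x‖ ^ 2 + g ^ 2 * ‖ϱ x‖ ^ 2) / α :=
    ((hi2.const_mul _).add (hi3.const_mul _)).div_const _
  rw [n2_sq h.v_mem, n2_sq h.memLp_conv, n2_sq h.ϱ_H1.mem, ← integral_const_mul,
    ← integral_const_mul, ← integral_const_mul, ← integral_add (hi2.const_mul _) (hi3.const_mul _),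
    ← integral_div, ← integral_sub (hi1.const_mul _) hi4]
  refine integral_mono ((hi1.const_mul _).sub hi4) (integrable_inner' h.v_mem hF) fun x => ?_
  simp only [force, inner_add_right, real_inner_smul_right, real_inner_self_eq_norm_sq]
  have hβ := h.norm_density_le hα x
  have h0 := h.lower x
  have hv := norm_nonneg (v x)
  have h1 : -(β * (‖v x‖ * ‖conv u x‖)) ≤ (ϱ x + ρbar (x 2)) * inner ℝ (v x) (conv u x) := by
    refine neg_le_of_abs_le ?_
    rw [abs_mul]
    exact mul_le_mul hβ (abs_real_inner_le_norm _ _) (abs_nonneg _) ((norm_nonneg _).trans hβ)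
  have h2 : -(g * (‖ϱ x‖ * ‖v x‖)) ≤ g * ϱ x * inner ℝ (v x) (e 2) := by
    refine neg_le_of_abs_le ?_
    rw [abs_mul, abs_mul, abs_of_pos hg, mul_assoc]
    refine mul_le_mul_of_nonneg_left (mul_le_mul_of_nonneg_left ?_ (abs_nonneg _)) hg.le
    exact (abs_real_inner_le_norm _ _).trans (by rw [norm_e, mul_one])
  have h3 := mul_le_mul_of_nonneg_right h0 (sq_nonneg ‖v x‖)
  have h4 : (β ^ 2 * ‖conv u x‖ ^ 2 + g ^ 2 * ‖ϱ x‖ ^ 2) / α + α / 2 * ‖v x‖ ^ 2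
      - (β * (‖v x‖ * ‖conv u x‖) + g * (‖ϱ x‖ * ‖v x‖))
      = ((2 * (β * ‖conv u x‖) - α * ‖v x‖) ^ 2 + (2 * (g * ‖ϱ x‖) - α * ‖v x‖) ^ 2) / (4 * α) := by
    field_simp
    ring
  have h5 : 0 ≤ ((2 * (β * ‖conv u x‖) - α * ‖v x‖) ^ 2
      + (2 * (g * ‖ϱ x‖) - α * ‖v x‖) ^ 2) / (4 * α) := by positivity
  linarith

/-- Dissipation produced by the acceleration in the `H¹` energy balance. -/
lemma exists_gr_deriv_bound {μ g α β : ℝ} (hμ : 0 < μ) (hg : 0 < g) (hα : 0 < α) :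
    ∃ c C : ℝ, 0 < c ∧ 0 < C ∧ ∀ {ρbar : ℝ → ℝ} {ϱ : R3 → ℝ} {u v : R3 → R3} {q : R3 → ℝ},
      Slice μ g α β ρbar ϱ u v q → gr u ≤ 1 →
        -2 * (∫ x, inner ℝ (v x) (lap u x)) ≤ -c * n2 v ^ 2 + C * (gr u + n2 ϱ ^ 2) := by
  obtain ⟨C₀, hC₀, hconv⟩ := exists_conv_bound
  obtain ⟨C₁, hC₁, hell⟩ := exists_elliptic_bound (β := β) hμ hg hα
  -- The elliptic estimate turns ε‖∇²u‖² into a multiple of ‖v‖²; this ε makes it cost at most half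
  -- of the available α/2.
  obtain ⟨ε, hε, hεα⟩ : ∃ ε, 0 < ε ∧ β ^ 2 / α * (ε * C₁) ≤ α / 4 := by
    refine ⟨α / 4 / (β ^ 2 / α * C₁ + 1), by positivity, ?_⟩
    rw [← mul_assoc, mul_comm (β ^ 2 / α), mul_assoc, div_mul_eq_mul_div, div_le_iff₀ (by positivity)]
    have : 0 ≤ α / 4 := by positivity
    linarith
  obtain ⟨K, hK⟩ : ∃ K, K = α / 4 + β ^ 2 / α * (C₀ / ε) + g ^ 2 / α := ⟨_, rfl⟩
  have hK0 : 0 < K := by rw [hK]; positivity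
  refine ⟨2 / μ * (α / 4), 2 / μ * K, by positivity, by positivity, fun {ρbar ϱ u v q} h hΦ => ?_⟩
  have hΦ0 := gr_nonneg u
  have hY := sq_nonneg (n2 v)
  have hr := sq_nonneg (n2 ϱ)
  have hΦ3 : gr u ^ 3 ≤ gr u := by
    calc gr u ^ 3 ≤ gr u ^ 1 := pow_le_pow_of_le_one hΦ0 hΦ (by norm_num)
      _ = gr u := pow_one _
  have h1 := h.integral_inner_force_ge hg hα
  rw [← h.integral_inner_force hg hα] at h1
  have h2 := (hconv u h.u_H2).2 ε hε
  have h3 := (hell h hΦ).1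
  have h4 : n2 (conv u) ^ 2 ≤ ε * (C₁ * (n2 v ^ 2 + gr u + n2 ϱ ^ 2)) + C₀ / ε * gr u :=
    h2.trans (add_le_add (mul_le_mul_of_nonneg_left h3 hε.le)
      (mul_le_mul_of_nonneg_left hΦ3 (by positivity)))
  have h5 := mul_le_mul_of_nonneg_left h4 (by positivity : 0 ≤ β ^ 2 / α)
  have h6 := mul_le_mul_of_nonneg_right hεα (by positivity : 0 ≤ n2 v ^ 2 + gr u + n2 ϱ ^ 2)
  have h7 : 0 ≤ β ^ 2 / α * (C₀ / ε) * n2 ϱ ^ 2 := by positivity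
  have h8 : 0 ≤ g ^ 2 / α * gr u := by positivity
  have h9 : (β ^ 2 * n2 (conv u) ^ 2 + g ^ 2 * n2 ϱ ^ 2) / α
      = β ^ 2 / α * n2 (conv u) ^ 2 + g ^ 2 / α * n2 ϱ ^ 2 := by ring
  rw [h9] at h1
  have h10 : α / 4 * n2 v ^ 2 - K * (gr u + n2 ϱ ^ 2) ≤ μ * ∫ x, inner ℝ (v x) (lap u x) := by
    rw [hK]
    linarith
  have h11 := mul_le_mul_of_nonneg_left h10 (by positivity : 0 ≤ 2 / μ)
  have h12 : 2 / μ * (μ * ∫ x, inner ℝ (v x) (lap u x)) = 2 * ∫ x, inner ℝ (v x) (lap u x) := by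
    field_simp
  rw [h12] at h11
  linarith

/-- The acceleration is controlled by the other norms at the same time. -/
lemma exists_acceleration_bound {μ g α β : ℝ} (hμ : 0 < μ) (hg : 0 < g) (hα : 0 < α) :
    ∃ C : ℝ, 0 < C ∧ ∀ {ρbar : ℝ → ℝ} {ϱ : R3 → ℝ} {u v : R3 → R3} {q : R3 → ℝ},
      Slice μ g α β ρbar ϱ u v q → gr u ≤ 1 →
        n2 v ^ 2 ≤ C * (gr u + hs u + n2 ϱ ^ 2) := by
  obtain ⟨C₀, hC₀, hconv⟩ := exists_conv_bound
  obtain ⟨K, hK⟩ : ∃ K, K = 3 * (μ ^ 2 / α) + β ^ 2 / α * (1 + C₀) + g ^ 2 / α := ⟨_, rfl⟩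
  have hK0 : 0 < K := by rw [hK]; positivity
  refine ⟨4 / α * K, by positivity, fun {ρbar ϱ u v q} h hΦ => ?_⟩
  have hΦ0 := gr_nonneg u
  have hH0 := hs_nonneg u
  have hr := sq_nonneg (n2 ϱ)
  have hΦ3 : gr u ^ 3 ≤ gr u := by
    calc gr u ^ 3 ≤ gr u ^ 1 := pow_le_pow_of_le_one hΦ0 hΦ (by norm_num)
      _ = gr u := pow_one _
  have h1 := h.integral_inner_force_ge hg hα
  rw [← h.integral_inner_force hg hα] at h1
  have h2 := (hconv u h.u_H2).2 1 one_pos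
  have h3 := mul_le_mul_of_nonneg_left hΦ3 hC₀.le
  rw [one_mul, div_one] at h2
  have h4 : n2 (conv u) ^ 2 ≤ (1 + C₀) * (gr u + hs u) := by
    linarith [mul_nonneg hC₀.le hH0]
  have h5 := mul_le_mul_of_nonneg_left h4 (by positivity : 0 ≤ β ^ 2 / α)
  have h6 := mul_le_mul_of_nonneg_left
    ((le_abs_self _).trans (abs_integral_inner_le h.v_mem (memLp_lap h.u_H2))) hμ.le
  have h7 : μ * (n2 v * n2 (lap u)) ≤ α / 4 * n2 v ^ 2 + μ ^ 2 / α * n2 (lap u) ^ 2 := by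
    have : α / 4 * n2 v ^ 2 + μ ^ 2 / α * n2 (lap u) ^ 2 - μ * (n2 v * n2 (lap u))
        = (α * n2 v - 2 * (μ * n2 (lap u))) ^ 2 / (4 * α) := by
      field_simp
      ring
    have h8 : 0 ≤ (α * n2 v - 2 * (μ * n2 (lap u))) ^ 2 / (4 * α) := by positivity
    linarith
  have h8 := mul_le_mul_of_nonneg_left (n2_lap_sq_le h.u_H2) (by positivity : 0 ≤ μ ^ 2 / α)
  have h9 : (β ^ 2 * n2 (conv u) ^ 2 + g ^ 2 * n2 ϱ ^ 2) / α
      = β ^ 2 / α * n2 (conv u) ^ 2 + g ^ 2 / α * n2 ϱ ^ 2 := by ring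
  rw [h9] at h1
  have h10 : α / 4 * n2 v ^ 2 ≤ K * (gr u + hs u + n2 ϱ ^ 2) := by
    rw [hK]
    have i1 : 0 ≤ μ ^ 2 / α * gr u := by positivity
    have i2 : 0 ≤ μ ^ 2 / α * n2 ϱ ^ 2 := by positivity
    have i3 : 0 ≤ β ^ 2 / α * (1 + C₀) * n2 ϱ ^ 2 := by positivity
    have i4 : 0 ≤ g ^ 2 / α * (gr u + hs u) := by positivity
    linarith
  have h11 := mul_le_mul_of_nonneg_left h10 (by positivity : 0 ≤ 4 / α)
  have h12 : 4 / α * (α / 4 * n2 v ^ 2) = n2 v ^ 2 := by field_simp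
  rw [h12] at h11
  linarith

lemma n6_add_le {F : Type*} [NormedAddCommGroup F] {f h : R3 → F} (hf : MemLp f 6)
    (hh : MemLp h 6) : n6 (fun x => f x + h x) ≤ n6 f + n6 h := by
  unfold n6
  rw [← ENNReal.toReal_add hf.eLpNorm_ne_top hh.eLpNorm_ne_top]
  exact ENNReal.toReal_mono (ENNReal.add_ne_top.2 ⟨hf.eLpNorm_ne_top, hh.eLpNorm_ne_top⟩)
    (eLpNorm_add_le hf.1 hh.1 (by norm_num))

lemma memLp_n6_of_le {F G : Type*} [NormedAddCommGroup F] [NormedAddCommGroup G] {f : R3 → F}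
    {h : R3 → G} {C : ℝ} (hC : 0 ≤ C) (hh : MemLp h 6) (hf : AEStronglyMeasurable f volume)
    (hle : ∀ x, ‖f x‖ ≤ C * ‖h x‖) : MemLp f 6 ∧ n6 f ≤ C * n6 h := by
  refine ⟨hh.of_le_mul hf (Eventually.of_forall hle), ?_⟩
  have h1 := eLpNorm_le_mul_eLpNorm_of_ae_le_mul (Eventually.of_forall hle)
    (p := 6) (μ := volume)
  unfold n6
  rw [← ENNReal.toReal_ofReal hC, ← ENNReal.toReal_mul]
  exact ENNReal.toReal_mono (ENNReal.mul_ne_top ENNReal.ofReal_ne_top hh.eLpNorm_ne_top) h1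

/-- Interpolation by |f|⁶ ≤ β⁴|f|². For f = ϱ this avoids the Sobolev inequality, whose right side
‖∇ϱ‖ is not yet controlled where the bound is used. -/
lemma n6_le_of_abs_le {f : R3 → ℝ} {β : ℝ} (hβ : 0 ≤ β) (hf : MemLp f 2)
    (h : ∀ x, |f x| ≤ β) (h1 : n2 f ≤ 1) : n6 f ≤ β + 1 := by
  have h2 : eLpNorm f 6 volume ^ 6 ≤ ENNReal.ofReal ((β + 1) ^ 6) := by
    rw [← lintegral_pow_six]
    calc ∫⁻ x, ‖f x‖ₑ ^ 6 ≤ ∫⁻ x, ENNReal.ofReal (β ^ 4) * ‖f x‖ₑ ^ 2 := by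
          refine lintegral_mono fun x => ?_
          rw [← ofReal_norm, ← ENNReal.ofReal_pow (norm_nonneg _),
            ← ENNReal.ofReal_pow (norm_nonneg _), ← ENNReal.ofReal_mul (by positivity)]
          refine ENNReal.ofReal_le_ofReal ?_
          have := mul_le_mul_of_nonneg_right (pow_le_pow_left₀ (norm_nonneg (f x)) (h x) 4)
            (sq_nonneg ‖f x‖)
          calc ‖f x‖ ^ 6 = ‖f x‖ ^ 4 * ‖f x‖ ^ 2 := by ring
            _ ≤ _ := this
      _ = ENNReal.ofReal (β ^ 4) * l2Sq f := lintegral_const_mul' _ _ ENNReal.ofReal_ne_top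
      _ ≤ ENNReal.ofReal (β ^ 4) * 1 := by
          rw [l2Sq_eq_ofReal hf]
          gcongr
          rw [ENNReal.ofReal_le_one]
          exact pow_le_one₀ (n2_nonneg _) h1
      _ ≤ _ := by
          rw [mul_one]
          refine ENNReal.ofReal_le_ofReal ?_
          calc β ^ 4 ≤ (β + 1) ^ 4 := pow_le_pow_left₀ hβ (by linarith) 4
            _ ≤ (β + 1) ^ 6 := pow_le_pow_right₀ (by linarith) (by norm_num)
  have h3 : n6 f ^ 6 ≤ (β + 1) ^ 6 := by
    have := ENNReal.toReal_mono ENNReal.ofReal_ne_top h2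
    rwa [ENNReal.toReal_pow, ENNReal.toReal_ofReal (by positivity)] at this
  exact le_of_pow_le_pow_left₀ (by norm_num) (by linarith) h3

lemma norm_fderiv_le_of_coord {u : R3 → R3} {x : R3} {M : ℝ} (h : ∀ k j, |pd k u x j| ≤ M) :
    ‖fderiv ℝ u x‖ ≤ 9 * M := by
  calc ‖fderiv ℝ u x‖ ≤ ∑ k, ‖pd k u x‖ := norm_fderiv_le_sum u x
    _ ≤ ∑ k, ∑ j, |pd k u x j| := Finset.sum_le_sum fun k _ => norm_le_sum_abs _
    _ ≤ ∑ _k : Fin 3, ∑ _j : Fin 3, M :=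
        Finset.sum_le_sum fun k _ => Finset.sum_le_sum fun j _ => h k j
    _ = 9 * M := by simp; ring

/-- Lipschitz bound for the velocity in terms of the acceleration. -/
lemma exists_lipschitz_bound {μ g α β : ℝ} (hμ : 0 < μ) (hg : 0 < g) (hα : 0 < α) :
    ∃ C : ℝ, 0 < C ∧ ∀ {ρbar : ℝ → ℝ} {ϱ : R3 → ℝ} {u v : R3 → R3} {q : R3 → ℝ},
      Slice μ g α β ρbar ϱ u v q → gr u ≤ 1 → n2 v ^ 2 ≤ 1 → n2 ϱ ^ 2 ≤ 1 → MemLp v 6 →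
        ∀ x, ‖fderiv ℝ u x‖ ≤ C * (1 + n6 v) := by
  obtain ⟨C₀, hC₀, hconv⟩ := exists_conv_bound
  obtain ⟨C₁, hC₁, hell⟩ := exists_elliptic_bound (β := β) hμ hg hα
  obtain ⟨C₂, hC₂, hsup⟩ := exists_sup_le
  obtain ⟨C₃, hC₃, hsto⟩ := exists_stokes_gradient_bound
  obtain ⟨S', hS', hSob'⟩ : ∃ S' : ℝ, 0 ≤ S' ∧ ∀ u : R3 → R3, H2C2 u →
      MemLp (fderiv ℝ u) 6 ∧ n6 (fderiv ℝ u) ≤ S' * √(hs u) :=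
    ⟨_, sobC_nonneg, fun u hu => hu.sobolev_fderiv⟩
  obtain ⟨H, hH⟩ : ∃ H, H = C₁ * 3 := ⟨_, rfl⟩
  have hH0 : 0 < H := by rw [hH]; positivity
  obtain ⟨D, hD⟩ : ∃ D, D = C₂ * √(1 + H) * (S' * √H) := ⟨_, rfl⟩
  have hD0 : 0 ≤ D := by rw [hD]; positivity
  obtain ⟨N, hN⟩ : ∃ N, N = 4 * β ^ 2 * (1 + (H + C₀)) + 2 * g ^ 2 := ⟨_, rfl⟩
  have hN0 : 0 ≤ N := by rw [hN]; positivity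
  refine ⟨9 * (C₃ / μ * (√N + |β| * (1 + D) + g * (|β| + 1))) + 1, by positivity,
    fun {ρbar ϱ u v q} h hΦ hv hr hv6 x => ?_⟩
  have hβ : 0 ≤ β := (abs_nonneg _).trans (h.abs_le 0)
  rw [abs_of_nonneg hβ]
  have hu := h.u_H2
  have hHb : hs u ≤ H := by
    refine (hell h hΦ).1.trans ?_
    rw [hH]
    exact mul_le_mul_of_nonneg_left (by linarith) hC₁.le
  have hΦ0 := gr_nonneg u
  have hsu : ∀ x, ‖u x‖ ≤ C₂ * √(1 + H) := fun x => (hsup u hu x).trans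
    (mul_le_mul_of_nonneg_left (Real.sqrt_le_sqrt (by linarith)) hC₂.le)
  obtain ⟨h6, h6'⟩ := hSob' u hu
  -- Since u is bounded, the convective term is in L⁶ as soon as ∇u is. Thus v is the only part of
  -- the force whose L⁶ norm is not bounded by a constant.
  obtain ⟨k1, k2⟩ := memLp_n6_of_le (f := conv u) (h := fderiv ℝ u) (C := C₂ * √(1 + H))
    (by positivity) h6 (continuous_conv hu.h1.c1).aestronglyMeasurable fun x => by
      rw [mul_comm]
      exact (ContinuousLinearMap.le_opNorm _ _).trans
        (mul_le_mul_of_nonneg_left (hsu x) (norm_nonneg _))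
  have k3 : n6 (conv u) ≤ D := by
    refine k2.trans ?_
    rw [hD]
    refine mul_le_mul_of_nonneg_left (h6'.trans ?_) (by positivity)
    exact mul_le_mul_of_nonneg_left (Real.sqrt_le_sqrt hHb) hS'
  have hvc6 : MemLp (fun x => v x + conv u x) 6 := memLp_fun_add hv6 k1
  have l1 := memLp_n6_of_le (f := fun x => (ϱ x + ρbar (x 2)) • (v x + conv u x)) hβ hvc6
    (h.density_continuous.smul (h.v_cont.add (continuous_conv h.u_H2.h1.c1))).aestronglyMeasurable
    fun x => by
      rw [norm_smul]
      exact mul_le_mul_of_nonneg_right (h.norm_density_le hα x) (norm_nonneg _)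
  have hϱ6 := h.ϱ_H1.sobolev.1
  have l2 := memLp_n6_of_le (f := fun x => (g * ϱ x) • e 2) hg.le hϱ6
    ((continuous_const.mul h.ϱ_H1.c1.continuous).smul continuous_const).aestronglyMeasurable
    fun x => by
      rw [norm_smul, norm_e, mul_one, norm_mul, Real.norm_of_nonneg hg.le]
  have hϱ1 : n2 ϱ ≤ 1 := by
    have := Real.sqrt_le_sqrt hr
    rwa [Real.sqrt_sq (n2_nonneg _), Real.sqrt_one] at this
  have hF6 : MemLp (force g ρbar ϱ u v) 6 := memLp_fun_add l1.1 l2.1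
  have hF6b : n6 (force g ρbar ϱ u v) ≤ β * (n6 v + D) + g * (β + 1) := by
    refine (n6_add_le l1.1 l2.1).trans (add_le_add (l1.2.trans ?_) (l2.2.trans ?_))
    · exact mul_le_mul_of_nonneg_left ((n6_add_le hv6 k1).trans (by linarith)) hβ
    · exact mul_le_mul_of_nonneg_left (n6_le_of_abs_le hβ h.ϱ_H1.mem h.abs_le hϱ1) hg.le
  obtain ⟨hF, hFb⟩ := h.force_bound hg hα
  have hF2 : n2 (force g ρbar ϱ u v) ≤ √N := by
    refine Real.le_sqrt_of_sq_le (hFb.trans ?_)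
    rw [hN]
    have m1 := (hconv u hu).2 1 one_pos
    have m2 : gr u ^ 3 ≤ 1 := pow_le_one₀ hΦ0 hΦ
    have m3 := mul_le_mul_of_nonneg_left m2 hC₀.le
    rw [one_mul, div_one] at m1
    have m4 : n2 v ^ 2 + n2 (conv u) ^ 2 ≤ 1 + (H + C₀) := by linarith
    have m5 := mul_le_mul_of_nonneg_left m4 (by positivity : 0 ≤ 4 * β ^ 2)
    have m6 := mul_le_mul_of_nonneg_left hr (by positivity : 0 ≤ 2 * g ^ 2)
    linarith
  have hfin := norm_fderiv_le_of_coord (x := x) fun k j =>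
    hsto μ u (force g ρbar ϱ u v) q hμ hu h.div_free h.q_C1 (h.memLp_gradient hg hα) hF hF6
      h.momentum x k j
  refine hfin.trans ?_
  have hn6 := n6_nonneg v
  have p1 : n2 (force g ρbar ϱ u v) + n6 (force g ρbar ϱ u v)
      ≤ (√N + β * (1 + D) + g * (β + 1)) * (1 + n6 v) := by
    have i1 : 0 ≤ √N * n6 v := by positivity
    have i2 : 0 ≤ β * D * n6 v := by positivity
    have i3 : 0 ≤ g * (β + 1) * n6 v := by positivity
    nlinarith
  have p2 := mul_le_mul_of_nonneg_left p1 (by positivity : 0 ≤ C₃ / μ)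
  nlinarith

namespace IsClassicalSolution

variable {μ g : ℝ} {ρbar : ℝ → ℝ} {T : EReal} {ϱ₀ : R3 → ℝ} {u₀ : R3 → R3} {ϱ : ℝ → R3 → ℝ}
  {u : ℝ → R3 → R3} {q : ℝ → R3 → ℝ} (hS : IsClassicalSolution μ g ρbar T ϱ₀ u₀ ϱ u q)
include hS

/-- Both ϱ + ρ̄ and ρ̄ take values in [α, β] with α > 0, which is why |ϱ| ≤ β. -/
lemma slice (hρ : IsProfile ρbar) {α β : ℝ} (hα : 0 < α)
    (h0 : ∀ x, α ≤ ϱ₀ x + ρbar (x 2) ∧ ϱ₀ x + ρbar (x 2) ≤ β) {t : ℝ} (ht : t ∈ openTimes T) :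
    Slice μ g α β ρbar (ϱ t) (u t) (dt u t) (q t) := by
  have h00 : (0 : ℝ) ∈ closedTimes T := ⟨le_rfl, by exact_mod_cast hS.T_pos⟩
  have h2 : l2Sq ϱ₀ < ⊤ := by
    have := (hS.ϱ_H1 0 h00).1
    rw [hS.ϱ_init, h1Sq, ENNReal.add_lt_top] at this
    exact this.1
  have hu0 : ∀ x, 1 * (ϱ₀ x + ρbar (x 2)) ≤ β := fun x => by linarith [(h0 x).2]
  have hl0 : ∀ x, -1 * (ϱ₀ x + ρbar (x 2)) ≤ -α := fun x => by linarith [(h0 x).1]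
  have hub : ∀ z, 1 * ρbar z ≤ β := le_of_perturbation hρ.smooth.continuous h2 hu0
  have hlb : ∀ z, -1 * ρbar z ≤ -α := le_of_perturbation hρ.smooth.continuous h2 hl0
  have hup : ∀ x, ϱ t x + ρbar (x 2) ≤ β := fun x => by
    linarith [hS.density_le hρ hub hu0 ht x]
  have hlo : ∀ x, α ≤ ϱ t x + ρbar (x 2) := fun x => by
    linarith [hS.density_le hρ hlb hl0 ht x]
  refine ⟨hρ, hS.h1C1 ht, hS.h2C2 ht, hS.continuous_dt_u ht, hS.memLp_dt_u ht, hS.q_C1 t ht,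
    hS.dvg_eq_zero ht, hlo, hup, fun x => ?_,
    fun p hp hg => hS.integral_gradient_dt_u ht hp hg, hS.momentum_pd ht⟩
  rw [abs_le]
  constructor <;> linarith [hup x, hlo x, hub (x 2), hlb (x 2)]

end IsClassicalSolution

/-! ### Weak form of the density transport -/

namespace Slice

variable {μ g α β : ℝ} {ρbar : ℝ → ℝ} {ϱ : R3 → ℝ} {u v : R3 → R3} {q : R3 → ℝ}

lemma density_contDiff (h : Slice μ g α β ρbar ϱ u v q) :
    ContDiff ℝ 1 fun x => ϱ x + ρbar (x 2) := h.ϱ_H1.c1.add h.profile.contDiff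

lemma fderiv_density (h : Slice μ g α β ρbar ϱ u v q) (x z : R3) :
    fderiv ℝ (fun y => ϱ y + ρbar (y 2)) x z = fderiv ℝ ϱ x z + deriv ρbar (x 2) * z 2 := by
  rw [show (fun y => ϱ y + ρbar (y 2)) = ϱ + fun y : R3 => ρbar (y 2) from rfl, fderiv_add
    (h.ϱ_H1.diff x) (h.profile.contDiff.differentiable (by norm_num) x), add_apply,
    h.profile.fderiv_apply]

lemma norm_fderiv_density_le (h : Slice μ g α β ρbar ϱ u v q) {L : ℝ}
    (hL : ∀ z, |deriv ρbar z| ≤ L) (x : R3) :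
    ‖fderiv ℝ (fun y => ϱ y + ρbar (y 2)) x‖ ≤ ‖fderiv ℝ ϱ x‖ + L := by
  have hL0 : 0 ≤ L := (abs_nonneg _).trans (hL 0)
  refine ContinuousLinearMap.opNorm_le_bound _ (by positivity) fun z => ?_
  rw [h.fderiv_density, add_mul]
  refine (norm_add_le _ _).trans (add_le_add (ContinuousLinearMap.le_opNorm _ _) ?_)
  rw [norm_mul]
  exact mul_le_mul (hL _) (PiLp.norm_apply_le _ _) (norm_nonneg _) hL0

/-- Weak form of the transport operator, when the test function `ψ` is square integrable. -/
lemma integral_transport (h : Slice μ g α β ρbar ϱ u v q) (hα : 0 < α) {ψ : R3 → ℝ}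
    (hψ : ContDiff ℝ 1 ψ) (hψ2 : MemLp ψ 2)
    (hi : Integrable fun x => ‖u x‖ * ‖fderiv ℝ ψ x‖) {K : ℝ} (hK : ∀ x, ‖u x‖ ≤ K) :
    ∫ x, fderiv ℝ (fun y => ϱ y + ρbar (y 2)) x (u x) * ψ x
      = - ∫ x, (ϱ x + ρbar (x 2)) * fderiv ℝ ψ x (u x) := by
  obtain ⟨L, hL0, hL⟩ := h.profile.exists_bound
  have hK0 : 0 ≤ K := (norm_nonneg _).trans (hK 0)
  have hR := h.density_contDiff
  have hβ : 0 ≤ β := (abs_nonneg _).trans (h.abs_le 0)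
  have hRu : Integrable fun x => fderiv ℝ (fun y => ϱ y + ρbar (y 2)) x (u x) * ψ x := by
    refine integrable_of_le_mul (f := fun x => K * ‖fderiv ℝ ϱ x‖ + L * ‖u x‖) (g := ψ) 1
      (((hR.continuous_fderiv (by norm_num)).clm_apply h.u_H2.c2.continuous).mul
        hψ.continuous).aestronglyMeasurable (memLp_fun_add (h.ϱ_H1.memD.norm.const_mul K)
        (h.u_H2.h1.mem.norm.const_mul L)) hψ2 fun x => ?_
    rw [norm_mul, one_mul, Real.norm_of_nonneg
      (show 0 ≤ K * ‖fderiv ℝ ϱ x‖ + L * ‖u x‖ by positivity)]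
    refine mul_le_mul_of_nonneg_right ((ContinuousLinearMap.le_opNorm _ _).trans ?_) (norm_nonneg _)
    have h1 := mul_le_mul_of_nonneg_right (h.norm_fderiv_density_le hL x) (norm_nonneg (u x))
    have h2 := mul_le_mul_of_nonneg_left (hK x) (norm_nonneg (fderiv ℝ ϱ x))
    linarith
  have hRψ : Integrable fun x => (ϱ x + ρbar (x 2)) * fderiv ℝ ψ x (u x) := by
    refine (hi.const_mul β).mono' (hR.continuous.mul ((hψ.continuous_fderiv
      (by norm_num)).clm_apply h.u_H2.c2.continuous)).aestronglyMeasurable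
      (Eventually.of_forall fun x => ?_)
    rw [norm_mul]
    refine mul_le_mul (h.norm_density_le hα x) ?_ (norm_nonneg _) hβ
    rw [mul_comm]
    exact ContinuousLinearMap.le_opNorm _ _
  have hG : ContDiff ℝ 1 fun x => (ϱ x + ρbar (x 2)) * ψ x := hR.mul hψ
  have hfd : ∀ x z, fderiv ℝ (fun x => (ϱ x + ρbar (x 2)) * ψ x) x z
      = fderiv ℝ (fun y => ϱ y + ρbar (y 2)) x z * ψ x
        + (ϱ x + ρbar (x 2)) * fderiv ℝ ψ x z := fun x z => by
    have h1 := ((hR.differentiable (by norm_num) x).hasFDerivAt.mul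
      (hψ.differentiable (by norm_num) x).hasFDerivAt).fderiv
    change fderiv ℝ ((fun x => ϱ x + ρbar (x 2)) * ψ) x z = _
    rw [h1]
    simp only [add_apply, smul_apply, smul_eq_mul]
    ring
  have h0 := integral_transport_eq_zero h.u_H2.h1 h.div_free hG
    (memLp_n2_of_le hβ hψ2 (hR.continuous.mul hψ.continuous).aestronglyMeasurable fun x => by
      rw [Pi.mul_apply, norm_mul]
      exact mul_le_mul_of_nonneg_right (h.norm_density_le hα x) (norm_nonneg _)).1 fun i => by
    have hm : Integrable fun x => (K * ‖fderiv ℝ ϱ x‖ + L * ‖u x‖) * ‖ψ x‖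
        + β * (‖u x‖ * ‖fderiv ℝ ψ x‖) :=
      (integrable_mul_l2 (memLp_fun_add (h.ϱ_H1.memD.norm.const_mul K)
        (h.u_H2.h1.mem.norm.const_mul L)) hψ2.norm).add (hi.const_mul β)
    refine hm.mono' (((contDiff_coord i).continuous.comp h.u_H2.c2.continuous).mul
      (continuous_pd hG i)).aestronglyMeasurable (Eventually.of_forall fun x => ?_)
    rw [pd_eq, hfd, norm_mul]
    have h1 : ‖u x i‖ ≤ ‖u x‖ := PiLp.norm_apply_le _ _
    have h2 : ‖fderiv ℝ (fun y => ϱ y + ρbar (y 2)) x (e i) * ψ x‖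
        ≤ (‖fderiv ℝ ϱ x‖ + L) * ‖ψ x‖ := by
      rw [norm_mul]
      exact mul_le_mul_of_nonneg_right ((norm_pd_le i _ x).trans (h.norm_fderiv_density_le hL x))
        (norm_nonneg _)
    have h3 : ‖(ϱ x + ρbar (x 2)) * fderiv ℝ ψ x (e i)‖ ≤ β * ‖fderiv ℝ ψ x‖ := by
      rw [norm_mul]
      exact mul_le_mul (h.norm_density_le hα x) (norm_pd_le i _ x) (norm_nonneg _) hβ
    calc _ ≤ ‖u x‖ * ((‖fderiv ℝ ϱ x‖ + L) * ‖ψ x‖ + β * ‖fderiv ℝ ψ x‖) :=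
          mul_le_mul h1 ((norm_add_le _ _).trans (add_le_add h2 h3)) (norm_nonneg _)
            (norm_nonneg _)
      _ ≤ _ := by
        have h4 := mul_le_mul_of_nonneg_right (hK x)
          (by positivity : 0 ≤ ‖fderiv ℝ ϱ x‖ * ‖ψ x‖)
        linarith
  simp only [hfd] at h0
  rw [integral_add hRu hRψ] at h0
  linarith

end Slice

namespace IsClassicalSolution

variable {μ g : ℝ} {ρbar : ℝ → ℝ} {T : EReal} {ϱ₀ : R3 → ℝ} {u₀ : R3 → R3} {ϱ : ℝ → R3 → ℝ}
  {u : ℝ → R3 → R3} {q : ℝ → R3 → ℝ} (hS : IsClassicalSolution μ g ρbar T ϱ₀ u₀ ϱ u q)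
include hS

/-- A density increment is small in a negative norm. -/
lemma abs_integral_increment_le {α β : ℝ} (hα : 0 < α)
    (hsl : ∀ t ∈ openTimes T, Slice μ g α β ρbar (ϱ t) (u t) (dt u t) (q t)) {a b : ℝ}
    (ha : a ∈ openTimes T) (hb : b ∈ openTimes T) (hab : a ≤ b) {ψ : R3 → ℝ}
    (hψ : ContDiff ℝ 1 ψ) (hψ2 : MemLp ψ 2) {B : ℝ}
    (hB : ∀ s ∈ Icc a b, Integrable (fun x => ‖u s x‖ * ‖fderiv ℝ ψ x‖) ∧
      ∫ x, ‖u s x‖ * ‖fderiv ℝ ψ x‖ ≤ B) :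
    |∫ x, (ϱ b x - ϱ a x) * ψ x| ≤ (b - a) * (β * B) := by
  have hρ := (hsl a ha).profile
  have hβ : 0 ≤ β := (abs_nonneg _).trans ((hsl a ha).abs_le 0)
  obtain ⟨L, hL0, hL⟩ := hρ.exists_bound
  have hsub := Icc_subset_openTimes ha hb
  obtain ⟨K, hK0, hK⟩ := hS.exists_bound ha hb
  have hϱt : ∀ t ∈ Icc a b, MemLp (dt ϱ t) 2 ∧ n2 (dt ϱ t) ≤ K * K + L * K := fun t ht => by
    obtain ⟨-, k2, k3, -, -, -, -, hu⟩ := hK t ht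
    obtain ⟨m1, m2⟩ := hS.memLp_dt_ϱ hρ hL (hsub ht) hu
    exact ⟨m1, m2.trans (add_le_add (mul_le_mul_of_nonneg_left k2 hK0)
      (mul_le_mul_of_nonneg_left k3 hL0))⟩
  have hϱtc : ContinuousOn (fun p : ℝ × R3 => dt ϱ p.1 p.2) (Icc a b ×ˢ univ) :=
    (continuousOn_dt (isOpen_openTimes T) hS.ϱ_C1).mono (prod_mono hsub subset_rfl)
  obtain ⟨-, h⟩ := integral_sub_eq_integral_deriv (F := fun t x => ϱ t x * ψ x)
    (F' := fun t x => dt ϱ t x * ψ x) (B := (K * K + L * K) * n2 ψ) hab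
    (fun t ht => integrable_mul_l2 (hS.h1C1 (hsub ht)).mem hψ2)
    (fun t ht x => (hS.hasDerivAt_ϱ (hsub ht) x).mul_const (ψ x))
    (hϱtc.mul (hψ.continuous.comp continuous_snd).continuousOn)
    (fun t ht => integrable_mul_l2 (hϱt t ht).1 hψ2) fun t ht => by
      simp only [abs_mul]
      exact (integral_norm_mul_le (hϱt t ht).1 hψ2).trans
        (mul_le_mul_of_nonneg_right (hϱt t ht).2 (n2_nonneg _))
  have h1 : ∫ x, (ϱ b x - ϱ a x) * ψ x = ∫ t in a..b, ∫ x, dt ϱ t x * ψ x := by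
    rw [← h, ← integral_sub (integrable_mul_l2 (hS.h1C1 hb).mem hψ2)
      (integrable_mul_l2 (hS.h1C1 ha).mem hψ2)]
    simp only [sub_mul]
  rw [h1, mul_comm (b - a), ← abs_of_nonneg (sub_nonneg.2 hab)]
  refine intervalIntegral.norm_integral_le_of_norm_le_const
    (f := fun t => ∫ x, dt ϱ t x * ψ x) fun t ht => ?_
  rw [uIoc_of_le hab] at ht
  have ht' := Ioc_subset_Icc_self ht
  have hs := hsl t (hsub ht')
  -- The derivative is moved from the density to ψ, after which the density enters only through its
  -- bound β; no norm of ∇ϱ appears in the result.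
  have h2 : ∫ x, dt ϱ t x * ψ x = ∫ x, (ϱ t x + ρbar (x 2)) * fderiv ℝ ψ x (u t x) := by
    have h3 := hs.integral_transport hα hψ hψ2 (hB t ht').1 (hK t ht').2.2.2.2.2.2.2
    rw [← neg_eq_iff_eq_neg] at h3
    rw [← h3, ← integral_neg]
    refine integral_congr_ae (Eventually.of_forall fun x => ?_)
    simp only [hS.dt_ϱ_eq hρ (hsub ht'), hs.fderiv_density]
    ring
  rw [h2, Real.norm_eq_abs]
  refine (abs_integral_le_of_le ((hB t ht').1.const_mul β) fun x => ?_).trans ?_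
  · rw [abs_mul]
    refine mul_le_mul (hs.norm_density_le hα x) ?_ (abs_nonneg _) hβ
    rw [mul_comm, ← Real.norm_eq_abs]
    exact ContinuousLinearMap.le_opNorm _ _
  · rw [integral_const_mul]
    exact mul_le_mul_of_nonneg_left (hB t ht').2 hβ

end IsClassicalSolution

/-! ### The difference of two states of the flow -/

lemma fderiv_inner_apply' {V w : R3 → R3} {x : R3} (hV : DifferentiableAt ℝ V x)
    (hw : DifferentiableAt ℝ w x) (z : R3) :
    fderiv ℝ (fun x => inner ℝ (V x) (w x)) x z
      = inner ℝ (V x) (fderiv ℝ w x z) + inner ℝ (fderiv ℝ V x z) (w x) :=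
  fderiv_inner_apply ℝ hV hw z

lemma norm_fderiv_inner_le {V w : R3 → R3} {x : R3} (hV : DifferentiableAt ℝ V x)
    (hw : DifferentiableAt ℝ w x) :
    ‖fderiv ℝ (fun x => inner ℝ (V x) (w x)) x‖
      ≤ ‖fderiv ℝ V x‖ * ‖w x‖ + ‖V x‖ * ‖fderiv ℝ w x‖ := by
  refine ContinuousLinearMap.opNorm_le_bound _ (by positivity) fun z => ?_
  rw [fderiv_inner_apply' hV hw]
  have h1 := norm_inner_le_norm (𝕜 := ℝ) (V x) (fderiv ℝ w x z)
  have h2 := norm_inner_le_norm (𝕜 := ℝ) (fderiv ℝ V x z) (w x)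
  have h3 := mul_le_mul_of_nonneg_left (ContinuousLinearMap.le_opNorm (fderiv ℝ w x) z)
    (norm_nonneg (V x))
  have h4 := mul_le_mul_of_nonneg_right (ContinuousLinearMap.le_opNorm (fderiv ℝ V x) z)
    (norm_nonneg (w x))
  refine (norm_add_le _ _).trans ?_
  linarith

lemma conv_sub {u u' : R3 → R3} (hu : Differentiable ℝ u) (hu' : Differentiable ℝ u') (x : R3) :
    conv u' x - conv u x = fderiv ℝ (fun y => u' y - u y) x (u' x)
      + fderiv ℝ u x (u' x - u x) := by
  rw [conv, conv, show (fun y => u' y - u y) = u' - u from rfl, fderiv_sub (hu' x) (hu x)]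
  simp

lemma lap_sub {u u' : R3 → R3} (hu : ContDiff ℝ 2 u) (hu' : ContDiff ℝ 2 u') (x : R3) :
    lap (fun y => u' y - u y) x = lap u' x - lap u x := by
  have hd : ∀ {w : R3 → R3}, ContDiff ℝ 2 w → Differentiable ℝ w := fun h =>
    h.differentiable (by norm_num)
  have hd' : ∀ {w : R3 → R3}, ContDiff ℝ 2 w → ∀ i, Differentiable ℝ (pd i w) := fun h i =>
    (contDiff_pd h i).differentiable (by norm_num)
  simp only [lap, ← Finset.sum_sub_distrib]
  refine Finset.sum_congr rfl fun i _ => ?_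
  rw [pd_sub (hd hu') (hd hu), pd_sub (hd' hu' i) (hd' hu i)]

namespace Slice

variable {μ g α β : ℝ} {ρbar : ℝ → ℝ} {ϱ ϱ' : R3 → ℝ} {u v u' v' : R3 → R3} {q q' : R3 → ℝ}

/-- Energy identity for the difference of two states of the same flow. -/
lemma difference_identity (h : Slice μ g α β ρbar ϱ u v q) (h' : Slice μ g α β ρbar ϱ' u' v' q')
    (hg : 0 < g) (hα : 0 < α) {w : R3 → R3} (hw : w = fun x => u' x - u x) {K : ℝ}
    (hK : ∀ x, ‖u x‖ ≤ K) (hK' : ∀ x, ‖u' x‖ ≤ K) :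
    ∫ x, (2 * ((ϱ' x + ρbar (x 2)) * inner ℝ (w x) (v' x - v x))
        - fderiv ℝ (fun y => ϱ' y + ρbar (y 2)) x (u' x) * inner ℝ (w x) (w x))
      = -2 * μ * gr w - 2 * (∫ x, (ϱ' x - ϱ x) * inner ℝ (v x) (w x))
        - 2 * (∫ x, (ϱ' x - ϱ x) * inner ℝ (conv u x) (w x))
        - 2 * (∫ x, (ϱ' x - ϱ x) * (g * w x 2))
        - 2 * ∫ x, (ϱ' x + ρbar (x 2)) * inner ℝ (fderiv ℝ u x (w x)) (w x) := by
  have hK0 : 0 ≤ K := (norm_nonneg _).trans (hK 0)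
  have hβ : 0 ≤ β := (abs_nonneg _).trans (h.abs_le 0)
  have hwH : H2C2 w := by rw [hw]; exact h'.u_H2.sub h.u_H2
  have hwK : ∀ x, ‖w x‖ ≤ 2 * K := fun x => by
    rw [hw]
    exact (norm_sub_le _ _).trans (by linarith [hK x, hK' x])
  have hR := h'.density_continuous
  have hwc := hwH.c2.continuous
  have hδc : Continuous fun x => ϱ' x - ϱ x := h'.ϱ_H1.c1.continuous.sub h.ϱ_H1.c1.continuous
  have hδ : ∀ x, ‖ϱ' x - ϱ x‖ ≤ 2 * β := fun x =>
    (norm_sub_le _ _).trans (by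
      have h1 := h.abs_le x
      have h2 := h'.abs_le x
      rw [Real.norm_eq_abs, Real.norm_eq_abs]
      linarith)
  have hdw : Continuous fun x => fderiv ℝ w x (u' x) :=
    (hwH.h1.c1.continuous_fderiv (by norm_num)).clm_apply h'.u_H2.c2.continuous
  have hduw : Continuous fun x => fderiv ℝ u x (w x) :=
    (h.u_H2.h1.c1.continuous_fderiv (by norm_num)).clm_apply hwc
  have hdv : MemLp (fun x => v' x - v x) 2 := memLp_fun_sub h'.v_mem h.v_mem
  -- integrability
  have i1 : Integrable fun x => (ϱ' x + ρbar (x 2)) * inner ℝ (w x) (v' x - v x) := by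
    refine integrable_of_le_mul β (hR.mul (hwc.inner (h'.v_cont.sub h.v_cont))).aestronglyMeasurable
      hwH.h1.mem hdv fun x => ?_
    rw [norm_mul]
    exact mul_le_mul (h'.norm_density_le hα x) (norm_inner_le_norm _ _) (norm_nonneg _) hβ
  have i2 : Integrable fun x => (ϱ' x + ρbar (x 2)) * inner ℝ (fderiv ℝ w x (u' x)) (w x) := by
    refine integrable_of_le_mul (β * K) (hR.mul (hdw.inner hwc)).aestronglyMeasurable
      hwH.h1.memD hwH.h1.mem fun x => ?_
    rw [norm_mul, mul_assoc]
    refine mul_le_mul (h'.norm_density_le hα x) ?_ (norm_nonneg _) hβ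
    refine (norm_inner_le_norm _ _).trans ?_
    rw [← mul_assoc]
    refine mul_le_mul_of_nonneg_right ?_ (norm_nonneg _)
    rw [mul_comm]
    exact (ContinuousLinearMap.le_opNorm _ _).trans
      (mul_le_mul_of_nonneg_left (hK' x) (norm_nonneg _))
  have i3 : Integrable fun x => (ϱ' x + ρbar (x 2)) * inner ℝ (fderiv ℝ u x (w x)) (w x) := by
    refine integrable_of_le_mul (β * (2 * K)) (hR.mul (hduw.inner hwc)).aestronglyMeasurable
      h.u_H2.h1.memD hwH.h1.mem fun x => ?_
    rw [norm_mul, mul_assoc]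
    refine mul_le_mul (h'.norm_density_le hα x) ?_ (norm_nonneg _) hβ
    refine (norm_inner_le_norm _ _).trans ?_
    rw [← mul_assoc]
    refine mul_le_mul_of_nonneg_right ?_ (norm_nonneg _)
    rw [mul_comm]
    exact (ContinuousLinearMap.le_opNorm _ _).trans
      (mul_le_mul_of_nonneg_left (hwK x) (norm_nonneg _))
  have i4 : ∀ V : R3 → R3, Continuous V → MemLp V 2 →
      Integrable fun x => (ϱ' x - ϱ x) * inner ℝ (V x) (w x) := fun V hV hV2 => by
    refine integrable_of_le_mul (2 * β) (hδc.mul (hV.inner hwc)).aestronglyMeasurable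
      hV2 hwH.h1.mem fun x => ?_
    rw [norm_mul]
    exact mul_le_mul (hδ x) (norm_inner_le_norm _ _) (norm_nonneg _) (by positivity)
  have i5 : Integrable fun x => (ϱ' x - ϱ x) * (g * w x 2) :=
    integrable_mul_l2 (h'.ϱ_H1.sub h.ϱ_H1).mem ((hwH.h1.coord 2).mem.const_mul g)
  have i6 := i4 v h.v_cont h.v_mem
  have i7 := i4 (conv u) (continuous_conv h.u_H2.h1.c1) h.memLp_conv
  -- transport
  have hψ : ContDiff ℝ 1 fun x => inner ℝ (w x) (w x) := hwH.h1.c1.inner ℝ hwH.h1.c1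
  have hdiff := hwH.h1.diff
  have ht := h'.integral_transport hα hψ
    (memLp_n2_of_le (by positivity : 0 ≤ 2 * K) hwH.h1.mem hψ.continuous.aestronglyMeasurable
      fun x => (norm_inner_le_norm _ _).trans
        (mul_le_mul_of_nonneg_right (hwK x) (norm_nonneg _))).1
    (integrable_of_le_mul (2 * K) (h'.u_H2.c2.continuous.norm.mul
      (hψ.continuous_fderiv (by norm_num)).norm).aestronglyMeasurable hwH.h1.memD hwH.h1.mem
      fun x => by
        rw [norm_mul, norm_norm, norm_norm]
        have h1 := norm_fderiv_inner_le (hdiff x) (hdiff x)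
        have h2 := mul_le_mul (hK' x) h1 (norm_nonneg _) hK0
        linarith) hK'
  have i8 : Integrable fun x => (ϱ' x + ρbar (x 2)) * fderiv ℝ (fun x => inner ℝ (w x) (w x)) x
      (u' x) := by
    refine (i2.const_mul 2).congr (Eventually.of_forall fun x => ?_)
    simp only [fderiv_inner_apply' (hdiff x) (hdiff x), real_inner_comm (w x)]
    ring
  -- This is what cancels twice the convective term (ϱ' + ρ̄)⟨(u'·∇)w, w⟩ in the final identity.
  have ht2 : ∫ x, fderiv ℝ (fun y => ϱ' y + ρbar (y 2)) x (u' x) * inner ℝ (w x) (w x)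
      = -2 * ∫ x, (ϱ' x + ρbar (x 2)) * inner ℝ (fderiv ℝ w x (u' x)) (w x) := by
    rw [ht, ← integral_const_mul, ← integral_neg]
    refine integral_congr_ae (Eventually.of_forall fun x => ?_)
    simp only [fderiv_inner_apply' (hdiff x) (hdiff x), real_inner_comm (w x)]
    ring
  have i9 : Integrable fun x =>
      fderiv ℝ (fun y => ϱ' y + ρbar (y 2)) x (u' x) * inner ℝ (w x) (w x) := by
    obtain ⟨L, hL0, hL⟩ := h'.profile.exists_bound
    refine integrable_of_le_mul (f := fun x => K * ‖fderiv ℝ ϱ' x‖ + L * ‖u' x‖) (g := w) (2 * K)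
      (((h'.density_contDiff.continuous_fderiv (by norm_num)).clm_apply
        h'.u_H2.c2.continuous).mul (hwc.inner hwc)).aestronglyMeasurable
      (memLp_fun_add (h'.ϱ_H1.memD.norm.const_mul K) (h'.u_H2.h1.mem.norm.const_mul L))
      hwH.h1.mem fun x => ?_
    rw [norm_mul, Real.norm_of_nonneg
      (show 0 ≤ K * ‖fderiv ℝ ϱ' x‖ + L * ‖u' x‖ by positivity)]
    have h1 : ‖fderiv ℝ (fun y => ϱ' y + ρbar (y 2)) x (u' x)‖
        ≤ K * ‖fderiv ℝ ϱ' x‖ + L * ‖u' x‖ := by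
      refine (ContinuousLinearMap.le_opNorm _ _).trans ?_
      have h1 := mul_le_mul_of_nonneg_right (h'.norm_fderiv_density_le hL x) (norm_nonneg (u' x))
      have h2 := mul_le_mul_of_nonneg_left (hK' x) (norm_nonneg (fderiv ℝ ϱ' x))
      linarith
    have h2 : ‖inner ℝ (w x) (w x)‖ ≤ 2 * K * ‖w x‖ := (norm_inner_le_norm _ _).trans
      (mul_le_mul_of_nonneg_right (hwK x) (norm_nonneg _))
    have h3 := mul_le_mul h1 h2 (norm_nonneg _) (by positivity)
    linarith
  -- pressure
  have hp : ∫ x, inner ℝ (gradient q' x - gradient q x) (w x) = 0 := by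
    have hdw0 : ∀ x, dvg w x = 0 := by
      rw [hw]
      exact dvg_sub h'.u_H2.h1.diff h.u_H2.h1.diff h'.div_free h.div_free
    have h1 := integral_inner_gradient_eq_zero h'.q_C1 (h'.memLp_gradient hg hα) hwH.h1 hdw0
    have h2 := integral_inner_gradient_eq_zero h.q_C1 (h.memLp_gradient hg hα) hwH.h1 hdw0
    simp only [inner_sub_left]
    rw [integral_sub (integrable_inner' (h'.memLp_gradient hg hα) hwH.h1.mem)
      (integrable_inner' (h.memLp_gradient hg hα) hwH.h1.mem), h1, h2, sub_zero]
  have ip : Integrable fun x => inner ℝ (gradient q' x - gradient q x) (w x) :=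
    integrable_inner' (memLp_fun_sub (h'.memLp_gradient hg hα) (h.memLp_gradient hg hα)) hwH.h1.mem
  have il := integrable_inner' hwH.h1.mem (memLp_lap hwH)
  have hlap : ∫ x, inner ℝ (w x) (lap w x) = - gr w := by
    rw [integral_inner_lap hwH.h1 hwH, hwH.h1.gr_eq]
  -- Subtraction of the two momentum equations, arranged so that v' - v and the convective
  -- differences carry the later density, while ϱ' - ϱ multiplies only the earlier v and convective
  -- term, and gravity.
  have hpt : ∀ x, (ϱ' x + ρbar (x 2)) * inner ℝ (w x) (v' x - v x)
      = μ * inner ℝ (w x) (lap w x) - inner ℝ (gradient q' x - gradient q x) (w x)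
        - (ϱ' x + ρbar (x 2)) * inner ℝ (fderiv ℝ w x (u' x)) (w x)
        - (ϱ' x + ρbar (x 2)) * inner ℝ (fderiv ℝ u x (w x)) (w x)
        - (ϱ' x - ϱ x) * inner ℝ (v x) (w x) - (ϱ' x - ϱ x) * inner ℝ (conv u x) (w x)
        - (ϱ' x - ϱ x) * (g * w x 2) := fun x => by
    have h1 : conv u' x = conv u x + fderiv ℝ w x (u' x) + fderiv ℝ u x (w x) := by
      have := conv_sub h.u_H2.h1.diff h'.u_H2.h1.diff x
      rw [← hw] at this
      have hwx : u' x - u x = w x := by rw [hw]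
      rw [hwx, sub_eq_iff_eq_add] at this
      rw [this]
      abel
    have h2 : lap w x = lap u' x - lap u x := by
      rw [hw]
      exact lap_sub h.u_H2.c2 h'.u_H2.c2 x
    have h3 : inner ℝ (w x) (e 2) = w x 2 := by
      rw [e, EuclideanSpace.inner_single_right]
      simp
    rw [h.gradient_eq, h'.gradient_eq, h2, force, force, h1, ← h3]
    simp only [real_inner_comm (w x), inner_sub_right, inner_add_right, real_inner_smul_right]
    ring
  have hI1 : ∫ x, (ϱ' x + ρbar (x 2)) * inner ℝ (w x) (v' x - v x)
      = - μ * gr w - (∫ x, (ϱ' x + ρbar (x 2)) * inner ℝ (fderiv ℝ w x (u' x)) (w x))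
        - (∫ x, (ϱ' x + ρbar (x 2)) * inner ℝ (fderiv ℝ u x (w x)) (w x))
        - (∫ x, (ϱ' x - ϱ x) * inner ℝ (v x) (w x))
        - (∫ x, (ϱ' x - ϱ x) * inner ℝ (conv u x) (w x))
        - ∫ x, (ϱ' x - ϱ x) * (g * w x 2) := by
    rw [integral_congr_ae (Eventually.of_forall hpt), integral_sub _ i5, integral_sub _ i7,
      integral_sub _ i6, integral_sub _ i3, integral_sub _ i2, integral_sub (il.const_mul μ) ip, hp,
      integral_const_mul, hlap]
    · ring
    · exact (il.const_mul μ).sub ip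
    · exact ((il.const_mul μ).sub ip).sub i2
    · exact (((il.const_mul μ).sub ip).sub i2).sub i3
    · exact ((((il.const_mul μ).sub ip).sub i2).sub i3).sub i6
    · exact (((((il.const_mul μ).sub ip).sub i2).sub i3).sub i6).sub i7
  rw [integral_sub (i1.const_mul 2) i9, ht2, integral_const_mul, hI1]
  ring

end Slice

/-! ### The convective term in H¹ -/

lemma exists_sobolev_fderiv : ∃ S : ℝ, 0 ≤ S ∧ ∀ u : R3 → R3, H2C2 u →
    MemLp (fderiv ℝ u) 6 ∧ n6 (fderiv ℝ u) ≤ S * √(hs u) :=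
  ⟨_, sobC_nonneg, fun _ hu => hu.sobolev_fderiv⟩

lemma contDiff_conv {u : R3 → R3} (hu : ContDiff ℝ 2 u) : ContDiff ℝ 1 (conv u) :=
  (hu.fderiv_right (m := 1) (by norm_num)).clm_apply (hu.of_le (by norm_num))

lemma norm_fderiv_conv_le {u : R3 → R3} (hu : ContDiff ℝ 2 u) (x : R3) :
    ‖fderiv ℝ (conv u) x‖
      ≤ ‖u x‖ * ‖fderiv ℝ (fderiv ℝ u) x‖ + ‖fderiv ℝ u x‖ * ‖fderiv ℝ u x‖ := by
  have hDu : ContDiff ℝ 1 (fderiv ℝ u) := hu.fderiv_right (by norm_num)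
  have hd : Differentiable ℝ u := hu.differentiable (by norm_num)
  have h3 := ((hDu.differentiable (by norm_num) x).hasFDerivAt.clm_apply (hd x).hasFDerivAt).fderiv
  change fderiv ℝ (conv u) x = _ at h3
  rw [h3]
  refine (norm_add_le _ _).trans ?_
  rw [add_comm]
  refine add_le_add ?_ (ContinuousLinearMap.opNorm_comp_le _ _)
  refine (ContinuousLinearMap.le_opNorm _ _).trans ?_
  rw [ContinuousLinearMap.opNorm_flip, mul_comm]

lemma exists_norm_majorant {G : Type*} [NormedAddCommGroup G] {f : R3 → G} (hf : MemLp f 2) :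
    ∃ d : R3 → ℝ, MemLp d 2 ∧ n2 d = n2 f ∧ ∀ x, 0 ≤ d x ∧ ‖f x‖ ≤ d x :=
  ⟨fun x => ‖f x‖, hf.norm, congrArg ENNReal.toReal (eLpNorm_norm f),
    fun _ => ⟨norm_nonneg _, le_rfl⟩⟩

lemma H2C2.exists_hessian_majorant {u : R3 → R3} (hu : H2C2 u) : ∃ d : R3 → ℝ, MemLp d 2 ∧
    n2 d ≤ √(hs u) ∧ ∀ x, 0 ≤ d x ∧
      ‖fderiv ℝ (conv u) x‖ ≤ ‖u x‖ * d x + ‖fderiv ℝ u x‖ * ‖fderiv ℝ u x‖ := by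
  obtain ⟨d, d1, d2, d3⟩ := exists_norm_majorant (f := fderiv ℝ (fderiv ℝ u)) hu.memDD
  have h1 := hu.n2_fderiv2_sq_le_hs
  rw [← d2] at h1
  refine ⟨d, d1, Real.le_sqrt_of_sq_le h1, fun x => ⟨(d3 x).1,
    (norm_fderiv_conv_le hu.c2 x).trans ?_⟩⟩
  have := mul_le_mul_of_nonneg_left (d3 x).2 (norm_nonneg (u x))
  exact add_le_add this le_rfl

/-- The derivative of (u·∇)u consists of u·∇²u, where u is bounded, and of a product of two factors
∇u, handled by the L²–L⁶ product estimate. An H¹ bound is required because the convective term is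
tested against density increments. -/
lemma exists_conv_h1_bound : ∃ C : ℝ, 0 < C ∧ ∀ u : R3 → R3, H2C2 u → H1C1 (conv u) ∧
    n2 (conv u) ≤ C * (gr u + hs u) ∧ n2 (fderiv ℝ (conv u)) ≤ C * (gr u + hs u) := by
  obtain ⟨C, hC, hsup⟩ := exists_sup_le
  obtain ⟨S, hS, hSob⟩ := exists_sobolev_fderiv
  refine ⟨C + (S ^ 3 + 1), by positivity, fun u hu => ?_⟩
  obtain ⟨h1, h2⟩ := hSob u hu
  obtain ⟨d, d1, d2, d3⟩ := hu.exists_hessian_majorant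
  have hc := contDiff_conv hu.c2
  have hDc := hu.h1.c1.continuous_fderiv (by norm_num)
  obtain ⟨E, hE0, hE⟩ : ∃ E, 0 ≤ E ∧ E ^ 2 = gr u + hs u :=
    ⟨_, Real.sqrt_nonneg _, Real.sq_sqrt (add_nonneg (gr_nonneg u) (hs_nonneg u))⟩
  have hgE : √(gr u) ≤ E := Real.sqrt_le_iff.2 ⟨hE0, by linarith [hs_nonneg u]⟩
  have hhE : √(hs u) ≤ E := Real.sqrt_le_iff.2 ⟨hE0, by linarith [gr_nonneg u]⟩
  have hsup : ∀ x, ‖u x‖ ≤ C * E := fun x => by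
    have := hsup u hu x
    rwa [← hE, Real.sqrt_sq hE0] at this
  rw [← hE]
  have hCE : 0 ≤ C * E := by positivity
  have hm := memLp_n2_of_le (f := conv u) hCE hu.memD hc.continuous.aestronglyMeasurable fun x => by
    rw [mul_comm]
    exact (ContinuousLinearMap.le_opNorm _ _).trans
      (mul_le_mul_of_nonneg_left (hsup x) (norm_nonneg _))
  obtain ⟨m1, m2⟩ := memLp_n2_mul (h := fun x => ‖fderiv ℝ u x‖ * ‖fderiv ℝ u x‖) zero_le_one h1
    hu.memD h1 (hDc.norm.mul hDc.norm).aestronglyMeasurable fun x => by simp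
  have m3 : MemLp (fun x => C * E * d x) 2 := d1.const_mul _
  obtain ⟨m4, m5⟩ := memLp_n2_of_le zero_le_one (memLp_fun_add m3 m1)
    (hc.continuous_fderiv (by norm_num)).aestronglyMeasurable (fun x => by
      rw [one_mul, Real.norm_of_nonneg (by have := (d3 x).1; positivity)]
      refine (d3 x).2.trans ?_
      have := (d3 x).1
      gcongr
      exact hsup x)
  have hn1 : n2 (fderiv ℝ u) ≤ E := hu.n2_fderiv_le.trans hgE
  have hn6 : n6 (fderiv ℝ u) ≤ S * E := h2.trans (mul_le_mul_of_nonneg_left hhE hS)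
  refine ⟨⟨hc, hm.1, m4⟩, ?_, ?_⟩
  · have h5 : 0 ≤ (S ^ 3 + 1) * E ^ 2 := by positivity
    have h6 : n2 (conv u) ≤ C * E * E := hm.2.trans (mul_le_mul_of_nonneg_left hn1 hCE)
    linarith
  · have h5 : n2 (fun x => ‖fderiv ℝ u x‖ * ‖fderiv ℝ u x‖) ≤ (S ^ 3 + 1) * E ^ 2 := by
      refine le_of_sq_le_sq ?_ (by positivity)
      have h6 := n6_nonneg (fderiv ℝ u)
      have h7 := n2_nonneg (fderiv ℝ u)
      calc _ ≤ 1 ^ 2 * (n6 (fderiv ℝ u) ^ 2 * (n2 (fderiv ℝ u) * n6 (fderiv ℝ u))) := m2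
        _ ≤ 1 ^ 2 * ((S * E) ^ 2 * (E * (S * E))) := by gcongr
        _ = S ^ 3 * (E ^ 2) ^ 2 := by ring
        _ ≤ (S ^ 3 + 1) ^ 2 * (E ^ 2) ^ 2 :=
          mul_le_mul_of_nonneg_right (by nlinarith [pow_nonneg hS 3]) (sq_nonneg _)
        _ = _ := by ring
    have h6 : n2 (fun x => C * E * d x) ≤ C * E * E := by
      rw [n2_mul_const_left, abs_of_nonneg hCE]
      exact mul_le_mul_of_nonneg_left (d2.trans hhE) hCE
    have h7 := n2_add_le m3 m1
    linarith

/-! ### Density increments against products -/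

namespace IsClassicalSolution

variable {μ g : ℝ} {ρbar : ℝ → ℝ} {T : EReal} {ϱ₀ : R3 → ℝ} {u₀ : R3 → R3} {ϱ : ℝ → R3 → ℝ}
  {u : ℝ → R3 → R3} {q : ℝ → R3 → ℝ} (hS : IsClassicalSolution μ g ρbar T ϱ₀ u₀ ϱ u q)
include hS

/-- The negative-norm estimate with ψ = ⟨V, w⟩: the product rule lets the derivative fall on either
factor. -/
lemma abs_increment_inner_le {α β : ℝ} (hα : 0 < α)
    (hsl : ∀ t ∈ openTimes T, Slice μ g α β ρbar (ϱ t) (u t) (dt u t) (q t)) {a b : ℝ}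
    (ha : a ∈ openTimes T) (hb : b ∈ openTimes T) (hab : a ≤ b) {V w : R3 → R3} (hV : H1C1 V)
    (hw : H1C1 w) {K U : ℝ} (hK : ∀ x, ‖w x‖ ≤ K) (hU : ∀ s ∈ Icc a b, ∀ x, ‖u s x‖ ≤ U) :
    |∫ x, (ϱ b x - ϱ a x) * inner ℝ (V x) (w x)|
      ≤ (b - a) * (β * (U * (n2 (fderiv ℝ V) * n2 w + n2 V * n2 (fderiv ℝ w)))) := by
  have hU0 : 0 ≤ U := (norm_nonneg _).trans (hU a (left_mem_Icc.2 hab) 0)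
  have hK0 : 0 ≤ K := (norm_nonneg _).trans (hK 0)
  have hψ : ContDiff ℝ 1 fun x => inner ℝ (V x) (w x) := hV.c1.inner ℝ hw.c1
  have i1 := integrable_norm_mul hV.memD hw.mem
  have i2 := integrable_norm_mul hV.mem hw.memD
  refine hS.abs_integral_increment_le hα hsl ha hb hab hψ
    (memLp_n2_of_le hK0 hV.mem hψ.continuous.aestronglyMeasurable fun x => by
      rw [mul_comm]
      exact (norm_inner_le_norm _ _).trans
        (mul_le_mul_of_nonneg_left (hK x) (norm_nonneg _))).1 fun s hs => ?_
  have hle : ∀ x, ‖u s x‖ * ‖fderiv ℝ (fun x => inner ℝ (V x) (w x)) x‖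
      ≤ U * (‖fderiv ℝ V x‖ * ‖w x‖ + ‖V x‖ * ‖fderiv ℝ w x‖) := fun x =>
    mul_le_mul (hU s hs x) (norm_fderiv_inner_le (hV.diff x) (hw.diff x)) (norm_nonneg _) hU0
  have huc := (hS.h2C2 (Icc_subset_openTimes ha hb hs)).c2.continuous
  have i3 := (i1.add i2).const_mul U
  have i4 : Integrable fun x => ‖u s x‖ * ‖fderiv ℝ (fun x => inner ℝ (V x) (w x)) x‖ :=
    i3.mono' (huc.norm.mul (hψ.continuous_fderiv (by norm_num)).norm).aestronglyMeasurable
      (Eventually.of_forall fun x => by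
        rw [Real.norm_of_nonneg (by positivity)]
        exact hle x)
  refine ⟨i4, (integral_mono i4 i3 hle).trans ?_⟩
  simp only [Pi.add_apply]
  rw [integral_const_mul, integral_add i1 i2]
  exact mul_le_mul_of_nonneg_left (add_le_add (integral_norm_mul_le hV.memD hw.mem)
    (integral_norm_mul_le hV.mem hw.memD)) hU0

/-- The case V = u_t, with only a weak gradient. The estimate holds for mollifications of V, and
|ϱ(b) - ϱ(a)| ≤ 2β lets their L² convergence carry it to V. -/
lemma abs_increment_inner_le_of_gradSq {α β : ℝ} (hα : 0 < α)
    (hsl : ∀ t ∈ openTimes T, Slice μ g α β ρbar (ϱ t) (u t) (dt u t) (q t)) {a b : ℝ}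
    (ha : a ∈ openTimes T) (hb : b ∈ openTimes T) (hab : a ≤ b) {V w : R3 → R3}
    (hVc : Continuous V) (hV : MemLp V 2) {G : ℝ} (hG0 : 0 ≤ G)
    (hG : gradSq V ≤ ENNReal.ofReal (G ^ 2))
    (hw : H1C1 w) {K U : ℝ} (hK : ∀ x, ‖w x‖ ≤ K) (hU : ∀ s ∈ Icc a b, ∀ x, ‖u s x‖ ≤ U) :
    |∫ x, (ϱ b x - ϱ a x) * inner ℝ (V x) (w x)|
      ≤ (b - a) * (β * (U * (G * n2 w + n2 V * n2 (fderiv ℝ w)))) := by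
  have hU0 : 0 ≤ U := (norm_nonneg _).trans (hU a (left_mem_Icc.2 hab) 0)
  have hβ : 0 ≤ β := (abs_nonneg _).trans ((hsl a ha).abs_le 0)
  have hGt := hG.trans_lt ENNReal.ofReal_lt_top
  have hmo := fun n => h1C1_moll (bump n) hVc hV hGt
  have hδ : ∀ x, ‖ϱ b x - ϱ a x‖ ≤ 2 * β := fun x =>
    (norm_sub_le _ _).trans (by
      have h1 := (hsl a ha).abs_le x
      have h2 := (hsl b hb).abs_le x
      rw [Real.norm_eq_abs, Real.norm_eq_abs]
      linarith)
  have hδc : Continuous fun x => ϱ b x - ϱ a x :=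
    (hS.h1C1 hb).c1.continuous.sub (hS.h1C1 ha).c1.continuous
  have hle : ∀ V : R3 → R3, ∀ x, ‖(ϱ b x - ϱ a x) * inner ℝ (V x) (w x)‖
      ≤ 2 * β * (‖V x‖ * ‖w x‖) := fun V x => by
    rw [norm_mul]
    exact mul_le_mul (hδ x) (norm_inner_le_norm _ _) (norm_nonneg _) (by positivity)
  have hint : ∀ V : R3 → R3, Continuous V → MemLp V 2 →
      Integrable fun x => (ϱ b x - ϱ a x) * inner ℝ (V x) (w x) := fun V hVc hV =>
    integrable_of_le_mul (2 * β) (hδc.mul (hVc.inner hw.c1.continuous)).aestronglyMeasurable hV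
      hw.mem (hle V)
  have hlim := (tendsto_n2_moll_sub hVc hV hGt).mul_const (2 * β * n2 w)
  rw [zero_mul] at hlim
  have hlim2 := hlim.add_const ((b - a) * (β * (U * (G * n2 w + n2 V * n2 (fderiv ℝ w)))))
  rw [zero_add] at hlim2
  refine ge_of_tendsto' hlim2 fun n => ?_
  obtain ⟨h1, h2, h3⟩ := hmo n
  have h4 := hS.abs_increment_inner_le hα hsl ha hb hab h1 hw hK hU
  have h5 : n2 (fderiv ℝ (moll (bump n) V)) ≤ G := by
    refine le_of_sq_le_sq (h1.n2_fderiv_sq_le_gr.trans (h3.trans ?_)) hG0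
    exact ENNReal.toReal_le_of_le_ofReal (sq_nonneg _) hG
  have h6 : (∫ x, (ϱ b x - ϱ a x) * inner ℝ (moll (bump n) V x) (w x))
      - ∫ x, (ϱ b x - ϱ a x) * inner ℝ (V x) (w x)
      = ∫ x, (ϱ b x - ϱ a x) * inner ℝ (moll (bump n) V x - V x) (w x) := by
    rw [← integral_sub (hint _ h1.c1.continuous h1.mem) (hint _ hVc hV)]
    simp only [inner_sub_left, mul_sub]
  have h7 := abs_integral_le_n2_mul (by positivity) (memLp_fun_sub h1.mem hV) hw.mem
    (hle fun x => moll (bump n) V x - V x)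
  rw [← h6] at h7
  have h8 : (b - a) * (β * (U * (n2 (fderiv ℝ (moll (bump n) V)) * n2 w
      + n2 (moll (bump n) V) * n2 (fderiv ℝ w))))
      ≤ (b - a) * (β * (U * (G * n2 w + n2 V * n2 (fderiv ℝ w)))) := by
    have := sub_nonneg.2 hab
    have := n2_nonneg w
    have := n2_nonneg (fderiv ℝ w)
    gcongr
  have h9 := abs_sub_abs_le_abs_sub (∫ x, (ϱ b x - ϱ a x) * inner ℝ (V x) (w x))
    (∫ x, (ϱ b x - ϱ a x) * inner ℝ (moll (bump n) V x) (w x))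
  rw [abs_sub_comm] at h9
  linarith

lemma abs_increment_coord_le {α β : ℝ} (hα : 0 < α)
    (hsl : ∀ t ∈ openTimes T, Slice μ g α β ρbar (ϱ t) (u t) (dt u t) (q t)) {a b : ℝ}
    (ha : a ∈ openTimes T) (hb : b ∈ openTimes T) (hab : a ≤ b) {w : R3 → R3} (hw : H1C1 w)
    (hg : 0 < g) {M : ℝ} (hM : ∀ s ∈ Icc a b, n2 (u s) ≤ M) :
    |∫ x, (ϱ b x - ϱ a x) * (g * w x 2)| ≤ (b - a) * (β * (M * (g * n2 (fderiv ℝ w)))) := by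
  have hψ : H1C1 fun x => g * w x 2 := (hw.coord 2).smul g
  have hle : ∀ x, ‖fderiv ℝ (fun x => g * w x 2) x‖ ≤ g * ‖fderiv ℝ w x‖ := fun x => by
    have h1 : HasFDerivAt (fun x => w x 2)
        ((EuclideanSpace.proj (𝕜 := ℝ) (2 : Fin 3)).comp (fderiv ℝ w x)) x :=
      (EuclideanSpace.proj (𝕜 := ℝ) (2 : Fin 3)).hasFDerivAt.comp x (hw.diff x).hasFDerivAt
    rw [(h1.const_mul g).fderiv, norm_smul, Real.norm_of_nonneg hg.le]
    refine mul_le_mul_of_nonneg_left ?_ hg.le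
    refine ContinuousLinearMap.opNorm_le_bound _ (norm_nonneg _) fun z => ?_
    exact (PiLp.norm_apply_le (fderiv ℝ w x z) 2).trans (ContinuousLinearMap.le_opNorm _ _)
  obtain ⟨h1, h2⟩ := memLp_n2_of_le hg.le hw.memD hψ.memD.1 hle
  refine hS.abs_integral_increment_le hα hsl ha hb hab hψ.c1 hψ.mem fun s hs => ?_
  have hu := (hS.h2C2 (Icc_subset_openTimes ha hb hs)).mem
  exact ⟨integrable_norm_mul hu h1, (integral_norm_mul_le hu h1).trans
    (mul_le_mul (hM s hs) h2 (n2_nonneg _) ((n2_nonneg _).trans (hM s hs)))⟩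

end IsClassicalSolution

/-- Sobolev puts w in L⁶, controlled by ∇w, while ∇u lies in L² ∩ L⁶: exactly the setting of the
product estimate. -/
lemma exists_stretching_bound : ∃ B : ℝ, 0 < B ∧ ∀ u w : R3 → R3, H2C2 u → H1C1 w →
    MemLp (fun x => fderiv ℝ u x (w x)) 2 ∧
      n2 (fun x => fderiv ℝ u x (w x)) ≤ B * √(gr u + hs u) * √(gr w) := by
  obtain ⟨S, hS, hSob⟩ := exists_sobolev_const
  obtain ⟨S', hS', hSob'⟩ := exists_sobolev_fderiv
  refine ⟨S ^ 2 * S' + 1, by positivity, fun u w hu hw => ?_⟩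
  obtain ⟨h1, h2⟩ := hSob w hw
  obtain ⟨h3, h4⟩ := hSob' u hu
  obtain ⟨h5, h6⟩ := memLp_n2_mul (h := fun x => fderiv ℝ u x (w x)) zero_le_one h1 hu.memD h3
    ((hu.h1.c1.continuous_fderiv (by norm_num)).clm_apply hw.c1.continuous).aestronglyMeasurable
    fun x => by
      rw [one_mul, mul_comm]
      exact ContinuousLinearMap.le_opNorm _ _
  refine ⟨h5, ?_⟩
  obtain ⟨E, hE0, hE⟩ : ∃ E, 0 ≤ E ∧ √(gr u + hs u) = E := ⟨_, Real.sqrt_nonneg _, rfl⟩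
  have hgE : n2 (fderiv ℝ u) ≤ E :=
    hu.n2_fderiv_le.trans (hE ▸ Real.sqrt_le_sqrt (by linarith [hs_nonneg u]))
  have hhE : n6 (fderiv ℝ u) ≤ S' * E :=
    h4.trans (mul_le_mul_of_nonneg_left (hE ▸ Real.sqrt_le_sqrt (by linarith [gr_nonneg u])) hS')
  have hX := Real.sqrt_nonneg (gr w)
  have := n6_nonneg w
  have := n6_nonneg (fderiv ℝ u)
  have := n2_nonneg (fderiv ℝ u)
  rw [hE]
  refine le_of_sq_le_sq ?_ (by positivity)
  calc _ ≤ 1 ^ 2 * (n6 w ^ 2 * (n2 (fderiv ℝ u) * n6 (fderiv ℝ u))) := h6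
    _ ≤ 1 ^ 2 * ((S * √(gr w)) ^ 2 * (E * (S' * E))) := by gcongr
    _ = (S ^ 2 * S') * (E * √(gr w)) ^ 2 := by ring
    _ ≤ (S ^ 2 * S' + 1) ^ 2 * (E * √(gr w)) ^ 2 := by
      refine mul_le_mul_of_nonneg_right ?_ (sq_nonneg _)
      have : 0 ≤ S ^ 2 * S' := by positivity
      nlinarith
    _ = _ := by ring

/-! ### Estimates for the increment of the velocity -/

lemma difference_arith {h β M G X g Cs Cc A B n d v c c' f I₁ I₂ I₃ I₄ Y : ℝ} (hh : 0 ≤ h)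
    (hβ : 0 ≤ β) (hM0 : 0 ≤ M) (hM1 : M ≤ 1) (hG0 : 0 ≤ G) (hX0 : 0 ≤ X) (hg : 0 ≤ g)
    (hCs : 0 ≤ Cs) (hCc : 0 ≤ Cc) (hA : 0 ≤ A) (hB : 0 ≤ B) (hn0 : 0 ≤ n) (hd0 : 0 ≤ d)
    (hn : n ≤ h * M) (hd : d ≤ X) (hv : v ≤ M)
    (hc' : c' ≤ Cc * (A * M) ^ 2) (hc : c ≤ Cc * (A * M) ^ 2) (hf : f ≤ B * (A * M) * X)
    (h₁ : |I₁| ≤ h * (β * (Cs * (A * M) * (G * n + v * d))))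
    (h₂ : |I₂| ≤ h * (β * (Cs * (A * M) * (c' * n + c * d))))
    (h₃ : |I₃| ≤ h * (β * (M * (g * d)))) (h₄ : |I₄| ≤ β * (f * n)) :
    Y - 2 * I₁ - 2 * I₂ - 2 * I₃ - 2 * I₄
      ≤ Y + (2 * β * (Cs * A + Cs * A * (Cc * A ^ 2) + g + B * A) + 1)
        * (h ^ 2 * G * M ^ 2 + h * M * X + h ^ 2 * M ^ 2) := by
  -- Since M ≤ 1, surplus powers of M are discarded until only the three quantities of the
  -- conclusion remain.
  have hMM : M ^ 2 ≤ M := by nlinarith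
  have b1 : h * (β * (Cs * (A * M) * (G * n + v * d)))
      ≤ β * (Cs * A) * (h ^ 2 * G * M ^ 2 + h * M * X) := by
    calc _ ≤ h * (β * (Cs * (A * M) * (G * (h * M) + M * X))) := by gcongr
      _ = β * (Cs * A) * (h ^ 2 * G * M ^ 2 + h * M ^ 2 * X) := by ring
      _ ≤ _ := by gcongr
  have b2 : h * (β * (Cs * (A * M) * (c' * n + c * d)))
      ≤ β * (Cs * A * (Cc * A ^ 2)) * (h * M * X + h ^ 2 * M ^ 2) := by
    have hM3 : M ^ 3 ≤ M := by nlinarith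
    have hM4 : M ^ 4 ≤ M ^ 2 := pow_le_pow_of_le_one hM0 hM1 (by norm_num)
    calc _ ≤ h * (β * (Cs * (A * M) * (Cc * (A * M) ^ 2 * (h * M) + Cc * (A * M) ^ 2 * X))) := by
          gcongr
      _ = β * (Cs * A * (Cc * A ^ 2)) * (h * M ^ 3 * X + h ^ 2 * M ^ 4) := by ring
      _ ≤ _ := by gcongr
  have b3 : h * (β * (M * (g * d))) ≤ β * g * (h * M * X) := by
    calc _ ≤ h * (β * (M * (g * X))) := by gcongr
      _ = _ := by ring
  have b4 : β * (f * n) ≤ β * (B * A) * (h * M * X) := by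
    calc _ ≤ β * ((B * (A * M) * X) * (h * M)) := by gcongr
      _ = β * (B * A) * (h * M ^ 2 * X) := by ring
      _ ≤ _ := by gcongr
  have J1 := (abs_le.1 (h₁.trans b1)).1
  have J2 := (abs_le.1 (h₂.trans b2)).1
  have J3 := (abs_le.1 (h₃.trans b3)).1
  have J4 := (abs_le.1 (h₄.trans b4)).1
  have p1 : 0 ≤ h ^ 2 * G * M ^ 2 := by positivity
  have p2 : 0 ≤ h * M * X := by positivity
  have p3 : 0 ≤ h ^ 2 * M ^ 2 := by positivity
  have q1 : 0 ≤ β * (Cs * A) * (h ^ 2 * M ^ 2) := by positivity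
  have q2 : 0 ≤ β * (Cs * A * (Cc * A ^ 2)) * (h ^ 2 * G * M ^ 2) := by positivity
  have q3 : 0 ≤ β * g * (h ^ 2 * G * M ^ 2 + h ^ 2 * M ^ 2) := by positivity
  have q4 : 0 ≤ β * (B * A) * (h ^ 2 * G * M ^ 2 + h ^ 2 * M ^ 2) := by positivity
  linarith

/-- The increment w is O(h) in L² and the density increment is O(h) in a negative norm, so every
error is quadratic in h and √(gr w) together, and at least linear in M. The bound G is needed for
∇u_t only at the left time t, because the identity pairs density increments with the earlier
acceleration. -/
lemma exists_difference_bound {μ g α β : ℝ} (hμ : 0 < μ) (hg : 0 < g) (hα : 0 < α) :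
    ∃ D : ℝ, 0 < D ∧ ∀ {ρbar : ℝ → ℝ} {T : EReal} {ϱ₀ : R3 → ℝ} {u₀ : R3 → R3} {ϱ : ℝ → R3 → ℝ}
      {u : ℝ → R3 → R3} {q : ℝ → R3 → ℝ}, IsClassicalSolution μ g ρbar T ϱ₀ u₀ ϱ u q →
      (∀ t ∈ openTimes T, Slice μ g α β ρbar (ϱ t) (u t) (dt u t) (q t)) →
      ∀ {t h M G : ℝ}, 0 < h → t ∈ openTimes T → t + h ∈ openTimes T → 0 ≤ M → M ≤ 1 →
      (∀ s ∈ Icc t (t + h), n2 (u s) ^ 2 + gr (u s) + n2 (ϱ s) ^ 2 + n2 (dt u s) ^ 2 ≤ M ^ 2) →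
      0 ≤ G → gradSq (dt u t) ≤ ENNReal.ofReal (G ^ 2) →
      ∀ {w : R3 → R3}, (w = fun x => u (t + h) x - u t x) →
      ∫ x, (2 * ((ϱ (t + h) x + ρbar (x 2)) * inner ℝ (w x) (dt u (t + h) x - dt u t x))
        - fderiv ℝ (fun y => ϱ (t + h) y + ρbar (y 2)) x (u (t + h) x) * inner ℝ (w x) (w x))
      ≤ -2 * μ * gr w + D * (h ^ 2 * G * M ^ 2 + h * M * √(gr w) + h ^ 2 * M ^ 2) := by
  obtain ⟨Cs, hCs, hsup⟩ := exists_sup_le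
  obtain ⟨Cc, hCc, hconv⟩ := exists_conv_h1_bound
  obtain ⟨B, hB, hstr⟩ := exists_stretching_bound
  obtain ⟨Ce, hCe, hell⟩ := exists_elliptic_bound (β := β) hμ hg hα
  -- Chosen so that ‖∇u‖² + ‖∇²u‖² ≤ (AM)² follows from the elliptic estimate.
  obtain ⟨A, hA, hAe⟩ : ∃ A : ℝ, 0 ≤ A ∧ 1 + Ce ≤ A ^ 2 :=
    ⟨1 + Ce, by positivity, by nlinarith⟩
  refine ⟨2 * |β| * (Cs * A + Cs * A * (Cc * A ^ 2) + g + B * A) + 1, by positivity, ?_⟩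
  intro ρbar T ϱ₀ u₀ ϱ u q hS hsl t h M G hh ht hth hM0 hM1 hZ hG0 hG w hw
  have hβ : 0 ≤ β := (abs_nonneg _).trans ((hsl t ht).abs_le 0)
  rw [abs_of_nonneg hβ]
  have hsub := Icc_subset_openTimes ht hth
  have htm : t ∈ Icc t (t + h) := ⟨le_rfl, by linarith⟩
  have htm' : t + h ∈ Icc t (t + h) := ⟨by linarith, le_rfl⟩
  -- bounds at each time
  have hE : ∀ s ∈ Icc t (t + h), gr (u s) + hs (u s) ≤ (A * M) ^ 2 := fun s hs => by
    have hz := hZ s hs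
    have h1 := sq_nonneg (n2 (u s))
    have h2 := sq_nonneg (n2 (ϱ s))
    have h3 := sq_nonneg (n2 (dt u s))
    have h4 := (hell (hsl s (hsub hs)) (by nlinarith)).1
    have h5 : Ce * (n2 (dt u s) ^ 2 + gr (u s) + n2 (ϱ s) ^ 2) ≤ Ce * M ^ 2 :=
      mul_le_mul_of_nonneg_left (by linarith) hCe.le
    have h6 := mul_le_mul_of_nonneg_right hAe (sq_nonneg M)
    rw [mul_pow]
    linarith
  have hsE : ∀ s ∈ Icc t (t + h), √(gr (u s) + hs (u s)) ≤ A * M := fun s hs =>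
    Real.sqrt_le_iff.2 ⟨by positivity, hE s hs⟩
  have hU : ∀ s ∈ Icc t (t + h), ∀ x, ‖u s x‖ ≤ Cs * (A * M) := fun s hs x =>
    (hsup _ (hS.h2C2 (hsub hs)) x).trans (mul_le_mul_of_nonneg_left (hsE s hs) hCs.le)
  have hn2 : ∀ s ∈ Icc t (t + h), n2 (u s) ≤ M ∧ n2 (dt u s) ≤ M := fun s hs => by
    have hz := hZ s hs
    have h1 := sq_nonneg (n2 (u s))
    have h2 := sq_nonneg (n2 (ϱ s))
    have h3 := sq_nonneg (n2 (dt u s))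
    have h4 := gr_nonneg (u s)
    exact ⟨le_of_sq_le_sq (by linarith) hM0, le_of_sq_le_sq (by linarith) hM0⟩
  -- the difference
  have hwH : H2C2 w := by rw [hw]; exact (hS.h2C2 hth).sub (hS.h2C2 ht)
  have hwK : ∀ x, ‖w x‖ ≤ 2 * (Cs * (A * M)) := fun x => by
    rw [hw]
    exact (norm_sub_le _ _).trans (by linarith [hU t htm x, hU _ htm' x])
  have hwt : w = fun x => h • tdq u t h x := by
    rw [hw]
    funext x
    rw [tdq, smul_inv_smul₀ hh.ne']
  have hwn : n2 w ≤ h * M := by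
    rw [hwt, n2_smul, abs_of_pos hh]
    exact mul_le_mul_of_nonneg_left
      (hS.n2_tdq_le hh ht hth hM0 fun s hs => (hn2 s hs).2) hh.le
  have hwd : n2 (fderiv ℝ w) ≤ √(gr w) := hwH.n2_fderiv_le
  obtain ⟨X, hX0, hX⟩ : ∃ X, 0 ≤ X ∧ √(gr w) = X := ⟨_, Real.sqrt_nonneg _, rfl⟩
  rw [hX] at hwd ⊢
  have hid := (hsl t ht).difference_identity (hsl _ hth) hg hα hw (hU t htm) (hU _ htm')
  rw [hid]
  have hab : t ≤ t + h := by linarith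
  have I1 := hS.abs_increment_inner_le_of_gradSq hα hsl ht hth hab (hsl t ht).v_cont
    (hsl t ht).v_mem hG0 hG hwH.h1 hwK hU
  obtain ⟨c1, c2, c3⟩ := hconv _ (hS.h2C2 ht)
  have I2 := hS.abs_increment_inner_le hα hsl ht hth hab c1 hwH.h1 hwK hU
  have I3 := hS.abs_increment_coord_le hα hsl ht hth hab hwH.h1 hg fun s hs => (hn2 s hs).1
  obtain ⟨s1, s2⟩ := hstr _ w (hS.h2C2 ht) hwH.h1
  have I4 := abs_integral_le_n2_mul (k := fun x => (ϱ (t + h) x + ρbar (x 2)) *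
    inner ℝ (fderiv ℝ (u t) x (w x)) (w x)) hβ s1 hwH.h1.mem fun x => by
      rw [abs_mul]
      exact mul_le_mul ((hsl _ hth).norm_density_le hα x) (abs_real_inner_le_norm _ _)
        (abs_nonneg _) hβ
  have hcE : Cc * (gr (u t) + hs (u t)) ≤ Cc * (A * M) ^ 2 :=
    mul_le_mul_of_nonneg_left (hE t htm) hCc.le
  rw [add_sub_cancel_left] at I1 I2 I3
  rw [hX] at s2
  exact difference_arith hh.le hβ hM0 hM1 hG0 hX0 hg.le hCs.le hCc.le hA hB.le (n2_nonneg _)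
    (n2_nonneg _) hwn hwd (hn2 t htm).2 (c3.trans hcE) (c2.trans hcE)
    (s2.trans (mul_le_mul_of_nonneg_right (mul_le_mul_of_nonneg_left (hsE t htm) hB.le) hX0))
    I1 I2 I3 I4

/-- Absorbed form of the bound, with an arbitrarily small multiple of `‖∇u_t‖²`. -/
lemma exists_difference_bound_absorbed {μ g α β ε : ℝ} (hμ : 0 < μ) (hg : 0 < g) (hα : 0 < α)
    (hε : 0 < ε) :
    ∃ D : ℝ, 0 < D ∧ ∀ {ρbar : ℝ → ℝ} {T : EReal} {ϱ₀ : R3 → ℝ} {u₀ : R3 → R3} {ϱ : ℝ → R3 → ℝ}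
      {u : ℝ → R3 → R3} {q : ℝ → R3 → ℝ}, IsClassicalSolution μ g ρbar T ϱ₀ u₀ ϱ u q →
      (∀ t ∈ openTimes T, Slice μ g α β ρbar (ϱ t) (u t) (dt u t) (q t)) →
      ∀ {t h m : ℝ}, 0 < h → t ∈ openTimes T → t + h ∈ openTimes T → m ≤ 1 →
      (∀ s ∈ Icc t (t + h), n2 (u s) ^ 2 + gr (u s) + n2 (ϱ s) ^ 2 + n2 (dt u s) ^ 2 ≤ m) →
      gradSq (dt u t) < ⊤ →
      ∀ {w : R3 → R3}, (w = fun x => u (t + h) x - u t x) →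
      ∫ x, (2 * ((ϱ (t + h) x + ρbar (x 2)) * inner ℝ (w x) (dt u (t + h) x - dt u t x))
        - fderiv ℝ (fun y => ϱ (t + h) y + ρbar (y 2)) x (u (t + h) x) * inner ℝ (w x) (w x))
      ≤ -μ * gr w + h ^ 2 * (ε * (gradSq (dt u t)).toReal + D * m) := by
  obtain ⟨D, hD, hb⟩ := exists_difference_bound (β := β) hμ hg hα
  refine ⟨D ^ 2 / (4 * ε) + D ^ 2 / (4 * μ) + D, by positivity, ?_⟩
  intro ρbar T ϱ₀ u₀ ϱ u q hS hsl t h m hh ht hth hm1 hZ hG w hw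
  have hm0 : 0 ≤ m := by
    refine le_trans ?_ (hZ t ⟨le_rfl, by linarith⟩)
    have := gr_nonneg (u t)
    positivity
  obtain ⟨M, hM0, hM⟩ : ∃ M : ℝ, 0 ≤ M ∧ M ^ 2 = m := ⟨√m, Real.sqrt_nonneg _, Real.sq_sqrt hm0⟩
  obtain ⟨G, hG0, hG2⟩ : ∃ G : ℝ, 0 ≤ G ∧ G ^ 2 = (gradSq (dt u t)).toReal :=
    ⟨_, Real.sqrt_nonneg _, Real.sq_sqrt ENNReal.toReal_nonneg⟩
  have hM1 : M ≤ 1 := by nlinarith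
  have h1 := hb hS hsl hh ht hth hM0 hM1 (by rwa [hM]) hG0
    (by rw [hG2, ENNReal.ofReal_toReal hG.ne]) hw
  refine h1.trans ?_
  rw [← hG2, ← hM]
  obtain ⟨X, hX0, hX⟩ : ∃ X, 0 ≤ X ∧ X ^ 2 = gr w :=
    ⟨_, Real.sqrt_nonneg _, Real.sq_sqrt (gr_nonneg w)⟩
  rw [← hX, Real.sqrt_sq hX0]
  have e1 : D * (G * M ^ 2) ≤ ε * G ^ 2 + D ^ 2 / (4 * ε) * M ^ 2 := by
    have h2 : ε * G ^ 2 + D ^ 2 / (4 * ε) * M ^ 4 - D * (G * M ^ 2)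
        = (2 * ε * G - D * M ^ 2) ^ 2 / (4 * ε) := by field_simp; ring
    have h3 : 0 ≤ (2 * ε * G - D * M ^ 2) ^ 2 / (4 * ε) := by positivity
    have h4 : D ^ 2 / (4 * ε) * M ^ 4 ≤ D ^ 2 / (4 * ε) * M ^ 2 :=
      mul_le_mul_of_nonneg_left (pow_le_pow_of_le_one hM0 hM1 (by norm_num)) (by positivity)
    linarith
  -- One of the two multiples of μ‖∇w‖² is spent here; the other remains as dissipation.
  have e2 : D * (h * M * X) ≤ μ * X ^ 2 + D ^ 2 / (4 * μ) * (h ^ 2 * M ^ 2) := by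
    have h2 : μ * X ^ 2 + D ^ 2 / (4 * μ) * (h ^ 2 * M ^ 2) - D * (h * M * X)
        = (2 * μ * X - D * h * M) ^ 2 / (4 * μ) := by field_simp; ring
    have h3 : 0 ≤ (2 * μ * X - D * h * M) ^ 2 / (4 * μ) := by positivity
    linarith
  have e3 := mul_le_mul_of_nonneg_left e1 (sq_nonneg h)
  linarith

/-! ### Energy inequality for the acceleration -/

lemma ofReal_integral_le_lintegral {X : Type*} [MeasurableSpace X] {ν : Measure X} {f : X → ℝ}
    (hf : Integrable f ν) : ENNReal.ofReal (∫ x, f x ∂ν) ≤ ∫⁻ x, ENNReal.ofReal (f x) ∂ν := by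
  rw [integral_eq_lintegral_pos_part_sub_lintegral_neg_part hf]
  refine (ENNReal.ofReal_le_ofReal (sub_le_self _ ENNReal.toReal_nonneg)).trans ?_
  exact ENNReal.ofReal_toReal_le

/-- The low-order part of the energy of a solution. -/
noncomputable def energy (ϱ : ℝ → R3 → ℝ) (u : ℝ → R3 → R3) (t : ℝ) : ℝ :=
  n2 (u t) ^ 2 + gr (u t) + n2 (ϱ t) ^ 2 + n2 (dt u t) ^ 2

lemma energy_nonneg (ϱ : ℝ → R3 → ℝ) (u : ℝ → R3 → R3) (t : ℝ) : 0 ≤ energy ϱ u t := by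
  have := gr_nonneg (u t)
  unfold energy
  positivity

/-- The time increment of the velocity. -/
noncomputable def tinc (u : ℝ → R3 → R3) (h t : ℝ) : R3 → R3 := fun x => u (t + h) x - u t x

lemma tinc_eq (u : ℝ → R3 → R3) {h : ℝ} (hh : h ≠ 0) (t : ℝ) :
    tinc u h t = fun x => h • tdq u t h x := by
  funext x
  rw [tdq, smul_inv_smul₀ hh, tinc]

lemma gr_smul (c : ℝ) (f : R3 → R3) :
    gr (fun x => c • f x) = c ^ 2 * gr f := by
  simp only [gr, pd_smul, n2_smul, mul_pow, sq_abs, Finset.mul_sum]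

/-- The time derivative of the kinetic energy of the increment. -/
noncomputable def incRate (ρbar : ℝ → ℝ) (ϱ : ℝ → R3 → ℝ) (u : ℝ → R3 → R3) (h t : ℝ) : ℝ :=
  ∫ x, (2 * ((ϱ (t + h) x + ρbar (x 2)) * inner ℝ (tinc u h t x) (dt u (t + h) x - dt u t x))
    - fderiv ℝ (fun y => ϱ (t + h) y + ρbar (y 2)) x (u (t + h) x)
      * inner ℝ (tinc u h t x) (tinc u h t x))

namespace IsClassicalSolution

variable {μ g : ℝ} {ρbar : ℝ → ℝ} {T : EReal} {ϱ₀ : R3 → ℝ} {u₀ : R3 → R3} {ϱ : ℝ → R3 → ℝ}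
  {u : ℝ → R3 → R3} {q : ℝ → R3 → ℝ} (hS : IsClassicalSolution μ g ρbar T ϱ₀ u₀ ϱ u q)
include hS

lemma continuousOn_energy : ContinuousOn (energy ϱ u) (openTimes T) :=
  (((hS.continuousOn_n2_u.pow 2).add hS.continuousOn_gr_u).add (hS.continuousOn_n2_ϱ.pow 2)).add
    (hS.continuousOn_n2_dt_u.pow 2)

omit hS in
lemma add_mem_openTimes {a b h t : ℝ} (ha : a ∈ openTimes T) (hb : b + h ∈ openTimes T)
    (hh : 0 < h) (ht : t ∈ Icc a b) : t ∈ openTimes T ∧ t + h ∈ openTimes T :=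
  ⟨Icc_subset_openTimes ha hb ⟨ht.1, by linarith [ht.2]⟩,
    Icc_subset_openTimes ha hb ⟨by linarith [ht.1], by linarith [ht.2]⟩⟩

lemma h2C2_tinc {h t : ℝ} (ht : t ∈ openTimes T) (hth : t + h ∈ openTimes T) :
    H2C2 (tinc u h t) := (hS.h2C2 hth).sub (hS.h2C2 ht)

lemma continuousOn_gr_tinc {a b h : ℝ} (ha : a ∈ openTimes T) (hb : b + h ∈ openTimes T)
    (hh : 0 < h) : ContinuousOn (fun t => gr (tinc u h t)) (Icc a b) := by
  refine continuousOn_finsetSum _ fun i _ => ContinuousOn.pow (fun t ht => ?_) 2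
  have hm := fun s (hs : s ∈ Icc a b) => add_mem_openTimes ha hb hh hs
  have hpd : ∀ s ∈ Icc a b, pd i (tinc u h s) = fun x => pd i (u (s + h)) x - pd i (u s) x :=
    fun s hs => pd_sub (hS.h2C2 (hm s hs).2).h1.diff (hS.h2C2 (hm s hs).1).h1.diff i
  have hev : ∀ᶠ s in 𝓝[Icc a b] t, s ∈ Icc a b := self_mem_nhdsWithin
  have h1 := (hS.tendsto_n2_pd_u (hm t ht).2 i).comp
    ((continuous_id.add continuous_const).tendsto t : Tendsto (fun s => s + h) (𝓝 t) (𝓝 (t + h)))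
  have h2 := (h1.add (hS.tendsto_n2_pd_u (hm t ht).1 i)).mono_left
    (nhdsWithin_le_nhds (s := Icc a b))
  rw [add_zero] at h2
  refine tendsto_n2_of_sub (hev.mono fun s hs => ((hS.h2C2_tinc (hm s hs).1 (hm s hs).2).h1.mem_pd
    i).1) ((hS.h2C2_tinc (hm t ht).1 (hm t ht).2).h1.mem_pd i).1 ?_
  refine tendsto_of_tendsto_of_tendsto_of_le_of_le' tendsto_const_nhds h2
    (Eventually.of_forall fun s => n2_nonneg _) (hev.mono fun s hs => ?_)
  have hp : ∀ r ∈ openTimes T, MemLp (pd i (u r)) 2 := fun r hr => ((hS.h2C2 hr).h1.mem_pd i).1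
  have h3 : (fun x => pd i (tinc u h s) x - pd i (tinc u h t) x)
      = fun x => (pd i (u (s + h)) x - pd i (u (t + h)) x) - (pd i (u s) x - pd i (u t) x) := by
    rw [hpd s hs, hpd t ht]
    funext x
    exact sub_sub_sub_comm _ _ _ _
  rw [h3]
  exact n2_sub_le (memLp_fun_sub (hp _ (hm s hs).2) (hp _ (hm t ht).2))
    (memLp_fun_sub (hp _ (hm s hs).1) (hp _ (hm t ht).1))

/-- `incRate` is the time derivative of ∫(ϱ + ρ̄)(t + h)|w|², with ϱ_t replaced through the mass
equation. The weights α and β on the left come from the two-sided bound of the density. -/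
lemma kinetic_increment {α β : ℝ} (hα : 0 < α)
    (hsl : ∀ t ∈ openTimes T, Slice μ g α β ρbar (ϱ t) (u t) (dt u t) (q t)) {a b h : ℝ}
    (hab : a ≤ b) (ha : a ∈ openTimes T) (hb : b + h ∈ openTimes T) (hh : 0 < h) :
    IntervalIntegrable (incRate ρbar ϱ u h) volume a b ∧
      α * n2 (tinc u h b) ^ 2 - β * n2 (tinc u h a) ^ 2 ≤ ∫ t in a..b, incRate ρbar ϱ u h t := by
  have hm := fun s (hs : s ∈ Icc a b) => add_mem_openTimes ha hb hh hs
  have hρ := (hsl a ha).profile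
  have hβ : 0 ≤ β := (abs_nonneg _).trans ((hsl a ha).abs_le 0)
  obtain ⟨L, hL0, hL⟩ := hρ.exists_bound
  obtain ⟨K, hK0, hK⟩ := hS.exists_bound ha hb
  have hKl : ∀ t ∈ Icc a b, t ∈ Icc a (b + h) := fun t ht => ⟨ht.1, by linarith [ht.2]⟩
  have hKr : ∀ t ∈ Icc a b, t + h ∈ Icc a (b + h) := fun t ht =>
    ⟨by linarith [ht.1], by linarith [ht.2]⟩
  have hw2 : ∀ t ∈ Icc a b, n2 (tinc u h t) ≤ 2 * K := fun t ht =>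
    (n2_sub_le (hS.h2C2 (hm t ht).2).mem (hS.h2C2 (hm t ht).1).mem).trans
      (by linarith [(hK _ (hKl t ht)).2.2.1, (hK _ (hKr t ht)).2.2.1])
  have hwK : ∀ t ∈ Icc a b, ∀ x, ‖tinc u h t x‖ ≤ 2 * K := fun t ht x =>
    (norm_sub_le _ _).trans
      (by linarith [(hK _ (hKl t ht)).2.2.2.2.2.2.2 x, (hK _ (hKr t ht)).2.2.2.2.2.2.2 x])
  have hw := fun t ht => hS.h2C2_tinc (hm t ht).1 (hm t ht).2
  have hv : ∀ t ∈ Icc a b, MemLp (fun x => dt u (t + h) x - dt u t x) 2 ∧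
      n2 (fun x => dt u (t + h) x - dt u t x) ≤ 2 * K := fun t ht => by
    have m1 := hS.memLp_dt_u (hm t ht).2
    have m2 := hS.memLp_dt_u (hm t ht).1
    exact ⟨memLp_fun_sub m1 m2, (n2_sub_le m1 m2).trans
      (by linarith [(hK _ (hKl t ht)).2.2.2.1, (hK _ (hKr t ht)).2.2.2.1])⟩
  have hϱt : ∀ t ∈ Icc a b, MemLp (dt ϱ (t + h)) 2 ∧ n2 (dt ϱ (t + h)) ≤ K * K + L * K :=
    fun t ht => by
      obtain ⟨-, k2, k3, -, -, -, -, hu⟩ := hK _ (hKr t ht)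
      obtain ⟨m1, m2⟩ := hS.memLp_dt_ϱ hρ hL (hm t ht).2 hu
      exact ⟨m1, m2.trans (add_le_add (mul_le_mul_of_nonneg_left k2 hK0)
        (mul_le_mul_of_nonneg_left k3 hL0))⟩
  have hshift : ∀ {G : Type} [TopologicalSpace G] {f : ℝ → R3 → G},
      ContinuousOn (fun p : ℝ × R3 => f p.1 p.2) (openTimes T ×ˢ univ) →
      ContinuousOn (fun p : ℝ × R3 => f (p.1 + h) p.2) (Icc a b ×ˢ univ) ∧
      ContinuousOn (fun p : ℝ × R3 => f p.1 p.2) (Icc a b ×ˢ univ) := fun {G} _ {f} hf =>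
    ⟨hf.comp (f := fun p : ℝ × R3 => (p.1 + h, p.2)) (by fun_prop) fun p hp =>
      ⟨(hm _ hp.1).2, mem_univ _⟩, hf.mono fun p hp => ⟨(hm _ hp.1).1, mem_univ _⟩⟩
  have cu := hshift (f := u) hS.u_C1.continuousOn
  have cϱ := hshift (f := ϱ) hS.ϱ_C1.continuousOn
  have cut := hshift (continuousOn_dt (isOpen_openTimes T) hS.u_C1)
  have cϱt := hshift (continuousOn_dt (isOpen_openTimes T) hS.ϱ_C1)
  have cρ : ContinuousOn (fun p : ℝ × R3 => ρbar (p.2 2)) (Icc a b ×ˢ univ) :=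
    (hρ.contDiff.continuous.comp continuous_snd).continuousOn
  have hF : ∀ t ∈ Icc a b, Integrable fun x => (ϱ (t + h) x + ρbar (x 2)) *
      inner ℝ (tinc u h t x) (tinc u h t x) := fun t ht => by
    have hs := hsl _ (hm t ht).2
    exact integrable_of_le_mul β (hs.density_continuous.mul
      ((hw t ht).c2.continuous.inner (hw t ht).c2.continuous)).aestronglyMeasurable (hw t ht).mem
      (hw t ht).mem fun x => by
        rw [norm_mul]
        exact mul_le_mul (hs.norm_density_le hα x) (norm_inner_le_norm _ _) (norm_nonneg _) hβ
  have hi1 : ∀ t ∈ Icc a b, Integrable (fun x => ‖dt ϱ (t + h) x‖ * ‖tinc u h t x‖) := fun t ht =>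
    integrable_norm_mul (hϱt t ht).1 (hw t ht).mem
  have hi2 : ∀ t ∈ Icc a b, Integrable (fun x => ‖tinc u h t x‖ *
      ‖dt u (t + h) x - dt u t x‖) := fun t ht => integrable_norm_mul (hw t ht).mem (hv t ht).1
  have hle : ∀ t ∈ Icc a b, ∀ x, ‖dt ϱ (t + h) x * inner ℝ (tinc u h t x) (tinc u h t x)
      + (ϱ (t + h) x + ρbar (x 2)) * (2 * inner ℝ (tinc u h t x) (dt u (t + h) x - dt u t x))‖
      ≤ 2 * K * (‖dt ϱ (t + h) x‖ * ‖tinc u h t x‖)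
        + 2 * β * (‖tinc u h t x‖ * ‖dt u (t + h) x - dt u t x‖) := fun t ht x => by
    refine (norm_add_le _ _).trans (add_le_add ?_ ?_)
    · rw [norm_mul, mul_left_comm]
      refine mul_le_mul_of_nonneg_left ((norm_inner_le_norm _ _).trans ?_) (norm_nonneg _)
      exact mul_le_mul_of_nonneg_right (hwK t ht x) (norm_nonneg _)
    · rw [norm_mul, norm_mul, Real.norm_two]
      have h1 := mul_le_mul ((hsl _ (hm t ht).2).norm_density_le hα x)
        (norm_inner_le_norm (𝕜 := ℝ) (tinc u h t x) (dt u (t + h) x - dt u t x)) (norm_nonneg _) hβ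
      linarith
  have hFc : ContinuousOn (fun p : ℝ × R3 => dt ϱ (p.1 + h) p.2 *
      inner ℝ (tinc u h p.1 p.2) (tinc u h p.1 p.2) + (ϱ (p.1 + h) p.2 + ρbar (p.2 2)) *
      (2 * inner ℝ (tinc u h p.1 p.2) (dt u (p.1 + h) p.2 - dt u p.1 p.2))) (Icc a b ×ˢ univ) := by
    have cw : ContinuousOn (fun p : ℝ × R3 => tinc u h p.1 p.2) (Icc a b ×ˢ univ) :=
      cu.1.sub cu.2
    exact (cϱt.1.mul (cw.inner cw)).add ((cϱ.1.add cρ).mul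
      (continuousOn_const.mul (cw.inner (cut.1.sub cut.2))))
  have hFi : ∀ t ∈ Icc a b, Integrable fun x => dt ϱ (t + h) x * inner ℝ (tinc u h t x)
      (tinc u h t x) + (ϱ (t + h) x + ρbar (x 2)) *
      (2 * inner ℝ (tinc u h t x) (dt u (t + h) x - dt u t x)) := fun t ht =>
    (((hi1 t ht).const_mul (2 * K)).add ((hi2 t ht).const_mul (2 * β))).mono'
      (hFc.comp_continuous (f := fun x => (t, x)) (by fun_prop)
        fun x => ⟨ht, mem_univ _⟩).aestronglyMeasurable
      (Eventually.of_forall (hle t ht))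
  obtain ⟨k1, k2⟩ := integral_sub_eq_integral_deriv
    (F := fun t x => (ϱ (t + h) x + ρbar (x 2)) * inner ℝ (tinc u h t x) (tinc u h t x))
    (F' := fun t x => dt ϱ (t + h) x * inner ℝ (tinc u h t x) (tinc u h t x)
      + (ϱ (t + h) x + ρbar (x 2)) * (2 * inner ℝ (tinc u h t x) (dt u (t + h) x - dt u t x)))
    (B := 2 * K * ((K * K + L * K) * (2 * K)) + 2 * β * (2 * K * (2 * K))) hab hF
    (fun t ht x => by
      have d1 : HasDerivAt (fun s => ϱ (s + h) x + ρbar (x 2)) (dt ϱ (t + h) x) t :=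
        ((hS.hasDerivAt_ϱ (hm t ht).2 x).comp_add_const t h).add_const _
      have d2 : HasDerivAt (fun s => tinc u h s x) (dt u (t + h) x - dt u t x) t :=
        ((hS.hasDerivAt_u (hm t ht).2 x).comp_add_const t h).sub (hS.hasDerivAt_u (hm t ht).1 x)
      refine (d1.mul (d2.inner ℝ d2)).congr_deriv ?_
      rw [real_inner_comm (tinc u h t x) (dt u (t + h) x - dt u t x)]
      ring) hFc hFi fun t ht => by
      refine (integral_mono (hFi t ht).abs (((hi1 t ht).const_mul (2 * K)).add
        ((hi2 t ht).const_mul (2 * β))) (hle t ht)).trans ?_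
      simp only [Pi.add_apply]
      rw [integral_add ((hi1 t ht).const_mul (2 * K)) ((hi2 t ht).const_mul (2 * β)),
        integral_const_mul, integral_const_mul]
      have e1 := (integral_norm_mul_le (hϱt t ht).1 (hw t ht).mem).trans
        (mul_le_mul (hϱt t ht).2 (hw2 t ht) (n2_nonneg _) (by positivity))
      have e2 := (integral_norm_mul_le (hw t ht).mem (hv t ht).1).trans
        (mul_le_mul (hw2 t ht) (hv t ht).2 (n2_nonneg _) (by positivity))
      exact add_le_add (mul_le_mul_of_nonneg_left e1 (by positivity))
        (mul_le_mul_of_nonneg_left e2 (by positivity))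
  have hrate : ∀ t ∈ Icc a b, ∫ x, (dt ϱ (t + h) x * inner ℝ (tinc u h t x) (tinc u h t x)
      + (ϱ (t + h) x + ρbar (x 2)) * (2 * inner ℝ (tinc u h t x) (dt u (t + h) x - dt u t x)))
      = incRate ρbar ϱ u h t := fun t ht => by
    refine integral_congr_ae (Eventually.of_forall fun x => ?_)
    have := hS.mass _ (hm t ht).2 x
    simp only [eq_neg_of_add_eq_zero_left this]
    ring
  have hrate' : ∀ t ∈ uIcc a b, _ := fun t ht => hrate t (by rwa [uIcc_of_le hab] at ht)
  rw [intervalIntegral.integral_congr hrate'] at k2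
  have hsq : ∀ t ∈ Icc a b, n2 (tinc u h t) ^ 2 = ∫ x, inner ℝ (tinc u h t x) (tinc u h t x) :=
    fun t ht => by
      rw [n2_sq (hw t ht).mem]
      simp only [real_inner_self_eq_norm_sq]
  have hint : ∀ t ∈ Icc a b, Integrable fun x => inner ℝ (tinc u h t x) (tinc u h t x) :=
    fun t ht => integrable_inner' (hw t ht).mem (hw t ht).mem
  refine ⟨k1.congr fun t ht => hrate t (by
    rw [uIoc_of_le hab] at ht; exact Ioc_subset_Icc_self ht), ?_⟩
  rw [← k2, hsq b ⟨hab, le_rfl⟩, hsq a ⟨le_rfl, hab⟩, ← integral_const_mul, ← integral_const_mul]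
  refine sub_le_sub (integral_mono ((hint b ⟨hab, le_rfl⟩).const_mul α) (hF b ⟨hab, le_rfl⟩)
    fun x => ?_) (integral_mono (hF a ⟨le_rfl, hab⟩) ((hint a ⟨le_rfl, hab⟩).const_mul β)
    fun x => ?_)
  · exact mul_le_mul_of_nonneg_right ((hsl _ hb).lower x) real_inner_self_nonneg
  · exact mul_le_mul_of_nonneg_right ((hsl _ (hm a ⟨le_rfl, hab⟩).2).upper x)
      real_inner_self_nonneg

end IsClassicalSolution

/-- The energy inequality for `u_t`, before passing to the limit in the difference quotient. -/
lemma exists_tdq_bound {μ g α β ε : ℝ} (hμ : 0 < μ) (hg : 0 < g) (hα : 0 < α) (hε : 0 < ε) :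
    ∃ D : ℝ, 0 < D ∧ ∀ {ρbar : ℝ → ℝ} {T : EReal} {ϱ₀ : R3 → ℝ} {u₀ : R3 → R3} {ϱ : ℝ → R3 → ℝ}
      {u : ℝ → R3 → R3} {q : ℝ → R3 → ℝ}, IsClassicalSolution μ g ρbar T ϱ₀ u₀ ϱ u q →
      (∀ t ∈ openTimes T, Slice μ g α β ρbar (ϱ t) (u t) (dt u t) (q t)) →
      ∀ {a b h θ : ℝ}, a ≤ b → a ∈ openTimes T → b + h ∈ openTimes T → 0 < h →
      (∀ t ∈ Icc a b, ∀ s ∈ Icc t (t + h), energy ϱ u s ≤ 1 ∧ energy ϱ u s ≤ energy ϱ u t + θ) →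
      IntervalIntegrable (fun t => gr (tdq u t h)) volume a b ∧
      α * n2 (tdq u b h) ^ 2 + μ * (∫ t in a..b, gr (tdq u t h)) ≤ β * n2 (tdq u a h) ^ 2
        + ε * (∫⁻ s in Icc a b, gradSq (dt u s)).toReal
        + D * ((∫ s in a..b, energy ϱ u s) + θ * (b - a)) := by
  obtain ⟨D, hD, hb⟩ := exists_difference_bound_absorbed (β := β) hμ hg hα hε
  refine ⟨D, hD, ?_⟩
  intro ρbar T ϱ₀ u₀ ϱ u q hS hsl a b h θ hab ha hbh hh hθ
  have hm := fun s (hs : s ∈ Icc a b) => IsClassicalSolution.add_mem_openTimes ha hbh hh hs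
  have hbm := (hm b ⟨hab, le_rfl⟩).1
  obtain ⟨k1, k2⟩ := hS.kinetic_increment hα hsl hab ha hbh hh
  have hgr : ∀ t, gr (tinc u h t) = h ^ 2 * gr (tdq u t h) := fun t => by
    rw [tinc_eq u hh.ne', gr_smul]
  have hn2 : ∀ t, n2 (tinc u h t) ^ 2 = h ^ 2 * n2 (tdq u t h) ^ 2 := fun t => by
    rw [tinc_eq u hh.ne', n2_smul, mul_pow, sq_abs]
  have hgi : IntervalIntegrable (fun t => gr (tdq u t h)) volume a b := by
    have := (hS.continuousOn_gr_tinc ha hbh hh).const_mul ((h ^ 2)⁻¹)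
    simp only [hgr, inv_mul_cancel_left₀ (pow_ne_zero 2 hh.ne')] at this
    exact this.intervalIntegrable_of_Icc hab
  have hZi : IntervalIntegrable (energy ϱ u) volume a b :=
    (hS.continuousOn_energy.mono (Icc_subset_openTimes ha hbm)).intervalIntegrable_of_Icc hab
  refine ⟨hgi, ?_⟩
  have hj : IntervalIntegrable (fun t => (h ^ 2)⁻¹ * incRate ρbar ϱ u h t) volume a b :=
    k1.const_mul _
  have hDi : IntervalIntegrable (fun t => D * (energy ϱ u t + θ)) volume a b :=
    (hZi.add intervalIntegrable_const).const_mul D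
  have hφ := (hj.add (hgi.const_mul μ)).sub hDi
  -- Stated with values in [0, ∞], since ‖∇u_t‖² may be infinite at exceptional times, where the
  -- bound is trivial.
  have hpt : ∀ t ∈ Icc a b, ENNReal.ofReal ((h ^ 2)⁻¹ * incRate ρbar ϱ u h t
      + μ * gr (tdq u t h) - D * (energy ϱ u t + θ)) ≤ ENNReal.ofReal ε * gradSq (dt u t) := by
    intro t ht
    by_cases hG : gradSq (dt u t) = ⊤
    · rw [hG, ENNReal.mul_top (by simpa using hε)]
      exact le_top
    have htm : t ∈ Icc t (t + h) := ⟨le_rfl, by linarith⟩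
    -- Both bounds are needed: m ≤ 1 for the nonlinear estimate, and energy at t plus θ so that the
    -- integral in time involves the energy at t alone.
    have h1 := hb hS hsl (m := min 1 (energy ϱ u t + θ)) hh (hm t ht).1 (hm t ht).2
      (min_le_left _ _) (fun s hs => le_min (hθ t ht s hs).1 (hθ t ht s hs).2)
      (lt_top_iff_ne_top.2 hG) (w := tinc u h t) rfl
    change incRate ρbar ϱ u h t ≤ _ at h1
    rw [hgr] at h1
    have h2 := mul_le_mul_of_nonneg_left h1 (by positivity : 0 ≤ (h ^ 2)⁻¹)
    have h3 : (h ^ 2)⁻¹ * (-μ * (h ^ 2 * gr (tdq u t h)) + h ^ 2 *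
        (ε * (gradSq (dt u t)).toReal + D * min 1 (energy ϱ u t + θ)))
        = -μ * gr (tdq u t h) + ε * (gradSq (dt u t)).toReal + D * min 1 (energy ϱ u t + θ) := by
      field_simp
      ring
    have h4 := mul_le_mul_of_nonneg_left (min_le_right 1 (energy ϱ u t + θ)) hD.le
    rw [← ENNReal.ofReal_toReal hG, ← ENNReal.ofReal_mul hε.le]
    exact ENNReal.ofReal_le_ofReal (by linarith)
  have hΓ := hS.ut_H1 a ha b hbm
  have hint : ∫ t in a..b, ((h ^ 2)⁻¹ * incRate ρbar ϱ u h t + μ * gr (tdq u t h)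
      - D * (energy ϱ u t + θ)) ≤ ε * (∫⁻ s in Icc a b, gradSq (dt u s)).toReal := by
    rw [intervalIntegral.integral_of_le hab]
    have h1 := ofReal_integral_le_lintegral
      ((intervalIntegrable_iff_integrableOn_Ioc_of_le hab).1 hφ)
    have h2 : ∫⁻ t in Ioc a b, ENNReal.ofReal ((h ^ 2)⁻¹ * incRate ρbar ϱ u h t
        + μ * gr (tdq u t h) - D * (energy ϱ u t + θ))
        ≤ ENNReal.ofReal ε * ∫⁻ s in Icc a b, gradSq (dt u s) := by
      rw [← lintegral_const_mul' _ _ ENNReal.ofReal_ne_top]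
      refine (setLIntegral_mono_ae' measurableSet_Ioc (Eventually.of_forall fun t ht => hpt t
        (Ioc_subset_Icc_self ht))).trans (lintegral_mono_set Ioc_subset_Icc_self)
    have h3 := h1.trans h2
    rw [← ENNReal.ofReal_toReal hΓ.ne, ← ENNReal.ofReal_mul hε.le] at h3
    exact (ENNReal.ofReal_le_ofReal_iff (by positivity)).1 h3
  rw [intervalIntegral.integral_sub (hj.add (hgi.const_mul μ)) hDi,
    intervalIntegral.integral_add hj (hgi.const_mul μ), intervalIntegral.integral_const_mul,
    intervalIntegral.integral_const_mul, intervalIntegral.integral_const_mul,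
    intervalIntegral.integral_add hZi intervalIntegrable_const,
    intervalIntegral.integral_const, smul_eq_mul] at hint
  rw [hn2, hn2] at k2
  have k3 := mul_le_mul_of_nonneg_left k2 (by positivity : 0 ≤ (h ^ 2)⁻¹)
  have k4 : (h ^ 2)⁻¹ * (α * (h ^ 2 * n2 (tdq u b h) ^ 2) - β * (h ^ 2 * n2 (tdq u a h) ^ 2))
      = α * n2 (tdq u b h) ^ 2 - β * n2 (tdq u a h) ^ 2 := by
    field_simp
  rw [k4] at k3
  linarith [mul_comm θ (b - a)]

/-- The energy inequality for `u_t`. -/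
lemma exists_acceleration_energy {μ g α β : ℝ} (hμ : 0 < μ) (hg : 0 < g) (hα : 0 < α) :
    ∃ C : ℝ, 0 < C ∧ ∀ {ρbar : ℝ → ℝ} {T : EReal} {ϱ₀ : R3 → ℝ} {u₀ : R3 → R3} {ϱ : ℝ → R3 → ℝ}
      {u : ℝ → R3 → R3} {q : ℝ → R3 → ℝ}, IsClassicalSolution μ g ρbar T ϱ₀ u₀ ϱ u q →
      (∀ t ∈ openTimes T, Slice μ g α β ρbar (ϱ t) (u t) (dt u t) (q t)) →
      ∀ {a b b' : ℝ}, a ≤ b → b < b' → a ∈ openTimes T → b' ∈ openTimes T →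
      (∀ s ∈ Icc a b', energy ϱ u s ≤ 1) →
      n2 (dt u b) ^ 2 + (∫⁻ s in Icc a b, gradSq (dt u s)).toReal
        ≤ C * (n2 (dt u a) ^ 2 + ∫ s in a..b, energy ϱ u s) := by
  -- Lower semicontinuity costs a factor 3, so the absorbed term μ/6 returns as half of ∫‖∇u_t‖² and
  -- can still be moved to the left.
  obtain ⟨D, hD, hb⟩ := exists_tdq_bound (β := β) hμ hg hα (by positivity : 0 < μ / 6)
  refine ⟨(|β| + D) * (α⁻¹ + (μ / 6)⁻¹), by positivity, ?_⟩
  intro ρbar T ϱ₀ u₀ ϱ u q hS hsl a b b' hab hbb ha hb' hZ1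
  have hβ : 0 ≤ β := (abs_nonneg _).trans ((hsl a ha).abs_le 0)
  rw [abs_of_nonneg hβ]
  have hsub := Icc_subset_openTimes ha hb'
  have hbm : b ∈ openTimes T := hsub ⟨hab, hbb.le⟩
  have hΓ := hS.ut_H1 a ha b hbm
  obtain ⟨Γ, hΓr⟩ : ∃ Γ, Γ = (∫⁻ s in Icc a b, gradSq (dt u s)).toReal := ⟨_, rfl⟩
  obtain ⟨I, hI⟩ : ∃ I, I = ∫ s in a..b, energy ϱ u s := ⟨_, rfl⟩
  have hI0 : 0 ≤ I := hI ▸ intervalIntegral.integral_nonneg hab fun s _ => energy_nonneg ϱ u s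
  have hΓ0 : 0 ≤ Γ := hΓr ▸ ENNReal.toReal_nonneg
  rw [← hΓr, ← hI]
  -- uniform continuity of the energy
  have huc := isCompact_Icc.uniformContinuousOn_of_continuous (hS.continuousOn_energy.mono hsub)
  rw [Metric.uniformContinuousOn_iff] at huc
  have key : ∀ θ : ℝ, 0 < θ → α * n2 (dt u b) ^ 2 + μ / 6 * Γ
      ≤ β * n2 (dt u a) ^ 2 + D * (I + θ * (b - a)) := by
    intro θ hθ
    -- Steps h below the modulus of continuity keep the energy on [t, t + h] within θ of its value
    -- at t. The gap b' - b leaves room for the forward quotient at b.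
    obtain ⟨η, hη, huη⟩ := huc θ hθ
    obtain ⟨κ, hκ0, hκη, hκb⟩ : ∃ κ : ℝ, 0 < κ ∧ κ < η ∧ κ ≤ b' - b :=
      ⟨min (η / 2) (b' - b), lt_min (by positivity) (by linarith),
        (min_le_left _ _).trans_lt (by linarith), min_le_right _ _⟩
    obtain ⟨hn, hhn⟩ : ∃ hn : ℕ → ℝ, hn = fun n : ℕ => κ * (1 / ((n : ℝ) + 1)) := ⟨_, rfl⟩
    have hpos : ∀ n, 0 < hn n := fun n => by rw [hhn]; positivity
    have hle : ∀ n, hn n ≤ κ := fun n => by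
      rw [hhn]
      refine mul_le_of_le_one_right hκ0.le ?_
      rw [div_le_one (by positivity)]
      linarith [n.cast_nonneg (α := ℝ)]
    have hlim0 : Tendsto hn atTop (𝓝 0) := by
      rw [hhn]
      simpa using (tendsto_one_div_add_atTop_nhds_zero_nat (𝕜 := ℝ)).const_mul κ
    have hlim : Tendsto hn atTop (𝓝[>] 0) :=
      tendsto_nhdsWithin_iff.2 ⟨hlim0, Eventually.of_forall hpos⟩
    have hmem : ∀ n, b + hn n ∈ openTimes T := fun n =>
      hsub ⟨by linarith [hpos n], by linarith [hle n]⟩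
    have hbn := fun n => hb hS hsl (θ := θ) hab ha (hmem n) (hpos n) fun t ht s hs => by
      have hs' : s ∈ Icc a b' := ⟨ht.1.trans hs.1, by linarith [hs.2, ht.2, hle n]⟩
      refine ⟨hZ1 s hs', ?_⟩
      have h1 := huη s hs' t ⟨ht.1, by linarith [ht.2]⟩
        (by rw [Real.dist_eq, abs_of_nonneg (by linarith [hs.1])]; linarith [hs.2, hle n])
      rw [Real.dist_eq] at h1
      linarith [(abs_lt.1 h1).2]
    rw [← hΓr, ← hI] at hbn
    have hW : ∀ t ∈ Icc a b, Tendsto (fun n => n2 fun x => tdq u t (hn n) x - dt u t x) atTop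
        (𝓝 0) := fun t ht => (hS.tendsto_tdq (hsub ⟨ht.1, by linarith [ht.2]⟩)).comp hlim
    have hWH : ∀ t ∈ Icc a b, ∀ n, H2C2 (tdq u t (hn n)) := fun t ht n =>
      have := IsClassicalSolution.add_mem_openTimes ha (hmem n) (hpos n) ht
      hS.h2C2_tdq this.1 this.2
    have hWn : ∀ t ∈ Icc a b, Tendsto (fun n => n2 (tdq u t (hn n))) atTop (𝓝 (n2 (dt u t))) :=
      fun t ht => tendsto_n2_of_sub (Eventually.of_forall fun n => (hWH t ht n).mem)
        (hS.memLp_dt_u (hsub ⟨ht.1, by linarith [ht.2]⟩)) (hW t ht)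
    have hR : Tendsto (fun n => μ⁻¹ * (β * n2 (tdq u a (hn n)) ^ 2 + μ / 6 * Γ
        + D * (I + θ * (b - a)) - α * n2 (tdq u b (hn n)) ^ 2)) atTop
        (𝓝 (μ⁻¹ * (β * n2 (dt u a) ^ 2 + μ / 6 * Γ + D * (I + θ * (b - a))
          - α * n2 (dt u b) ^ 2))) :=
      (((((hWn a ⟨le_rfl, hab⟩).pow 2).const_mul β).add_const _).add_const _ |>.sub
        (((hWn b ⟨hab, le_rfl⟩).pow 2).const_mul α)).const_mul _
    have hgrn : ∀ n, 0 ≤ ∫ t in a..b, gr (tdq u t (hn n)) := fun n =>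
      intervalIntegral.integral_nonneg hab fun t _ => gr_nonneg _
    have hbn' : ∀ n, ∫ t in a..b, gr (tdq u t (hn n)) ≤ μ⁻¹ * (β * n2 (tdq u a (hn n)) ^ 2
        + μ / 6 * Γ + D * (I + θ * (b - a)) - α * n2 (tdq u b (hn n)) ^ 2) := fun n => by
      rw [inv_mul_eq_div, le_div_iff₀ hμ]
      linarith [(hbn n).2]
    have hR0 := ge_of_tendsto' hR fun n => (hgrn n).trans (hbn' n)
    -- Lower semicontinuity at each time, then Fatou's lemma in time.
    have hL : ∫⁻ s in Icc a b, gradSq (dt u s) ≤ 3 * ENNReal.ofReal (μ⁻¹ * (β * n2 (dt u a) ^ 2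
        + μ / 6 * Γ + D * (I + θ * (b - a)) - α * n2 (dt u b) ^ 2)) := by
      have hio := fun n => (intervalIntegrable_iff_integrableOn_Ioc_of_le hab).1 (hbn n).1
      calc ∫⁻ s in Icc a b, gradSq (dt u s)
          ≤ ∫⁻ s in Icc a b, 3 * liminf (fun n => ENNReal.ofReal (gr (tdq u s (hn n)))) atTop :=
            setLIntegral_mono_ae' measurableSet_Icc (Eventually.of_forall fun t ht =>
              gradSq_le_liminf (fun n => (hWH t ht n).h1)
                (hS.memLp_dt_u (hsub ⟨ht.1, by linarith [ht.2]⟩)) (hW t ht))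
        _ = 3 * ∫⁻ s in Ioc a b, liminf (fun n => ENNReal.ofReal (gr (tdq u s (hn n)))) atTop := by
            rw [lintegral_const_mul' _ _ (by norm_num), setLIntegral_congr Ioc_ae_eq_Icc]
        _ ≤ 3 * liminf (fun n => ∫⁻ s in Ioc a b, ENNReal.ofReal (gr (tdq u s (hn n)))) atTop := by
            gcongr
            exact lintegral_liminf_le' fun n => (hio n).aemeasurable.ennreal_ofReal
        _ ≤ 3 * liminf (fun n => ENNReal.ofReal (μ⁻¹ * (β * n2 (tdq u a (hn n)) ^ 2 + μ / 6 * Γ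
            + D * (I + θ * (b - a)) - α * n2 (tdq u b (hn n)) ^ 2))) atTop := by
            gcongr
            refine liminf_le_liminf (Eventually.of_forall fun n => ?_)
            rw [← ofReal_integral_eq_lintegral_ofReal (hio n)
              (Eventually.of_forall fun t => gr_nonneg _), ← intervalIntegral.integral_of_le hab]
            exact ENNReal.ofReal_le_ofReal (hbn' n)
        _ = _ := by rw [((ENNReal.continuous_ofReal.tendsto _).comp hR).liminf_eq.symm]; rfl
    have hL' : Γ ≤ 3 * (μ⁻¹ * (β * n2 (dt u a) ^ 2 + μ / 6 * Γ + D * (I + θ * (b - a))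
        - α * n2 (dt u b) ^ 2)) := by
      rw [hΓr]
      refine ENNReal.toReal_le_of_le_ofReal (by rw [← hΓr]; positivity) ?_
      rw [ENNReal.ofReal_mul (by norm_num), ← hΓr]
      simpa using hL
    rw [← mul_assoc, mul_comm (3 : ℝ), mul_assoc, inv_mul_eq_div, le_div_iff₀ hμ] at hL'
    linarith
  have key2 : α * n2 (dt u b) ^ 2 + μ / 6 * Γ ≤ β * n2 (dt u a) ^ 2 + D * I := by
    have h1 : Tendsto (fun θ : ℝ => β * n2 (dt u a) ^ 2 + D * (I + θ * (b - a))) (𝓝[>] 0)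
        (𝓝 (β * n2 (dt u a) ^ 2 + D * I)) :=
      (Continuous.tendsto' (by fun_prop) 0 _ (by simp)).mono_left nhdsWithin_le_nhds
    exact ge_of_tendsto h1 (eventually_mem_nhdsWithin.mono fun θ hθ => key θ hθ)
  obtain ⟨R, hR⟩ : ∃ R, R = β * n2 (dt u a) ^ 2 + D * I := ⟨_, rfl⟩
  have hRle : R ≤ (β + D) * (n2 (dt u a) ^ 2 + I) := by
    have : 0 ≤ D * n2 (dt u a) ^ 2 + β * I := by positivity
    rw [hR]
    linarith
  rw [← hR] at key2
  have r1 : n2 (dt u b) ^ 2 ≤ α⁻¹ * R := by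
    rw [inv_mul_eq_div, le_div_iff₀ hα]
    have : 0 ≤ μ / 6 * Γ := by positivity
    linarith
  have r2 : Γ ≤ (μ / 6)⁻¹ * R := by
    rw [inv_mul_eq_div, le_div_iff₀ (by positivity)]
    have : 0 ≤ α * n2 (dt u b) ^ 2 := by positivity
    linarith
  calc _ ≤ (α⁻¹ + (μ / 6)⁻¹) * R := by linarith
    _ ≤ (α⁻¹ + (μ / 6)⁻¹) * ((β + D) * (n2 (dt u a) ^ 2 + I)) :=
      mul_le_mul_of_nonneg_left hRle (by positivity)
    _ = _ := by ring

/-! ### Gronwall's inequality and the low-order energy -/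

lemma add_integral_le_exp_of_le {f : ℝ → ℝ} {a b A C : ℝ} (hab : a ≤ b) (hC : 0 < C)
    (hf : ContinuousOn f (Icc a b)) (h0 : ∀ t ∈ Icc a b, 0 ≤ f t)
    (h : ∀ t ∈ Icc a b, f t ≤ A + C * ∫ s in a..t, f s) :
    A + C * (∫ s in a..b, f s) ≤ A * Real.exp (C * (b - a)) := by
  let F : ℝ → ℝ := fun s => f (projIcc a b hab s)
  have hF : Continuous F := hf.comp_continuous (continuous_subtype_val.comp continuous_projIcc)
    fun s => (projIcc a b hab s).2
  have hFf : ∀ s ∈ Icc a b, F s = f s := fun s hs => by simp [F, projIcc_of_mem hab hs]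
  have hFi : ∀ t ∈ Icc a b, ∫ s in a..t, f s = ∫ s in a..t, F s := fun t ht =>
    intervalIntegral.integral_congr fun s hs => by
      rw [uIcc_of_le ht.1] at hs
      exact (hFf s ⟨hs.1, hs.2.trans ht.2⟩).symm
  have hpos : ∀ t ∈ Icc a b, 0 ≤ ∫ s in a..t, F s := fun t ht =>
    intervalIntegral.integral_nonneg ht.1 fun s _ => h0 _ (projIcc a b hab s).2
  have hb : b ∈ Icc a b := ⟨hab, le_rfl⟩
  have hder : ∀ x, HasDerivAt (fun t => ∫ s in a..t, F s) (F x) x := fun x =>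
    intervalIntegral.integral_hasDerivAt_right (hF.intervalIntegrable _ _)
      (hF.stronglyMeasurableAtFilter _ _) hF.continuousAt
  -- Gronwall for the primitive F of f, which satisfies F' ≤ A + CF. This bounds the whole right
  -- side of the hypothesis, so additional nonnegative terms on its left can be kept.
  have key := norm_le_gronwallBound_of_norm_deriv_right_le (f := fun t => ∫ s in a..t, F s)
    (f' := F) (δ := 0) (K := C) (ε := A) (a := a) (b := b)
    (fun x _ => (hder x).continuousAt.continuousWithinAt) (fun x _ => (hder x).hasDerivWithinAt)
    (by simp) (fun x hx => by
      have hx' := Ico_subset_Icc_self hx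
      rw [Real.norm_of_nonneg (hpos x hx'), Real.norm_of_nonneg (h0 _ (projIcc a b hab x).2),
        add_comm, ← hFi x hx']
      change F x ≤ _
      rw [hFf x hx']
      exact h x hx') b hb
  rw [gronwallBound_of_K_ne_0 hC.ne', Real.norm_of_nonneg (hpos b hb), ← hFi b hb] at key
  simp only [zero_mul, zero_add] at key
  have h2 := mul_le_mul_of_nonneg_left key hC.le
  rw [← mul_assoc, mul_div_cancel₀ _ hC.ne'] at h2
  linarith

lemma n2_sq_sub_eq_integral {F : Type*} [NormedAddCommGroup F] [InnerProductSpace ℝ F]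
    {f f' : ℝ → R3 → F} {a b K : ℝ} (hab : a ≤ b)
    (hd : ∀ t ∈ Icc a b, ∀ x, HasDerivAt (fun s => f s x) (f' t x) t)
    (hc : ContinuousOn (fun p : ℝ × R3 => f p.1 p.2) (Icc a b ×ˢ univ))
    (hc' : ContinuousOn (fun p : ℝ × R3 => f' p.1 p.2) (Icc a b ×ˢ univ))
    (hm : ∀ t ∈ Icc a b, MemLp (f t) 2 ∧ n2 (f t) ≤ K)
    (hm' : ∀ t ∈ Icc a b, MemLp (f' t) 2 ∧ n2 (f' t) ≤ K) :
    IntervalIntegrable (fun t => ∫ x, 2 * inner ℝ (f t x) (f' t x)) volume a b ∧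
      n2 (f b) ^ 2 - n2 (f a) ^ 2 = ∫ t in a..b, ∫ x, 2 * inner ℝ (f t x) (f' t x) := by
  have hK : 0 ≤ K := (n2_nonneg _).trans (hm a ⟨le_rfl, hab⟩).2
  have hi : ∀ t ∈ Icc a b, Integrable fun x => 2 * inner ℝ (f t x) (f' t x) := fun t ht =>
    (integrable_inner' (hm t ht).1 (hm' t ht).1).const_mul 2
  obtain ⟨h1, h2⟩ := integral_sub_eq_integral_deriv (F := fun t x => inner ℝ (f t x) (f t x))
    (F' := fun t x => 2 * inner ℝ (f t x) (f' t x)) (B := 2 * (K * K)) hab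
    (fun t ht => integrable_inner' (hm t ht).1 (hm t ht).1)
    (fun t ht x => by
      refine ((hd t ht x).inner ℝ (hd t ht x)).congr_deriv ?_
      rw [real_inner_comm (f t x) (f' t x)]
      ring) (continuousOn_const.mul (hc.inner hc')) hi fun t ht => by
      have h3 := integrable_norm_mul (hm t ht).1 (hm' t ht).1
      refine (integral_mono (hi t ht).abs (h3.const_mul 2) fun x => ?_).trans ?_
      · simp only [abs_mul, abs_two]
        exact mul_le_mul_of_nonneg_left (abs_real_inner_le_norm _ _) zero_le_two
      · rw [integral_const_mul]
        exact mul_le_mul_of_nonneg_left ((integral_norm_mul_le (hm t ht).1 (hm' t ht).1).trans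
          (mul_le_mul (hm t ht).2 (hm' t ht).2 (n2_nonneg _) hK)) zero_le_two
  refine ⟨h1, ?_⟩
  rw [n2_sq (hm b ⟨hab, le_rfl⟩).1, n2_sq (hm a ⟨le_rfl, hab⟩).1, ← h2]
  simp only [real_inner_self_eq_norm_sq]

lemma integral_mul_transport_eq_zero {w : R3 → R3} {f : R3 → ℝ} {K : ℝ} (hw : H1C1 w)
    (hdiv : ∀ x, dvg w x = 0) (hK : ∀ x, ‖w x‖ ≤ K) (hf : H1C1 f) :
    ∫ x, f x * fderiv ℝ f x (w x) = 0 := by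
  have hfd : ∀ x z, fderiv ℝ (fun x => f x ^ 2) x z = 2 * (f x * fderiv ℝ f x z) := fun x z => by
    have h1 := ((hf.diff x).hasFDerivAt.pow 2).fderiv
    change fderiv ℝ (fun x => f x ^ 2) x = _ at h1
    rw [h1]
    simp
    ring
  have hG : ContDiff ℝ 1 fun x => f x ^ 2 := hf.c1.pow 2
  have h0 := integral_transport_eq_zero hw hdiv hG (memLp_mul_self hf.mem hf.sobolev.1) fun i => by
    refine integrable_of_le_mul (2 * K) (((contDiff_coord i).continuous.comp hw.c1.continuous).mul
      (continuous_pd hG i)).aestronglyMeasurable hf.mem hf.memD fun x => ?_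
    rw [pd_eq, hfd, norm_mul, norm_mul, norm_mul, Real.norm_two]
    have h1 : ‖w x i‖ ≤ K := (PiLp.norm_apply_le _ _).trans (hK x)
    have h2 := mul_le_mul_of_nonneg_left (norm_pd_le i f x) (norm_nonneg (f x))
    have h3 := mul_le_mul h1 h2 (by positivity) ((norm_nonneg _).trans h1)
    rw [pd_eq] at h3
    linarith
  simp only [hfd, integral_const_mul] at h0
  linarith

/-- Four balances are added, for ‖u‖², ‖∇u‖², ‖ϱ‖² and ‖u_t‖². In that of ‖ϱ‖² the transport term
has zero mean and only ρ̄'u₃ remains, so ∇ϱ never enters and the system closes in the energy alone.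
The bound is assumed slightly beyond b because the balance for u_t uses forward differences. -/
lemma exists_energy_inequality {μ g α β : ℝ} {ρbar : ℝ → ℝ} (hμ : 0 < μ) (hg : 0 < g) (hα : 0 < α)
    (hρ : IsProfile ρbar) :
    ∃ C : ℝ, 1 ≤ C ∧ ∀ {T : EReal} {ϱ₀ : R3 → ℝ} {u₀ : R3 → R3} {ϱ : ℝ → R3 → ℝ}
      {u : ℝ → R3 → R3} {q : ℝ → R3 → ℝ}, IsClassicalSolution μ g ρbar T ϱ₀ u₀ ϱ u q →
      (∀ t ∈ openTimes T, Slice μ g α β ρbar (ϱ t) (u t) (dt u t) (q t)) →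
      ∀ {a b b' : ℝ}, a ≤ b → b < b' → a ∈ openTimes T → b' ∈ openTimes T →
      (∀ s ∈ Icc a b', energy ϱ u s ≤ 1) →
      energy ϱ u b + (∫⁻ s in Icc a b, gradSq (dt u s)).toReal
        ≤ C * energy ϱ u a * Real.exp (C * (b - a)) := by
  obtain ⟨L, hL0, hL⟩ := hρ.exists_bound
  obtain ⟨c, C₁, hc, hC₁, hder⟩ := exists_gr_deriv_bound (β := β) hμ hg hα
  obtain ⟨C₂, hC₂, hacc⟩ := exists_acceleration_energy (β := β) hμ hg hα
  refine ⟨1 + C₂ + C₁ + L, by linarith, ?_⟩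
  intro T ϱ₀ u₀ ϱ u q hS hsl a b b' hab hbb ha hb' hZ1
  have hsub := Icc_subset_openTimes ha hb'
  have hsubb : Icc a b ⊆ Icc a b' := Icc_subset_Icc_right hbb.le
  have hZc : ContinuousOn (energy ϱ u) (Icc a b) := hS.continuousOn_energy.mono (hsubb.trans hsub)
  obtain ⟨K, hK0, hK⟩ := hS.exists_bound ha hb'
  have main : ∀ t ∈ Icc a b, energy ϱ u t + (∫⁻ s in Icc a t, gradSq (dt u s)).toReal
      ≤ (1 + C₂ + C₁ + L) * energy ϱ u a + (1 + C₂ + C₁ + L) * ∫ s in a..t, energy ϱ u s := by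
    intro t ht
    have hsubt : Icc a t ⊆ Icc a b' := Icc_subset_Icc_right (ht.2.trans hbb.le)
    have hst := hsubt.trans hsub
    have htm : t ∈ openTimes T := hst ⟨ht.1, le_rfl⟩
    have hZi : IntervalIntegrable (energy ϱ u) volume a t :=
      (hS.continuousOn_energy.mono hst).intervalIntegrable_of_Icc ht.1
    have hZ0 := energy_nonneg ϱ u a
    have hI0 : 0 ≤ ∫ s in a..t, energy ϱ u s :=
      intervalIntegral.integral_nonneg ht.1 fun s _ => energy_nonneg ϱ u s
    have hpt : ∀ s, n2 (u s) ^ 2 ≥ 0 ∧ gr (u s) ≥ 0 ∧ n2 (ϱ s) ^ 2 ≥ 0 ∧ n2 (dt u s) ^ 2 ≥ 0 :=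
      fun s => ⟨sq_nonneg _, gr_nonneg _, sq_nonneg _, sq_nonneg _⟩
    -- velocity
    obtain ⟨i1, e1⟩ := n2_sq_sub_eq_integral (K := K) ht.1
      (fun s hs x => hS.hasDerivAt_u (hst hs) x)
      (hS.u_C1.continuousOn.mono (prod_mono hst subset_rfl))
      ((continuousOn_dt (isOpen_openTimes T) hS.u_C1).mono (prod_mono hst subset_rfl))
      (fun s hs => ⟨(hS.h2C2 (hst hs)).mem, (hK s (hsubt hs)).2.2.1⟩)
      (fun s hs => ⟨hS.memLp_dt_u (hst hs), (hK s (hsubt hs)).2.2.2.1⟩)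
    have b1 := intervalIntegral.integral_mono_on ht.1 i1 hZi fun s hs => by
      have h1 := (le_abs_self _).trans
        (abs_integral_inner_le (hS.h2C2 (hst hs)).mem (hS.memLp_dt_u (hst hs)))
      obtain ⟨p1, p2, p3, p4⟩ := hpt s
      rw [integral_const_mul, energy]
      linarith [two_mul_le_add_sq (n2 (u s)) (n2 (dt u s))]
    -- gradient of the velocity
    obtain ⟨i2, e2⟩ := hS.gr_sub_eq_integral ht.1 ha htm
    have b2 := intervalIntegral.integral_mono_on ht.1 i2 (hZi.const_mul C₁) fun s hs => by
      obtain ⟨p1, p2, p3, p4⟩ := hpt s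
      have hz := hZ1 s (hsubt hs)
      rw [energy] at hz
      have h1 := hder (hsl s (hst hs)) (by linarith)
      have h2 : C₁ * (gr (u s) + n2 (ϱ s) ^ 2) ≤ C₁ * energy ϱ u s :=
        mul_le_mul_of_nonneg_left (by rw [energy]; linarith) hC₁.le
      have h3 : 0 ≤ c * n2 (dt u s) ^ 2 := by positivity
      linarith
    -- density
    have hϱt : ∀ s ∈ Icc a t, MemLp (dt ϱ s) 2 ∧ n2 (dt ϱ s) ≤ K * K + L * K := fun s hs => by
      obtain ⟨-, k2, k3, -, -, -, -, hu⟩ := hK s (hsubt hs)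
      obtain ⟨m1, m2⟩ := hS.memLp_dt_ϱ hρ hL (hst hs) hu
      exact ⟨m1, m2.trans (add_le_add (mul_le_mul_of_nonneg_left k2 hK0)
        (mul_le_mul_of_nonneg_left k3 hL0))⟩
    obtain ⟨i3, e3⟩ := n2_sq_sub_eq_integral (K := K + (K * K + L * K)) ht.1
      (fun s hs x => hS.hasDerivAt_ϱ (hst hs) x)
      (hS.ϱ_C1.continuousOn.mono (prod_mono hst subset_rfl))
      ((continuousOn_dt (isOpen_openTimes T) hS.ϱ_C1).mono (prod_mono hst subset_rfl))
      (fun s hs => ⟨(hS.h1C1 (hst hs)).mem, (hK s (hsubt hs)).1.trans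
        (le_add_of_nonneg_right (by positivity))⟩)
      (fun s hs => ⟨(hϱt s hs).1, (hϱt s hs).2.trans (le_add_of_nonneg_left hK0)⟩)
    have b3 := intervalIntegral.integral_mono_on ht.1 i3 (hZi.const_mul L) fun s hs => by
      have hs' := hst hs
      have hr := hS.h1C1 hs'
      have hu := hS.h2C2 hs'
      have huK := (hK s (hsubt hs)).2.2.2.2.2.2.2
      have h0 := integral_mul_transport_eq_zero hu.h1 (hS.dvg_eq_zero hs') huK hr
      have j1 : Integrable fun x => ϱ s x * fderiv ℝ (ϱ s) x (u s x) :=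
        integrable_of_le_mul K (hr.c1.continuous.mul
          ((hr.c1.continuous_fderiv (by norm_num)).clm_apply hu.c2.continuous)).aestronglyMeasurable
          hr.mem hr.memD fun x => by
            rw [norm_mul]
            have h1 := (ContinuousLinearMap.le_opNorm (fderiv ℝ (ϱ s) x) (u s x)).trans
              (mul_le_mul_of_nonneg_left (huK x) (norm_nonneg _))
            linarith [mul_le_mul_of_nonneg_left h1 (norm_nonneg (ϱ s x))]
      have j2 : Integrable fun x => ϱ s x * (deriv ρbar (x 2) * u s x 2) := by
        refine (integrable_mul_l2 hr.mem (hϱt s hs).1).neg.sub j1 |>.congr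
          (Eventually.of_forall fun x => ?_)
        simp only [Pi.sub_apply, Pi.neg_apply, hS.dt_ϱ_eq hρ hs']
        ring
      have h2 : ∫ x, 2 * inner ℝ (ϱ s x) (dt ϱ s x)
          = -2 * ∫ x, ϱ s x * (deriv ρbar (x 2) * u s x 2) := by
        have h3 : ∀ x, 2 * inner ℝ (ϱ s x) (dt ϱ s x) = -2 * (ϱ s x * fderiv ℝ (ϱ s) x (u s x))
            + -2 * (ϱ s x * (deriv ρbar (x 2) * u s x 2)) := fun x => by
          rw [hS.dt_ϱ_eq hρ hs']
          simp
          ring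
        rw [integral_congr_ae (Eventually.of_forall h3), integral_add (j1.const_mul _)
          (j2.const_mul _), integral_const_mul, integral_const_mul, h0]
        ring
      have h4 := abs_integral_le_n2_mul hL0 hr.mem hu.mem
        (k := fun x => ϱ s x * (deriv ρbar (x 2) * u s x 2)) fun x => by
          rw [abs_mul, abs_mul]
          have h5 := mul_le_mul (hL (x 2)) (PiLp.norm_apply_le (u s x) 2) (norm_nonneg _) hL0
          have h6 := mul_le_mul_of_nonneg_left h5 (abs_nonneg (ϱ s x))
          rw [Real.norm_eq_abs] at h6 ⊢
          linarith
      have h7 := (abs_le.1 h4).1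
      obtain ⟨p1, p2, p3, p4⟩ := hpt s
      have h8 : L * (2 * (n2 (ϱ s) * n2 (u s))) ≤ L * energy ϱ u s := by
        refine mul_le_mul_of_nonneg_left ?_ hL0
        rw [energy]
        linarith [two_mul_le_add_sq (n2 (ϱ s)) (n2 (u s))]
      simp only [h2]
      linarith
    have e4 := hacc hS hsl ht.1 (ht.2.trans_lt hbb) ha hb' hZ1
    rw [← e1] at b1
    rw [← e2, intervalIntegral.integral_const_mul] at b2
    rw [← e3, intervalIntegral.integral_const_mul] at b3
    obtain ⟨p1, p2, p3, p4⟩ := hpt a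
    have q1 : C₂ * n2 (dt u a) ^ 2 ≤ C₂ * energy ϱ u a :=
      mul_le_mul_of_nonneg_left (by rw [energy]; linarith) hC₂.le
    have q2 : 0 ≤ (C₁ + L) * energy ϱ u a := by positivity
    have q3 : n2 (u a) ^ 2 + gr (u a) + n2 (ϱ a) ^ 2 ≤ energy ϱ u a := by rw [energy]; linarith
    have q4 : energy ϱ u t = n2 (u t) ^ 2 + gr (u t) + n2 (ϱ t) ^ 2 + n2 (dt u t) ^ 2 := rfl
    linarith
  have hCpos : 0 < 1 + C₂ + C₁ + L := by positivity
  exact (main b ⟨hab, le_rfl⟩).trans (add_integral_le_exp_of_le hab hCpos hZc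
    (fun t _ => energy_nonneg ϱ u t) fun t ht =>
      (le_add_of_nonneg_right ENNReal.toReal_nonneg).trans (main t ht))

/-! ### Growth of the density gradient -/

lemma IsProfile.exists_lipschitz {ρbar : ℝ → ℝ} (hρ : IsProfile ρbar) :
    ∃ L : ℝ, 0 ≤ L ∧ ∀ y z, |deriv ρbar y - deriv ρbar z| ≤ L * |y - z| := by
  have h1 : ContDiff ℝ 1 (deriv ρbar) :=
    (contDiff_succ_iff_deriv (n := 1)).1 (hρ.smooth.of_le (by norm_cast)) |>.2.2
  obtain ⟨C, hC⟩ := h1.lipschitzWith_of_hasCompactSupport hρ.compact (by norm_num)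
  exact ⟨C, C.2, fun y z => by simpa [Real.dist_eq] using hC.dist_le_mul y z⟩

lemma fderiv_dq {F : Type*} [NormedAddCommGroup F] [NormedSpace ℝ F] {f : R3 → F}
    (hf : Differentiable ℝ f) (η : ℝ) (j : Fin 3) (x : R3) :
    fderiv ℝ (dq η j f) x = η⁻¹ • (fderiv ℝ f (x + η • e j) - fderiv ℝ f x) := by
  have h1 : HasFDerivAt (fun x => f (x + η • e j)) (fderiv ℝ f (x + η • e j)) x :=
    (hasFDerivAt_comp_add_right (η • e j)).2 (hf _).hasFDerivAt
  exact ((h1.sub (hf x).hasFDerivAt).const_smul η⁻¹).fderiv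

lemma norm_dq_le {F : Type*} [NormedAddCommGroup F] [NormedSpace ℝ F] {f : R3 → F}
    (hf : Differentiable ℝ f) {M : ℝ} (hM : ∀ x, ‖fderiv ℝ f x‖ ≤ M) {η : ℝ} (hη : η ≠ 0)
    (j : Fin 3) (x : R3) : ‖dq η j f x‖ ≤ M := by
  have h1 := convex_univ.norm_image_sub_le_of_norm_fderiv_le (𝕜 := ℝ) (fun y _ => hf y)
    (fun y _ => hM y) (mem_univ x) (mem_univ (x + η • e j))
  rw [add_sub_cancel_left, norm_smul, norm_e, mul_one] at h1
  rw [dq, norm_smul, norm_inv, inv_mul_le_iff₀ (norm_pos_iff.2 hη), mul_comm]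
  exact h1

/-- The time derivative of the density prescribed by the transport equation. -/
noncomputable def transportRate (ρbar : ℝ → ℝ) (ϱ : R3 → ℝ) (u : R3 → R3) : R3 → ℝ := fun x =>
  -(fderiv ℝ ϱ x (u x) + deriv ρbar (x 2) * u x 2)

/-- Discrete Leibniz rule: transport of the difference quotient plus a commutator containing
difference quotients of u and of ρ̄'. -/
lemma dq_transportRate {ρbar : ℝ → ℝ} {ϱ : R3 → ℝ} {u : R3 → R3} (hϱ : Differentiable ℝ ϱ)
    (η : ℝ) (j : Fin 3) (x : R3) :
    dq η j (transportRate ρbar ϱ u) x = -(fderiv ℝ (dq η j ϱ) x (u x))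
      - (fderiv ℝ ϱ (x + η • e j) (dq η j u x)
        + deriv ρbar ((x + η • e j) 2) * dq η j u x 2
        + η⁻¹ * (deriv ρbar ((x + η • e j) 2) - deriv ρbar (x 2)) * u x 2) := by
  rw [fderiv_dq hϱ]
  simp only [dq, transportRate, smul_eq_mul, map_smul, map_sub, smul_apply, sub_apply,
    PiLp.smul_apply, PiLp.sub_apply]
  ring

namespace Slice

variable {μ g α β : ℝ} {ρbar : ℝ → ℝ} {ϱ : R3 → ℝ} {u v : R3 → R3} {q : R3 → ℝ}

/-- Difference quotients replace ∇ϱ because ϱ is only C¹. Transport of the quotient has zero mean;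
the commutator costs ‖∇u‖_∞ on ∇ϱ and the bounds of ρ̄' and its Lipschitz constant on u, all
uniformly in η. -/
lemma integral_dq_transportRate_le (h : Slice μ g α β ρbar ϱ u v q) {L L' M K : ℝ}
    (hL : ∀ z, |deriv ρbar z| ≤ L) (hL0 : 0 ≤ L')
    (hL' : ∀ y z, |deriv ρbar y - deriv ρbar z| ≤ L' * |y - z|)
    (hM : ∀ x, ‖fderiv ℝ u x‖ ≤ M) (hK : ∀ x, ‖u x‖ ≤ K) {η : ℝ} (hη : η ≠ 0) (j : Fin 3)
    (hr : MemLp (dq η j (transportRate ρbar ϱ u)) 2) :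
    ∫ x, 2 * inner ℝ (dq η j ϱ x) (dq η j (transportRate ρbar ϱ u) x)
      ≤ 2 * (M * gr ϱ + (L + L') * (gr ϱ + gr u + n2 u ^ 2)) := by
  have hM0 : 0 ≤ M := (norm_nonneg _).trans (hM 0)
  have hL00 : 0 ≤ L := (abs_nonneg _).trans (hL 0)
  have hf := h.ϱ_H1.dq η j
  have hu := h.u_H2.h1.dq η j
  obtain ⟨f1, f2⟩ := memLp_dq h.ϱ_H1.c1 j (h.ϱ_H1.mem_pd j).1 hη
  obtain ⟨u1, u2⟩ := memLp_dq h.u_H2.h1.c1 j (h.u_H2.h1.mem_pd j).1 hη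
  have hP : MemLp (fun x => fderiv ℝ ϱ (x + η • e j)) 2 := RayleighTaylor.MemLp.translate h.ϱ_H1.memD _
  have hPn : n2 (fun x => fderiv ℝ ϱ (x + η • e j)) = n2 (fderiv ℝ ϱ) :=
    n2_translate h.ϱ_H1.memD _
  obtain ⟨f, hfd⟩ : ∃ f, f = dq η j ϱ := ⟨_, rfl⟩
  obtain ⟨w, hwd⟩ : ∃ w, w = dq η j u := ⟨_, rfl⟩
  obtain ⟨r, hrd⟩ : ∃ r, r = dq η j (transportRate ρbar ϱ u) := ⟨_, rfl⟩
  obtain ⟨k, hk⟩ : ∃ k : R3 → ℝ, k = fun x => fderiv ℝ ϱ (x + η • e j) (w x)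
    + deriv ρbar ((x + η • e j) 2) * w x 2
    + η⁻¹ * (deriv ρbar ((x + η • e j) 2) - deriv ρbar (x 2)) * u x 2 := ⟨_, rfl⟩
  have hrk : ∀ x, r x = -(fderiv ℝ f x (u x)) - k x := fun x => by
    rw [hrd, hk, hfd, hwd, dq_transportRate h.ϱ_H1.diff]
  have hwM : ∀ x, ‖w x‖ ≤ M := fun x => hwd ▸ norm_dq_le h.u_H2.h1.diff hM hη j x
  rw [← hfd] at hf f1 f2 ⊢
  rw [← hwd] at u1 u2
  rw [← hrd] at hr ⊢
  -- size of the commutator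
  obtain ⟨G, hG⟩ : ∃ G : R3 → ℝ, G = fun x => (M * ‖fderiv ℝ ϱ (x + η • e j)‖ + L * ‖w x‖)
    + L' * ‖u x‖ := ⟨_, rfl⟩
  have g1 := hP.norm.const_mul M
  have g2 := u1.norm.const_mul L
  have g3 := h.u_H2.mem.norm.const_mul L'
  have hG2 : MemLp G 2 := hG ▸ memLp_fun_add (memLp_fun_add g1 g2) g3
  have hnn : ∀ {F : Type} [NormedAddCommGroup F] (c : ℝ) (f : R3 → F), 0 ≤ c →
      n2 (fun x => c * ‖f x‖) = c * n2 f := fun c f hc => by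
    rw [n2_mul_const_left, abs_of_nonneg hc]
    congr 1
    exact congrArg ENNReal.toReal (eLpNorm_norm f)
  have hGn : n2 G ≤ M * n2 (fderiv ℝ ϱ) + L * n2 (pd j u) + L' * n2 u := by
    rw [hG]
    refine (n2_add_le (memLp_fun_add g1 g2) g3).trans ?_
    have := n2_add_le g1 g2
    rw [hnn M _ hM0, hPn, hnn L _ hL00] at this
    rw [hnn L' _ hL0]
    have := mul_le_mul_of_nonneg_left u2 hL00
    linarith
  have hkG : ∀ x, |k x| ≤ ‖G x‖ := fun x => by
    rw [hG, Real.norm_of_nonneg (by positivity), hk]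
    refine (abs_add_le _ _).trans (add_le_add ((abs_add_le _ _).trans (add_le_add ?_ ?_)) ?_)
    · rw [mul_comm M]
      exact (ContinuousLinearMap.le_opNorm (fderiv ℝ ϱ (x + η • e j)) (w x)).trans
        (mul_le_mul_of_nonneg_left (hwM x) (norm_nonneg _))
    · rw [abs_mul]
      exact mul_le_mul (hL _) (PiLp.norm_apply_le (w x) 2) (abs_nonneg _) hL00
    · rw [abs_mul]
      refine mul_le_mul ?_ (PiLp.norm_apply_le (u x) 2) (abs_nonneg _) hL0
      rw [abs_mul, abs_inv, inv_mul_le_iff₀ (abs_pos.2 hη), mul_comm]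
      refine (hL' _ _).trans (mul_le_mul_of_nonneg_left ?_ hL0)
      have h1 := PiLp.norm_apply_le (η • e j) 2
      rw [norm_smul, norm_e, mul_one] at h1
      simpa using h1
  have h0 := integral_mul_transport_eq_zero h.u_H2.h1 h.div_free hK hf
  have i1 : Integrable fun x => f x * fderiv ℝ f x (u x) :=
    integrable_of_le_mul K (hf.c1.continuous.mul
      ((hf.c1.continuous_fderiv (by norm_num)).clm_apply h.u_H2.c2.continuous)).aestronglyMeasurable
      f1 hf.memD fun x => by
        rw [norm_mul]
        have h1 := (ContinuousLinearMap.le_opNorm (fderiv ℝ f x) (u x)).trans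
          (mul_le_mul_of_nonneg_left (hK x) (norm_nonneg _))
        linarith [mul_le_mul_of_nonneg_left h1 (norm_nonneg (f x))]
  have i2 : Integrable fun x => f x * k x := by
    refine ((integrable_mul_l2 f1 hr).neg.sub i1).congr (Eventually.of_forall fun x => ?_)
    simp only [Pi.sub_apply, Pi.neg_apply, hrk]
    ring
  have h2 : ∫ x, 2 * inner ℝ (f x) (r x) = -2 * ∫ x, f x * k x := by
    have h3 : ∀ x, 2 * inner ℝ (f x) (r x) = -2 * (f x * fderiv ℝ f x (u x))
        + -2 * (f x * k x) := fun x => by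
      rw [hrk]
      simp
      ring
    rw [integral_congr_ae (Eventually.of_forall h3), integral_add (i1.const_mul _)
      (i2.const_mul _), integral_const_mul, integral_const_mul, h0]
    ring
  have h3 := abs_integral_le_n2_mul (k := fun x => f x * k x) zero_le_one f1 hG2 fun x => by
    rw [abs_mul, one_mul, Real.norm_eq_abs (f x)]
    exact mul_le_mul_of_nonneg_left (hkG x) (abs_nonneg _)
  rw [one_mul] at h3
  have h4 := (_root_.abs_le.1 h3).1
  rw [h2]
  obtain ⟨p, hp0, hp⟩ : ∃ p, 0 ≤ p ∧ p ^ 2 = gr ϱ :=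
    ⟨_, Real.sqrt_nonneg _, Real.sq_sqrt (gr_nonneg ϱ)⟩
  obtain ⟨y, hy0, hy⟩ : ∃ y, 0 ≤ y ∧ y ^ 2 = gr u :=
    ⟨_, Real.sqrt_nonneg _, Real.sq_sqrt (gr_nonneg u)⟩
  have c1 : n2 f ≤ p := f2.trans (le_of_sq_le_sq (hp ▸ n2_pd_sq_le_gr ϱ j) hp0)
  have c2 : n2 (fderiv ℝ ϱ) ≤ p := le_of_sq_le_sq (hp ▸ h.ϱ_H1.n2_fderiv_sq_le_gr) hp0
  have c3 : n2 (pd j u) ≤ y := le_of_sq_le_sq (hy ▸ n2_pd_sq_le_gr u j) hy0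
  have c4 : n2 f * n2 G ≤ p * (M * p + L * y + L' * n2 u) := by
    refine mul_le_mul c1 (hGn.trans ?_) (n2_nonneg _) hp0
    gcongr
  rw [← hp, ← hy]
  have d1 := mul_le_mul_of_nonneg_left (two_mul_le_add_sq p y) hL00
  have d2 := mul_le_mul_of_nonneg_left (two_mul_le_add_sq p (n2 u)) hL0
  have d3 : 0 ≤ L * n2 u ^ 2 := by positivity
  have d4 : 0 ≤ L' * y ^ 2 := by positivity
  have d5 : 0 ≤ (L + L') * (p ^ 2 + y ^ 2 + n2 u ^ 2) := by positivity
  linarith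

end Slice

lemma sq_integral_mul_le {X : Type*} [MeasurableSpace X] {ν : Measure X} {f k : X → ℝ}
    (hf : MemLp f 2 ν) (hk : MemLp k 2 ν) :
    (∫ x, k x * f x ∂ν) ^ 2 ≤ (∫ x, k x ^ 2 ∂ν) * ∫ x, f x ^ 2 ∂ν := by
  have h := integral_mul_norm_le_Lp_mul_Lq (μ := ν) (f := k)
    (g := f) (p := 2) (q := 2) ⟨by norm_num, by norm_num, by norm_num⟩
    (by simpa using hk) (by simpa using hf)
  simp only [Real.rpow_ofNat, ← Real.sqrt_eq_rpow, Real.norm_eq_abs, sq_abs] at h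
  have h1 : |∫ x, k x * f x ∂ν| ≤ √(∫ x, k x ^ 2 ∂ν) * √(∫ x, f x ^ 2 ∂ν) := by
    refine (abs_integral_le_integral_abs (f := fun x => k x * f x)).trans ?_
    simpa only [abs_mul] using h
  rw [← sq_abs]
  refine (pow_le_pow_left₀ (abs_nonneg _) h1 2).trans ?_
  rw [mul_pow, Real.sq_sqrt (integral_nonneg fun x => sq_nonneg _),
    Real.sq_sqrt (integral_nonneg fun x => sq_nonneg _)]

/-- The coefficient k is only square integrable in time. Cauchy–Schwarz turns the hypothesis into a
linear inequality for f² with constant coefficient, to which Gronwall applies; taking the root costs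
the factor 2. -/
lemma le_exp_of_le_integral_mul {f k : ℝ → ℝ} {a b A C κ : ℝ} (hab : a ≤ b) (hA : 0 ≤ A)
    (hC : 0 < C) (hκ : 0 < κ) (hf : ContinuousOn f (Icc a b)) (h0 : ∀ t ∈ Icc a b, 0 ≤ f t)
    (hk : MemLp k 2 (volume.restrict (Ioc a b))) (hkκ : ∫ s in Ioc a b, k s ^ 2 ≤ κ)
    (h : ∀ t ∈ Icc a b, f t ≤ A + C * ∫ s in a..t, k s * f s) :
    f b ≤ 2 * A * Real.exp (C ^ 2 * κ * (b - a)) := by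
  have key : ∀ t ∈ Icc a b, f t ^ 2 ≤ 2 * A ^ 2 + 2 * C ^ 2 * κ * ∫ s in a..t, f s ^ 2 := by
    intro t ht
    have hsub : Ioc a t ⊆ Ioc a b := Ioc_subset_Ioc_right ht.2
    have hk' := hk.mono_measure (Measure.restrict_mono_set volume hsub)
    have hfc := hf.mono (Icc_subset_Icc_right ht.2)
    have hf2 : MemLp f 2 (volume.restrict (Ioc a t)) :=
      (memLp_two_iff_integrable_sq ((hfc.mono Ioc_subset_Icc_self).aestronglyMeasurable
        measurableSet_Ioc)).2 ((hfc.pow 2).integrableOn_Icc.mono_set Ioc_subset_Icc_self)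
    have h1 := sq_integral_mul_le hf2 hk'
    have h2 : ∫ s in Ioc a t, k s ^ 2 ≤ κ :=
      (setIntegral_mono_set hk.integrable_sq (Eventually.of_forall fun s => sq_nonneg _)
        hsub.eventuallyLE).trans hkκ
    have h3 := h t ht
    rw [intervalIntegral.integral_of_le ht.1] at h3 ⊢
    have h4 : 0 ≤ ∫ s in Ioc a t, f s ^ 2 := integral_nonneg fun s => sq_nonneg _
    have h5 := h1.trans (mul_le_mul_of_nonneg_right h2 h4)
    have h6 := pow_le_pow_left₀ (h0 t ht) h3 2
    have h7 := mul_le_mul_of_nonneg_left h5 (by positivity : 0 ≤ 2 * C ^ 2)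
    linarith [two_mul_le_add_sq A (C * ∫ s in Ioc a t, k s * f s)]
  have h1 := add_integral_le_exp_of_le hab (by positivity : 0 < 2 * C ^ 2 * κ) (hf.pow 2)
    (fun t _ => sq_nonneg _) key
  have hb := (key b ⟨hab, le_rfl⟩).trans h1
  refine le_of_sq_le_sq (hb.trans ?_) (by positivity)
  have h2 : Real.exp (2 * C ^ 2 * κ * (b - a)) = Real.exp (C ^ 2 * κ * (b - a)) ^ 2 := by
    rw [← Real.exp_nat_mul]
    congr 1
    push_cast
    ring
  rw [h2, mul_pow, mul_pow]
  have : 0 ≤ A ^ 2 * Real.exp (C ^ 2 * κ * (b - a)) ^ 2 := by positivity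
  linarith

/-- Sobolev's inequality at the times where ‖∇u_t‖ is finite, hence almost everywhere. It makes the
Lipschitz constant of the velocity square integrable in time. -/
lemma exists_n6_dt_bound : ∃ S : ℝ, 0 < S ∧ ∀ {μ g : ℝ} {ρbar : ℝ → ℝ} {T : EReal} {ϱ₀ : R3 → ℝ}
    {u₀ : R3 → R3} {ϱ : ℝ → R3 → ℝ} {u : ℝ → R3 → R3} {q : ℝ → R3 → ℝ},
    IsClassicalSolution μ g ρbar T ϱ₀ u₀ ϱ u q → ∀ {a b : ℝ}, a ≤ b → a ∈ openTimes T →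
    b ∈ openTimes T → (∀ᵐ t ∂volume.restrict (Ioc a b), MemLp (dt u t) 6) ∧
      MemLp (fun t => n6 (dt u t)) 2 (volume.restrict (Ioc a b)) ∧
      ∫ t in Ioc a b, n6 (dt u t) ^ 2 ≤ S * (∫⁻ s in Icc a b, gradSq (dt u s)).toReal := by
  obtain ⟨S, hS0, hSob⟩ := exists_sobolev_gradSq
  refine ⟨S, hS0, ?_⟩
  intro μ g ρbar T ϱ₀ u₀ ϱ u q hS a b hab ha hb
  have hsub := Icc_subset_openTimes ha hb
  have hgc : Continuous fun p : ℝ × R3 => dt u (projIcc a b hab p.1) p.2 :=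
    continuous_clamp hab ((continuousOn_dt (isOpen_openTimes T) hS.u_C1).mono
      (prod_mono hsub subset_rfl))
  have hΦ : Measurable fun t => ∫⁻ x, ‖dt u (projIcc a b hab t) x‖ₑ ^ 6 :=
    (hgc.measurable.enorm.pow_const 6).lintegral_prod_right'
  have hm : AEMeasurable (fun t => eLpNorm (dt u t) 6 volume) (volume.restrict (Ioc a b)) := by
    refine ⟨_, hΦ.pow_const (1 / 6 : ℝ), (ae_restrict_mem measurableSet_Ioc).mono fun t ht => ?_⟩
    simp only [projIcc_of_mem hab (Ioc_subset_Icc_self ht), lintegral_pow_six]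
    rw [← ENNReal.rpow_natCast, ← ENNReal.rpow_mul]
    norm_num
  have hΓ := hS.ut_H1 a ha b hb
  have hle : ∫⁻ t in Ioc a b, eLpNorm (dt u t) 6 volume ^ 2
      ≤ ENNReal.ofReal S * ∫⁻ s in Icc a b, gradSq (dt u s) := by
    rw [← lintegral_const_mul' _ _ ENNReal.ofReal_ne_top]
    refine (setLIntegral_mono_ae' measurableSet_Ioc (Eventually.of_forall fun t ht => ?_)).trans
      (lintegral_mono_set Ioc_subset_Icc_self)
    have ht' := hsub (Ioc_subset_Icc_self ht)
    exact hSob _ (hS.continuous_dt_u ht') (hS.memLp_dt_u ht')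
  have hfin := hle.trans_lt (ENNReal.mul_lt_top ENNReal.ofReal_lt_top hΓ)
  have hae : ∀ᵐ t ∂volume.restrict (Ioc a b), MemLp (dt u t) 6 := by
    filter_upwards [ae_lt_top' (hm.pow_const 2) hfin.ne, ae_restrict_mem measurableSet_Ioc]
      with t h1 h2
    refine ⟨(hS.continuous_dt_u (hsub (Ioc_subset_Icc_self h2))).aestronglyMeasurable, ?_⟩
    exact (ENNReal.pow_lt_top_iff.1 h1).resolve_right (by norm_num)
  have hm6 : AEStronglyMeasurable (fun t => n6 (dt u t)) (volume.restrict (Ioc a b)) :=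
    hm.ennreal_toReal.aestronglyMeasurable
  have hle2 : ∫⁻ t in Ioc a b, ENNReal.ofReal (n6 (dt u t) ^ 2)
      ≤ ENNReal.ofReal S * ∫⁻ s in Icc a b, gradSq (dt u s) := by
    refine (lintegral_mono fun t => ?_).trans hle
    rw [ENNReal.ofReal_pow (n6_nonneg _)]
    exact pow_le_pow_left' ENNReal.ofReal_toReal_le 2
  have hint : Integrable (fun t => n6 (dt u t) ^ 2) (volume.restrict (Ioc a b)) := by
    refine ⟨hm6.pow 2, ?_⟩
    rw [hasFiniteIntegral_iff_ofReal (Eventually.of_forall fun t => sq_nonneg _)]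
    exact hle2.trans_lt (ENNReal.mul_lt_top ENNReal.ofReal_lt_top hΓ)
  refine ⟨hae, (memLp_two_iff_integrable_sq hm6).2 hint, ?_⟩
  rw [integral_eq_lintegral_of_nonneg_ae (Eventually.of_forall fun t => sq_nonneg _) hint.1]
  refine (ENNReal.toReal_mono (ENNReal.mul_lt_top ENNReal.ofReal_lt_top hΓ).ne hle2).trans ?_
  rw [ENNReal.toReal_mul, ENNReal.toReal_ofReal hS0.le]

namespace IsClassicalSolution

variable {μ g : ℝ} {ρbar : ℝ → ℝ} {T : EReal} {ϱ₀ : R3 → ℝ} {u₀ : R3 → R3} {ϱ : ℝ → R3 → ℝ}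
  {u : ℝ → R3 → R3} {q : ℝ → R3 → ℝ} (hS : IsClassicalSolution μ g ρbar T ϱ₀ u₀ ϱ u q)
include hS

lemma n2_dq_sq_sub_eq_integral (hρ : IsProfile ρbar) {a b η : ℝ} (hab : a ≤ b)
    (ha : a ∈ openTimes T) (hb : b ∈ openTimes T) (hη : η ≠ 0) (j : Fin 3) :
    (∀ t ∈ Icc a b, MemLp (dq η j (transportRate ρbar (ϱ t) (u t))) 2) ∧
    IntervalIntegrable (fun t => ∫ x, 2 * inner ℝ (dq η j (ϱ t) x)
      (dq η j (transportRate ρbar (ϱ t) (u t)) x)) volume a b ∧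
    n2 (dq η j (ϱ b)) ^ 2 - n2 (dq η j (ϱ a)) ^ 2 = ∫ t in a..b, ∫ x,
      2 * inner ℝ (dq η j (ϱ t) x) (dq η j (transportRate ρbar (ϱ t) (u t)) x) := by
  have hsub := Icc_subset_openTimes ha hb
  obtain ⟨L, hL0, hL⟩ := hρ.exists_bound
  obtain ⟨K, hK0, hK⟩ := hS.exists_bound ha hb
  have hrate : ∀ t ∈ Icc a b, dt ϱ t = transportRate ρbar (ϱ t) (u t) := fun t ht =>
    funext fun x => hS.dt_ϱ_eq hρ (hsub ht) x
  have hϱt : ∀ t ∈ Icc a b, MemLp (dt ϱ t) 2 ∧ n2 (dt ϱ t) ≤ K * K + L * K := fun s hs => by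
    obtain ⟨-, k2, k3, -, -, -, -, hu⟩ := hK s hs
    obtain ⟨m1, m2⟩ := hS.memLp_dt_ϱ hρ hL (hsub hs) hu
    exact ⟨m1, m2.trans (add_le_add (mul_le_mul_of_nonneg_left k2 hK0)
      (mul_le_mul_of_nonneg_left k3 hL0))⟩
  have hdqm : ∀ {f : R3 → ℝ}, MemLp f 2 → MemLp (dq η j f) 2 ∧ n2 (dq η j f) ≤ |η⁻¹| * (2 * n2 f) :=
    fun {f} hf => by
      have h1 : MemLp (fun x => f (x + η • e j)) 2 := MemLp.translate hf _
      refine ⟨memLp_fun_smul (memLp_fun_sub h1 hf) _, ?_⟩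
      rw [show dq η j f = fun x => η⁻¹ • (f (x + η • e j) - f x) from rfl, n2_smul]
      refine mul_le_mul_of_nonneg_left ((n2_sub_le h1 hf).trans ?_) (abs_nonneg _)
      rw [n2_translate hf]
      linarith
  have hcont : ∀ {f : ℝ → R3 → ℝ}, ContinuousOn (fun p : ℝ × R3 => f p.1 p.2)
      (openTimes T ×ˢ univ) → ContinuousOn (fun p : ℝ × R3 => dq η j (f p.1) p.2)
      (Icc a b ×ˢ univ) := fun {f} hf => by
    have h1 : ContinuousOn (fun p : ℝ × R3 => f p.1 (p.2 + η • e j)) (Icc a b ×ˢ univ) :=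
      hf.comp (f := fun p : ℝ × R3 => (p.1, p.2 + η • e j)) (by fun_prop)
        fun p hp => ⟨hsub hp.1, mem_univ _⟩
    exact (h1.sub (hf.mono (prod_mono hsub subset_rfl))).const_smul η⁻¹
  have hmem : ∀ t ∈ Icc a b, MemLp (dq η j (transportRate ρbar (ϱ t) (u t))) 2 := fun t ht => by
    rw [← hrate t ht]
    exact (hdqm (hϱt t ht).1).1
  obtain ⟨h1, h2⟩ := n2_sq_sub_eq_integral (f := fun t => dq η j (ϱ t))
    (f' := fun t => dq η j (dt ϱ t)) (K := |η⁻¹| * (2 * (K + (K * K + L * K)))) hab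
    (fun t ht x => ((hS.hasDerivAt_ϱ (hsub ht) (x + η • e j)).sub
      (hS.hasDerivAt_ϱ (hsub ht) x)).const_smul η⁻¹)
    (hcont hS.ϱ_C1.continuousOn) (hcont (continuousOn_dt (isOpen_openTimes T) hS.ϱ_C1))
    (fun t ht => by
      obtain ⟨m1, m2⟩ := hdqm (hS.h1C1 (hsub ht)).mem
      refine ⟨m1, m2.trans ?_⟩
      gcongr
      exact (hK t ht).1.trans (le_add_of_nonneg_right (by positivity)))
    fun t ht => by
      obtain ⟨m1, m2⟩ := hdqm (hϱt t ht).1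
      refine ⟨m1, m2.trans ?_⟩
      gcongr
      exact (hϱt t ht).2.trans (le_add_of_nonneg_left hK0)
  have h3 : ∀ t ∈ Icc a b, ∫ x, 2 * inner ℝ (dq η j (ϱ t) x) (dq η j (dt ϱ t) x)
      = ∫ x, 2 * inner ℝ (dq η j (ϱ t) x) (dq η j (transportRate ρbar (ϱ t) (u t)) x) :=
    fun t ht => by rw [hrate t ht]
  refine ⟨hmem, h1.congr fun t ht => h3 t (by
    rw [uIoc_of_le hab] at ht; exact Ioc_subset_Icc_self ht), h2.trans ?_⟩
  exact intervalIntegral.integral_congr fun t ht => h3 t (by rwa [uIcc_of_le hab] at ht)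

end IsClassicalSolution

/-- Growth of `‖∇ϱ‖²` along the transport equation. -/
lemma exists_gr_density_bound {μ g α β : ℝ} {ρbar : ℝ → ℝ} (hμ : 0 < μ) (hg : 0 < g) (hα : 0 < α)
    (hρ : IsProfile ρbar) :
    ∃ C : ℝ, 0 < C ∧ ∀ {T : EReal} {ϱ₀ : R3 → ℝ} {u₀ : R3 → R3} {ϱ : ℝ → R3 → ℝ}
      {u : ℝ → R3 → R3} {q : ℝ → R3 → ℝ}, IsClassicalSolution μ g ρbar T ϱ₀ u₀ ϱ u q →
      (∀ t ∈ openTimes T, Slice μ g α β ρbar (ϱ t) (u t) (dt u t) (q t)) →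
      ∀ {a b : ℝ}, a ≤ b → a ∈ openTimes T → b ∈ openTimes T →
      (∀ s ∈ Icc a b, energy ϱ u s ≤ 1) →
      gr (ϱ b) ≤ 2 * (gr (ϱ a) + C * ∫ s in a..b, energy ϱ u s) * Real.exp (C * (b - a)
        * (1 + (b - a) + (∫⁻ s in Icc a b, gradSq (dt u s)).toReal)) := by
  obtain ⟨L, hL0, hL⟩ := hρ.exists_bound
  obtain ⟨L', hL'0, hL'⟩ := hρ.exists_lipschitz
  obtain ⟨Cl, hCl, hlip⟩ := exists_lipschitz_bound (β := β) hμ hg hα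
  obtain ⟨S, hS0, hSob⟩ := exists_n6_dt_bound
  obtain ⟨C₁, hC₁⟩ : ∃ C₁, C₁ = 3 * (2 * (Cl + (L + L'))) := ⟨_, rfl⟩
  have hC₁0 : 0 < C₁ := by rw [hC₁]; positivity
  refine ⟨C₁ + C₁ ^ 2 * (2 + 2 * S), by positivity, ?_⟩
  intro T ϱ₀ u₀ ϱ u q hS hsl a b hab ha hb hZ1
  have hsub := Icc_subset_openTimes ha hb
  obtain ⟨hae, hn6, hn6S⟩ := hSob hS hab ha hb
  obtain ⟨K, hK0, hK⟩ := hS.exists_bound ha hb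
  obtain ⟨Γ, hΓ⟩ : ∃ Γ, Γ = (∫⁻ s in Icc a b, gradSq (dt u s)).toReal := ⟨_, rfl⟩
  have hΓ0 : 0 ≤ Γ := hΓ ▸ ENNReal.toReal_nonneg
  rw [← hΓ] at hn6S ⊢
  have hZi : ∀ t ∈ Icc a b, IntervalIntegrable (energy ϱ u) volume a t := fun t ht =>
    (hS.continuousOn_energy.mono (Icc_subset_openTimes ha
      (hsub ht))).intervalIntegrable_of_Icc ht.1
  have hPc : ContinuousOn (fun t => gr (ϱ t)) (Icc a b) := hS.continuousOn_gr_ϱ.mono hsub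
  -- Up to a constant, 1 + ‖u_t‖₆ bounds ‖∇u‖_∞ and is the Gronwall coefficient.
  have hk : MemLp (fun t => 1 + n6 (dt u t)) 2 (volume.restrict (Ioc a b)) :=
    MemLp.add (f := fun _ => (1 : ℝ)) (g := fun t => n6 (dt u t)) (memLp_const 1) hn6
  -- The final 1 only makes the bound strictly positive, also when a = b.
  have hkκ : ∫ s in Ioc a b, (1 + n6 (dt u s)) ^ 2 ≤ 2 * (b - a) + 2 * (S * Γ) + 1 := by
    have h1 : ∫ s in Ioc a b, (1 + n6 (dt u s)) ^ 2
        ≤ ∫ s in Ioc a b, (2 + 2 * n6 (dt u s) ^ 2) :=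
      integral_mono hk.integrable_sq ((integrable_const _).add (hn6.integrable_sq.const_mul 2))
        fun s => by nlinarith [sq_nonneg (1 - n6 (dt u s))]
    rw [integral_add (integrable_const _) (hn6.integrable_sq.const_mul 2),
      integral_const_mul, integral_const] at h1
    have h2 : (volume.restrict (Ioc a b)).real univ = b - a := by
      simp [Measure.real, hab]
    rw [h2, smul_eq_mul] at h1
    linarith
  have hkP : ∀ t ∈ Icc a b, IntervalIntegrable (fun s => (1 + n6 (dt u s)) * gr (ϱ s)) volume a t :=
    fun t ht => by
      rw [intervalIntegrable_iff_integrableOn_Ioc_of_le ht.1]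
      obtain ⟨B, hB⟩ := isCompact_Icc.exists_bound_of_continuousOn hPc
      have h1 : IntegrableOn (fun s => (1 + n6 (dt u s)) * gr (ϱ s)) (Ioc a b) :=
        (hk.integrable one_le_two).mul_bdd (c := B)
          ((hPc.mono Ioc_subset_Icc_self).aestronglyMeasurable measurableSet_Ioc)
          ((ae_restrict_mem measurableSet_Ioc).mono fun s hs => hB s (Ioc_subset_Icc_self hs))
      exact h1.mono_set (Ioc_subset_Ioc_right ht.2)
  -- difference quotients
  have hdq : ∀ t ∈ Icc a b, ∀ j : Fin 3, ∀ η : ℝ, η ≠ 0 → n2 (dq η j (ϱ t)) ^ 2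
      ≤ n2 (pd j (ϱ a)) ^ 2 + (2 * (Cl + (L + L'))) * ((∫ s in a..t, (1 + n6 (dt u s)) * gr (ϱ s))
        + ∫ s in a..t, energy ϱ u s) := by
    intro t ht j η hη
    have hst : Icc a t ⊆ Icc a b := Icc_subset_Icc_right ht.2
    obtain ⟨h1, h2, h3⟩ := hS.n2_dq_sq_sub_eq_integral hρ ht.1 ha (hsub ht) hη j
    have h4 := intervalIntegral.integral_mono_ae_restrict ht.1 h2
      (((hkP t ht).add (hZi t ht)).const_mul (2 * (Cl + (L + L')))) (by
        rw [← restrict_Ioc_eq_restrict_Icc]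
        have hae' := ae_mono (Measure.restrict_mono_set volume (Ioc_subset_Ioc_right ht.2)) hae
        filter_upwards [hae', ae_restrict_mem measurableSet_Ioc] with s hs6 hs
        have hs' := Ioc_subset_Icc_self hs
        have hsT := hsub (hst hs')
        have hz := hZ1 s (hst hs')
        have p1 := sq_nonneg (n2 (u s))
        have p2 := gr_nonneg (u s)
        have p3 := sq_nonneg (n2 (ϱ s))
        have p4 := sq_nonneg (n2 (dt u s))
        have p5 := gr_nonneg (ϱ s)
        have p6 := n6_nonneg (dt u s)
        rw [energy] at hz
        have h5 := (hsl s hsT).integral_dq_transportRate_le hL hL'0 hL'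
          (hlip (hsl s hsT) (by linarith) (by linarith) (by linarith) hs6)
          (hK s (hst hs')).2.2.2.2.2.2.2 hη j (h1 s hs')
        refine h5.trans ?_
        have h6 : (L + L') * (gr (ϱ s) + gr (u s) + n2 (u s) ^ 2)
            ≤ (L + L') * ((1 + n6 (dt u s)) * gr (ϱ s) + energy ϱ u s) := by
          refine mul_le_mul_of_nonneg_left ?_ (by positivity)
          rw [energy]
          have := mul_nonneg p6 p5
          linarith
        have h7 : 0 ≤ Cl * energy ϱ u s := mul_nonneg hCl.le (energy_nonneg ϱ u s)
        linarith)
    rw [← h3, intervalIntegral.integral_const_mul,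
      intervalIntegral.integral_add (hkP t ht) (hZi t ht)] at h4
    have hr := hS.h1C1 ha
    have h5 := pow_le_pow_left₀ (n2_nonneg _)
      (memLp_dq hr.c1 j (hr.mem_pd j).1 hη).2 2
    linarith
  have hP : ∀ t ∈ Icc a b, gr (ϱ t) ≤ (gr (ϱ a) + C₁ * ∫ s in a..b, energy ϱ u s)
      + C₁ * ∫ s in a..t, (1 + n6 (dt u s)) * gr (ϱ s) := by
    intro t ht
    have hr := hS.h1C1 (hsub ht)
    obtain ⟨R, hR⟩ : ∃ R, R = (2 * (Cl + (L + L'))) * ((∫ s in a..t, (1 + n6 (dt u s)) * gr (ϱ s))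
        + ∫ s in a..t, energy ϱ u s) := ⟨_, rfl⟩
    have hR0 : 0 ≤ R := by
      rw [hR]
      refine mul_nonneg (by positivity) (add_nonneg ?_ ?_)
      · exact intervalIntegral.integral_nonneg ht.1 fun s _ =>
          mul_nonneg (add_nonneg zero_le_one (n6_nonneg _)) (gr_nonneg _)
      · exact intervalIntegral.integral_nonneg ht.1 fun s _ => energy_nonneg ϱ u s
    have hdq' : ∀ j : Fin 3, ∀ η : ℝ, η ≠ 0 → n2 (dq η j (ϱ t)) ^ 2 ≤ n2 (pd j (ϱ a)) ^ 2 + R :=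
      fun j η hη => by rw [hR]; exact hdq t ht j η hη
    have h1 : ∀ j : Fin 3, n2 (pd j (ϱ t)) ^ 2 ≤ n2 (pd j (ϱ a)) ^ 2 + R := fun j => by
      have hη : ∀ n : ℕ, (1 / ((n : ℝ) + 1)) ≠ 0 := fun n => by positivity
      have hlim : Tendsto (fun n : ℕ => 1 / ((n : ℝ) + 1)) atTop (𝓝[≠] 0) :=
        tendsto_nhdsWithin_iff.2 ⟨tendsto_one_div_add_atTop_nhds_zero_nat,
          Eventually.of_forall hη⟩
      have h2 := (memLp_of_tendsto (f := fun n : ℕ => dq (1 / ((n : ℝ) + 1)) j (ϱ t))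
        (Real.sqrt_nonneg (n2 (pd j (ϱ a)) ^ 2 + R))
        (fun n => (memLp_dq hr.c1 j (hr.mem_pd j).1 (hη n)).1)
        (fun n => Real.le_sqrt_of_sq_le (hdq' j _ (hη n)))
        -- Fatou's lemma for η → 0 recovers ∂ⱼϱ, since the bound does not depend on η.
        fun x => (tendsto_dq hr.diff j x).comp hlim).2
      have h3 := pow_le_pow_left₀ (n2_nonneg _) h2 2
      rwa [Real.sq_sqrt (by positivity)] at h3
    have h4 : gr (ϱ t) ≤ gr (ϱ a) + 3 * R := by
      refine (Finset.sum_le_sum fun j _ => h1 j).trans ?_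
      rw [Finset.sum_add_distrib]
      simp [gr]
    have h5 : ∫ s in a..t, energy ϱ u s ≤ ∫ s in a..b, energy ϱ u s :=
      intervalIntegral.integral_mono_interval le_rfl ht.1 ht.2
        (Eventually.of_forall fun s => energy_nonneg ϱ u s) (hZi b ⟨hab, le_rfl⟩)
    have h6 := mul_le_mul_of_nonneg_left h5 hC₁0.le
    have h7 : 3 * R = C₁ * (∫ s in a..t, (1 + n6 (dt u s)) * gr (ϱ s))
        + C₁ * ∫ s in a..t, energy ϱ u s := by rw [hR, hC₁]; ring
    linarith
  have hI0 : 0 ≤ ∫ s in a..b, energy ϱ u s :=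
    intervalIntegral.integral_nonneg hab fun s _ => energy_nonneg ϱ u s
  have hA0 : 0 ≤ gr (ϱ a) + C₁ * ∫ s in a..b, energy ϱ u s :=
    add_nonneg (gr_nonneg _) (by positivity)
  have hba := sub_nonneg.2 hab
  refine (le_exp_of_le_integral_mul hab hA0 hC₁0 (by positivity) hPc (fun t _ => gr_nonneg _)
    hk hkκ hP).trans ?_
  have e1 : 0 ≤ C₁ ^ 2 * (2 + 2 * S) * ∫ s in a..b, energy ϱ u s := by positivity
  have e2 : C₁ ^ 2 * (2 * (b - a) + 2 * (S * Γ) + 1) * (b - a)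
      ≤ (C₁ + C₁ ^ 2 * (2 + 2 * S)) * (b - a) * (1 + (b - a) + Γ) := by
    have : 0 ≤ C₁ * (b - a) * (1 + (b - a) + Γ)
        + C₁ ^ 2 * (b - a) * (1 + 2 * S + 2 * S * (b - a) + 2 * Γ) := by positivity
    linarith
  refine mul_le_mul (by linarith) (Real.exp_le_exp.2 e2) (Real.exp_nonneg _) ?_
  have := gr_nonneg (ϱ a)
  positivity

/-! ### Continuation argument up to the time T_δ -/

lemma le_quarter_of_bootstrap {f : ℝ → ℝ} {a b : ℝ} (hf : ContinuousOn f (Icc a b))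
    (ha : f a ≤ 1 / 4) (h : ∀ t b', a ≤ t → t < b' → b' ≤ b → (∀ s ∈ Icc a b', f s ≤ 1) →
      f t ≤ 1 / 4) : ∀ t ∈ Icc a b, f t ≤ 1 / 4 := by
  have key : ∀ c ∈ Icc a b, (∀ s ∈ Ico a c, f s ≤ 1) → ∀ t ∈ Icc a c, f t ≤ 1 / 4 := by
    intro c hc h1
    have h2 : ∀ t ∈ Ico a c, f t ≤ 1 / 4 := fun t ht =>
      h t ((t + c) / 2) ht.1 (by linarith [ht.2]) (by linarith [ht.2, hc.2]) fun s hs =>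
        h1 s ⟨hs.1, by linarith [hs.2, ht.2]⟩
    intro t ht
    rcases ht.2.lt_or_eq with h3 | h3
    · exact h2 t ⟨ht.1, h3⟩
    rcases ht.1.lt_or_eq with h4 | h4
    · rw [h3] at h4 ⊢
      have h5 : Tendsto f (𝓝[Ico a c] c) (𝓝 (f c)) :=
        (hf c hc).mono_left (nhdsWithin_mono c fun s hs => ⟨hs.1, hs.2.le.trans hc.2⟩)
      have : (𝓝[Ico a c] c).NeBot := by
        rw [← mem_closure_iff_nhdsWithin_neBot, closure_Ico h4.ne]
        exact ⟨h4.le, le_rfl⟩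
      exact le_of_tendsto h5 (mem_of_superset self_mem_nhdsWithin h2)
    · rwa [← h4]
  rcases (({t ∈ Icc a b | 1 / 2 ≤ f t}).eq_empty_or_nonempty) with hE | hE
  · intro t ht
    refine key b ⟨ht.1.trans ht.2, le_rfl⟩ (fun s hs => ?_) t ht
    by_contra hc
    exact (Set.eq_empty_iff_forall_notMem.1 hE s) ⟨⟨hs.1, hs.2.le⟩, by linarith⟩
  · have hcl : IsClosed {t ∈ Icc a b | 1 / 2 ≤ f t} :=
      hf.preimage_isClosed_of_isClosed isClosed_Icc isClosed_Ici
    have hcomp : IsCompact {t ∈ Icc a b | 1 / 2 ≤ f t} :=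
      isCompact_Icc.of_isClosed_subset hcl fun t ht => ht.1
    -- At the first time where f reaches 1/2, f has stayed below 1 before it, so the improvement
    -- applies there and continuity gives f ≤ 1/4, a contradiction.
    obtain ⟨c, hc, hmin⟩ := hcomp.exists_isLeast hE
    have h1 := key c hc.1 (fun s hs => by
      by_contra hn
      exact absurd (hmin ⟨⟨hs.1, hs.2.le.trans hc.1.2⟩, by linarith⟩) (not_le.2 hs.2))
      c ⟨hc.1.1, le_rfl⟩
    linarith [hc.2]

namespace IsClassicalSolution

variable {μ g : ℝ} {ρbar : ℝ → ℝ} {T : EReal} {ϱ₀ : R3 → ℝ} {u₀ : R3 → R3} {ϱ : ℝ → R3 → ℝ}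
  {u : ℝ → R3 → R3} {q : ℝ → R3 → ℝ} (hS : IsClassicalSolution μ g ρbar T ϱ₀ u₀ ϱ u q)
include hS

/-- Estimates start at small positive times, where the derivatives exist. Squared norms satisfy |x +
y|² ≤ 2|x|² + 2|y|², so the limiting bound is 2δ₀², and 3δ₀² holds on a whole interval of times. -/
lemma exists_initial_bound {δ₀ : ℝ} (hδ : 0 < δ₀)
    (h0 : h1Sq ϱ₀ + h2Sq u₀ = ENNReal.ofReal (δ₀ ^ 2)) : ∃ a₀ : ℝ, 0 < a₀ ∧
      ∀ a ∈ openTimes T, a < a₀ → (n2 (ϱ a) ^ 2 + gr (ϱ a)) + kap (u a) ≤ 3 * δ₀ ^ 2 := by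
  have h00 : (0 : ℝ) ∈ closedTimes T := ⟨le_rfl, by exact_mod_cast hS.T_pos⟩
  have hlim := (ENNReal.Tendsto.const_mul (a := 2) ((hS.ϱ_H1 0 h00).2.add (hS.u_H2 0 h00).2)
    (Or.inr (by simp))).add (tendsto_const_nhds (x := 2 * ENNReal.ofReal (δ₀ ^ 2)))
  rw [add_zero, mul_zero, zero_add] at hlim
  have hlt : 2 * ENNReal.ofReal (δ₀ ^ 2) < ENNReal.ofReal (3 * δ₀ ^ 2) := by
    rw [← ENNReal.ofReal_ofNat, ← ENNReal.ofReal_mul (by norm_num)]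
    exact (ENNReal.ofReal_lt_ofReal_iff (by positivity)).2 (by nlinarith)
  have hev := hlim.eventually (eventually_lt_nhds hlt)
  obtain ⟨a₀, ha₀, hball⟩ := Metric.mem_nhdsWithin_iff.1 hev
  refine ⟨a₀, ha₀, fun a ha haa => ?_⟩
  have hac := openTimes_subset T ha
  have h1 := mem_ball_zero_iff.2 (show ‖a‖ < a₀ by rwa [Real.norm_eq_abs, abs_of_pos ha.1])
  have h1 := mem_ofPred.1 (hball ⟨h1, hac⟩)
  have hcϱ : ∀ s ∈ closedTimes T, Continuous (ϱ s) := fun s hs =>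
    continuous_slice_of_continuousOn hS.ϱ_cont hs
  have hcu : ∀ s ∈ closedTimes T, Continuous (u s) := fun s hs =>
    continuous_slice_of_continuousOn hS.u_cont hs
  have h2 : h1Sq (ϱ a) ≤ 2 * h1Sq (fun x => ϱ a x - ϱ 0 x) + 2 * h1Sq ϱ₀ := by
    have := h1Sq_add_le (f := fun x => ϱ a x - ϱ 0 x) (g := ϱ 0)
      ((hcϱ a hac).sub (hcϱ 0 h00)).aestronglyMeasurable
    simp only [sub_add_cancel] at this
    rwa [hS.ϱ_init] at this ⊢
  have h3 : h2Sq (u a) ≤ 2 * h2Sq (fun x => u a x - u 0 x) + 2 * h2Sq u₀ := by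
    have := h2Sq_add_le (f := fun x => u a x - u 0 x) (g := u 0)
      ((hcu a hac).sub (hcu 0 h00)).aestronglyMeasurable
    simp only [sub_add_cancel] at this
    rwa [hS.u_init] at this ⊢
  have h4 : h1Sq (ϱ a) + h2Sq (u a) ≤ ENNReal.ofReal (3 * δ₀ ^ 2) := by
    refine le_trans ?_ h1.le
    rw [← h0]
    refine (add_le_add h2 h3).trans (le_of_eq ?_)
    ring
  have hgϱ : 0 ≤ n2 (ϱ a) ^ 2 + gr (ϱ a) := add_nonneg (sq_nonneg _) (gr_nonneg _)
  rw [(hS.h1C1 ha).h1Sq_eq, (hS.h2C2 ha).h2Sq_eq, ← ENNReal.ofReal_add hgϱ (kap_nonneg _)] at h4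
  exact (ENNReal.ofReal_le_ofReal_iff (by positivity)).1 h4

end IsClassicalSolution

/-- The logarithm in T_δ matters only through exp(C₁ T_δ) ≤ 1/δ₀. -/
lemma Tδ_spec {T : EReal} (hT : 0 < T) {C₁ δ₀ : ℝ} (hC : 0 < C₁) (hδ : 0 < δ₀) (hδ1 : δ₀ < 1) :
    0 < Tδ T C₁ δ₀ ∧ (Tδ T C₁ δ₀ : EReal) ≤ T ∧ Real.exp (C₁ * Tδ T C₁ δ₀) ≤ δ₀⁻¹ := by
  have hx : 0 < -(C₁⁻¹ * Real.log δ₀) := by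
    have := mul_neg_of_pos_of_neg (inv_pos.2 hC) (Real.log_neg hδ hδ1)
    linarith
  obtain ⟨m, hm⟩ : ∃ m, m = min T ((-(C₁⁻¹ * Real.log δ₀) : ℝ) : EReal) := ⟨_, rfl⟩
  have hm0 : 0 < m := hm ▸ lt_min hT (by exact_mod_cast hx)
  have hmx : m ≤ ((-(C₁⁻¹ * Real.log δ₀) : ℝ) : EReal) := hm ▸ min_le_right _ _
  have hco : (Tδ T C₁ δ₀ : EReal) = m := by
    rw [Tδ, ← hm]
    exact EReal.coe_toReal (ne_top_of_le_ne_top (EReal.coe_ne_top _) hmx) (ne_bot_of_gt hm0)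
  rw [← hco] at hm0 hmx
  have h1 : 0 < Tδ T C₁ δ₀ := by exact_mod_cast hm0
  have h2 : Tδ T C₁ δ₀ ≤ -(C₁⁻¹ * Real.log δ₀) := by exact_mod_cast hmx
  refine ⟨h1, by rw [hco, hm]; exact min_le_left _ _, ?_⟩
  rw [← Real.exp_log (inv_pos.2 hδ), Real.log_inv]
  refine Real.exp_le_exp.2 ?_
  have := mul_le_mul_of_nonneg_left h2 hC.le
  rwa [mul_neg, ← mul_assoc, mul_inv_cancel₀ hC.ne', one_mul] at this

/-- Exhaustion by compact intervals: the estimates are available away from 0 and from the endpoint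
τ, which may be the end of the existence interval. -/
lemma lintegral_Ioo_le {f : ℝ → ℝ≥0∞} {τ : ℝ} {B : ℝ≥0∞}
    (h : ∀ a b, 0 < a → a ≤ b → b < τ → ∫⁻ s in Icc a b, f s ≤ B) : ∫⁻ s in Ioo 0 τ, f s ≤ B := by
  obtain ⟨k, hk⟩ : ∃ k : ℕ → ℝ, k = fun n : ℕ => 1 / ((n : ℝ) + 1) := ⟨_, rfl⟩
  have hk0 : ∀ n, 0 < k n := fun n => by rw [hk]; positivity
  have hanti : Antitone k := fun m n hmn => by
    rw [hk]
    exact one_div_le_one_div_of_le (by positivity) (by simpa using hmn)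
  have hlim : Tendsto k atTop (𝓝 0) := hk ▸ tendsto_one_div_add_atTop_nhds_zero_nat
  have hU : Ioo 0 τ = ⋃ n, Icc (k n) (τ - k n) := by
    ext s
    simp only [mem_iUnion, mem_Icc, mem_Ioo]
    constructor
    · rintro ⟨h1, h2⟩
      have h3 := (hlim.eventually (eventually_lt_nhds h1)).and
        (hlim.eventually (eventually_lt_nhds (sub_pos.2 h2)))
      obtain ⟨n, h4, h5⟩ := h3.exists
      exact ⟨n, h4.le, by linarith⟩
    · rintro ⟨n, h1, h2⟩
      exact ⟨(hk0 n).trans_le h1, by linarith [hk0 n]⟩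
  have hmono : Monotone fun n => Icc (k n) (τ - k n) := fun m n hmn =>
    Icc_subset_Icc (hanti hmn) (sub_le_sub_left (hanti hmn) _)
  rw [hU, setLIntegral_iUnion_of_directed _ hmono.directed_le]
  refine iSup_le fun n => ?_
  rcases le_or_gt (k n) (τ - k n) with h1 | h1
  · exact h _ _ (hk0 n) h1 (by linarith [hk0 n])
  · simp [Icc_eq_empty (not_le.2 h1)]

/-- The exponential consumes one of the two powers of δ; the other makes the product small. Allowing
s ≤ τ + 1 costs the factor e^C. -/
lemma mul_sq_mul_exp_le {C C₀ δ τ s : ℝ} (hC : 0 < C) (hC₀ : 0 < C₀) (hδ : 0 < δ)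
    (hδs : δ ≤ 1 / (4 * (C * C₀ * Real.exp C))) (hτ : Real.exp (C * τ) ≤ δ⁻¹) (hs : s ≤ τ + 1) :
    C * (C₀ * δ ^ 2) * Real.exp (C * s) ≤ 1 / 4 := by
  have h1 : Real.exp (C * s) ≤ δ⁻¹ * Real.exp C :=
    calc Real.exp (C * s) ≤ Real.exp (C * τ + C) := Real.exp_le_exp.2 (by nlinarith)
      _ = Real.exp (C * τ) * Real.exp C := Real.exp_add _ _
      _ ≤ _ := by gcongr
  have hE := Real.exp_pos C
  rw [le_div_iff₀ (by positivity)] at hδs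
  calc C * (C₀ * δ ^ 2) * Real.exp (C * s) ≤ C * (C₀ * δ ^ 2) * (δ⁻¹ * Real.exp C) := by gcongr
    _ = δ * (C * C₀ * Real.exp C) := by field_simp
    _ ≤ 1 / 4 := by linarith

/-- Up to the time `Tδ` the low-order energy stays comparable to its initial size. -/
lemma exists_energy_bound {μ g α β : ℝ} {ρbar : ℝ → ℝ} (hμ : 0 < μ) (hg : 0 < g) (hα : 0 < α)
    (hρ : IsProfile ρbar) : ∃ δ₁ C₁ K : ℝ, 0 < δ₁ ∧ δ₁ < 1 ∧ 0 < C₁ ∧ 0 < K ∧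
      ∀ {δ₀ : ℝ} {T : EReal} {ϱ₀ : R3 → ℝ} {u₀ : R3 → R3} {ϱ : ℝ → R3 → ℝ} {u : ℝ → R3 → R3}
        {q : ℝ → R3 → ℝ}, 0 < δ₀ → δ₀ < δ₁ → h1Sq ϱ₀ + h2Sq u₀ = ENNReal.ofReal (δ₀ ^ 2) →
        (∀ x, α ≤ ϱ₀ x + ρbar (x 2) ∧ ϱ₀ x + ρbar (x 2) ≤ β) →
        IsClassicalSolution μ g ρbar T ϱ₀ u₀ ϱ u q →
        ∃ a₀ : ℝ, 0 < a₀ ∧ ∀ {a b : ℝ}, a ∈ openTimes T → a < a₀ → a ≤ b → b ∈ openTimes T →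
          b ≤ Tδ T C₁ δ₀ → gr (ϱ a) ≤ 3 * δ₀ ^ 2 ∧ ∀ t ∈ Icc a b, energy ϱ u t ≤ 1 ∧
            energy ϱ u t + (∫⁻ s in Icc a t, gradSq (dt u s)).toReal
              ≤ K * Real.exp (C₁ * Tδ T C₁ δ₀) * δ₀ ^ 2 ∧
            (∫⁻ s in Icc a t, gradSq (dt u s)).toReal ≤ 1 := by
  obtain ⟨CE, hCE, hen⟩ := exists_energy_inequality (β := β) hμ hg hα hρ
  obtain ⟨Ca, hCa, hac⟩ := exists_acceleration_bound (β := β) hμ hg hα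
  obtain ⟨C₀, hC₀⟩ : ∃ C₀, C₀ = 3 * (1 + Ca) := ⟨_, rfl⟩
  have hCE0 : 0 < CE := by linarith
  have hC₀0 : 0 < C₀ := by rw [hC₀]; positivity
  have hE := Real.exp_pos CE
  -- The second bound on δ₁ is the hypothesis of `mul_sq_mul_exp_le`; the first keeps δ₀ < 1, so
  -- that its logarithm is negative.
  refine ⟨min (1 / 2) (1 / (4 * (CE * C₀ * Real.exp CE))), CE, CE * C₀,
    lt_min (by norm_num) (by positivity), (min_le_left _ _).trans_lt (by norm_num), hCE0,
    by positivity, fun {δ₀ T ϱ₀ u₀ ϱ u q} hδ hδ1 h0 hdata hS => ?_⟩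
  have hδh : δ₀ < 1 / 2 := hδ1.trans_le (min_le_left _ _)
  have hδs := hδ1.le.trans (min_le_right _ _)
  obtain ⟨hτ0, -, hτe⟩ := Tδ_spec hS.T_pos hCE0 hδ (by linarith)
  obtain ⟨τ, hτ⟩ : ∃ τ, τ = Tδ T CE δ₀ := ⟨_, rfl⟩
  rw [← hτ] at hτ0 hτe ⊢
  have hsl : ∀ t ∈ openTimes T, Slice μ g α β ρbar (ϱ t) (u t) (dt u t) (q t) :=
    fun t ht => hS.slice hρ hα hdata ht
  obtain ⟨a₀, ha₀, hini⟩ := hS.exists_initial_bound hδ h0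
  refine ⟨a₀, ha₀, fun {a b} ha haa hab hb hbτ => ?_⟩
  have hia := hini a ha haa
  have n1 := gr_nonneg (ϱ a)
  have n2' := gr_nonneg (u a)
  have n3 := hs_nonneg (u a)
  have n4 := sq_nonneg (n2 (u a))
  have n5 := sq_nonneg (n2 (ϱ a))
  rw [kap] at hia
  -- No limit of u_t at time zero is assumed: u_t(a) is controlled by the H² norm of u(a) and the L²
  -- norm of ϱ(a) at the same time.
  have hEa : energy ϱ u a ≤ C₀ * δ₀ ^ 2 := by
    have h1 := hac (hsl a ha) (by nlinarith)
    have h2 : Ca * (gr (u a) + hs (u a) + n2 (ϱ a) ^ 2) ≤ Ca * (3 * δ₀ ^ 2) :=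
      mul_le_mul_of_nonneg_left (by linarith) hCa.le
    rw [energy, hC₀]
    linarith
  have hEle : ∀ {t b'}, a ≤ t → t < b' → b' ∈ openTimes T → (∀ s ∈ Icc a b', energy ϱ u s ≤ 1) →
      energy ϱ u t + (∫⁻ s in Icc a t, gradSq (dt u s)).toReal
        ≤ CE * (C₀ * δ₀ ^ 2) * Real.exp (CE * (t - a)) := fun h1 h2 h3 h4 =>
    (hen hS hsl h1 h2 ha h3 h4).trans (by gcongr)
  -- A slightly later time, since the energy inequality at b requires the smallness of the energy
  -- beyond b.
  obtain ⟨b'', hb'', hbb, hb1⟩ : ∃ b'' ∈ openTimes T, b < b'' ∧ b'' ≤ b + 1 := by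
    obtain ⟨ε, hε, hball⟩ := Metric.isOpen_iff.1 (isOpen_openTimes T) b hb
    refine ⟨b + min (ε / 2) 1, hball ?_, by linarith [lt_min (half_pos hε) one_pos],
      by linarith [min_le_right (ε / 2) 1]⟩
    rw [Metric.mem_ball, Real.dist_eq, add_sub_cancel_left,
      abs_of_pos (lt_min (half_pos hε) one_pos)]
    linarith [min_le_left (ε / 2) 1]
  have hsub := Icc_subset_openTimes ha hb''
  have hq : ∀ t ∈ Icc a b'', energy ϱ u t ≤ 1 / 4 := by
    refine le_quarter_of_bootstrap (hS.continuousOn_energy.mono hsub) ?_ ?_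
    · have h1 := mul_sq_mul_exp_le hCE0 hC₀0 hδ hδs hτe (s := 0) (by linarith)
      rw [mul_zero, Real.exp_zero, mul_one] at h1
      nlinarith [energy_nonneg ϱ u a]
    · intro t b' h1 h2 h3 h4
      have h5 := hEle h1 h2 (hsub ⟨h1.trans h2.le, h3⟩) h4
      have h6 := mul_sq_mul_exp_le hCE0 hC₀0 hδ hδs hτe (s := t - a) (by linarith [ha.1])
      linarith [ENNReal.toReal_nonneg (a := ∫⁻ s in Icc a t, gradSq (dt u s))]
  refine ⟨by linarith, fun t ht => ?_⟩
  have htb : t < b'' := ht.2.trans_lt hbb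
  have h1 := hEle ht.1 htb hb'' fun s hs => (hq s hs).trans (by norm_num)
  have h2 := mul_sq_mul_exp_le hCE0 hC₀0 hδ hδs hτe (s := t - a) (by linarith [ha.1, ht.2])
  have h3 := energy_nonneg ϱ u t
  refine ⟨(hq t ⟨ht.1, htb.le⟩).trans (by norm_num), h1.trans ?_, by linarith⟩
  calc CE * (C₀ * δ₀ ^ 2) * Real.exp (CE * (t - a))
      ≤ CE * (C₀ * δ₀ ^ 2) * Real.exp (CE * τ) := by
        gcongr
        linarith [ha.1, ht.2]
    _ = _ := by ring

namespace IsClassicalSolution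

variable {μ g : ℝ} {ρbar : ℝ → ℝ} {T : EReal} {ϱ₀ : R3 → ℝ} {u₀ : R3 → R3} {ϱ : ℝ → R3 → ℝ}
  {u : ℝ → R3 → R3} {q : ℝ → R3 → ℝ} (hS : IsClassicalSolution μ g ρbar T ϱ₀ u₀ ϱ u q)
include hS

lemma lintegral_gradH1Sq_add_le {a b M N : ℝ} (hab : a ≤ b) (ha : a ∈ openTimes T)
    (hb : b ∈ openTimes T) (hM : ∀ s ∈ Icc a b, gr (u s) + hs (u s) ≤ M)
    (hN : (∫⁻ s in Icc a b, gradSq (dt u s)).toReal ≤ N) :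
    ∫⁻ s in Icc a b, (gradH1Sq (u s) + gradSq (dt u s)) ≤ ENNReal.ofReal (b * M + N) := by
  have hM0 : 0 ≤ M := (add_nonneg (gr_nonneg (u a)) (hs_nonneg (u a))).trans (hM a ⟨le_rfl, hab⟩)
  have hN0 : 0 ≤ N := ENNReal.toReal_nonneg.trans hN
  have hb0 : 0 ≤ b := ha.1.le.trans hab
  have hsub := Icc_subset_openTimes ha hb
  calc ∫⁻ s in Icc a b, (gradH1Sq (u s) + gradSq (dt u s))
      ≤ ∫⁻ s in Icc a b, (ENNReal.ofReal M + gradSq (dt u s)) := by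
        refine setLIntegral_mono_ae' measurableSet_Icc (Eventually.of_forall fun s hs' => ?_)
        have h2 := hS.h2C2 (hsub hs')
        rw [gradH1Sq, h2.h1.gradSq_eq, h2.hessSq_eq,
          ← ENNReal.ofReal_add (gr_nonneg _) (hs_nonneg _)]
        exact add_le_add_left (ENNReal.ofReal_le_ofReal (hM s hs')) _
    _ = ENNReal.ofReal M * ENNReal.ofReal (b - a) + ∫⁻ s in Icc a b, gradSq (dt u s) := by
        rw [lintegral_add_left measurable_const, lintegral_const, Measure.restrict_apply_univ,
          Real.volume_Icc]
    _ ≤ ENNReal.ofReal (b * M) + ENNReal.ofReal N := by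
        refine add_le_add ?_ ((ENNReal.le_ofReal_iff_toReal_le (hS.ut_H1 a ha b hb).ne hN0).2 hN)
        rw [← ENNReal.ofReal_mul hM0]
        refine ENNReal.ofReal_le_ofReal ?_
        nlinarith [ha.1]
    _ = _ := (ENNReal.ofReal_add (mul_nonneg hb0 hM0) hN0).symm

end IsClassicalSolution

end RayleighTaylor

/-! ### Assembly of the final estimate -/

open RayleighTaylor in
theorem proposition4p1 (μ g : ℝ) (hμ : 0 < μ) (hg : 0 < g) (ρbar : ℝ → ℝ)
    (hρbar : IsProfile ρbar) (α β : ℝ) (hα : 0 < α) (hαβ : α ≤ β) :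
    ∃ (δ₁ C₁ : ℝ) (C : ℝ → ℝ), 0 < δ₁ ∧ δ₁ ≤ 1 ∧ 0 < C₁ ∧ Monotone C ∧ (∀ τ, 0 < C τ) ∧
      ∀ (δ₀ : ℝ) (ϱ₀ : R3 → ℝ) (u₀ : R3 → R3),
        0 < δ₀ → δ₀ < δ₁ → h1Sq ϱ₀ + h2Sq u₀ = ENNReal.ofReal (δ₀ ^ 2) →
        (∀ x, α ≤ ϱ₀ x + ρbar (x 2) ∧ ϱ₀ x + ρbar (x 2) ≤ β) →
        ∀ (T : EReal) (ϱ : ℝ → R3 → ℝ) (u : ℝ → R3 → R3) (q : ℝ → R3 → ℝ),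
          IsClassicalSolution μ g ρbar T ϱ₀ u₀ ϱ u q →
          (⨆ s ∈ {s : ℝ | s ∈ openTimes T ∧ s ≤ Tδ T C₁ δ₀},
              (h1Sq (ϱ s) + h2Sq (u s) + l2Sq (dt u s) + l2Sq (gradient (q s))))
            + ∫⁻ s in Ioo 0 (Tδ T C₁ δ₀), (gradH1Sq (u s) + gradSq (dt u s))
          ≤ ENNReal.ofReal (C (Tδ T C₁ δ₀) * δ₀ ^ 2) := by
  obtain ⟨δ₁, C₁, K, hδ₁, hδ₁1, hC₁, hK, henergy⟩ :=
    exists_energy_bound (β := β) hμ hg hα hρbar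
  obtain ⟨P, hP, hden⟩ := exists_gr_density_bound (β := β) hμ hg hα hρbar
  obtain ⟨E, hE, hell⟩ := exists_elliptic_bound (β := β) hμ hg hα
  -- `A` bounds the energy. `B` adds two elliptic bounds (for ∇²u and ∇q) and the density gradient,
  -- where 3 comes from the initial bound and 2 + t from 1 + t + ∫‖∇u_t‖² with the last integral at
  -- most 1. `D` collects the time integrals.
  obtain ⟨A, hA⟩ : ∃ A : ℝ → ℝ, A = fun t => K * Real.exp (C₁ * t) := ⟨_, rfl⟩
  obtain ⟨B, hB⟩ : ∃ B : ℝ → ℝ, B = fun t => (1 + 2 * E) * A t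
    + 2 * (3 + P * (t * A t)) * Real.exp (P * t * (2 + t)) := ⟨_, rfl⟩
  obtain ⟨D, hD⟩ : ∃ D : ℝ → ℝ, D = fun t => t * ((1 + E) * A t) + A t := ⟨_, rfl⟩
  have hA0 : ∀ t, 0 < A t := fun t => by rw [hA]; positivity
  have hAm : Monotone A := fun s t hst => by
    rw [hA]
    dsimp only
    gcongr
  have hB0 : ∀ t, 0 ≤ t → 0 < B t := fun t ht => by
    have := hA0 t
    rw [hB]
    positivity
  have hD0 : ∀ t, 0 ≤ t → 0 < D t := fun t ht => by
    have := hA0 t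
    rw [hD]
    positivity
  -- Truncation at 0 makes the function positive and nondecreasing on all of ℝ; the relevant time is
  -- positive.
  refine ⟨δ₁, C₁, fun t => B (max t 0) + D (max t 0), hδ₁, hδ₁1.le, hC₁, fun s t hst => ?_,
    fun t => add_pos (hB0 _ (le_max_right _ _)) (hD0 _ (le_max_right _ _)), ?_⟩
  · have h1 : max s 0 ≤ max t 0 := max_le_max_right 0 hst
    have h2 := le_max_right s 0
    have h3 := hAm h1
    have h4 := hA0 (max s 0)
    rw [hB, hD]
    dsimp only
    have h5 := h4.trans_le h3
    have h6 := h2.trans h1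
    gcongr
  intro δ₀ ϱ₀ u₀ hδ hδ1 h0 hdata T ϱ u q hS
  obtain ⟨hτ0, hτT, -⟩ := Tδ_spec hS.T_pos hC₁ hδ (hδ1.trans hδ₁1)
  obtain ⟨a₀, ha₀, hbd⟩ := henergy hδ hδ1 h0 hdata hS
  obtain ⟨τ, hτ⟩ : ∃ τ, τ = Tδ T C₁ δ₀ := ⟨_, rfl⟩
  have hAτ : K * Real.exp (C₁ * τ) = A τ := by rw [hA]
  rw [← hτ] at hτ0 hτT hbd ⊢
  rw [hAτ] at hbd
  dsimp only
  rw [max_eq_left hτ0.le]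
  have hsl : ∀ t ∈ openTimes T, Slice μ g α β ρbar (ϱ t) (u t) (dt u t) (q t) :=
    fun t ht => hS.slice hρbar hα hdata ht
  have hδ2 : 0 < δ₀ ^ 2 := by positivity
  have hAδ : 0 < A τ * δ₀ ^ 2 := mul_pos (hA0 τ) hδ2
  have hEt : ∀ {a b t}, a ∈ openTimes T → a < a₀ → a ≤ b → b ∈ openTimes T → b ≤ τ →
      t ∈ Icc a b → energy ϱ u t ≤ A τ * δ₀ ^ 2 := fun ha haa hab hb hbτ ht =>
    le_of_add_le_of_nonneg_left ((hbd ha haa hab hb hbτ).2 _ ht).2.1 ENNReal.toReal_nonneg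
  have hel : ∀ {t}, t ∈ openTimes T → energy ϱ u t ≤ 1 → hs (u t) ≤ E * energy ϱ u t ∧
      n2 (gradient (q t)) ^ 2 ≤ E * energy ϱ u t ∧ gr (u t) ≤ energy ϱ u t := fun {t} ht h1 => by
    have h2 := gr_nonneg (u t)
    have h3 := sq_nonneg (n2 (u t))
    have h4 := sq_nonneg (n2 (ϱ t))
    have h5 := sq_nonneg (n2 (dt u t))
    rw [energy] at h1 ⊢
    have h6 := hell (hsl t ht) (by linarith)
    have h7 : E * (n2 (dt u t) ^ 2 + gr (u t) + n2 (ϱ t) ^ 2)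
        ≤ E * (n2 (u t) ^ 2 + gr (u t) + n2 (ϱ t) ^ 2 + n2 (dt u t) ^ 2) :=
      mul_le_mul_of_nonneg_left (by linarith) hE.le
    exact ⟨h6.1.trans h7, h6.2.trans h7, by linarith⟩
  -- Every time is reached from a starting time below a₀, so none of the constants depends on how
  -- close to zero the estimates begin.
  have hstart : ∀ {b : ℝ}, b ∈ openTimes T → ∃ a ∈ openTimes T, a < a₀ ∧ a ≤ b := fun {b} hb => by
    have h1 : 0 < min a₀ b := lt_min ha₀ hb.1
    have h2 := min_le_right a₀ b
    refine ⟨min a₀ b / 2, ⟨by linarith, lt_of_le_of_lt (EReal.coe_le_coe_iff.2 ?_) hb.2⟩,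
      by linarith [min_le_left a₀ b], by linarith⟩
    linarith
  have hsup : ∀ b ∈ openTimes T, b ≤ τ →
      h1Sq (ϱ b) + h2Sq (u b) + l2Sq (dt u b) + l2Sq (gradient (q b))
        ≤ ENNReal.ofReal (B τ * δ₀ ^ 2) := by
    intro b hb hbτ
    obtain ⟨a, ha, haa, hab⟩ := hstart hb
    obtain ⟨hgra, hall⟩ := hbd ha haa hab hb hbτ
    obtain ⟨hb1, hb2, hb3⟩ := hall b ⟨hab, le_rfl⟩
    have hEb := hEt ha haa hab hb hbτ (right_mem_Icc.2 hab)
    obtain ⟨e1, e2, -⟩ := hel hb hb1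
    have hba : b - a ≤ τ := by linarith [ha.1]
    have hint : ∫ s in a..b, energy ϱ u s ≤ τ * (A τ * δ₀ ^ 2) := by
      have h1 := intervalIntegral.integral_mono_on hab
        ((hS.continuousOn_energy.mono (Icc_subset_openTimes ha hb)).intervalIntegrable_of_Icc hab)
        (intervalIntegrable_const (μ := volume) (c := A τ * δ₀ ^ 2))
        fun s hs => hEt ha haa hab hb hbτ hs
      rw [intervalIntegral.integral_const, smul_eq_mul] at h1
      exact h1.trans (mul_le_mul_of_nonneg_right hba hAδ.le)
    have hgr : gr (ϱ b) ≤ 2 * (3 + P * (τ * A τ)) * Real.exp (P * τ * (2 + τ)) * δ₀ ^ 2 := by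
      refine (hden hS hsl hab ha hb fun s hs => (hall s hs).1).trans ?_
      have hba0 := sub_nonneg.2 hab
      have hx := Real.exp_pos (P * τ * (2 + τ))
      calc _ ≤ 2 * (3 * δ₀ ^ 2 + P * (τ * (A τ * δ₀ ^ 2))) * Real.exp (P * τ * (1 + τ + 1)) := by
            gcongr
        _ = _ := by
            rw [show 1 + τ + 1 = 2 + τ by ring]
            ring
    have hEE : E * energy ϱ u b ≤ E * (A τ * δ₀ ^ 2) := mul_le_mul_of_nonneg_left hEb hE.le
    rw [(hS.h1C1 hb).h1Sq_eq, (hS.h2C2 hb).h2Sq_eq, l2Sq_eq_ofReal (hS.memLp_dt_u hb),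
      l2Sq_eq_ofReal ((hsl b hb).memLp_gradient hg hα),
      ← ENNReal.ofReal_add (add_nonneg (sq_nonneg _) (gr_nonneg _)) (kap_nonneg _),
      ← ENNReal.ofReal_add (add_nonneg (add_nonneg (sq_nonneg _) (gr_nonneg _)) (kap_nonneg _))
        (sq_nonneg _),
      ← ENNReal.ofReal_add (add_nonneg (add_nonneg (add_nonneg (sq_nonneg _) (gr_nonneg _))
        (kap_nonneg _)) (sq_nonneg _)) (sq_nonneg _)]
    refine ENNReal.ofReal_le_ofReal ?_
    have hBτ : B τ * δ₀ ^ 2 = A τ * δ₀ ^ 2 + 2 * (E * (A τ * δ₀ ^ 2))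
        + 2 * (3 + P * (τ * A τ)) * Real.exp (P * τ * (2 + τ)) * δ₀ ^ 2 := by
      rw [hB]
      ring
    rw [energy] at hEb
    rw [kap, hBτ]
    linarith
  have hintg : ∫⁻ s in Ioo 0 τ, (gradH1Sq (u s) + gradSq (dt u s))
      ≤ ENNReal.ofReal (D τ * δ₀ ^ 2) := by
    refine lintegral_Ioo_le fun a b ha hab hbτ => ?_
    have hb : b ∈ openTimes T :=
      ⟨ha.trans_le hab, (EReal.coe_lt_coe_iff.2 hbτ).trans_le hτT⟩
    have hao : a ∈ openTimes T :=
      ⟨ha, lt_of_le_of_lt (EReal.coe_le_coe_iff.2 hab) hb.2⟩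
    obtain ⟨c, hc, hca, hcl⟩ := hstart hao
    have hcb := hcl.trans hab
    obtain ⟨-, hall⟩ := hbd hc hca hcb hb hbτ.le
    refine (lintegral_mono_set (Icc_subset_Icc_left hcl)).trans ?_
    refine (hS.lintegral_gradH1Sq_add_le hcb hc hb (M := (1 + E) * (A τ * δ₀ ^ 2))
      (N := A τ * δ₀ ^ 2) (fun s hs => ?_) ?_).trans (ENNReal.ofReal_le_ofReal ?_)
    · obtain ⟨e1, -, e3⟩ := hel (Icc_subset_openTimes hc hb hs) (hall s hs).1
      have h1 := hEt hc hca hcb hb hbτ.le hs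
      have h2 := mul_le_mul_of_nonneg_left h1 hE.le
      linarith
    · have h1 := (hall b ⟨hcb, le_rfl⟩).2.1
      linarith [energy_nonneg ϱ u b]
    · have hDτ : D τ * δ₀ ^ 2 = τ * ((1 + E) * (A τ * δ₀ ^ 2)) + A τ * δ₀ ^ 2 := by
        rw [hD]
        ring
      rw [hDτ]
      gcongr
  refine (add_le_add (iSup₂_le fun s hs => hsup s hs.1 hs.2) hintg).trans (le_of_eq ?_)
  rw [← ENNReal.ofReal_add (mul_pos (hB0 τ hτ0.le) hδ2).le (mul_pos (hD0 τ hτ0.le) hδ2).le,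
    add_mul]
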